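/- Graphs are finite undirected multigraphs (loops and parallel edges allowed). A graph is $3$-edge-connected if it stays connected (in particular non-empty) after deletion of any set of at most two edges. A cycle is the edge set of a connected subgraph in which every vertex has degree two (a loop is a cycle of length one). The cycle lattice of $G=(V,E)$ is the subgroup of $\mathbb Z^E$ generated by the $0/1$-vectors $\chi_C$ of the cycles $C$ of $G$, and a lattice cycle basis of $G$ is a set of cycles whose vectors $\chi_C$ form a $\mathbb Z$-basis of the cycle lattice. A graph $G$ is a topological one-edge extension of $H$, written $H\xrightarrow{e}G$, if it arises from $H$ in one of these ways: (A) a new edge $e$ is added between existing, possibly equal, vertices; (B) an edge $f$ of $H$ is divided into two edges by a new vertex $a$, and a new edge $e$ is added between $a$ and an existing vertex of $H$; (C) two distinct edges $f,g$ of $H$ are divided by new vertices $a$ and $b$ respectively, and a new edge $e$ is added between $a$ and $b$. Replacing every divided edge by its two halves maps the cycles of $H$ injectively to cycles of $G$. A topological extension sequence of $G$ is a sequence $G_0\xrightarrow{e_1}G_1\xrightarrow{e_2}\cdots\xrightarrow{e_k}G_k=G$ where $G_0$ is a single vertex without edges. A compatible chain of lattice cycle bases for it is a nested sequence $\mathcal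 C_0\subset\mathcal C_1\subset\cdots\subset\mathcal C_k$, where $\mathcal C_i$ is a lattice cycle basis of $G_i$, and the inclusions are proper and understood via the above maps from the cycles of $G_{i-1}$ to the cycles of $G_i$. **Theorem.** There is an algorithm which, for every $3$-edge-connected graph $G$ with $n$ vertices and $m$ edges, given by its adjacency lists, constructs a topological extension sequence of $G$ and a compatible chain of lattice cycle bases for it in time $O(mn)$ (that is, in at most $c\,(mn+1)$ steps for an absolute constant $c$). Here an algorithm is a fixed program for a random access machine with unit-cost addition, truncated subtraction, and memory access, all of whose numbers stay below $(n+m+2)^{c}$. The vertices and edges of $G$ are numbered $0,\dots,n-1$ and $0,\dots,m-1$. The extension sequence is output as the vertex of $G_0$ together with the list of the $k$ extension operations; when an edge is divided, one half keeps its label. The chain is output as a list, without repetition, of the cycles in $\mathcal C_k$ (each as a list of edges of $G$), together with non-decreasing numbers $N_0,\dots,N_k$ such that, for every $i$, $\mathcal C_i$ consists of the intersections of the first $N_i$ listed cycles with the edge set of $G_i$. -/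

import Mathlib

/-! ### Multigraphs: connectivity, cycles and the cycle lattice

Graphs are Mathlib's multigraphs `Graph α β` (loops and parallel edges allowed), with vertex set
`G.vertexSet`, edge set `G.edgeSet`, and `G.IsLink e x y` saying that `e` has the ends `x`, `y`. -/

namespace Graph

variable {α β : Type*}

/-- `G` has a vertex, and any two vertices are joined by a walk. -/
def IsConnected (G : Graph α β) : Prop :=
  G.vertexSet.Nonempty ∧
    ∀ x ∈ G.vertexSet, ∀ y ∈ G.vertexSet, Relation.ReflTransGen G.Adj x y

/-- `G` is `k`-edge-connected: it stays connected whenever fewer than `k` edges are deleted. -/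
def IsEdgeConnected (G : Graph α β) (k : ℕ) : Prop :=
  ∀ F : Finset β, (F : Set β) ⊆ G.edgeSet → F.card < k →
    (G.deleteEdges (F : Set β)).IsConnected

/-- `C` is the edge set of a (simple) cycle of `G`: there are `k ≥ 1` distinct vertices
`x 0, …, x (k - 1)` and `k` distinct edges `e 0, …, e (k - 1)`, with `e i` joining `x i` to
`x (i + 1)` (indices mod `k`), and `C` is the set of these edges. For `k = 1` it is a loop. -/
def IsCycleSet (G : Graph α β) (C : Set β) : Prop :=
  ∃ (k : ℕ) (x : ℕ → α) (e : ℕ → β), 0 < k ∧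
    Set.InjOn x (Set.Iio k) ∧ Set.InjOn e (Set.Iio k) ∧
    (∀ i < k, G.IsLink (e i) (x i) (x ((i + 1) % k))) ∧ C = e '' Set.Iio k

/-- The 0/1 characteristic vector of a set of edges. The group `ℤ^E` is regarded as the group of
the integer vectors on the type of all edge labels that vanish outside `E`. -/
noncomputable def indVect (A : Set β) : β → ℤ := A.indicator 1

/-- The cycle lattice of `G`: all integer combinations of characteristic vectors of cycles. -/
noncomputable def cycleLattice (G : Graph α β) : Submodule ℤ (β → ℤ) :=
  Submodule.span ℤ (indVect '' {C | G.IsCycleSet C})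

/-- `𝒞` is a set of cycles of `G` whose characteristic vectors form a `ℤ`-basis of the cycle
lattice of `G`. -/
def IsLatticeCycleBasis (G : Graph α β) (𝒞 : Set (Set β)) : Prop :=
  (∀ C ∈ 𝒞, G.IsCycleSet C) ∧ LinearIndepOn ℤ (indVect (β := β)) 𝒞 ∧
    Submodule.span ℤ (indVect '' 𝒞) = G.cycleLattice

/-! ### Topological one-edge extensions -/

/-- `G` arises from `H` by dividing the edge `f`, with ends `u` and `v`, into two edges by a new
vertex `a`. The half at `u` keeps the label `f`, the half at `v` gets the new label `f₂`. -/
structure IsDivision (H G : Graph α β) (f f₂ : β) (u v a : α) : Prop where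
  link : H.IsLink f u v
  new_vertex : a ∉ H.vertexSet
  new_edge : f₂ ∉ H.edgeSet
  vertexSet_eq : G.vertexSet = insert a H.vertexSet
  edgeSet_eq : G.edgeSet = insert f₂ H.edgeSet
  old_links : ∀ d ∈ H.edgeSet, d ≠ f → ∀ x y, G.IsLink d x y ↔ H.IsLink d x y
  link_first : G.IsLink f u a
  link_second : G.IsLink f₂ a v

/-- `G` arises from `H` by adding a new edge `e` between the existing, possibly equal, vertices
`a` and `b`. -/
structure IsEdgeAddition (H G : Graph α β) (e : β) (a b : α) : Prop where
  left_mem : a ∈ H.vertexSet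
  right_mem : b ∈ H.vertexSet
  new_edge : e ∉ H.edgeSet
  vertexSet_eq : G.vertexSet = H.vertexSet
  edgeSet_eq : G.edgeSet = insert e H.edgeSet
  old_links : ∀ d ∈ H.edgeSet, ∀ x y, G.IsLink d x y ↔ H.IsLink d x y
  link_new : G.IsLink e a b

end Graph

/-- The instructions for the three types of topological one-edge extensions. -/
inductive ExtOp (α β : Type*) where
  /-- Add the new edge `e` between existing vertices `a` and `b`. -/
  | typeA (e : β) (a b : α)
  /-- Divide `f = uv` by the new vertex `a` into `f` (at `u`) and `f₂` (at `v`), and add the new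
  edge `e` between `a` and the existing vertex `b`. -/
  | typeB (e : β) (a b : α) (f f₂ : β) (u v : α)
  /-- Divide `f = uv` by the new vertex `a` into `f` (at `u`) and `f₂` (at `v`), divide another
  edge `g = xy` by the new vertex `b` into `g` (at `x`) and `g₂` (at `y`), and add the new
  edge `e` between `a` and `b`. -/
  | typeC (e : β) (a b : α) (f f₂ : β) (u v : α) (g g₂ : β) (x y : α)

namespace ExtOp

variable {α β : Type*}

/-- `o.Applies H G`: the operation `o` is a topological one-edge extension of `H` with result
`G`. -/
def Applies (o : ExtOp α β) (H G : Graph α β) : Prop :=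
  match o with
  | typeA e a b => H.IsEdgeAddition G e a b
  | typeB e a b f f₂ u v =>
      b ∈ H.vertexSet ∧
        ∃ K : Graph α β, H.IsDivision K f f₂ u v a ∧ K.IsEdgeAddition G e a b
  | typeC e a b f f₂ u v g g₂ x y =>
      f ∈ H.edgeSet ∧ g ∈ H.edgeSet ∧ f ≠ g ∧
        ∃ K L : Graph α β, H.IsDivision K f f₂ u v a ∧ K.IsDivision L g g₂ x y b ∧
          L.IsEdgeAddition G e a b

/-- Replace the edge `f` of an edge set, if present, by its two halves `f` and `f₂`. -/
def splitEdge (f f₂ : β) (C : Set β) : Set β := {d | d ∈ C ∨ (d = f₂ ∧ f ∈ C)}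

/-- The natural map from the cycles of `H` to those of its extension `G`: every divided edge is
replaced by its two halves. On characteristic vectors this is the natural linear embedding of the
cycle lattice of `H` into that of `G`. -/
def embed (o : ExtOp α β) (C : Set β) : Set β :=
  match o with
  | typeA _ _ _ => C
  | typeB _ _ _ f f₂ _ _ => splitEdge f f₂ C
  | typeC _ _ _ f f₂ _ _ g g₂ _ _ => splitEdge g g₂ (splitEdge f f₂ C)

end ExtOp

namespace Graph

variable {α β : Type*}

/-- `Γ 0 → Γ 1 → ⋯ → Γ k = G` is a topological extension sequence of `G`, starting with the single
vertex `v₀`, in which `Γ (i + 1)` is obtained from `Γ i` by the operation `op i`. -/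
structure IsTopExtSeq (G : Graph α β) (v₀ : α) (k : ℕ) (op : ℕ → ExtOp α β)
    (Γ : ℕ → Graph α β) : Prop where
  start_vertexSet : (Γ 0).vertexSet = {v₀}
  start_edgeSet : (Γ 0).edgeSet = ∅
  step : ∀ i < k, (op i).Applies (Γ i) (Γ (i + 1))
  final : Γ k = G

/-- `𝒞 0 ⊂ 𝒞 1 ⊂ ⋯ ⊂ 𝒞 k` is a compatible chain of lattice cycle bases for the topological
extension sequence `Γ 0 → ⋯ → Γ k`: each `𝒞 i` is a lattice cycle basis of `Γ i`, and the sets are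
nested, the cycles of `Γ i` being regarded as cycles of `Γ (i + 1)` via the natural map. -/
structure IsCompatibleChain (k : ℕ) (op : ℕ → ExtOp α β) (Γ : ℕ → Graph α β)
    (𝒞 : ℕ → Set (Set β)) : Prop where
  basis : ∀ i ≤ k, (Γ i).IsLatticeCycleBasis (𝒞 i)
  nested : ∀ i < k, (op i).embed '' 𝒞 i ⊂ 𝒞 (i + 1)

end Graph

/-! ### The machine model

A random access machine with finitely many integer variables and finitely many integer arrays per
program (all cells initially zero, except for the input), whose arithmetic consists of addition and
truncated subtraction. Every elementary operation costs one unit of time. All values that occur in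
a computation, addresses included, have to stay below a bound `W`; with `W` polynomial in the input
size this is the usual word RAM with words of logarithmic length. -/

namespace RAM

/-- A memory configuration: the variables, and the cells of the arrays. -/
structure State where
  var : ℕ → ℕ
  arr : ℕ → ℕ → ℕ

/-- Set the variable `x` to `c`. -/
def State.setVar (s : State) (x c : ℕ) : State :=
  { s with var := Function.update s.var x c }

/-- Set the cell `i` of the array `A` to `c`. -/
def State.setCell (s : State) (A i c : ℕ) : State :=
  { s with arr := Function.update s.arr A (Function.update (s.arr A) i c) }

/-- Expressions: constants, variables, array cells, sums and truncated differences. -/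
inductive Expr where
  | const (c : ℕ)
  | var (x : ℕ)
  | cell (A : ℕ) (i : Expr)
  | plus (a b : Expr)
  | minus (a b : Expr)

/-- The value of an expression. -/
def Expr.eval (s : State) : Expr → ℕ
  | .const c => c
  | .var x => s.var x
  | .cell A i => s.arr A (i.eval s)
  | .plus a b => a.eval s + b.eval s
  | .minus a b => a.eval s - b.eval s

/-- The number of operations needed to evaluate an expression. -/
def Expr.cost : Expr → ℕ
  | .const _ => 1
  | .var _ => 1
  | .cell _ i => i.cost + 1
  | .plus a b => a.cost + b.cost + 1
  | .minus a b => a.cost + b.cost + 1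

/-- No value above `W` occurs in the evaluation of an expression. -/
def Expr.Fits (W : ℕ) (s : State) : Expr → Prop
  | .const c => c ≤ W
  | .var x => s.var x ≤ W
  | .cell A i => i.Fits W s ∧ s.arr A (i.eval s) ≤ W
  | .plus a b => a.Fits W s ∧ b.Fits W s ∧ a.eval s + b.eval s ≤ W
  | .minus a b => a.Fits W s ∧ b.Fits W s

/-- Programs. A condition holds if the value of the expression is not zero. -/
inductive Prog where
  | skip
  | assign (x : ℕ) (e : Expr)
  | store (A : ℕ) (i e : Expr)
  | seq (p q : Prog)
  | cond (e : Expr) (p q : Prog)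
  | loop (e : Expr) (p : Prog)

/-- `Exec W p s t s'`: started in the state `s`, the program `p` halts after exactly `t` time
units in the state `s'`, and all values that occur are at most `W`. -/
inductive Exec (W : ℕ) : Prog → State → ℕ → State → Prop where
  | skip (s : State) : Exec W .skip s 1 s
  | assign (x : ℕ) (e : Expr) (s : State) (he : e.Fits W s) :
      Exec W (.assign x e) s (e.cost + 1) (s.setVar x (e.eval s))
  | store (A : ℕ) (i e : Expr) (s : State) (hi : i.Fits W s) (he : e.Fits W s) :
      Exec W (.store A i e) s (i.cost + e.cost + 1) (s.setCell A (i.eval s) (e.eval s))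
  | seq {p q : Prog} {s s₁ s₂ : State} {t₁ t₂ : ℕ} (hp : Exec W p s t₁ s₁)
      (hq : Exec W q s₁ t₂ s₂) : Exec W (.seq p q) s (t₁ + t₂) s₂
  | cond_true {e : Expr} {p q : Prog} {s s₁ : State} {t : ℕ} (he : e.Fits W s)
      (hc : e.eval s ≠ 0) (hp : Exec W p s t s₁) : Exec W (.cond e p q) s (e.cost + 1 + t) s₁
  | cond_false {e : Expr} {p q : Prog} {s s₁ : State} {t : ℕ} (he : e.Fits W s)
      (hc : e.eval s = 0) (hq : Exec W q s t s₁) : Exec W (.cond e p q) s (e.cost + 1 + t) s₁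
  | loop_done {e : Expr} {p : Prog} {s : State} (he : e.Fits W s) (hc : e.eval s = 0) :
      Exec W (.loop e p) s (e.cost + 1) s
  | loop_step {e : Expr} {p : Prog} {s s₁ s₂ : State} {t₁ t₂ : ℕ} (he : e.Fits W s)
      (hc : e.eval s ≠ 0) (hp : Exec W p s t₁ s₁) (hl : Exec W (.loop e p) s₁ t₂ s₂) :
      Exec W (.loop e p) s (e.cost + 1 + t₁ + t₂) s₂

/-! ### Input and output -/

open Classical in
/-- `adj` is an adjacency list representation of `G`: the list `adj v` consists of the pairs
`(w, e)` with `e` an edge joining `v` and `w`, each listed once, except that loops are listed twice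
(so that `adj v` has length `deg v`). The order within each list is arbitrary. -/
def IsAdjacencyList (G : Graph ℕ ℕ) (adj : ℕ → List (ℕ × ℕ)) : Prop :=
  ∀ v w e, (adj v).count (w, e) = if G.IsLink e v w then (if v = w then 2 else 1) else 0

/-- The initial memory. Variables 0 and 1 hold `n` and `m`. The lists `adj 0, …, adj (n - 1)` are
stored one after the other: array 0 holds for each `v ≤ n` the position at which the list of `v`
starts, arrays 1 and 2 hold the neighbours and the edges in the list entries. -/
def inputState (n m : ℕ) (adj : ℕ → List (ℕ × ℕ)) : State where
  var := fun x => if x = 0 then n else if x = 1 then m else 0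
  arr := fun A i =>
    if A = 0 then (if i ≤ n then ((List.range i).flatMap adj).length else 0)
    else if A = 1 then (((List.range n).flatMap adj).getD i (0, 0)).1
    else if A = 2 then (((List.range n).flatMap adj).getD i (0, 0)).2
    else 0

/-- The first vertex of the extension sequence in the output. -/
def State.outStart (s : State) : ℕ := s.var 0

/-- The length of the extension sequence in the output. -/
def State.outLength (s : State) : ℕ := s.var 1

/-- The `i`-th extension operation in the output: its type is in array 3 and its parameters are in
arrays 4 to 14, at position `i`. -/
def State.outOp (s : State) (i : ℕ) : ExtOp ℕ ℕ :=
  if s.arr 3 i = 0 then .typeA (s.arr 4 i) (s.arr 5 i) (s.arr 6 i)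
  else if s.arr 3 i = 1 then
    .typeB (s.arr 4 i) (s.arr 5 i) (s.arr 6 i)
      (s.arr 7 i) (s.arr 8 i) (s.arr 9 i) (s.arr 10 i)
  else
    .typeC (s.arr 4 i) (s.arr 5 i) (s.arr 6 i)
      (s.arr 7 i) (s.arr 8 i) (s.arr 9 i) (s.arr 10 i)
      (s.arr 11 i) (s.arr 12 i) (s.arr 13 i) (s.arr 14 i)

/-- The number `N i` of the listed cycles that belong to the `i`-th basis. -/
def State.outCount (s : State) (i : ℕ) : ℕ := s.arr 15 i

/-- The `j`-th listed cycle, as a set of edges of `G`: its edges are stored in array 17, from the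
position held in cell `j` of array 16 up to the one held in cell `j + 1` (exclusive). -/
def State.outCycle (s : State) (j : ℕ) : Set ℕ :=
  s.arr 17 '' Set.Ico (s.arr 16 j) (s.arr 16 (j + 1))

/-- The output describes the chain `𝒞 0, …, 𝒞 k` for the sequence `Γ 0, …, Γ k`: it lists the
members of the last basis `𝒞 k` without repetition, in such an order that the first `N i` of them
form `𝒞 i`. Since a divided edge passes its label on to one of its halves, the edges of `Γ i` are
also edges of `Γ k`, and a cycle of `Γ i` is the intersection of its image in `Γ k` with the edge
set of `Γ i`. -/
structure State.DescribesChain (s : State) (k : ℕ) (Γ : ℕ → Graph ℕ ℕ)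
    (𝒞 : ℕ → Set (Set ℕ)) : Prop where
  last : 𝒞 k = s.outCycle '' Set.Iio (s.outCount k)
  no_repetition : Set.InjOn s.outCycle (Set.Iio (s.outCount k))
  mono : ∀ i < k, s.outCount i ≤ s.outCount (i + 1)
  initial : ∀ i ≤ k,
    𝒞 i = (fun j => s.outCycle j ∩ (Γ i).edgeSet) '' Set.Iio (s.outCount i)

end RAM

/-! The sequence is built from ears. At every moment a subgraph of `G` is kept that is a subdivision
of a 3-edge-connected multigraph, the `net` of a `Layout`; initially it is the vertex 0. Adding an
ear, a path that meets the subgraph exactly in its ends, is a one-edge extension of the net. Its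
type is A, B or C according to whether none, one or both of its ends are interior to subdivided
edges; in type C these edges have to be distinct.

Suitable ears exist because `G` is 3-edge-connected. If the edge `f` is subdivided, delete the first
and the last edge of its path: the interior of the path is still joined to the rest of the subgraph,
and a connection yields an ear with one end inside the path and the other end elsewhere. If nothing
is subdivided but a vertex is missing, some edge leaves the subgraph, and a way back that avoids
this edge gives an ear of length at least two between branch vertices (possibly equal ones). When
all vertices are branch vertices, the missing edges are ears of length one. This is
`Layout.Embedded.exists_target` and `Layout.exists_ear`. The net stays 3-edge-connected by
`Net.Cut3.add`, `Net.Cut3.typeB` and `Net.Cut3.typeC`.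

For the bases, the cycle lattice is replaced by the lattice of even vectors, those with an even sum
over every edge cut. Cycles are even, so cycles whose vectors form a basis of the even lattice also
form a basis of the cycle lattice (`Net.Basis.isLatticeCycleBasis`). Along an extension the even
lattice is controlled by the functionals `x e`, `x f - x f₂` and `x g - x g₂` (as many as the type
provides). Their common kernel in the new even lattice is the old even lattice. As the new vertices
have degree three, the functionals take values of equal parity on an even vector. It therefore
suffices to add cycles through `e` whose value vectors form a basis of the integer vectors with all
entries of equal parity: one cycle in type A; in type B one cycle through each half of `f`; in type
C cycles through the pairs `(f, g)`, `(f, g₂)` and `(f₂, g)`. See `Net.Basis.extend`,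
`Net.Basis.typeB`, `Net.Basis.typeC`. Such cycles exist because the old net stays connected when `f`
and `g` are deleted (`Net.Cut3.mem_typeC`). Old basis cycles are never changed, which makes the
chain compatible.

For the time bound, weigh branch vertices by 2 and other vertices of the subgraph by 1. As long as
not all vertices are branch vertices, every extension raises the weight. So there are at most `2 *
n` such extensions, each with one search for an ear and at most three searches for cycles, in time
O(n + m) (`RAM.span_spec`). Afterwards one search tree per root is reused for all missing edges at
this root, and each of these edges costs O(n) (`RAM.complete_spec`). The total is O(n(n + m)), which
is O(mn + 1) since `n ≤ 4 * m + 1`.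

The program is verified in a semantics without a bound on the values. The bound is recovered at the
end from the fact that an assignment raises the largest stored value at most by a constant
(`RAM.Run.exec`). -/

namespace Graph

/-! ### Cycles of multigraphs and their images under extensions. -/

variable {α β : Type*}

/-- A path `x 0, …, x k` with edges `e 0, …, e (k - 1)`, closed to a cycle by the edge `f`. -/
structure IsClosedPath (G : Graph α β) (k : ℕ) (x : ℕ → α) (e : ℕ → β) (f : β) : Prop where
  link : ∀ i < k, G.IsLink (e i) (x i) (x (i + 1))
  close : G.IsLink f (x k) (x 0)
  inj : ∀ i ≤ k, ∀ j ≤ k, x i = x j → i = j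
  notMem : ∀ i < k, e i ≠ f

/-- An edge determines its ends: if the positions `i < j` carried the same edge, then `x i` would be
`x j` or `x (j + 1)`, against the injectivity of `x`. -/
theorem IsClosedPath.edge_inj {G : Graph α β} {k : ℕ} {x : ℕ → α} {e : ℕ → β} {f : β}
    (h : G.IsClosedPath k x e f) : ∀ i < k, ∀ j < k, e i = e j → i = j := by
  have key : ∀ i < k, ∀ j < k, i < j → e i ≠ e j := by
    intro i hi j hj hij he
    have h1 := h.link i hi
    rw [he] at h1
    rcases h1.left_eq_or_eq (h.link j hj) with h2 | h2
    · have := h.inj i (by omega) j (by omega) h2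
      omega
    · have := h.inj i (by omega) (j + 1) (by omega) h2
      omega
  intro i hi j hj he
  rcases lt_trichotomy i j with h1 | h1 | h1
  · exact absurd he (key i hi j hj h1)
  · exact h1
  · exact absurd he.symm (key j hj i hi h1)

theorem IsClosedPath.isCycleSet {G : Graph α β} {k : ℕ} {x : ℕ → α} {e : ℕ → β} {f : β}
    (h : G.IsClosedPath k x e f) : G.IsCycleSet (insert f (e '' Set.Iio k)) := by
  refine ⟨k + 1, x, fun i => if i < k then e i else f, by omega, ?_, ?_, ?_, ?_⟩
  · intro i hi j hj hij
    exact h.inj i (Nat.lt_succ_iff.1 hi) j (Nat.lt_succ_iff.1 hj) hij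
  · intro i hi j hj hij
    simp only [Set.mem_Iio] at hi hj
    dsimp only at hij
    split_ifs at hij with h1 h2 h2
    · exact h.edge_inj i h1 j h2 hij
    · exact absurd hij (h.notMem i h1)
    · exact absurd hij.symm (h.notMem j h2)
    · omega
  · intro i hi
    rcases Nat.lt_or_ge i k with h1 | h1
    · rw [Nat.mod_eq_of_lt (by omega)]
      simpa [h1] using h.link i h1
    · obtain rfl : i = k := by omega
      simpa using h.close
  · ext d
    simp only [Set.mem_insert_iff, Set.mem_image, Set.mem_Iio]
    constructor
    · rintro (rfl | ⟨i, hi, rfl⟩)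
      · exact ⟨k, by omega, by simp⟩
      · exact ⟨i, by omega, by simp [hi]⟩
    · rintro ⟨i, hi, rfl⟩
      by_cases h1 : i < k
      · exact Or.inr ⟨i, h1, by simp [h1]⟩
      · exact Or.inl (by simp [h1])

/-- Rotate the cyclic order by `j + 1`, where `j` is the position of `f`. Then `f` becomes the last
edge, which closes the path formed by the others. -/
theorem IsCycleSet.exists_closedPath {G : Graph α β} {C : Set β} (hC : G.IsCycleSet C) {f : β}
    (hf : f ∈ C) : ∃ k x e, G.IsClosedPath k x e f ∧ C = insert f (e '' Set.Iio k) := by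
  obtain ⟨K, x, e, hK, hx, he, hl, rfl⟩ := hC
  obtain ⟨j, hj, rfl⟩ := hf
  simp only [Set.mem_Iio] at hj
  have hmod : ∀ i < K, ∀ i' < K, (i + (j + 1)) % K = (i' + (j + 1)) % K → i = i' := by
    intro i hi i' hi' h
    have h1 : i ≡ i' [MOD K] := Nat.ModEq.add_right_cancel' (j + 1) h
    rwa [Nat.ModEq, Nat.mod_eq_of_lt hi, Nat.mod_eq_of_lt hi'] at h1
  have hlast : (K - 1 + (j + 1)) % K = j := by
    have : K - 1 + (j + 1) = j + K := by omega
    rw [this, Nat.add_mod_right, Nat.mod_eq_of_lt hj]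
  refine ⟨K - 1, fun i => x ((i + (j + 1)) % K), fun i => e ((i + (j + 1)) % K), ⟨?_, ?_, ?_, ?_⟩, ?_⟩
  · intro i hi
    have := hl ((i + (j + 1)) % K) (Nat.mod_lt _ hK)
    rw [Nat.mod_add_mod] at this
    rwa [show i + 1 + (j + 1) = i + (j + 1) + 1 by ring]
  · simp only [hlast, zero_add]
    exact hl j hj
  · intro i hi i' hi' h
    exact hmod i (by omega) i' (by omega) (hx (Nat.mod_lt _ hK) (Nat.mod_lt _ hK) h)
  · intro i hi h
    have := he (Nat.mod_lt _ hK) hj h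
    have := hmod i (by omega) (K - 1) (by omega) (this.trans hlast.symm)
    omega
  · ext d
    simp only [Set.mem_image, Set.mem_Iio, Set.mem_insert_iff]
    constructor
    · rintro ⟨i, hi, rfl⟩
      by_cases hij : i = j
      · left; rw [hij]
      · right
        -- Adding `K - (j + 1)` modulo `K` inverts the rotation. The value `K - 1` would belong to
        -- the closing edge, so it does not occur for `i ≠ j`.
        refine ⟨(i + (K - (j + 1))) % K, ?_, ?_⟩
        · have h1 : (i + (K - (j + 1))) % K < K := Nat.mod_lt _ hK
          have h2 : (i + (K - (j + 1))) % K ≠ K - 1 := by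
            intro h
            have h3 : ((i + (K - (j + 1))) % K + (j + 1)) % K = i := by
              rw [Nat.mod_add_mod, show i + (K - (j + 1)) + (j + 1) = i + K by omega,
                Nat.add_mod_right, Nat.mod_eq_of_lt hi]
            rw [h, hlast] at h3
            exact hij h3.symm
          omega
        · rw [Nat.mod_add_mod, show i + (K - (j + 1)) + (j + 1) = i + K by omega,
                Nat.add_mod_right, Nat.mod_eq_of_lt hi]
    · rintro (rfl | ⟨i, hi, rfl⟩)
      · exact ⟨j, hj, rfl⟩
      · exact ⟨_, Nat.mod_lt _ hK, rfl⟩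

theorem IsCycleSet.nonempty {G : Graph α β} {C : Set β} (hC : G.IsCycleSet C) : C.Nonempty := by
  obtain ⟨K, x, e, hK, -, -, -, rfl⟩ := hC
  exact ⟨e 0, 0, hK, rfl⟩

theorem IsCycleSet.subset {G : Graph α β} {C : Set β} (hC : G.IsCycleSet C) : C ⊆ G.edgeSet := by
  obtain ⟨K, x, e, hK, -, -, hl, rfl⟩ := hC
  rintro _ ⟨i, hi, rfl⟩
  exact (hl i hi).edge_mem

theorem IsCycleSet.of_isEdgeAddition {H G : Graph α β} {e : β} {a b : α}
    (h : H.IsEdgeAddition G e a b) {C : Set β} (hC : H.IsCycleSet C) : G.IsCycleSet C := by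
  obtain ⟨K, x, d, hK, hx, hd, hl, rfl⟩ := hC
  exact ⟨K, x, d, hK, hx, hd, fun i hi =>
    (h.old_links _ (hl i hi).edge_mem _ _).2 (hl i hi), rfl⟩

/-- Open the cycle at `f`. The remaining path is prolonged by one half of `f` to the new vertex `a`
and closed by the other half. A cycle that avoids `f` is not affected. -/
theorem IsCycleSet.of_isDivision {H G : Graph α β} {f f₂ : β} {u v a : α}
    (h : H.IsDivision G f f₂ u v a) {C : Set β} (hC : H.IsCycleSet C) :
    G.IsCycleSet (ExtOp.splitEdge f f₂ C) := by
  by_cases hf : f ∈ C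
  · obtain ⟨k, x, e, hp, rfl⟩ := hC.exists_closedPath hf
    have hmem : ∀ i ≤ k, x i ∈ H.vertexSet := by
      intro i hi
      rcases Nat.lt_or_ge i k with h1 | h1
      · exact (hp.link i h1).left_mem
      · obtain rfl : i = k := by omega
        exact hp.close.left_mem
    have hne : ∀ i ≤ k, x i ≠ a := fun i hi hia => h.new_vertex (hia ▸ hmem i hi)
    have hff : f ≠ f₂ := fun hff => h.new_edge (hff ▸ h.link.edge_mem)
    -- Here `p` is the half of `f` at the last vertex of the path and `q` the half at the first one.
    -- Which of the two keeps the label `f` depends on the direction in which the cycle traverses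
    -- `f`.
    have key : ∀ p q : β, G.IsLink p (x k) a → G.IsLink q a (x 0) → (p = f ∧ q = f₂ ∨ p = f₂ ∧ q = f) →
        G.IsCycleSet (ExtOp.splitEdge f f₂ (insert f (e '' Set.Iio k))) := by
      intro p q hlp hlq hpq
      have hold : ∀ i < k, e i ≠ p ∧ e i ≠ q := by
        intro i hi
        have h1 := hp.notMem i hi
        have h2 : e i ≠ f₂ := fun h2 => h.new_edge (h2 ▸ (hp.link i hi).edge_mem)
        rcases hpq with ⟨rfl, rfl⟩ | ⟨rfl, rfl⟩ <;> exact ⟨by assumption, by assumption⟩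
      have hc : G.IsClosedPath (k + 1) (Function.update x (k + 1) a) (Function.update e k p) q := by
        refine ⟨?_, ?_, ?_, ?_⟩
        · intro i hi
          rcases Nat.lt_or_ge i k with h1 | h1
          · rw [Function.update_of_ne (by omega), Function.update_of_ne (by omega),
              Function.update_of_ne (by omega)]
            exact (h.old_links _ (hp.link i h1).edge_mem (hp.notMem i h1) _ _).2 (hp.link i h1)
          · obtain rfl : i = k := by omega
            simpa using hlp
        · simpa using hlq
        · intro i hi j hj hij
          rcases Nat.lt_or_ge k i with h1 | h1 <;> rcases Nat.lt_or_ge k j with h2 | h2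
          · omega
          · obtain rfl : i = k + 1 := by omega
            rw [Function.update_self, Function.update_of_ne (by omega)] at hij
            exact absurd hij.symm (hne j h2)
          · obtain rfl : j = k + 1 := by omega
            rw [Function.update_self, Function.update_of_ne (by omega)] at hij
            exact absurd hij (hne i h1)
          · rw [Function.update_of_ne (by omega), Function.update_of_ne (by omega)] at hij
            exact hp.inj i h1 j h2 hij
        · intro i hi
          rcases Nat.lt_or_ge i k with h1 | h1
          · rw [Function.update_of_ne (by omega)]
            exact (hold i h1).2
          · obtain rfl : i = k := by omega
            rw [Function.update_self]
            rcases hpq with ⟨rfl, rfl⟩ | ⟨rfl, rfl⟩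
            · exact hff
            · exact hff.symm
      have hset : ExtOp.splitEdge f f₂ (insert f (e '' Set.Iio k)) =
          insert q (Function.update e k p '' Set.Iio (k + 1)) := by
        have himg : Function.update e k p '' Set.Iio (k + 1) = insert p (e '' Set.Iio k) := by
          ext d
          simp only [Set.mem_image, Set.mem_Iio, Set.mem_insert_iff]
          constructor
          · rintro ⟨i, hi, rfl⟩
            rcases Nat.lt_or_ge i k with h1 | h1
            · exact Or.inr ⟨i, h1, by rw [Function.update_of_ne (by omega)]⟩
            · obtain rfl : i = k := by omega
              simp
          · rintro (rfl | ⟨i, hi, rfl⟩)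
            · exact ⟨k, by omega, by simp⟩
            · exact ⟨i, by omega, by rw [Function.update_of_ne (by omega)]⟩
        rw [himg]
        ext d
        simp only [ExtOp.splitEdge, Set.mem_insert_iff, true_or, and_true, Set.mem_ofPred_eq]
        rcases hpq with ⟨rfl, rfl⟩ | ⟨rfl, rfl⟩ <;> tauto
      rw [hset]
      exact hc.isCycleSet
    rcases hp.close.eq_and_eq_or_eq_and_eq h.link with ⟨h1, h2⟩ | ⟨h1, h2⟩
    · exact key f f₂ (by rw [h1]; exact h.link_first) (by rw [h2]; exact h.link_second)
        (Or.inl ⟨rfl, rfl⟩)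
    · exact key f₂ f (by rw [h1]; exact h.link_second.symm) (by rw [h2]; exact h.link_first.symm)
        (Or.inr ⟨rfl, rfl⟩)
  · have hs : ExtOp.splitEdge f f₂ C = C := by
      ext d
      simp [ExtOp.splitEdge, hf]
    rw [hs]
    obtain ⟨K, x, d, hK, hx, hd, hl, rfl⟩ := hC
    refine ⟨K, x, d, hK, hx, hd, fun i hi => (h.old_links _ (hl i hi).edge_mem ?_ _ _).2 (hl i hi),
      rfl⟩
    rintro rfl
    exact hf ⟨i, hi, rfl⟩

theorem IsCycleSet.of_applies {H G : Graph α β} {o : ExtOp α β} (h : o.Applies H G) {C : Set β}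
    (hC : H.IsCycleSet C) : G.IsCycleSet (o.embed C) := by
  cases o with
  | typeA e a b => exact hC.of_isEdgeAddition h
  | typeB e a b f f₂ u v =>
    obtain ⟨-, K, h1, h2⟩ := h
    exact (hC.of_isDivision h1).of_isEdgeAddition h2
  | typeC e a b f f₂ u v g g₂ x y =>
    obtain ⟨-, -, -, K, L, h1, h2, h3⟩ := h
    exact ((hC.of_isDivision h1).of_isDivision h2).of_isEdgeAddition h3

end Graph

/-! ### Multigraphs given by end functions, with division and addition of edges. -/

/-- A finite multigraph on natural numbers: vertices, edges, and the two ends of each edge. -/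
@[ext]
structure Net where
  V : Set ℕ
  E : Finset ℕ
  src : ℕ → ℕ
  tgt : ℕ → ℕ

namespace Net

/-- The ends of the edges are vertices. -/
def Closed (N : Net) : Prop := ∀ e ∈ N.E, N.src e ∈ N.V ∧ N.tgt e ∈ N.V

/-- The multigraph described by `N`. -/
def graph (N : Net) : Graph ℕ ℕ where
  vertexSet := N.V
  IsLink e x y := e ∈ N.E ∧ N.Closed ∧ (N.src e = x ∧ N.tgt e = y ∨ N.src e = y ∧ N.tgt e = x)
  isLink_symm := by
    intro e _
    exact ⟨fun x y h => ⟨h.1, h.2.1, h.2.2.symm⟩⟩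
  eq_or_eq_of_isLink_of_isLink := by
    rintro e x y v w ⟨-, -, h1⟩ ⟨-, -, h2⟩
    omega
  left_mem_of_isLink := by
    rintro e x y ⟨h1, h2, h3⟩
    have := h2 e h1
    rcases h3 with ⟨rfl, rfl⟩ | ⟨rfl, rfl⟩
    · exact this.1
    · exact this.2

theorem isLink_iff {N : Net} (h : N.Closed) {e x y : ℕ} : N.graph.IsLink e x y ↔
    e ∈ N.E ∧ (N.src e = x ∧ N.tgt e = y ∨ N.src e = y ∧ N.tgt e = x) := by
  simp [graph, h]

theorem edgeSet_graph {N : Net} (h : N.Closed) : N.graph.edgeSet = N.E := by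
  ext e
  rw [Graph.edge_mem_iff_exists_isLink]
  simp only [isLink_iff h]
  constructor
  · rintro ⟨x, y, h, -⟩; exact h
  · intro h; exact ⟨_, _, h, Or.inl ⟨rfl, rfl⟩⟩

/-- Divide the edge `f` by the new vertex `a`. -/
def divide (N : Net) (f f₂ a : ℕ) : Net where
  V := insert a N.V
  E := insert f₂ N.E
  src := Function.update N.src f₂ a
  tgt := Function.update (Function.update N.tgt f₂ (N.tgt f)) f a

/-- Add the edge `e` from `b` to `a`. -/
def add (N : Net) (e b a : ℕ) : Net where
  V := N.V
  E := insert e N.E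
  src := Function.update N.src e b
  tgt := Function.update N.tgt e a

/-- An ear is added to the subgraph first and its ends are turned into branch vertices afterwards,
whereas extensions of types B and C divide before the new edge is added. The two orders give the
same net. -/
theorem add_divide (N : Net) {e f f₂ : ℕ} (b a c : ℕ) (h : e ≠ f) (h₂ : e ≠ f₂) :
    (N.add e b a).divide f f₂ c = (N.divide f f₂ c).add e b a := by
  ext x
  · simp [Net.add, Net.divide]
  · simp only [Net.add, Net.divide, Finset.mem_insert]; tauto
  · simp only [Net.add, Net.divide, Function.update_apply]
    split_ifs <;> simp_all
  · simp only [Net.add, Net.divide, Function.update_apply]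
    split_ifs <;> simp_all

theorem Closed.divide {N : Net} (h : N.Closed) {f : ℕ} (hf : f ∈ N.E) (f₂ a : ℕ) :
    (N.divide f f₂ a).Closed := by
  intro e he
  simp only [Net.divide, Finset.mem_insert, Function.update_apply, Set.mem_insert_iff] at he ⊢
  have := h f hf
  constructor
  · split_ifs with h1
    · simp
    · exact Or.inr (h e (by tauto)).1
  · split_ifs with h1 h2
    · simp
    · exact Or.inr this.2
    · exact Or.inr (h e (by tauto)).2

theorem Closed.add {N : Net} (h : N.Closed) {e b a : ℕ} (hb : b ∈ N.V) (ha : a ∈ N.V) :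
    (N.add e b a).Closed := by
  intro d hd
  simp only [Net.add, Finset.mem_insert, Function.update_apply] at hd ⊢
  constructor
  · split_ifs with h1
    · exact hb
    · exact (h d (by tauto)).1
  · split_ifs with h1
    · exact ha
    · exact (h d (by tauto)).2

theorem Closed.isDivision {N : Net} (h : N.Closed) {f f₂ a : ℕ} (hf : f ∈ N.E) (hf₂ : f₂ ∉ N.E)
    (ha : a ∉ N.V) :
    N.graph.IsDivision (N.divide f f₂ a).graph f f₂ (N.src f) (N.tgt f) a := by
  have hff : f ≠ f₂ := fun hff => hf₂ (hff ▸ hf)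
  have h' := h.divide hf f₂ a
  refine ⟨?_, ha, ?_, rfl, ?_, ?_, ?_, ?_⟩
  · simp [isLink_iff h, hf]
  · simpa [edgeSet_graph h] using hf₂
  · rw [edgeSet_graph h, edgeSet_graph h']
    simp [Net.divide]
  · intro d hd hdf x y
    rw [edgeSet_graph h] at hd
    have hd₂ : d ≠ f₂ := fun hd₂ => hf₂ (hd₂ ▸ hd)
    rw [isLink_iff h, isLink_iff h']
    simp [Net.divide, hdf, hd₂]
  · rw [isLink_iff h']
    simp [Net.divide, hff, hf]
  · rw [isLink_iff h']
    simp [Net.divide, hff.symm]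

theorem Closed.isEdgeAddition {N : Net} (h : N.Closed) {e a b : ℕ} (he : e ∉ N.E) (ha : a ∈ N.V)
    (hb : b ∈ N.V) : N.graph.IsEdgeAddition (N.add e b a).graph e a b := by
  have h' : (N.add e b a).Closed := h.add hb ha
  refine ⟨ha, hb, ?_, rfl, ?_, ?_, ?_⟩
  · simpa [edgeSet_graph h] using he
  · rw [edgeSet_graph h, edgeSet_graph h']
    simp [Net.add]
  · intro d hd x y
    rw [edgeSet_graph h] at hd
    have hd₂ : d ≠ e := fun hd₂ => he (hd₂ ▸ hd)
    rw [isLink_iff h, isLink_iff h']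
    simp [Net.add, hd₂]
  · rw [isLink_iff h']
    simp [Net.add]

/-! ### Edge cuts -/

/-- The edge `e` joins `X` to its complement. -/
def Crosses (N : Net) (X : Set ℕ) (e : ℕ) : Prop := ¬ (N.src e ∈ X ↔ N.tgt e ∈ X)

/-- Every edge cut has at least three edges. -/
def Cut3 (N : Net) : Prop :=
  ∀ X : Set ℕ, (∃ x ∈ N.V, x ∈ X) → (∃ y ∈ N.V, y ∉ X) →
    ∀ p q, ∃ e ∈ N.E, e ≠ p ∧ e ≠ q ∧ N.Crosses X e

theorem Cut3.add {N : Net} (h : N.Cut3) {e : ℕ} (he : e ∉ N.E) (b a : ℕ) : (N.add e b a).Cut3 := by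
  intro X hx hy p q
  obtain ⟨d, hd, h1, h2, h3⟩ := h X hx hy p q
  have hde : d ≠ e := fun hde => he (hde ▸ hd)
  refine ⟨d, by simp [Net.add, hd], h1, h2, ?_⟩
  simpa [Crosses, Net.add, hde] using h3

/-- The edge cuts of `N.divide f f₂ a` that separate vertices of `N` have three edges. -/
theorem exists_crosses_divide {N : Net} {f f₂ a : ℕ} (hf : f ∈ N.E) (hf₂ : f₂ ∉ N.E) {X : Set ℕ}
    (h : ∀ p q, ∃ e ∈ N.E, e ≠ p ∧ e ≠ q ∧ N.Crosses X e) (p q : ℕ) :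
    ∃ e ∈ (N.divide f f₂ a).E, e ≠ p ∧ e ≠ q ∧ (N.divide f f₂ a).Crosses X e := by
  have hff : f₂ ≠ f := fun hff => hf₂ (hff ▸ hf)
  -- A forbidden `f₂` is replaced by the forbidden `f`. Hence if the crossing edge found in `N` is
  -- `f` itself, neither half of it is forbidden, and at least one of the halves crosses.
  obtain ⟨d, hd, h1, h2, h3⟩ := h (if p = f₂ then f else p) (if q = f₂ then f else q)
  have hd₂ : d ≠ f₂ := fun hd₂ => hf₂ (hd₂ ▸ hd)
  by_cases hdf : d = f
  · subst hdf
    have hp : p ≠ d ∧ p ≠ f₂ := by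
      constructor
      · rintro rfl; simp [hd₂] at h1
      · rintro rfl; simp at h1
    have hq : q ≠ d ∧ q ≠ f₂ := by
      constructor
      · rintro rfl; simp [hd₂] at h2
      · rintro rfl; simp at h2
    by_cases hc : (N.divide d f₂ a).Crosses X d
    · exact ⟨d, by simp [Net.divide, hd], hp.1.symm, hq.1.symm, hc⟩
    · refine ⟨f₂, by simp [Net.divide], hp.2.symm, hq.2.symm, ?_⟩
      simp only [Crosses, Net.divide, Function.update_apply, hd₂, if_false, if_true, hff] at h3 hc ⊢
      tauto
  · refine ⟨d, by simp [Net.divide, hd], ?_, ?_, ?_⟩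
    · rintro rfl; simp [hd₂] at h1
    · rintro rfl; simp [hd₂] at h2
    · simpa [Crosses, Net.divide, Function.update_apply, hdf, hd₂] using h3

theorem exists_crosses_add {N : Net} {e b a : ℕ} (he : e ∉ N.E) {X : Set ℕ} {p q : ℕ}
    (h : ∃ d ∈ N.E, d ≠ p ∧ d ≠ q ∧ N.Crosses X d) :
    ∃ d ∈ (N.add e b a).E, d ≠ p ∧ d ≠ q ∧ (N.add e b a).Crosses X d := by
  obtain ⟨d, hd, h1, h2, h3⟩ := h
  have hde : d ≠ e := fun hde => he (hde ▸ hd)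
  exact ⟨d, by simp [Net.add, hd], h1, h2, by simpa [Crosses, Net.add, hde] using h3⟩

/-- Applied to the edges at a new vertex: three distinct crossing edges cannot all be among two
deleted ones. -/
theorem exists_of_three {P : ℕ → Prop} {x y z : ℕ} (hx : P x) (hy : P y) (hz : P z) (hxy : x ≠ y)
    (hxz : x ≠ z) (hyz : y ≠ z) (p q : ℕ) : ∃ d, P d ∧ d ≠ p ∧ d ≠ q := by
  by_cases h1 : x ≠ p ∧ x ≠ q
  · exact ⟨x, hx, h1⟩
  · by_cases h2 : y ≠ p ∧ y ≠ q
    · exact ⟨y, hy, h2⟩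
    · exact ⟨z, hz, by omega⟩

/-- A cut that separates vertices of `N` inherits three edges from `N`. Any other cut separates `a`
from all old vertices, and then `f`, `f₂` and `e` cross it. -/
theorem Cut3.typeB {N : Net} (h : N.Cut3) (hN : N.Closed) {f f₂ e a b : ℕ} (hf : f ∈ N.E)
    (hf₂ : f₂ ∉ N.E) (he : e ∉ N.E) (hef : e ≠ f₂) (hb : b ∈ N.V) :
    ((N.divide f f₂ a).add e b a).Cut3 := by
  have hff : f₂ ≠ f := fun hff => hf₂ (hff ▸ hf)
  have hef' : e ≠ f := fun hff => he (hff ▸ hf)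
  have he' : e ∉ (N.divide f f₂ a).E := by simp [Net.divide, he, hef]
  rintro X ⟨x, hx, hxX⟩ ⟨y, hy, hyX⟩ p q
  by_cases hcut : (∃ x ∈ N.V, x ∈ X) ∧ (∃ y ∈ N.V, y ∉ X)
  · exact exists_crosses_add he' (exists_crosses_divide hf hf₂ (h X hcut.1 hcut.2) p q)
  · have hall : ∀ v ∈ N.V, ¬ (v ∈ X ↔ a ∈ X) := by
      intro v hv hva
      simp only [Net.add, Net.divide, Set.mem_insert_iff] at hx hy
      apply hcut
      rcases hx with rfl | hx
      · rcases hy with rfl | hy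
        · exact absurd hxX hyX
        · exact ⟨⟨v, hv, by tauto⟩, ⟨y, hy, hyX⟩⟩
      · rcases hy with rfl | hy
        · exact ⟨⟨x, hx, hxX⟩, ⟨v, hv, by tauto⟩⟩
        · exact ⟨⟨x, hx, hxX⟩, ⟨y, hy, hyX⟩⟩
    obtain ⟨d, ⟨h1, h2⟩, h3⟩ := exists_of_three
      (P := fun d => d ∈ ((N.divide f f₂ a).add e b a).E ∧ ((N.divide f f₂ a).add e b a).Crosses X d)
      (x := f) (y := f₂) (z := e)
      ⟨by simp [Net.add, Net.divide, hf], by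
        have := hall _ (hN f hf).1
        simpa [Crosses, Net.add, Net.divide, Function.update_apply, hef'.symm, hff.symm] using this⟩
      ⟨by simp [Net.add, Net.divide], by
        have := hall _ (hN f hf).2
        simp only [Crosses, Net.add, Net.divide, Function.update_apply, hef.symm, hff, if_false, if_true]
        tauto⟩
      ⟨by simp [Net.add], by
        have := hall _ hb
        simpa [Crosses, Net.add] using this⟩ hff.symm hef'.symm hef.symm p q
    exact ⟨d, h1, h3.1, h3.2, h2⟩

/-- As for type B, only cuts with all old vertices on one side need an argument. On the other side
lies `a`, or `b`, or both. -/
theorem Cut3.typeC {N : Net} (h : N.Cut3) (hN : N.Closed) {f f₂ g g₂ e a b : ℕ} (hf : f ∈ N.E)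
    (hf₂ : f₂ ∉ N.E) (hg : g ∈ N.E) (hg₂ : g₂ ∉ N.E) (hfg : f ≠ g) (hfg₂ : f₂ ≠ g₂) (he : e ∉ N.E)
    (hef : e ≠ f₂) (heg : e ≠ g₂) :
    (((N.divide f f₂ a).divide g g₂ b).add e b a).Cut3 := by
  have hff : f₂ ≠ f := fun hff => hf₂ (hff ▸ hf)
  have hgg : g₂ ≠ g := fun hff => hg₂ (hff ▸ hg)
  have hfg' : f₂ ≠ g := fun hff => hf₂ (hff ▸ hg)
  have hgf' : g₂ ≠ f := fun hff => hg₂ (hff ▸ hf)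
  have hef' : e ≠ f := fun hff => he (hff ▸ hf)
  have heg' : e ≠ g := fun hff => he (hff ▸ hg)
  have he' : e ∉ ((N.divide f f₂ a).divide g g₂ b).E := by simp [Net.divide, he, hef, heg]
  rintro X ⟨x, hx, hxX⟩ ⟨y, hy, hyX⟩ p q
  by_cases hcut : (∃ x ∈ N.V, x ∈ X) ∧ (∃ y ∈ N.V, y ∉ X)
  · exact exists_crosses_add he' (exists_crosses_divide (by simp [Net.divide, hg])
      (by simp [Net.divide, hg₂, hfg₂.symm]) (exists_crosses_divide hf hf₂ (h X hcut.1 hcut.2)) p q)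
  · set N' := ((N.divide f f₂ a).divide g g₂ b).add e b a with hN'
    have hall : ∀ v ∈ N.V, ∀ w ∈ N.V, (v ∈ X ↔ w ∈ X) := by
      intro v hv w hw
      by_contra hvw
      by_cases hv' : v ∈ X
      · exact hcut ⟨⟨v, hv, hv'⟩, ⟨w, hw, by tauto⟩⟩
      · exact hcut ⟨⟨w, hw, by tauto⟩, ⟨v, hv, hv'⟩⟩
    have hV : N'.V = insert b (insert a N.V) := rfl
    have hEf : f ∈ N'.E ∧ f₂ ∈ N'.E ∧ g ∈ N'.E ∧ g₂ ∈ N'.E ∧ e ∈ N'.E := by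
      simp [hN', Net.add, Net.divide, hf, hg]
    have hcf : N'.Crosses X f ↔ ¬ (N.src f ∈ X ↔ a ∈ X) := by
      simp [hN', Crosses, Net.add, Net.divide, Function.update_apply, hef'.symm, hff.symm, hgf'.symm, hfg]
    have hcf₂ : N'.Crosses X f₂ ↔ ¬ (a ∈ X ↔ N.tgt f ∈ X) := by
      simp [hN', Crosses, Net.add, Net.divide, Function.update_apply, hef.symm, hff, hfg₂, hfg']
    have hcg : N'.Crosses X g ↔ ¬ (N.src g ∈ X ↔ b ∈ X) := by
      simp [hN', Crosses, Net.add, Net.divide, Function.update_apply, heg'.symm, hgg.symm, hfg'.symm]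
    have hcg₂ : N'.Crosses X g₂ ↔ ¬ (b ∈ X ↔ N.tgt g ∈ X) := by
      simp [hN', Crosses, Net.add, Net.divide, heg.symm, hgg, hfg.symm,
        hfg'.symm]
    have hce : N'.Crosses X e ↔ ¬ (b ∈ X ↔ a ∈ X) := by
      simp [hN', Crosses, Net.add]
    have hs1 := hall _ (hN f hf).1 _ (hN f hf).2
    have hs2 := hall _ (hN f hf).1 _ (hN g hg).1
    have hs3 := hall _ (hN f hf).1 _ (hN g hg).2
    have hfin : ∀ {u v w : ℕ}, (u ∈ N'.E ∧ N'.Crosses X u) → (v ∈ N'.E ∧ N'.Crosses X v) →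
        (w ∈ N'.E ∧ N'.Crosses X w) → u ≠ v → u ≠ w → v ≠ w →
        ∃ d ∈ N'.E, d ≠ p ∧ d ≠ q ∧ N'.Crosses X d := by
      intro u v w hu hv hw h1 h2 h3
      obtain ⟨d, ⟨h4, h5⟩, h6⟩ := exists_of_three (P := fun d => d ∈ N'.E ∧ N'.Crosses X d)
        hu hv hw h1 h2 h3 p q
      exact ⟨d, h4, h6.1, h6.2, h5⟩
    -- The vertex `N.src f` represents the common side of the old vertices. If exactly one of `a`,
    -- `b` lies on the other side, the three edges at this vertex cross. If both do, then `e` need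
    -- not cross, but the halves of `f` and of `g` do.
    by_cases ha : (N.src f ∈ X ↔ a ∈ X)
    · have hb : ¬ (N.src f ∈ X ↔ b ∈ X) := by
        intro hb
        have hx' : x ∈ X ↔ N.src f ∈ X := by
          rw [hV] at hx
          rcases hx with rfl | rfl | hx
          · exact hb.symm
          · exact ha.symm
          · exact hall _ hx _ (hN f hf).1
        have hy' : y ∈ X ↔ N.src f ∈ X := by
          rw [hV] at hy
          rcases hy with rfl | rfl | hy
          · exact hb.symm
          · exact ha.symm
          · exact hall _ hy _ (hN f hf).1
        exact hyX (hy'.2 (hx'.1 hxX))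
      exact hfin (u := g) (v := g₂) (w := e) ⟨hEf.2.2.1, hcg.2 fun h => hb (hs2.trans h)⟩
        ⟨hEf.2.2.2.1, hcg₂.2 fun h => hb (hs3.trans h.symm)⟩
        ⟨hEf.2.2.2.2, hce.2 fun h => hb (ha.trans h.symm)⟩ hgg.symm heg'.symm heg.symm
    · by_cases hb : (N.src f ∈ X ↔ b ∈ X)
      · exact hfin (u := f) (v := f₂) (w := e) ⟨hEf.1, hcf.2 ha⟩
          ⟨hEf.2.1, hcf₂.2 fun h => ha (hs1.trans h.symm)⟩
          ⟨hEf.2.2.2.2, hce.2 fun h => ha (hb.trans h)⟩ hff.symm hef'.symm hef.symm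
      · exact hfin (u := f) (v := f₂) (w := g) ⟨hEf.1, hcf.2 ha⟩
          ⟨hEf.2.1, hcf₂.2 fun h => ha (hs1.trans h.symm)⟩
          ⟨hEf.2.2.1, hcg.2 fun h => hb (hs2.trans h)⟩ hff.symm hfg hfg'

end Net

/-! ### Even vectors, and bases of the lattice they form. -/

open Graph in
theorem Graph.indVect_apply {β : Type*} (A : Set β) (d : β) [Decidable (d ∈ A)] :
    indVect A d = if d ∈ A then 1 else 0 := by
  simp [indVect, Set.indicator_apply]

namespace Net

open Graph

/-- The vector `x` has an even sum over every edge cut: this is expressed with the potentials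
`φ` with values in `ZMod 2`. -/
def Even (N : Net) (x : ℕ → ℤ) : Prop :=
  ∀ φ : ℕ → ZMod 2, ∑ d ∈ N.E, (x d : ZMod 2) * (φ (N.src d) + φ (N.tgt d)) = 0

theorem Even.sub {N : Net} {x y : ℕ → ℤ} (hx : N.Even x) (hy : N.Even y) :
    N.Even fun d => x d - y d := by
  intro φ
  have := congrArg₂ (· - ·) (hx φ) (hy φ)
  simpa [sub_mul, Finset.sum_sub_distrib] using this

theorem Even.smul {N : Net} {x : ℕ → ℤ} (hx : N.Even x) (c : ℤ) : N.Even fun d => c * x d := by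
  intro φ
  have := congrArg ((c : ZMod 2) * ·) (hx φ)
  simpa [Finset.mul_sum, mul_assoc] using this

theorem Even.sum {N : Net} {ι : Type*} (s : Finset ι) {x : ι → ℕ → ℤ} (hx : ∀ i ∈ s, N.Even (x i)) :
    N.Even fun d => ∑ i ∈ s, x i d := by
  intro φ
  simp only [Int.cast_sum, Finset.sum_mul]
  rw [Finset.sum_comm]
  exact Finset.sum_eq_zero fun i hi => hx i hi φ

theorem Even.congr {N : Net} {x y : ℕ → ℤ} (hx : N.Even x) (h : ∀ d ∈ N.E, x d = y d) :
    N.Even y := by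
  intro φ
  rw [← hx φ]
  exact Finset.sum_congr rfl fun d hd => by rw [h d hd]

/-- The two halves have the same coefficient, and together they contribute the potentials at the
ends of `f` and twice the potential at `a`, which vanishes modulo 2. -/
theorem Even.of_divide {N : Net} {f f₂ a : ℕ} {x : ℕ → ℤ} (hx : (N.divide f f₂ a).Even x)
    (hf : f ∈ N.E) (hf₂ : f₂ ∉ N.E) (h : x f = x f₂) : N.Even x := by
  intro φ
  have hff : f₂ ≠ f := fun hff => hf₂ (hff ▸ hf)
  have h1 := hx φ
  simp only [divide] at h1
  rw [Finset.sum_insert hf₂, ← Finset.add_sum_erase _ _ hf] at h1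
  rw [← Finset.add_sum_erase _ _ hf]
  have h2 : ∀ d ∈ N.E.erase f, Function.update N.src f₂ a d = N.src d ∧
      Function.update (Function.update N.tgt f₂ (N.tgt f)) f a d = N.tgt d := by
    intro d hd
    rw [Finset.mem_erase] at hd
    have : d ≠ f₂ := fun hd₂ => hf₂ (hd₂ ▸ hd.2)
    simp [this, hd.1]
  rw [Finset.sum_congr rfl fun d hd => by rw [(h2 d hd).1, (h2 d hd).2]] at h1
  rw [← h1]
  have h3 : φ a + φ a = 0 := CharTwo.add_self_eq_zero _
  simp only [Function.update_self, Function.update_of_ne hff, Function.update_of_ne hff.symm, h]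
  linear_combination (-(x f₂ : ZMod 2)) * h3

theorem Even.of_add {N : Net} {e b a : ℕ} {x : ℕ → ℤ} (hx : (N.add e b a).Even x)
    (he : e ∉ N.E) (h : x e = 0) : N.Even x := by
  intro φ
  have h1 := hx φ
  simp only [Net.add] at h1
  rw [Finset.sum_insert he, h] at h1
  rw [← h1]
  simp only [Int.cast_zero, zero_mul, zero_add]
  refine Finset.sum_congr rfl fun d hd => ?_
  have : d ≠ e := fun hd₂ => he (hd₂ ▸ hd)
  simp [this]

/-- At a vertex of degree three the values on the three edges have an even sum. -/
theorem Even.degree_three {N : Net} {x : ℕ → ℤ} (hx : N.Even x) (a : ℕ) {p q r : ℕ} (hp : p ∈ N.E)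
    (hq : q ∈ N.E) (hr : r ∈ N.E) (hpq : p ≠ q) (hpr : p ≠ r) (hqr : q ≠ r)
    (h : ∀ d ∈ N.E, (d = p ∨ d = q ∨ d = r) ↔ N.Crosses {a} d) : ∃ c, x p + x q + x r = 2 * c := by
  classical
  -- The potential is the indicator of `a`; in characteristic two a loop at `a` contributes nothing.
  have h1 := hx fun v => if v = a then 1 else 0
  have h2 : ∀ d ∈ N.E, (if N.src d = a then (1 : ZMod 2) else 0) + (if N.tgt d = a then 1 else 0) =
      if (d = p ∨ d = q ∨ d = r) then 1 else 0 := by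
    intro d hd
    rw [if_congr (h d hd) rfl rfl]
    simp only [Crosses, Set.mem_singleton_iff]
    by_cases h3 : N.src d = a <;> by_cases h4 : N.tgt d = a <;> simp [h3, h4, CharTwo.add_self_eq_zero]
  rw [Finset.sum_congr rfl fun d hd => by rw [h2 d hd]] at h1
  simp only [mul_ite, mul_one, mul_zero] at h1
  rw [← Finset.sum_filter] at h1
  have h5 : N.E.filter (fun d => d = p ∨ d = q ∨ d = r) = {p, q, r} := by
    ext d
    simp only [Finset.mem_filter, Finset.mem_insert, Finset.mem_singleton]
    constructor
    · exact fun h => h.2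
    · intro h
      refine ⟨?_, h⟩
      rcases h with rfl | rfl | rfl <;> assumption
  rw [h5, Finset.sum_insert (by simp [hpq, hpr]), Finset.sum_insert (by simp [hqr]),
    Finset.sum_singleton] at h1
  have h6 : ((x p + x q + x r : ℤ) : ZMod 2) = 0 := by push_cast; rw [← h1]; ring
  obtain ⟨c, hc⟩ := (ZMod.intCast_zmod_eq_zero_iff_dvd _ 2).1 h6
  exact ⟨c, by exact_mod_cast hc⟩

/-- Along a closed path the sums of the potentials at consecutive vertices telescope, since every
vertex is counted twice and the characteristic is two. -/
theorem even_indVect_of_isCycleSet {N : Net} (hN : N.Closed) {C : Set ℕ}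
    (hC : N.graph.IsCycleSet C) : N.Even (indVect C) := by
  classical
  obtain ⟨f, hf⟩ := hC.nonempty
  obtain ⟨k, x, e, hp, rfl⟩ := hC.exists_closedPath hf
  intro φ
  have hends : ∀ d u v, N.graph.IsLink d u v → φ (N.src d) + φ (N.tgt d) = φ u + φ v := by
    intro d u v h
    rw [isLink_iff hN] at h
    rcases h.2 with ⟨rfl, rfl⟩ | ⟨rfl, rfl⟩
    · rfl
    · exact add_comm _ _
  have hinj : Set.InjOn e (Finset.range k) := by
    intro i hi j hj hij
    exact hp.edge_inj i (by simpa using hi) j (by simpa using hj) hij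
  have hset : insert f (e '' Set.Iio k) = ((insert f ((Finset.range k).image e) : Finset ℕ) : Set ℕ) := by
    ext d; simp
  have hsub : insert f ((Finset.range k).image e) ⊆ N.E := by
    intro d hd
    have : d ∈ N.graph.edgeSet := hp.isCycleSet.subset (by rw [hset]; exact_mod_cast hd)
    rw [edgeSet_graph hN] at this
    exact_mod_cast this
  rw [hset]
  simp only [indVect_apply, Finset.mem_coe, Int.cast_ite, Int.cast_one, Int.cast_zero, ite_mul,
    one_mul, zero_mul]
  rw [← Finset.sum_filter, Finset.filter_mem_eq_inter, Finset.inter_eq_right.2 hsub,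
    Finset.sum_insert, Finset.sum_image hinj, hends _ _ _ hp.close]
  · rw [Finset.sum_congr rfl fun i hi => hends _ _ _ (hp.link i (Finset.mem_range.1 hi))]
    have : ∀ n, ∑ i ∈ Finset.range n, (φ (x i) + φ (x (i + 1))) = φ (x 0) + φ (x n) := by
      intro n
      induction n with
      | zero => simp [CharTwo.add_self_eq_zero]
      | succ n ih =>
        rw [Finset.sum_range_succ, ih]
        linear_combination (CharTwo.add_self_eq_zero (φ (x n)))
    rw [this]
    linear_combination (CharTwo.add_self_eq_zero (φ (x k))) + (CharTwo.add_self_eq_zero (φ (x 0)))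
  · simp only [Finset.mem_image, Finset.mem_range, not_exists, not_and]
    exact hp.notMem

/-- The characteristic vectors of `U 0, …, U (K - 1)`, restricted to the edges of `N`, are linearly
independent and generate all even vectors. -/
structure Basis (N : Net) (U : ℕ → Set ℕ) (K : ℕ) : Prop where
  indep : ∀ c : ℕ → ℤ, (∀ d ∈ N.E, ∑ j ∈ Finset.range K, c j * indVect (U j) d = 0) →
    ∀ j < K, c j = 0
  span : ∀ x, N.Even x → ∃ c : ℕ → ℤ, ∀ d ∈ N.E, x d = ∑ j ∈ Finset.range K, c j * indVect (U j) d

theorem Basis.congr {N : Net} {U U' : ℕ → Set ℕ} {K : ℕ} (h : N.Basis U K)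
    (hU : ∀ j < K, U j = U' j) : N.Basis U' K := by
  have key : ∀ (c : ℕ → ℤ) d, ∑ j ∈ Finset.range K, c j * indVect (U' j) d =
      ∑ j ∈ Finset.range K, c j * indVect (U j) d := fun c d =>
    Finset.sum_congr rfl fun j hj => by rw [hU j (Finset.mem_range.1 hj)]
  constructor
  · intro c hc
    exact h.indep c fun d hd => by rw [← key]; exact hc d hd
  · intro x hx
    obtain ⟨c, hc⟩ := h.span x hx
    exact ⟨c, fun d hd => by rw [key]; exact hc d hd⟩

/-- The span of the given cycles is contained in the cycle lattice, whose elements are even; by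
`Basis.span` the even vectors lie in the span of the given cycles. So the three lattices agree, and
everything else can be done with even vectors. -/
theorem Basis.isLatticeCycleBasis {N : Net} (hN : N.Closed) {U : ℕ → Set ℕ} {K : ℕ}
    (h : N.Basis U K) (hU : ∀ j < K, N.graph.IsCycleSet (U j ∩ N.graph.edgeSet)) :
    N.graph.IsLatticeCycleBasis ((fun j => U j ∩ N.graph.edgeSet) '' Set.Iio K) ∧
      Set.InjOn (fun j => U j ∩ N.graph.edgeSet) (Set.Iio K) := by
  classical
  rw [edgeSet_graph hN] at hU ⊢
  have hval : ∀ j d, indVect (U j ∩ N.E) d = if d ∈ N.E then indVect (U j) d else 0 := by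
    intro j d
    simp only [indVect_apply, Set.mem_inter_iff, Finset.mem_coe]
    split_ifs <;> simp_all
  have hli : LinearIndepOn ℤ (fun j => indVect (U j ∩ N.E)) (Set.Iio K) := by
    rw [show Set.Iio K = ((Finset.range K : Finset ℕ) : Set ℕ) by ext; simp, linearIndepOn_finset_iff]
    intro c hc j hj
    refine h.indep c (fun d hd => ?_) j (Finset.mem_range.1 hj)
    have := congrFun hc d
    simpa [Finset.sum_apply, hval, hd] using this
  refine ⟨⟨?_, ?_, ?_⟩, ?_⟩
  · rintro _ ⟨j, hj, rfl⟩
    exact hU j hj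
  · exact LinearIndepOn.image_of_comp (fun j => U j ∩ (N.E : Set ℕ)) indVect hli
  · apply le_antisymm
    · refine Submodule.span_mono ?_
      rintro _ ⟨_, ⟨j, hj, rfl⟩, rfl⟩
      exact ⟨_, hU j hj, rfl⟩
    · refine Submodule.span_le.2 ?_
      rintro _ ⟨C, hC, rfl⟩
      obtain ⟨c, hc⟩ := h.span _ (even_indVect_of_isCycleSet hN hC)
      have hsum : indVect C = ∑ j ∈ Finset.range K, c j • indVect (U j ∩ (N.E : Set ℕ)) := by
        ext d
        simp only [Finset.sum_apply, Pi.smul_apply, hval, smul_eq_mul]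
        by_cases hd : d ∈ N.E
        · simpa [hd] using hc d hd
        · have hdC : d ∉ C := fun h' => hd (by simpa [edgeSet_graph hN] using hC.subset h')
          simp [hd, indVect_apply, hdC]
      rw [SetLike.mem_coe, hsum]
      exact Submodule.sum_mem _ fun j hj => Submodule.smul_mem _ _
        (Submodule.subset_span ⟨_, ⟨j, Finset.mem_range.1 hj, rfl⟩, rfl⟩)
  · intro i hi j hj hij
    exact hli.injOn hi hj (congrArg indVect hij)

/-- A basis for `N` is extended to a basis for `N'` by vectors on which suitable linear functions,
vanishing on the old vectors, take the right values. -/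
theorem Basis.extend {N N' : Net} {U : ℕ → Set ℕ} {K : ℕ} (h : N.Basis U K) (r : ℕ)
    (l : ℕ → (ℕ → ℤ) →ₗ[ℤ] ℤ) (hE : N.E ⊆ N'.E)
    (hl : ∀ i < r, ∀ x, (∀ d ∈ N'.E, x d = 0) → l i x = 0)
    (hdet : ∀ x, (∀ d ∈ N.E, x d = 0) → (∀ i < r, l i x = 0) → ∀ d ∈ N'.E, x d = 0)
    (hold : ∀ i < r, ∀ j < K, l i (indVect (U j)) = 0)
    (hnew : ∀ s < r, N'.Even (indVect (U (K + s))))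
    (hinj : ∀ c : ℕ → ℤ, (∀ i < r, ∑ s ∈ Finset.range r, c s * l i (indVect (U (K + s))) = 0) →
      ∀ s < r, c s = 0)
    (hsurj : ∀ x, N'.Even x → ∃ c : ℕ → ℤ, ∀ i < r,
      l i x = ∑ s ∈ Finset.range r, c s * l i (indVect (U (K + s))))
    (hker : ∀ x, N'.Even x → (∀ i < r, l i x = 0) → N.Even x) : N'.Basis U (K + r) := by
  have hlsum : ∀ (s : Finset ℕ) (c : ℕ → ℤ) (V : ℕ → ℕ → ℤ) i,
      l i (fun d => ∑ j ∈ s, c j * V j d) = ∑ j ∈ s, c j * l i (V j) := by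
    intro s c V i
    have : (fun d => ∑ j ∈ s, c j * V j d) = ∑ j ∈ s, c j • V j := by
      ext d; simp [Finset.sum_apply]
    rw [this, map_sum]
    exact Finset.sum_congr rfl fun j _ => by rw [map_smul, smul_eq_mul]
  constructor
  · intro c hc
    -- The functionals vanish on the old vectors, so they turn a linear relation into one between
    -- the values on the new vectors alone.
    have h1 : ∀ s < r, c (K + s) = 0 := by
      apply hinj fun s => c (K + s)
      intro i hi
      have h2 := hl i hi _ hc
      rw [hlsum (Finset.range (K + r)) c (fun j => indVect (U j)), Finset.sum_range_add,
        Finset.sum_eq_zero, zero_add] at h2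
      · exact h2
      · intro j hj
        rw [hold i hi j (Finset.mem_range.1 hj), mul_zero]
    have h2 : ∀ j < K, c j = 0 := by
      apply h.indep
      intro d hd
      have h3 := hc d (hE hd)
      rw [Finset.sum_range_add, Finset.sum_eq_zero (s := Finset.range r), add_zero] at h3
      · exact h3
      · intro s hs
        rw [h1 s (Finset.mem_range.1 hs), zero_mul]
    intro j hj
    rcases Nat.lt_or_ge j K with h3 | h3
    · exact h2 j h3
    · have := h1 (j - K) (by omega)
      rwa [Nat.add_sub_cancel' h3] at this
  · intro x hx
    -- Subtract the combination `z` of new vectors with the same values of the functionals as `x`.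
    -- What remains is even on `N` by `hker`, hence a combination of old vectors there.
    obtain ⟨c, hc⟩ := hsurj x hx
    set z : ℕ → ℤ := fun d => ∑ s ∈ Finset.range r, c s * indVect (U (K + s)) d with hz
    have hlz : ∀ i, l i z = ∑ s ∈ Finset.range r, c s * l i (indVect (U (K + s))) := fun i =>
      hlsum _ c (fun s => indVect (U (K + s))) i
    have hy : N'.Even fun d => x d - z d :=
      hx.sub (Even.sum _ fun s hs => (hnew s (Finset.mem_range.1 hs)).smul _)
    have hly : ∀ i < r, l i (fun d => x d - z d) = 0 := by
      intro i hi
      have : (fun d => x d - z d) = x - z := rfl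
      rw [this, map_sub, hlz, hc i hi, sub_self]
    obtain ⟨c', hc'⟩ := h.span _ (hker _ hy hly)
    refine ⟨fun j => if j < K then c' j else c (j - K), ?_⟩
    -- Equality is known on the old edges only. On the new edges it follows from `hdet`, because all
    -- functionals vanish on the difference.
    have h1 := hdet (fun d => (x d - z d) - ∑ j ∈ Finset.range K, c' j * indVect (U j) d)
      (fun d hd => sub_eq_zero.2 (hc' d hd)) (by
        intro i hi
        have : (fun d => (x d - z d) - ∑ j ∈ Finset.range K, c' j * indVect (U j) d) =
          (fun d => x d - z d) - fun d => ∑ j ∈ Finset.range K, c' j * indVect (U j) d := rfl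
        rw [this, map_sub, hly i hi, hlsum (Finset.range K) c' (fun j => indVect (U j)),
          Finset.sum_eq_zero, sub_zero]
        intro j hj
        rw [hold i hi j (Finset.mem_range.1 hj), mul_zero])
    intro d hd
    have h2 := h1 d hd
    rw [Finset.sum_range_add]
    have h3 : ∑ j ∈ Finset.range K, (if j < K then c' j else c (j - K)) * indVect (U j) d =
        ∑ j ∈ Finset.range K, c' j * indVect (U j) d :=
      Finset.sum_congr rfl fun j hj => by rw [if_pos (Finset.mem_range.1 hj)]
    have h4 : ∑ s ∈ Finset.range r, (if K + s < K then c' (K + s) else c (K + s - K)) *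
        indVect (U (K + s)) d = z d :=
      Finset.sum_congr rfl fun s hs => by
        rw [if_neg (by omega), Nat.add_sub_cancel_left]
    rw [h3, h4]
    linarith

end Net

/-! ### Extension of a basis, for each of the three types. -/

namespace Net

open Graph

/-- Since `a` is not a vertex of `N`, no old edge other than `f` is affected by it. So the edges at
`a` are `e` and the two halves of `f`, and `Even.degree_three` shows that `x e + x f + x f₂` is
even. -/
theorem divide_degree_three {N : Net} (hN : N.Closed) {f f₂ e a b : ℕ} (hf : f ∈ N.E)
    (hf₂ : f₂ ∉ N.E) (he : e ∉ N.E) (hef : e ≠ f₂) (ha : a ∉ N.V) (hb : b ∈ N.V) :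
    ∀ d ∈ ((N.divide f f₂ a).add e b a).E,
      (d = e ∨ d = f ∨ d = f₂) ↔ ((N.divide f f₂ a).add e b a).Crosses {a} d := by
  intro d hd
  have hff : f₂ ≠ f := fun hff => hf₂ (hff ▸ hf)
  have hef' : e ≠ f := fun hff => he (hff ▸ hf)
  have hva : ∀ v ∈ N.V, v ≠ a := fun v hv hva => ha (hva ▸ hv)
  have hba := hva b hb
  have h1 := hva _ (hN f hf).1
  have h2 := hva _ (hN f hf).2
  simp only [Net.add, Net.divide, Finset.mem_insert] at hd
  simp only [Crosses, Net.add, Net.divide, Set.mem_singleton_iff]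
  rcases hd with rfl | rfl | hd
  · simp [hba]
  · simp [hef.symm, hff, h2]
  · have hde : d ≠ e := fun h => he (h ▸ hd)
    have hdf : d ≠ f₂ := fun h => hf₂ (h ▸ hd)
    by_cases h : d = f
    · subst h; simp [hde, hdf, h1]
    · simp [hde, hdf, h, hva _ (hN d hd).1, hva _ (hN d hd).2]

theorem divide_divide_degree_three {N : Net} (hN : N.Closed) {f f₂ g g₂ e a b : ℕ} (hf : f ∈ N.E)
    (hf₂ : f₂ ∉ N.E) (hg : g ∈ N.E) (hg₂ : g₂ ∉ N.E) (hfg : f ≠ g) (hfg₂ : f₂ ≠ g₂) (he : e ∉ N.E)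
    (hef : e ≠ f₂) (heg : e ≠ g₂) (ha : a ∉ N.V) (hab : b ≠ a) :
    ∀ d ∈ (((N.divide f f₂ a).divide g g₂ b).add e b a).E, (d = e ∨ d = f ∨ d = f₂) ↔
      (((N.divide f f₂ a).divide g g₂ b).add e b a).Crosses {a} d := by
  intro d hd
  have hff : f₂ ≠ f := fun hff => hf₂ (hff ▸ hf)
  have hef' : e ≠ f := fun hff => he (hff ▸ hf)
  have hgg : g₂ ≠ g := fun hff => hg₂ (hff ▸ hg)
  have heg' : e ≠ g := fun hff => he (hff ▸ hg)
  have hgf : g₂ ≠ f := fun hff => hg₂ (hff ▸ hf)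
  have hfg' : f₂ ≠ g := fun hff => hf₂ (hff ▸ hg)
  have hva : ∀ v ∈ N.V, v ≠ a := fun v hv hva => ha (hva ▸ hv)
  have h1 := hva _ (hN f hf).1
  have h2 := hva _ (hN f hf).2
  have h3 := hva _ (hN g hg).1
  have h4 := hva _ (hN g hg).2
  simp only [Net.add, Net.divide, Finset.mem_insert] at hd
  simp only [Crosses, Net.add, Net.divide, Set.mem_singleton_iff]
  rcases hd with rfl | rfl | rfl | hd
  · simp [hab]
  · simp [heg.symm, hgf, hgg, hfg₂.symm, hab, h4, hfg.symm, hfg'.symm]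
  · simp [hef.symm, hff, h2, hfg', hfg₂]
  · have hde : d ≠ e := fun h => he (h ▸ hd)
    have hdf : d ≠ f₂ := fun h => hf₂ (h ▸ hd)
    have hdg : d ≠ g₂ := fun h => hg₂ (h ▸ hd)
    by_cases h : d = f
    · subst h; simp [hde, hdf, h1, hdg, hfg]
    · by_cases h' : d = g
      · subst h'; simp [hde, hdf, h3, hdg, h, hab]
      · simp [hde, hdf, h, h', hdg, hva _ (hN d hd).1, hva _ (hN d hd).2]

/-- Needed to exchange the roles of `a` and `b` in type C, so that the parity relation at `b`
follows from the one at `a`. -/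
theorem divide_comm (N : Net) {f f₂ g g₂ : ℕ} (a b : ℕ) (hfg : f ≠ g) (hfg₂ : f₂ ≠ g₂)
    (hfg' : f ≠ g₂) (hgf : g ≠ f₂) :
    (N.divide f f₂ a).divide g g₂ b = (N.divide g g₂ b).divide f f₂ a := by
  ext x
  · simp only [divide, Set.mem_insert_iff]; tauto
  · simp only [divide, Finset.mem_insert]; tauto
  · simp only [divide, Function.update_apply]
    split_ifs <;> simp_all
  · simp only [divide, Function.update_apply]
    split_ifs <;> simp_all

theorem add_crosses_swap (N : Net) (e b a : ℕ) (X : Set ℕ) (d : ℕ) :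
    (N.add e b a).Crosses X d ↔ (N.add e a b).Crosses X d := by
  simp only [Crosses, add, Function.update_apply]
  split_ifs <;> tauto

/-- The value of a vector on the edge `d`. -/
def coord (d : ℕ) : (ℕ → ℤ) →ₗ[ℤ] ℤ := LinearMap.proj d

@[simp]
theorem coord_apply (d : ℕ) (x : ℕ → ℤ) : coord d x = x d := rfl

theorem indVect_mem {A : Set ℕ} {d : ℕ} (h : d ∈ A) : indVect A d = 1 := by
  classical simp [indVect_apply, h]

theorem indVect_notMem {A : Set ℕ} {d : ℕ} (h : d ∉ A) : indVect A d = 0 := by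
  classical simp [indVect_apply, h]

theorem indVect_eq {A : Set ℕ} {d d' : ℕ} (h : d ∈ A ↔ d' ∈ A) : indVect A d = indVect A d' := by
  classical simp [indVect_apply, h]

/-- If two of three edges at a vertex of degree three are known, so is the third. -/
theorem mem_of_even {A : Set ℕ} {p q r : ℕ} (hp : p ∈ A) (hr : r ∉ A)
    (h : ∃ c, indVect A p + indVect A q + indVect A r = 2 * c) : q ∈ A := by
  by_contra hq
  obtain ⟨c, hc⟩ := h
  rw [indVect_mem hp, indVect_notMem hq, indVect_notMem hr] at hc
  omega

/-- The only functional is `x e`: it has the value 1 on the new cycle, and even vectors that vanish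
on `e` are even vectors of `N`. -/
theorem Basis.typeA {N : Net} {U : ℕ → Set ℕ} {K : ℕ} (h : N.Basis U K)
    {e a b : ℕ} (he : e ∉ N.E) (hold : ∀ j < K, e ∉ U j) (h₀ : (N.add e b a).Even (indVect (U K)))
    (he₀ : e ∈ U K) : (N.add e b a).Basis U (K + 1) := by
  apply h.extend 1 (fun _ => coord e)
  · simp [Net.add]
  · intro i _ x hx
    exact hx e (by simp [Net.add])
  · intro x hx hl d hd
    simp only [Net.add, Finset.mem_insert] at hd
    rcases hd with rfl | hd
    · exact hl 0 (by omega)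
    · exact hx d hd
  · intro i _ j hj
    exact indVect_notMem (hold j hj)
  · intro s hs
    obtain rfl : s = 0 := by omega
    exact h₀
  · intro c hc s hs
    obtain rfl : s = 0 := by omega
    have := hc 0 (by omega)
    simpa [indVect_mem he₀] using this
  · intro x _
    exact ⟨fun _ => x e, fun i _ => by simp [indVect_mem he₀]⟩
  · intro x hx hl
    exact hx.of_add he (hl 0 (by omega))

/-- The functionals are `x e` and `x f - x f₂`, which have the same parity on even vectors because
of the relation at `a`. A new cycle that contains `e` and avoids one half of `f` contains the other
half. So the new cycles have the values `(1, 1)` and `(1, -1)`, a basis of the lattice of index two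
formed by the pairs of equal parity. -/
theorem Basis.typeB {N : Net} (hN : N.Closed) {U : ℕ → Set ℕ} {K : ℕ} (h : N.Basis U K)
    {f f₂ e a b : ℕ} (hf : f ∈ N.E) (hf₂ : f₂ ∉ N.E) (he : e ∉ N.E) (hef : e ≠ f₂)
    (ha : a ∉ N.V) (hb : b ∈ N.V)
    (hold : ∀ j < K, e ∉ U j ∧ (f ∈ U j ↔ f₂ ∈ U j))
    (h₀ : ((N.divide f f₂ a).add e b a).Even (indVect (U K))) (he₀ : e ∈ U K) (hf₀ : f₂ ∉ U K)
    (h₁ : ((N.divide f f₂ a).add e b a).Even (indVect (U (K + 1)))) (he₁ : e ∈ U (K + 1))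
    (hf₁ : f ∉ U (K + 1)) :
    ((N.divide f f₂ a).add e b a).Basis U (K + 2) := by
  have hff : f₂ ≠ f := fun hff => hf₂ (hff ▸ hf)
  have hef' : e ≠ f := fun hff => he (hff ▸ hf)
  set N' := (N.divide f f₂ a).add e b a with hN'
  have hE : N'.E = insert e (insert f₂ N.E) := rfl
  have hdeg : ∀ x, N'.Even x → ∃ c, x e + x f + x f₂ = 2 * c := fun x hx =>
    hx.degree_three a (by simp [hE]) (by simp [hE, hf]) (by simp [hE]) hef' hef hff.symm
      (divide_degree_three hN hf hf₂ he hef ha hb)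
  have hf₀' : f ∈ U K := mem_of_even he₀ hf₀ (hdeg _ h₀)
  have hf₁' : f₂ ∈ U (K + 1) := mem_of_even he₁ hf₁ (by
    obtain ⟨c, hc⟩ := hdeg _ h₁
    exact ⟨c, by linarith⟩)
  apply h.extend 2 (fun i => if i = 0 then coord e else
    coord f - coord f₂)
  · intro d hd
    simp [hE, hd]
  · intro i hi x hx
    interval_cases i
    · exact hx e (by simp [hE])
    · simp [hx f (by simp [hE, hf]), hx f₂ (by simp [hE])]
  · intro x hx hl d hd
    have h1 := hl 0 (by omega)
    have h2 := hl 1 (by omega)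
    simp [hx f hf] at h1 h2
    simp only [hE, Finset.mem_insert] at hd
    rcases hd with rfl | rfl | hd
    · exact h1
    · exact h2
    · exact hx d hd
  · intro i hi j hj
    interval_cases i
    · exact indVect_notMem (hold j hj).1
    · simp [indVect_eq (hold j hj).2]
  · intro s hs
    interval_cases s
    · exact h₀
    · exact h₁
  · intro c hc s hs
    have h1 := hc 0 (by omega)
    have h2 := hc 1 (by omega)
    simp [Finset.sum_range_succ, indVect_mem he₀, indVect_mem he₁, indVect_mem hf₀',
      indVect_mem hf₁', indVect_notMem hf₀, indVect_notMem hf₁] at h1 h2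
    interval_cases s <;> omega
  · intro x hx
    obtain ⟨p, hp⟩ := hdeg x hx
    -- The solution of `c 0 + c 1 = x e` and `c 0 - c 1 = x f - x f₂`. It is integral because `x e +
    -- x f + x f₂ = 2 * p`.
    refine ⟨fun s => if s = 0 then p - x f₂ else x e - p + x f₂, ?_⟩
    intro i hi
    interval_cases i <;>
    · simp [Finset.sum_range_succ, indVect_mem he₀, indVect_mem he₁, indVect_mem hf₀',
        indVect_mem hf₁', indVect_notMem hf₀, indVect_notMem hf₁]
      try linarith
  · intro x hx hl
    have h1 := hl 0 (by omega)
    have h2 := hl 1 (by omega)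
    simp at h1 h2
    exact (hx.of_add (by simp [divide, he, hef]) h1).of_divide hf hf₂ (by linarith)

/-- The functionals `x e`, `x f - x f₂` and `x g - x g₂` have equal parity on even vectors, by the
relations at `a` and at `b`. The new cycles pass through `f, g`, through `f, g₂` and through `f₂,
g`, so their values are `(1, 1, 1)`, `(1, 1, -1)` and `(1, -1, 1)`. The determinant is 4 up to sign,
the index of the triples of equal parity in all triples. A fourth cycle through `f₂, g₂` is not
needed. -/
theorem Basis.typeC {N : Net} (hN : N.Closed) {U : ℕ → Set ℕ} {K : ℕ} (h : N.Basis U K)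
    {f f₂ g g₂ e a b : ℕ} (hf : f ∈ N.E) (hf₂ : f₂ ∉ N.E) (hg : g ∈ N.E) (hg₂ : g₂ ∉ N.E)
    (hfg : f ≠ g) (hfg₂ : f₂ ≠ g₂) (he : e ∉ N.E) (hef : e ≠ f₂) (heg : e ≠ g₂) (ha : a ∉ N.V)
    (hb : b ∉ N.V) (hab : b ≠ a)
    (hold : ∀ j < K, e ∉ U j ∧ (f ∈ U j ↔ f₂ ∈ U j) ∧ (g ∈ U j ↔ g₂ ∈ U j))
    (h₀ : (((N.divide f f₂ a).divide g g₂ b).add e b a).Even (indVect (U K))) (he₀ : e ∈ U K)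
    (hf₀ : f₂ ∉ U K) (hg₀ : g₂ ∉ U K)
    (h₁ : (((N.divide f f₂ a).divide g g₂ b).add e b a).Even (indVect (U (K + 1))))
    (he₁ : e ∈ U (K + 1)) (hf₁ : f₂ ∉ U (K + 1)) (hg₁ : g ∉ U (K + 1))
    (h₂ : (((N.divide f f₂ a).divide g g₂ b).add e b a).Even (indVect (U (K + 2))))
    (he₂ : e ∈ U (K + 2)) (hf₂' : f ∉ U (K + 2)) (hg₂' : g₂ ∉ U (K + 2)) :
    (((N.divide f f₂ a).divide g g₂ b).add e b a).Basis U (K + 3) := by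
  have hff : f₂ ≠ f := fun hff => hf₂ (hff ▸ hf)
  have hef' : e ≠ f := fun hff => he (hff ▸ hf)
  have hgg : g₂ ≠ g := fun hff => hg₂ (hff ▸ hg)
  have heg' : e ≠ g := fun hff => he (hff ▸ hg)
  have hgf : g₂ ≠ f := fun hff => hg₂ (hff ▸ hf)
  have hfg' : f₂ ≠ g := fun hff => hf₂ (hff ▸ hg)
  set N' := ((N.divide f f₂ a).divide g g₂ b).add e b a with hN'
  have hE : N'.E = insert e (insert g₂ (insert f₂ N.E)) := rfl
  have hdeg : ∀ x, N'.Even x → ∃ c, x e + x f + x f₂ = 2 * c := fun x hx =>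
    hx.degree_three a (by simp [hE]) (by simp [hE, hf]) (by simp [hE]) hef' hef hff.symm
      (divide_divide_degree_three hN hf hf₂ hg hg₂ hfg hfg₂ he hef heg ha hab)
  -- The vertex `b` plays the role of `a` after the two divisions are interchanged and the new edge
  -- is reversed.
  have hdeg' : ∀ x, N'.Even x → ∃ c, x e + x g + x g₂ = 2 * c := fun x hx =>
    hx.degree_three b (by simp [hE]) (by simp [hE, hg]) (by simp [hE]) heg' heg hgg.symm (by
      intro d hd
      rw [divide_divide_degree_three hN hg hg₂ hf hf₂ hfg.symm hfg₂.symm he heg hef hb hab.symm d,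
        ← divide_comm N a b hfg hfg₂ hgf.symm hfg'.symm, add_crosses_swap]
      rw [← divide_comm N a b hfg hfg₂ hgf.symm hfg'.symm]
      exact hd)
  have hf₀' : f ∈ U K := mem_of_even he₀ hf₀ (hdeg _ h₀)
  have hg₀' : g ∈ U K := mem_of_even he₀ hg₀ (hdeg' _ h₀)
  have hf₁' : f ∈ U (K + 1) := mem_of_even he₁ hf₁ (hdeg _ h₁)
  have hg₁' : g₂ ∈ U (K + 1) := mem_of_even he₁ hg₁ (by
    obtain ⟨c, hc⟩ := hdeg' _ h₁
    exact ⟨c, by linarith⟩)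
  have hf₂'' : f₂ ∈ U (K + 2) := mem_of_even he₂ hf₂' (by
    obtain ⟨c, hc⟩ := hdeg _ h₂
    exact ⟨c, by linarith⟩)
  have hg₂'' : g ∈ U (K + 2) := mem_of_even he₂ hg₂' (hdeg' _ h₂)
  apply h.extend 3 (fun i => if i = 0 then coord e else if i = 1 then
    coord f - coord f₂ else coord g - coord g₂)
  · intro d hd
    simp [hE, hd]
  · intro i hi x hx
    interval_cases i
    · exact hx e (by simp [hE])
    · simp [hx f (by simp [hE, hf]), hx f₂ (by simp [hE])]
    · simp [hx g (by simp [hE, hg]), hx g₂ (by simp [hE])]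
  · intro x hx hl d hd
    have h1 := hl 0 (by omega)
    have h2 := hl 1 (by omega)
    have h3 := hl 2 (by omega)
    simp [hx f hf, hx g hg] at h1 h2 h3
    simp only [hE, Finset.mem_insert] at hd
    rcases hd with rfl | rfl | rfl | hd
    · exact h1
    · exact h3
    · exact h2
    · exact hx d hd
  · intro i hi j hj
    interval_cases i
    · exact indVect_notMem (hold j hj).1
    · simp [indVect_eq (hold j hj).2.1]
    · simp [indVect_eq (hold j hj).2.2]
  · intro s hs
    interval_cases s
    · exact h₀
    · exact h₁
    · exact h₂
  · intro c hc s hs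
    have h1 := hc 0 (by omega)
    have h2 := hc 1 (by omega)
    have h3 := hc 2 (by omega)
    simp [Finset.sum_range_succ, indVect_mem he₀, indVect_mem he₁, indVect_mem he₂,
      indVect_mem hf₀', indVect_mem hf₁', indVect_mem hf₂'', indVect_mem hg₀', indVect_mem hg₁',
      indVect_mem hg₂'', indVect_notMem hf₀, indVect_notMem hf₁, indVect_notMem hf₂',
      indVect_notMem hg₀, indVect_notMem hg₁, indVect_notMem hg₂'] at h1 h2 h3
    interval_cases s <;> omega
  · intro x hx
    obtain ⟨p, hp⟩ := hdeg x hx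
    obtain ⟨q, hq⟩ := hdeg' x hx
    -- The solution of the linear system given by the three value vectors, with `2 * p = x e + x f +
    -- x f₂` and `2 * q = x e + x g + x g₂` used to divide by two.
    refine ⟨fun s => if s = 0 then p + q - x e - x f₂ - x g₂ else
      if s = 1 then x e - q + x g₂ else x e - p + x f₂, ?_⟩
    intro i hi
    interval_cases i <;>
    · simp [Finset.sum_range_succ, indVect_mem he₀, indVect_mem he₁, indVect_mem he₂,
        indVect_mem hf₀', indVect_mem hf₁', indVect_mem hf₂'', indVect_mem hg₀', indVect_mem hg₁',
        indVect_mem hg₂'', indVect_notMem hf₀, indVect_notMem hf₁, indVect_notMem hf₂',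
        indVect_notMem hg₀, indVect_notMem hg₁, indVect_notMem hg₂']
      try linarith
  · intro x hx hl
    have h1 := hl 0 (by omega)
    have h2 := hl 1 (by omega)
    have h3 := hl 2 (by omega)
    simp at h1 h2 h3
    refine ((hx.of_add (by simp [divide, he, hef, heg]) h1).of_divide (by simp [divide, hg])
      (by simp [divide, hg₂, hfg₂.symm]) (by linarith)).of_divide hf hf₂ (by linarith)

end Net

/-! ### Subgraphs of `G` as subdivisions: adding ears and dividing paths. -/

/-- A subgraph of `G`, presented as a subdivision of a multigraph: `lab e` is `f + 1` for an edge
`e` of the path that represents the edge `f`, and `0` for an edge outside the subgraph; `vst v` is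
`f + 2` for an interior vertex of this path, `1` for a branch vertex, and `0` for a vertex outside
the subgraph; `nv v` and `ne v` are the next vertex and edge after an interior vertex. -/
structure Layout where
  lab : ℕ → ℕ
  vst : ℕ → ℕ
  nv : ℕ → ℕ
  ne : ℕ → ℕ
  src : ℕ → ℕ
  tgt : ℕ → ℕ

namespace Layout

/-- The multigraph of which the subgraph is a subdivision. -/
def net (D : Layout) (m : ℕ) : Net where
  V := {v | D.vst v = 1}
  E := (Finset.range m).filter fun f => D.lab f = f + 1
  src := D.src
  tgt := D.tgt

/-- The edge `f` is represented by the path `x 0, …, x l` with edges `d 0, …, d (l - 1)`. -/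
structure Link (G : Graph ℕ ℕ) (D : Layout) (f l : ℕ) (x d : ℕ → ℕ) : Prop where
  pos : 0 < l
  src_eq : x 0 = D.src f
  tgt_eq : x l = D.tgt f
  first : d 0 = f
  link : ∀ i < l, G.IsLink (d i) (x i) (x (i + 1))
  next : ∀ i, 0 < i → i < l → D.nv (x i) = x (i + 1) ∧ D.ne (x i) = d i
  inj : ∀ i j, 0 < i → i < l → 0 < j → j < l → x i = x j → i = j
  edge_inj : ∀ i < l, ∀ j < l, d i = d j → i = j
  vst_iff : ∀ v, D.vst v = f + 2 ↔ ∃ i, 0 < i ∧ i < l ∧ x i = v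
  lab_iff : ∀ e, D.lab e = f + 1 ↔ ∃ i < l, d i = e
  src_vst : D.vst (D.src f) ≠ 0
  tgt_vst : D.vst (D.tgt f) ≠ 0

/-- The layout describes a subgraph of `G`. -/
structure Embedded (G : Graph ℕ ℕ) (n m : ℕ) (D : Layout) : Prop where
  lab_lt : ∀ e, D.lab e ≠ 0 → e < m
  vst_lt : ∀ v, D.vst v ≠ 0 → v < n
  lab_label : ∀ e, D.lab e ≠ 0 → ∃ f, D.lab e = f + 1 ∧ D.lab f = f + 1
  vst_label : ∀ v f, D.vst v = f + 2 → D.lab f = f + 1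
  exists_link : ∀ f, D.lab f = f + 1 → ∃ l x d, D.Link G f l x d

theorem Embedded.mem_net {G : Graph ℕ ℕ} {n m : ℕ} {D : Layout} (h : D.Embedded G n m) {f : ℕ} :
    f ∈ (D.net m).E ↔ D.lab f = f + 1 := by
  simp only [net, Finset.mem_filter, Finset.mem_range, and_iff_right_iff_imp]
  intro hf
  exact h.lab_lt f (by omega)

/-- A path depends only on the entries that carry its own label, and on its ends remaining in the
subgraph. So it survives all changes made elsewhere. -/
theorem Link.transfer {G : Graph ℕ ℕ} {D D' : Layout} {f l : ℕ} {x d : ℕ → ℕ}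
    (h : D.Link G f l x d) (hlab : ∀ e, D'.lab e = f + 1 ↔ D.lab e = f + 1)
    (hvst : ∀ v, D'.vst v = f + 2 ↔ D.vst v = f + 2)
    (hnext : ∀ v, D.vst v = f + 2 → D'.nv v = D.nv v ∧ D'.ne v = D.ne v)
    (hsrc : D'.src f = D.src f) (htgt : D'.tgt f = D.tgt f)
    (hpos : ∀ v, D.vst v ≠ 0 → D'.vst v ≠ 0) : D'.Link G f l x d where
  pos := h.pos
  src_eq := by rw [hsrc]; exact h.src_eq
  tgt_eq := by rw [htgt]; exact h.tgt_eq
  first := h.first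
  link := h.link
  next := by
    intro i hi hil
    have := hnext (x i) ((h.vst_iff _).2 ⟨i, hi, hil, rfl⟩)
    rw [this.1, this.2]
    exact h.next i hi hil
  inj := h.inj
  edge_inj := h.edge_inj
  vst_iff := fun v => (hvst v).trans (h.vst_iff v)
  lab_iff := fun e => (hlab e).trans (h.lab_iff e)
  src_vst := by rw [hsrc]; exact hpos _ h.src_vst
  tgt_vst := by rw [htgt]; exact hpos _ h.tgt_vst

/-- `D'` arises from `D` by declaring the path `x 0, …, x l` with edges `d 0, …, d (l - 1)` the
path that represents `d 0`. -/
structure Relabeled (D D' : Layout) (l : ℕ) (x d : ℕ → ℕ) : Prop where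
  lab_path : ∀ i < l, D'.lab (d i) = d 0 + 1
  lab_other : ∀ e, (∀ i < l, d i ≠ e) → D'.lab e = D.lab e
  vst_path : ∀ i, 0 < i → i < l → D'.vst (x i) = d 0 + 2
  vst_other : ∀ v, (∀ i, 0 < i → i < l → x i ≠ v) → D'.vst v = D.vst v
  next : ∀ i, 0 < i → i < l → D'.nv (x i) = x (i + 1) ∧ D'.ne (x i) = d i
  next_other : ∀ v, (∀ i, 0 < i → i < l → x i ≠ v) → D'.nv v = D.nv v ∧ D'.ne v = D.ne v
  src_eq : D'.src = Function.update D.src (d 0) (x 0)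
  tgt_eq : D'.tgt = Function.update D.tgt (d 0) (x l)

theorem Relabeled.lab_cases {D D' : Layout} {l : ℕ} {x d : ℕ → ℕ} (h : D.Relabeled D' l x d)
    (e : ℕ) : (∃ i < l, d i = e) ∧ D'.lab e = d 0 + 1 ∨
      (∀ i < l, d i ≠ e) ∧ D'.lab e = D.lab e := by
  by_cases he : ∃ i < l, d i = e
  · obtain ⟨i, hi, rfl⟩ := he
    exact Or.inl ⟨⟨i, hi, rfl⟩, h.lab_path i hi⟩
  · push Not at he
    exact Or.inr ⟨he, h.lab_other e he⟩

theorem Relabeled.vst_cases {D D' : Layout} {l : ℕ} {x d : ℕ → ℕ} (h : D.Relabeled D' l x d)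
    (v : ℕ) : (∃ i, 0 < i ∧ i < l ∧ x i = v) ∧ D'.vst v = d 0 + 2 ∨
      (∀ i, 0 < i → i < l → x i ≠ v) ∧ D'.vst v = D.vst v := by
  by_cases he : ∃ i, 0 < i ∧ i < l ∧ x i = v
  · obtain ⟨i, hi, hil, rfl⟩ := he
    exact Or.inl ⟨⟨i, hi, hil, rfl⟩, h.vst_path i hi hil⟩
  · push Not at he
    exact Or.inr ⟨he, h.vst_other v he⟩

section Ear

variable {G : Graph ℕ ℕ} {n m : ℕ} {D D' : Layout} {l : ℕ} {x d : ℕ → ℕ}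

/-- A path of `G` that meets the subgraph exactly in its ends. -/
structure Ear (G : Graph ℕ ℕ) (D : Layout) (l : ℕ) (x d : ℕ → ℕ) : Prop where
  pos : 0 < l
  link : ∀ i < l, G.IsLink (d i) (x i) (x (i + 1))
  inj : ∀ i j, 0 < i → i < l → 0 < j → j < l → x i = x j → i = j
  edge_inj : ∀ i < l, ∀ j < l, d i = d j → i = j
  lab_zero : ∀ i < l, D.lab (d i) = 0
  vst_zero : ∀ i, 0 < i → i < l → D.vst (x i) = 0
  src_vst : D.vst (x 0) ≠ 0
  tgt_vst : D.vst (x l) ≠ 0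

theorem Ear.vst_other (he : D.Ear G l x d) (hr : D.Relabeled D' l x d) {v : ℕ}
    (hv : D.vst v ≠ 0) : D'.vst v = D.vst v :=
  hr.vst_other v fun i hi hil hiv => hv (hiv ▸ he.vst_zero i hi hil)

/-- The ear is named after its first edge `d 0`. This name is free, because the edge was outside the
subgraph. The old paths share neither edges nor interior vertices with the ear, so they are
transferred. -/
theorem Embedded.ear (hD : D.Embedded G n m) (hE : G.edgeSet = Set.Iio m)
    (hV : G.vertexSet = Set.Iio n) (he : D.Ear G l x d) (hr : D.Relabeled D' l x d) :
    D'.Embedded G n m := by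
  have hlab0 : D.lab (d 0) = 0 := he.lab_zero 0 he.pos
  have hlabne : ∀ f, D.lab f = f + 1 → f ≠ d 0 := by
    rintro f hf rfl; omega
  have hsame : ∀ e, D.lab e ≠ 0 → D'.lab e = D.lab e := fun e h =>
    hr.lab_other e fun i hi hie => h (hie ▸ he.lab_zero i hi)
  have hnew : D'.lab (d 0) = d 0 + 1 := hr.lab_path 0 he.pos
  refine ⟨?_, ?_, ?_, ?_, ?_⟩
  · intro e h
    rcases hr.lab_cases e with ⟨⟨i, hi, rfl⟩, -⟩ | ⟨-, h2⟩
    · have := (he.link i hi).edge_mem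
      rw [hE] at this
      exact this
    · exact hD.lab_lt e (h2 ▸ h)
  · intro v h
    rcases hr.vst_cases v with ⟨⟨i, hi, hil, rfl⟩, -⟩ | ⟨-, h2⟩
    · have := (he.link i hil).left_mem
      rw [hV] at this
      exact this
    · exact hD.vst_lt v (h2 ▸ h)
  · intro e h
    rcases hr.lab_cases e with ⟨⟨i, hi, rfl⟩, h2⟩ | ⟨-, h2⟩
    · exact ⟨d 0, h2, hnew⟩
    · rw [h2] at h ⊢
      obtain ⟨f, h3, h4⟩ := hD.lab_label e h
      exact ⟨f, h3, by rw [hsame f (by omega), h4]⟩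
  · intro v f h
    rcases hr.vst_cases v with ⟨-, h2⟩ | ⟨-, h2⟩
    · obtain rfl : f = d 0 := by omega
      exact hnew
    · have h3 := hD.vst_label v f (h2 ▸ h)
      rw [hsame f (by omega), h3]
  · intro f hf
    by_cases hfd : f = d 0
    · subst hfd
      have h2 : ∀ v, D.vst v ≠ d 0 + 2 := fun v hv => hlabne _ (hD.vst_label v _ hv) rfl
      have h3 : ∀ e, D.lab e ≠ d 0 + 1 := by
        intro e h3
        obtain ⟨f, h4, h5⟩ := hD.lab_label e (by omega)
        obtain rfl : f = d 0 := by omega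
        exact hlabne _ h5 rfl
      refine ⟨l, x, d, he.pos, ?_, ?_, rfl, he.link, hr.next, he.inj, he.edge_inj, ?_, ?_, ?_, ?_⟩
      · simp [hr.src_eq]
      · simp [hr.tgt_eq]
      · intro v
        rcases hr.vst_cases v with ⟨h4, h5⟩ | ⟨h4, h5⟩
        · simp [h4, h5]
        · constructor
          · intro h; exact absurd (h5 ▸ h) (h2 v)
          · rintro ⟨i, hi, hil, rfl⟩; exact absurd rfl (h4 i hi hil)
      · intro e
        rcases hr.lab_cases e with ⟨h4, h5⟩ | ⟨h4, h5⟩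
        · simp [h4, h5]
        · constructor
          · intro h; exact absurd (h5 ▸ h) (h3 e)
          · rintro ⟨i, hi, rfl⟩; exact absurd rfl (h4 i hi)
      · simp only [hr.src_eq, Function.update_self]
        rw [he.vst_other hr he.src_vst]
        exact he.src_vst
      · simp only [hr.tgt_eq, Function.update_self]
        rw [he.vst_other hr he.tgt_vst]
        exact he.tgt_vst
    · have hf' : D.lab f = f + 1 := by
        rcases hr.lab_cases f with ⟨-, h2⟩ | ⟨-, h2⟩ <;> omega
      obtain ⟨l', x', d', h⟩ := hD.exists_link f hf'
      refine ⟨l', x', d', h.transfer ?_ ?_ ?_ ?_ ?_ ?_⟩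
      · intro e
        rcases hr.lab_cases e with ⟨⟨i, hi, rfl⟩, h2⟩ | ⟨-, h2⟩
        · have := he.lab_zero i hi
          omega
        · rw [h2]
      · intro v
        rcases hr.vst_cases v with ⟨⟨i, hi, hil, rfl⟩, h2⟩ | ⟨-, h2⟩
        · have := he.vst_zero i hi hil
          omega
        · rw [h2]
      · intro v hv
        refine hr.next_other v fun i hi hil hiv => ?_
        have := he.vst_zero i hi hil
        rw [hiv] at this
        omega
      · simp [hr.src_eq, hfd]
      · simp [hr.tgt_eq, hfd]
      · intro v hv
        rw [he.vst_other hr hv]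
        exact hv

/-- The ends `x 0` and `x l` may still be interior to paths. In that case the resulting net is not
`Closed` until these paths have been divided as well; this is why the identity is stated for nets
and not for graphs. -/
theorem Ear.net_eq (hE : G.edgeSet = Set.Iio m) (he : D.Ear G l x d)
    (hr : D.Relabeled D' l x d) : D'.net m = (D.net m).add (d 0) (x 0) (x l) := by
  ext v
  · simp only [net, Net.add, Set.mem_ofPred_eq]
    rcases hr.vst_cases v with ⟨⟨i, hi, hil, rfl⟩, h2⟩ | ⟨-, h2⟩
    · have := he.vst_zero i hi hil
      omega
    · rw [h2]
  · simp only [net, Net.add, Finset.mem_insert, Finset.mem_filter, Finset.mem_range]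
    have hm : d 0 < m := by
      have := (he.link 0 he.pos).edge_mem
      rw [hE] at this
      exact this
    rcases hr.lab_cases v with ⟨⟨i, hi, rfl⟩, h2⟩ | ⟨h1, h2⟩
    · have := he.lab_zero i hi
      rw [h2, this]
      constructor
      · rintro ⟨-, h3⟩; left; omega
      · rintro (h3 | h3)
        · rw [h3]; exact ⟨hm, rfl⟩
        · omega
    · rw [h2]
      have := h1 0 he.pos
      constructor
      · intro h; exact Or.inr h
      · rintro (h3 | h3)
        · exact absurd h3.symm this
        · exact h3
  · simp [net, Net.add, hr.src_eq]
  · simp [net, Net.add, hr.tgt_eq]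

end Ear

section Divide

variable {G : Graph ℕ ℕ} {n m : ℕ} {D D' : Layout} {f l j : ℕ} {x d : ℕ → ℕ}

/-- `D'` arises from `D` by dividing the path that represents `f` at the vertex `x j`. -/
def Divided (D D' : Layout) (f l j : ℕ) (x d : ℕ → ℕ) : Prop :=
  ∃ D₁, Relabeled { D with vst := Function.update D.vst (x j) 1 } D₁ (l - j)
    (fun i => x (j + i)) (fun i => d (j + i)) ∧
    D' = { D₁ with tgt := Function.update D₁.tgt f (x j) }

theorem Divided.vst_cases (hdiv : D.Divided D' f l j x d) (hL : D.Link G f l x d) (hj : 0 < j)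
    (hjl : j < l) (v : ℕ) :
    (∃ i, j < i ∧ i < l ∧ x i = v) ∧ D.vst v = f + 2 ∧ D'.vst v = d j + 2 ∨
      v = x j ∧ D.vst v = f + 2 ∧ D'.vst v = 1 ∨
      (∀ i, j ≤ i → i < l → x i ≠ v) ∧ D'.vst v = D.vst v := by
  obtain ⟨D₁, hr, rfl⟩ := hdiv
  rcases hr.vst_cases v with ⟨⟨i, hi, hil, rfl⟩, h2⟩ | ⟨h1, h2⟩
  · exact Or.inl ⟨⟨j + i, by omega, by omega, rfl⟩,
      (hL.vst_iff _).2 ⟨j + i, by omega, by omega, rfl⟩, h2⟩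
  · right
    by_cases hv : v = x j
    · left
      exact ⟨hv, (hL.vst_iff _).2 ⟨j, hj, hjl, hv.symm⟩, by simpa [hv] using h2⟩
    · right
      refine ⟨?_, by simpa [hv] using h2⟩
      intro i hi hil hiv
      rcases Nat.eq_or_lt_of_le hi with rfl | h3
      · exact hv hiv.symm
      · refine h1 (i - j) (by omega) (by omega) ?_
        simpa [Nat.add_sub_cancel' hi] using hiv

theorem Divided.lab_cases (hdiv : D.Divided D' f l j x d) (hL : D.Link G f l x d) (e : ℕ) :
    (∃ i, j ≤ i ∧ i < l ∧ d i = e) ∧ D.lab e = f + 1 ∧ D'.lab e = d j + 1 ∨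
      (∀ i, j ≤ i → i < l → d i ≠ e) ∧ D'.lab e = D.lab e := by
  obtain ⟨D₁, hr, rfl⟩ := hdiv
  rcases hr.lab_cases e with ⟨⟨i, hi, rfl⟩, h2⟩ | ⟨h1, h2⟩
  · exact Or.inl ⟨⟨j + i, by omega, by omega, rfl⟩,
      (hL.lab_iff _).2 ⟨j + i, by omega, rfl⟩, h2⟩
  · right
    refine ⟨?_, h2⟩
    intro i hi hil hiv
    refine h1 (i - j) (by omega) ?_
    simpa [Nat.add_sub_cancel' hi] using hiv

theorem Divided.src_eq (hdiv : D.Divided D' f l j x d) :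
    D'.src = Function.update D.src (d j) (x j) := by
  obtain ⟨D₁, hr, rfl⟩ := hdiv
  simpa using hr.src_eq

theorem Divided.tgt_eq (hdiv : D.Divided D' f l j x d) (hjl : j < l) :
    D'.tgt = Function.update (Function.update D.tgt (d j) (x l)) f (x j) := by
  obtain ⟨D₁, hr, rfl⟩ := hdiv
  have := hr.tgt_eq
  simp only [Nat.add_zero, Nat.add_sub_cancel' hjl.le] at this
  simp [this]

theorem Divided.next (hdiv : D.Divided D' f l j x d) {i : ℕ} (hi : j < i) (hil : i < l) :
    D'.nv (x i) = x (i + 1) ∧ D'.ne (x i) = d i := by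
  obtain ⟨D₁, hr, rfl⟩ := hdiv
  have := hr.next (i - j) (by omega) (by omega)
  simpa [Nat.add_sub_cancel' hi.le, show j + (i - j + 1) = i + 1 by omega] using this

theorem Divided.next_other (hdiv : D.Divided D' f l j x d) {v : ℕ}
    (hv : ∀ i, j < i → i < l → x i ≠ v) : D'.nv v = D.nv v ∧ D'.ne v = D.ne v := by
  obtain ⟨D₁, hr, rfl⟩ := hdiv
  exact hr.next_other v fun i hi hil => hv (j + i) (by omega) (by omega)

/-- The part of the path before `x j` keeps the name `f`, and the part after it is named after its
first edge `d j`. This name is free, because `d j` carried the label of `f ≠ d j`. The remaining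
paths are transferred. -/
theorem Embedded.divide (hD : D.Embedded G n m) (hL : D.Link G f l x d) (hj : 0 < j) (hjl : j < l)
    (hdiv : D.Divided D' f l j x d) : D'.Embedded G n m := by
  have hf : D.lab f = f + 1 := (hL.lab_iff f).2 ⟨0, hL.pos, hL.first⟩
  have hff : d j ≠ f := by
    intro h
    have := hL.edge_inj j hjl 0 hL.pos (h.trans hL.first.symm)
    omega
  have hdj : D.lab (d j) = f + 1 := (hL.lab_iff _).2 ⟨j, hjl, rfl⟩
  have hnew : D'.lab (d j) = d j + 1 := by
    rcases hdiv.lab_cases hL (d j) with ⟨-, -, h⟩ | ⟨h, -⟩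
    · exact h
    · exact absurd rfl (h j le_rfl hjl)
  have hf' : D'.lab f = f + 1 := by
    rcases hdiv.lab_cases hL f with ⟨⟨i, hi, hil, hif⟩, -, -⟩ | ⟨-, h⟩
    · have := hL.edge_inj i hil 0 hL.pos (hif.trans hL.first.symm)
      omega
    · rw [h, hf]
  have hlabel : ∀ h, D.lab h = h + 1 → D'.lab h = h + 1 := by
    intro h hh
    rcases hdiv.lab_cases hL h with ⟨-, h1, -⟩ | ⟨-, h2⟩
    · obtain rfl : h = f := by omega
      exact hf'
    · rw [h2, hh]
  have hvpos : ∀ v, D.vst v ≠ 0 → D'.vst v ≠ 0 := by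
    intro v hv
    rcases hdiv.vst_cases hL hj hjl v with ⟨-, -, h⟩ | ⟨-, -, h⟩ | ⟨-, h⟩ <;> omega
  refine ⟨?_, ?_, ?_, ?_, ?_⟩
  · intro e he
    rcases hdiv.lab_cases hL e with ⟨-, h1, -⟩ | ⟨-, h2⟩
    · exact hD.lab_lt e (by omega)
    · exact hD.lab_lt e (by omega)
  · intro v hv
    rcases hdiv.vst_cases hL hj hjl v with ⟨-, h, -⟩ | ⟨-, h, -⟩ | ⟨-, h⟩ <;>
      exact hD.vst_lt v (by omega)
  · intro e he
    rcases hdiv.lab_cases hL e with ⟨-, -, h2⟩ | ⟨-, h2⟩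
    · exact ⟨d j, h2, hnew⟩
    · obtain ⟨h, h3, h4⟩ := hD.lab_label e (by omega)
      exact ⟨h, by omega, hlabel h h4⟩
  · intro v h hv
    rcases hdiv.vst_cases hL hj hjl v with ⟨-, -, h2⟩ | ⟨-, -, h2⟩ | ⟨-, h2⟩
    · obtain rfl : h = d j := by omega
      exact hnew
    · omega
    · exact hlabel h (hD.vst_label v h (by omega))
  · intro h hh
    by_cases hhf : h = f
    · subst hhf
      refine ⟨j, x, d, hj, ?_, ?_, hL.first, fun i hi => hL.link i (by omega), ?_, ?_, ?_, ?_, ?_,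
        ?_, ?_⟩
      · rw [hdiv.src_eq, Function.update_of_ne hff.symm, hL.src_eq]
      · rw [hdiv.tgt_eq hjl, Function.update_self]
      · intro i hi hij
        have := hdiv.next_other (v := x i) (by
          intro i' hi' hil' h
          have := hL.inj i' i (by omega) hil' hi (by omega) h
          omega)
        rw [this.1, this.2]
        exact hL.next i hi (by omega)
      · exact fun i i' hi hij hi' hij' => hL.inj i i' hi (by omega) hi' (by omega)
      · exact fun i hi i' hi' => hL.edge_inj i (by omega) i' (by omega)
      · intro v
        constructor
        · intro hv
          rcases hdiv.vst_cases hL hj hjl v with ⟨-, -, h2⟩ | ⟨-, -, h2⟩ | ⟨h1, h2⟩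
          · omega
          · omega
          · obtain ⟨i, hi, hil, rfl⟩ := (hL.vst_iff v).1 (by omega)
            exact ⟨i, hi, by by_contra h3; exact h1 i (by omega) hil rfl, rfl⟩
        · rintro ⟨i, hi, hij, rfl⟩
          have h4 := (hL.vst_iff (x i)).2 ⟨i, hi, by omega, rfl⟩
          rcases hdiv.vst_cases hL hj hjl (x i) with ⟨⟨i', h1, h2, h3⟩, -⟩ | ⟨h3, -⟩ | ⟨-, h2⟩
          · have := hL.inj i' i (by omega) h2 hi (by omega) h3
            omega
          · have := hL.inj i j (by omega) (by omega) hj (by omega) h3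
            omega
          · omega
      · intro e
        constructor
        · intro hv
          rcases hdiv.lab_cases hL e with ⟨-, -, h2⟩ | ⟨h1, h2⟩
          · omega
          · obtain ⟨i, hil, rfl⟩ := (hL.lab_iff e).1 (by omega)
            exact ⟨i, by by_contra h3; exact h1 i (by omega) hil rfl, rfl⟩
        · rintro ⟨i, hij, rfl⟩
          have h4 := (hL.lab_iff (d i)).2 ⟨i, by omega, rfl⟩
          rcases hdiv.lab_cases hL (d i) with ⟨⟨i', h1, h2, h3⟩, -⟩ | ⟨-, h2⟩
          · have := hL.edge_inj i' (by omega) i (by omega) h3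
            omega
          · omega
      · rw [hdiv.src_eq, Function.update_of_ne hff.symm]
        exact hvpos _ hL.src_vst
      · rw [hdiv.tgt_eq hjl, Function.update_self]
        apply hvpos
        rw [(hL.vst_iff (x j)).2 ⟨j, hj, hjl, rfl⟩]
        omega
    · by_cases hhj : h = d j
      · subst hhj
        have hno : ∀ v, D.vst v ≠ d j + 2 := by
          intro v hv
          have := hD.vst_label v _ hv
          omega
        have hno' : ∀ e, D.lab e ≠ d j + 1 := by
          intro e he
          obtain ⟨h, h3, h4⟩ := hD.lab_label e (by omega)
          obtain rfl : h = d j := by omega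
          omega
        refine ⟨l - j, fun i => x (j + i), fun i => d (j + i), by omega, ?_, ?_, rfl,
          fun i hi => hL.link (j + i) (by omega), ?_, ?_, ?_, ?_, ?_, ?_, ?_⟩
        · simp [hdiv.src_eq]
        · simp [hdiv.tgt_eq hjl, hff, Nat.add_sub_cancel' hjl.le]
        · intro i hi hij
          exact hdiv.next (by omega) (by omega)
        · intro i i' hi hij hi' hij' h
          have := hL.inj (j + i) (j + i') (by omega) (by omega) (by omega) (by omega) h
          omega
        · intro i hi i' hi' h
          have := hL.edge_inj (j + i) (by omega) (j + i') (by omega) h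
          omega
        · intro v
          constructor
          · intro hv
            rcases hdiv.vst_cases hL hj hjl v with ⟨⟨i, h1, h2, h3⟩, -, -⟩ | ⟨-, -, h2⟩ | ⟨h1, h2⟩
            · exact ⟨i - j, by omega, by omega, by simpa [Nat.add_sub_cancel' h1.le] using h3⟩
            · omega
            · exact absurd (h2 ▸ hv) (hno v)
          · rintro ⟨i, hi, hij, rfl⟩
            rcases hdiv.vst_cases hL hj hjl (x (j + i)) with ⟨-, -, h2⟩ | ⟨h3, -⟩ | ⟨h1, -⟩
            · exact h2
            · have := hL.inj (j + i) j (by omega) (by omega) hj (by omega) h3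
              omega
            · exact absurd rfl (h1 (j + i) (by omega) (by omega))
        · intro e
          constructor
          · intro hv
            rcases hdiv.lab_cases hL e with ⟨⟨i, h1, h2, h3⟩, -, -⟩ | ⟨h1, h2⟩
            · exact ⟨i - j, by omega, by simpa [Nat.add_sub_cancel' h1] using h3⟩
            · exact absurd (h2 ▸ hv) (hno' e)
          · rintro ⟨i, hij, rfl⟩
            rcases hdiv.lab_cases hL (d (j + i)) with ⟨-, -, h2⟩ | ⟨h1, -⟩
            · exact h2
            · exact absurd rfl (h1 (j + i) (by omega) (by omega))
        · rw [hdiv.src_eq, Function.update_self]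
          apply hvpos
          rw [(hL.vst_iff (x j)).2 ⟨j, hj, hjl, rfl⟩]
          omega
        · rw [hdiv.tgt_eq hjl, Function.update_of_ne hff, Function.update_self, hL.tgt_eq]
          exact hvpos _ hL.tgt_vst
      · have hh' : D.lab h = h + 1 := by
          rcases hdiv.lab_cases hL h with ⟨-, -, h2⟩ | ⟨-, h2⟩ <;> omega
        obtain ⟨l', x', d', hL'⟩ := hD.exists_link h hh'
        refine ⟨l', x', d', hL'.transfer ?_ ?_ ?_ ?_ ?_ hvpos⟩
        · intro e
          rcases hdiv.lab_cases hL e with ⟨-, h1, h2⟩ | ⟨-, h2⟩ <;> omega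
        · intro v
          rcases hdiv.vst_cases hL hj hjl v with ⟨-, h1, h2⟩ | ⟨-, h1, h2⟩ | ⟨-, h2⟩ <;> omega
        · intro v hv
          refine hdiv.next_other fun i hi hil hiv => ?_
          have := (hL.vst_iff v).2 ⟨i, by omega, hil, hiv⟩
          omega
        · rw [hdiv.src_eq, Function.update_of_ne hhj]
        · rw [hdiv.tgt_eq hjl, Function.update_of_ne hhf, Function.update_of_ne hhj]

theorem Embedded.divide_net (hD : D.Embedded G n m) (hL : D.Link G f l x d) (hj : 0 < j)
    (hjl : j < l) (hdiv : D.Divided D' f l j x d) :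
    D'.net m = (D.net m).divide f (d j) (x j) := by
  have hff : d j ≠ f := by
    intro h
    have := hL.edge_inj j hjl 0 hL.pos (h.trans hL.first.symm)
    omega
  have hdj : D.lab (d j) = f + 1 := (hL.lab_iff _).2 ⟨j, hjl, rfl⟩
  ext v
  · simp only [net, Net.divide, Set.mem_ofPred_eq, Set.mem_insert_iff]
    rcases hdiv.vst_cases hL hj hjl v with ⟨⟨i, h3, h4, h5⟩, h1, h2⟩ | ⟨h3, h1, h2⟩ | ⟨h1, h2⟩
    · have : v ≠ x j := by
        rintro rfl
        have := hL.inj i j (by omega) (by omega) hj (by omega) h5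
        omega
      simp [this, h1, h2]
    · subst h3; simp [h2]
    · have : v ≠ x j := fun h => h1 j le_rfl hjl h.symm
      simp [this, h2]
  · simp only [net, Net.divide, Finset.mem_insert, Finset.mem_filter, Finset.mem_range]
    have hm := hD.lab_lt (d j) (by omega)
    rcases hdiv.lab_cases hL v with ⟨⟨i, h3, h4, h5⟩, h1, h2⟩ | ⟨h1, h2⟩
    · constructor
      · rintro ⟨-, h⟩; left; omega
      · rintro (h | h)
        · subst h; exact ⟨hm, h2⟩
        · obtain rfl : v = f := by omega
          have := hL.edge_inj i h4 0 hL.pos (h5.trans hL.first.symm)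
          omega
    · have : v ≠ d j := fun h => h1 j le_rfl hjl h.symm
      simp [this, h2]
  · simp [net, Net.divide, hdiv.src_eq]
  · simp [net, Net.divide, hdiv.tgt_eq hjl, hL.tgt_eq]

end Divide

end Layout

/-! ### Existence of ears. -/

/-- In a 3-edge-connected graph every edge cut contains an edge other than `p` and `q`. -/
theorem Graph.IsEdgeConnected.exists_crossing {G : Graph ℕ ℕ} (h : G.IsEdgeConnected 3) {X : Set ℕ}
    (hx : ∃ x ∈ G.vertexSet, x ∈ X) (hy : ∃ y ∈ G.vertexSet, y ∉ X) (p q : ℕ) :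
    ∃ e u v, e ≠ p ∧ e ≠ q ∧ G.IsLink e u v ∧ u ∈ X ∧ v ∉ X := by
  classical
  by_contra hno
  push Not at hno
  obtain ⟨x, hx, hxX⟩ := hx
  obtain ⟨y, hy, hyX⟩ := hy
  set F : Finset ℕ := ({p, q} : Finset ℕ).filter fun e => e ∈ G.edgeSet with hF
  have hcard : F.card < 3 :=
    ((Finset.card_filter_le _ _).trans Finset.card_le_two).trans_lt (by norm_num)
  have hconn := (h F (by intro e he; simp [hF] at he; exact he.2) hcard).2 x
    (by simpa using hx) y (by simpa using hy)
  have : ∀ z, Relation.ReflTransGen (G.deleteEdges (F : Set ℕ)).Adj x z → z ∈ X := by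
    intro z hz
    induction hz with
    | refl => exact hxX
    | tail _ hbc ih =>
      obtain ⟨e, he⟩ := hbc
      rw [Graph.deleteEdges_isLink] at he
      by_contra hc
      refine hc (hno e _ _ ?_ ?_ he.1 ih)
      · rintro rfl
        exact he.2 (by simp [hF, he.1.edge_mem])
      · rintro rfl
        exact he.2 (by simp [hF, he.1.edge_mem])
  exact hyX (this y hconn)

/-- Following parent pointers of decreasing rank one arrives at a stopping vertex. -/
theorem exists_parent_path {X : Set ℕ} {halt : ℕ → Prop} {par rank : ℕ → ℕ}
    (h : ∀ v ∈ X, ¬ halt v → halt (par v) ∨ par v ∈ X ∧ rank (par v) < rank v) :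
    ∀ v ∈ X, ∃ r, (∀ i < r, par^[i] v ∈ X ∧ ¬ halt (par^[i] v)) ∧ halt (par^[r] v) := by
  intro v
  induction hr : rank v using Nat.strong_induction_on generalizing v with
  | _ k ih =>
    intro hv
    by_cases hs : halt v
    · exact ⟨0, by simp, hs⟩
    · rcases h v hv hs with h1 | ⟨h1, h2⟩
      · refine ⟨1, ?_, h1⟩
        intro i hi
        obtain rfl : i = 0 := by omega
        exact ⟨hv, hs⟩
      · obtain ⟨r, h3, h4⟩ := ih _ (hr ▸ h2) (par v) rfl h1
        refine ⟨r + 1, ?_, h4⟩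
        intro i hi
        cases i with
        | zero => exact ⟨hv, hs⟩
        | succ i => exact h3 i (by omega)

/-- If two iterates with indices `i < j` agreed, then `r - j` further steps would show that a
halting vertex occurs already at the index `r - j + i < r`. -/
theorem iterate_inj_of_halt {halt : ℕ → Prop} {par : ℕ → ℕ} {v r : ℕ}
    (h : ∀ i < r, ¬ halt (par^[i] v)) (hr : halt (par^[r] v)) :
    ∀ i ≤ r, ∀ j ≤ r, par^[i] v = par^[j] v → i = j := by
  have key : ∀ i j, i < j → j ≤ r → par^[i] v ≠ par^[j] v := by
    intro i j hij hj he
    have h1 := congrArg (par^[r - j]) he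
    rw [← Function.iterate_add_apply, ← Function.iterate_add_apply, Nat.sub_add_cancel hj] at h1
    exact h (r - j + i) (by omega) (h1 ▸ hr)
  intro i hi j hj he
  rcases lt_trichotomy i j with h1 | h1 | h1
  · exact absurd he (key i j h1 hj)
  · exact h1
  · exact absurd he.symm (key j i h1 hi)

namespace Layout

variable {G : Graph ℕ ℕ} {n m : ℕ} {D : Layout}

/-- The ends of an edge of the subgraph are branch vertices or interior to its path. -/
theorem Embedded.vst_of_isLink (hD : D.Embedded G n m) (hC : (D.net m).Closed) {e f u v : ℕ}
    (he : D.lab e = f + 1) (hl : G.IsLink e u v) :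
    D.lab f = f + 1 ∧ (D.vst u = f + 2 ∨ D.vst u = 1 ∧ (u = D.src f ∨ u = D.tgt f)) := by
  obtain ⟨h, h1, h2⟩ := hD.lab_label e (by omega)
  obtain rfl : h = f := by omega
  refine ⟨h2, ?_⟩
  obtain ⟨l, x, d, hL⟩ := hD.exists_link h h2
  obtain ⟨i, hi, rfl⟩ := (hL.lab_iff e).1 he
  have hsrc := (hC h (hD.mem_net.2 h2)).1
  have htgt := (hC h (hD.mem_net.2 h2)).2
  have key : ∀ i' ≤ l, D.vst (x i') = h + 2 ∨ D.vst (x i') = 1 ∧ (x i' = D.src h ∨ x i' = D.tgt h) := by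
    intro i' hi'
    by_cases h0 : i' = 0
    · subst h0
      right
      rw [hL.src_eq]
      exact ⟨hsrc, Or.inl rfl⟩
    · by_cases h3 : i' = l
      · subst h3
        right
        rw [hL.tgt_eq]
        exact ⟨htgt, Or.inr rfl⟩
      · left
        exact (hL.vst_iff _).2 ⟨i', by omega, by omega, rfl⟩
  rcases hl.left_eq_or_eq (hL.link i hi) with rfl | rfl
  · exact key i hi.le
  · exact key (i + 1) hi

/-- The start of the search for an ear: either from the interior of the path of `key - 2`, or from
a vertex `z` that is joined to the branch vertex `a₀` by the edge `e₀`. -/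
def SearchStart (G : Graph ℕ ℕ) (m : ℕ) (D : Layout) (z key e₀ a₀ : ℕ) : Prop :=
  (2 ≤ D.vst z ∧ key = D.vst z ∧ e₀ = m) ∨
    (D.vst z = 0 ∧ key = m + 2 ∧ D.vst a₀ = 1 ∧ G.IsLink e₀ z a₀ ∧ D.lab e₀ = 0 ∧
      ∀ v, D.vst v ≤ 1)

/-- The edges are below `m`, so `m + 2` is not the state of any vertex. It serves as the key of a
search that has no root in the subgraph. -/
theorem Embedded.key_ne (hD : D.Embedded G n m) (v : ℕ) : D.vst v ≠ m + 2 := by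
  intro h
  have := hD.lab_lt m (by have := hD.vst_label v m h; omega)
  omega

/-- Apply 3-edge-connectivity to the set `X` of reached vertices. If the search starts inside a
path, forbid the first and the last edge of this path. All other edges of the path join interior
vertices, which belong to `X`, so the crossing edge is outside the subgraph, and since `X` is closed
it ends in the subgraph but not inside the path. If the search starts outside, no vertex is interior
to a path; hence `X` is disjoint from the subgraph, and forbidding `e₀` suffices. -/
theorem Embedded.exists_target (hD : D.Embedded G n m) (hC : (D.net m).Closed)
    (hE : G.edgeSet = Set.Iio m) (hV : G.vertexSet = Set.Iio n)
    (hG : G.IsEdgeConnected 3) (h0 : ∃ v, D.vst v = 1) {z key e₀ a₀ : ℕ}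
    (hs : SearchStart G m D z key e₀ a₀) {X : Set ℕ} (hz : z ∈ X) (hzn : z < n)
    (hroot : ∀ v, D.vst v = key → v ∈ X) (hX : ∀ v ∈ X, D.vst v = 0 ∨ D.vst v = key)
    (hclosed : ∀ e v w, v ∈ X → G.IsLink e v w → D.lab e = 0 → e ≠ e₀ → D.vst w = 0 → w ∈ X) :
    ∃ e v w, v ∈ X ∧ G.IsLink e v w ∧ D.lab e = 0 ∧ e ≠ e₀ ∧ D.vst w ≠ 0 ∧ D.vst w ≠ key := by
  obtain ⟨v₀, hv₀⟩ := h0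
  have hcut := hG.exists_crossing (X := X) ⟨z, by rw [hV]; exact hzn, hz⟩ (by
    refine ⟨v₀, by rw [hV]; exact hD.vst_lt _ (by omega), fun h => ?_⟩
    have h1 := hX _ h
    rcases hs with ⟨h2, h3, -⟩ | ⟨-, h3, -⟩ <;> omega)
  rcases hs with ⟨h2, rfl, rfl⟩ | ⟨h2, rfl, h3, h4, h5, h6⟩
  · obtain ⟨f, hf⟩ : ∃ f, D.vst z = f + 2 := ⟨D.vst z - 2, by omega⟩
    obtain ⟨l, x, d, hL⟩ := hD.exists_link f (hD.vst_label z f hf)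
    obtain ⟨e, u, v, he1, he2, hl, hu, hv⟩ := hcut (d 0) (d (l - 1))
    by_cases hlab : D.lab e = 0
    · have hem : e ≠ e₀ := by
        have := hl.edge_mem
        rw [hE] at this
        exact this.ne
      exact ⟨e, u, v, hu, hl, hlab, hem, fun h => hv (hclosed e u v hu hl hlab hem h),
        fun h => hv (hroot v h)⟩
    · obtain ⟨h, h1⟩ : ∃ h, D.lab e = h + 1 := ⟨D.lab e - 1, by omega⟩
      obtain ⟨h7, h8⟩ := hD.vst_of_isLink hC h1 hl
      have h9 := hX u hu
      obtain rfl : h = f := by omega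
      obtain ⟨i, hi, rfl⟩ := (hL.lab_iff e).1 h1
      have hi0 : i ≠ 0 := by rintro rfl; exact he1 rfl
      have hil : i ≠ l - 1 := by rintro rfl; exact he2 rfl
      exfalso
      apply hv
      apply hroot
      rw [hf]
      rcases hl.right_eq_or_eq (hL.link i hi) with rfl | rfl
      · exact (hL.vst_iff _).2 ⟨i, by omega, hi, rfl⟩
      · exact (hL.vst_iff _).2 ⟨i + 1, by omega, by omega, rfl⟩
  · obtain ⟨e, u, v, he1, -, hl, hu, hv⟩ := hcut e₀ e₀
    have hlab : D.lab e = 0 := by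
      by_contra hlab
      obtain ⟨h, h1⟩ : ∃ h, D.lab e = h + 1 := ⟨D.lab e - 1, by omega⟩
      obtain ⟨h7, h8⟩ := hD.vst_of_isLink hC h1 hl
      have h9 := hX u hu
      have h10 := h6 u
      omega
    exact ⟨e, u, v, hu, hl, hlab, he1, fun h => hv (hclosed e u v hu hl hlab he1 h),
      fun h => by have := h6 v; omega⟩

/-- If there are neither interior vertices nor edges leaving the subgraph, then it is spanning. -/
theorem vst_eq_one (hV : G.vertexSet = Set.Iio n) (hG : G.IsEdgeConnected 3)
    (h0 : ∃ v, v < n ∧ D.vst v = 1) (hle : ∀ v < n, D.vst v ≤ 1)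
    (hno : ∀ e u v, G.IsLink e u v → D.vst u = 1 → D.vst v ≠ 0) :
    ∀ v < n, D.vst v = 1 := by
  intro v hv
  by_contra hne
  obtain ⟨w, hw, hw1⟩ := h0
  obtain ⟨e, a, b, -, -, hl, ha, hb⟩ := hG.exists_crossing (X := {v | D.vst v = 1})
    ⟨w, by rw [hV]; exact hw, hw1⟩ ⟨v, by rw [hV]; exact hv, hne⟩ 0 0
  have h1 := hl.right_mem
  rw [hV] at h1
  have h2 := hle b h1
  have h3 := hno e a b hl ha
  simp only [Set.mem_ofPred_eq] at hb
  omega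

/-- The ear given by an edge `e` from `b` to `v` and the path of parent pointers from `v`. -/
theorem exists_ear {X : Set ℕ} {par pe rank : ℕ → ℕ} {z key e₀ a₀ : ℕ}
    (hs : SearchStart G m D z key e₀ a₀) (hkey : ∀ v, D.vst v ≠ m + 2)
    (hX : ∀ v ∈ X, D.vst v = 0 ∨ D.vst v = key)
    (hpar : ∀ v ∈ X, v ≠ z → D.vst v = 0 → par v ∈ X ∧ rank (par v) < rank v ∧
      G.IsLink (pe v) v (par v) ∧ D.lab (pe v) = 0 ∧ pe v ≠ e₀)
    (hparz : par z = a₀ ∧ pe z = e₀) {e b v : ℕ} (hv : v ∈ X) (hl : G.IsLink e b v)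
    (hlab : D.lab e = 0) (hee : e ≠ e₀) (hb0 : D.vst b ≠ 0) (hbk : D.vst b ≠ key) :
    ∃ r, D.Ear G (r + 1) (fun i => if i = 0 then b else par^[i - 1] v)
        (fun i => if i = 0 then e else pe (par^[i - 1] v)) ∧
      (2 ≤ D.vst z ∧ D.vst (par^[r] v) = key ∨
        D.vst z = 0 ∧ D.vst (par^[r] v) = 1 ∧ ∃ i < r, par^[i] v = z) := by
  -- If `z` is outside the subgraph, its pointer leads along `e₀` to the branch vertex `a₀`, so that
  -- the path of pointers ends in the subgraph.
  have hzl : D.vst z = 0 → G.IsLink (pe z) z (par z) ∧ D.lab (pe z) = 0 ∧ D.vst (par z) = 1 := by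
    intro h
    rw [hparz.1, hparz.2]
    rcases hs with ⟨h2, -⟩ | ⟨-, -, h3, h4, h5, -⟩
    · omega
    · exact ⟨h4, h5, h3⟩
  obtain ⟨r, h1, h2⟩ := exists_parent_path (X := X) (halt := fun v => D.vst v ≠ 0) (par := par)
    (rank := rank) (by
      intro v hv hvs
      have hv0 : D.vst v = 0 := by simpa using hvs
      by_cases hvz : v = z
      · subst hvz
        left
        have := (hzl hv0).2.2
        omega
      · have := hpar v hv hvz hv0
        exact Or.inr ⟨this.1, this.2.1⟩) v hv
  have h1' : ∀ i < r, par^[i] v ∈ X ∧ D.vst (par^[i] v) = 0 := fun i hi =>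
    ⟨(h1 i hi).1, by simpa using (h1 i hi).2⟩
  have hinj := iterate_inj_of_halt (halt := fun v => D.vst v ≠ 0) (fun i hi => (h1 i hi).2) h2
  have hstep : ∀ i < r, G.IsLink (pe (par^[i] v)) (par^[i] v) (par^[i + 1] v) ∧
      D.lab (pe (par^[i] v)) = 0 := by
    intro i hi
    obtain ⟨h3, h4⟩ := h1' i hi
    rw [Function.iterate_succ_apply']
    by_cases hvz : par^[i] v = z
    · rw [hvz] at h4 ⊢
      exact ⟨(hzl h4).1, (hzl h4).2.1⟩
    · have := hpar _ h3 hvz h4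
      exact ⟨this.2.2.1, this.2.2.2.1⟩
  -- A search that starts outside reaches no vertex of the subgraph, as the key `m + 2` does not
  -- occur. So its path can enter the subgraph only through the pointer of `z`.
  have hend : 2 ≤ D.vst z ∧ D.vst (par^[r] v) = key ∨
        D.vst z = 0 ∧ D.vst (par^[r] v) = 1 ∧ ∃ i < r, par^[i] v = z := by
    rcases Nat.eq_zero_or_pos r with rfl | hr
    · have := hX v hv
      simp only [Function.iterate_zero, id] at h2 ⊢
      rcases hs with ⟨h5, -⟩ | ⟨h5, rfl, -⟩
      · exact Or.inl ⟨h5, by omega⟩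
      · exact absurd (by omega) (hkey v)
    · obtain ⟨h3, h4⟩ := h1' (r - 1) (by omega)
      have h5 : par^[r] v = par (par^[r - 1] v) := by
        rw [← Function.iterate_succ_apply' par, Nat.succ_eq_add_one, Nat.sub_add_cancel hr]
      by_cases hvz : par^[r - 1] v = z
      · right
        rw [hvz] at h4 h5
        rw [h5]
        exact ⟨h4, (hzl h4).2.2, r - 1, by omega, hvz⟩
      · have h6 := hpar _ h3 hvz h4
        rw [← h5] at h6
        have h7 := hX _ h6.1
        rcases hs with ⟨h5, -⟩ | ⟨h5, rfl, -⟩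
        · exact Or.inl ⟨h5, by omega⟩
        · exact absurd (by omega) (hkey (par^[r] v))
  have hedge : ∀ i < r, ∀ j < r, i < j → pe (par^[i] v) ≠ pe (par^[j] v) := by
    intro i hi j hj hij he
    have h3 := (hstep i hi).1
    rw [he] at h3
    rcases h3.left_eq_or_eq (hstep j hj).1 with h4 | h4
    · have := hinj i hi.le j hj.le h4
      omega
    · have := hinj i hi.le (j + 1) hj h4
      omega
  -- If `e` were also a pointer edge, its end `b` in the subgraph would be the end of the whole
  -- path. This contradicts `hbk` if the search starts inside a path. Otherwise the last pointer
  -- edge is `e₀`, which is different from `e`.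
  have hedge0 : ∀ i < r, e ≠ pe (par^[i] v) := by
    intro i hi he
    have h3 := (hstep i hi).1
    rw [← he] at h3
    rcases hl.left_eq_or_eq h3 with h4 | h4
    · rw [h4] at hb0
      exact hb0 (h1' i hi).2
    · have hir : i + 1 = r := by
        by_contra hne
        rw [h4] at hb0
        exact hb0 (h1' (i + 1) (by omega)).2
      rw [h4, hir] at hbk
      rcases hend with ⟨-, h5⟩ | ⟨h5, h6, i', hi', h7⟩
      · exact hbk h5
      · -- the last edge of the path is `e₀`
        have h8 : par^[i + 1] v = par (par^[i] v) := Function.iterate_succ_apply' _ _ _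
        by_cases hvz : par^[i] v = z
        · rw [hvz, hparz.2] at he
          exact hee he
        · obtain ⟨h9, h10⟩ := h1' i hi
          have h11 := (hpar _ h9 hvz h10).1
          rw [← h8, hir] at h11
          rcases hs with ⟨h12, -⟩ | ⟨-, rfl, -⟩
          · omega
          · have := hX _ h11
            omega
  refine ⟨r, ⟨by omega, ?_, ?_, ?_, ?_, ?_, ?_, ?_⟩, hend⟩
  · intro i hi
    cases i with
    | zero => simpa using hl
    | succ i => simpa using (hstep i (by omega)).1
  · intro i j hi hil hj hjl hij
    simp only [hi.ne', hj.ne', if_false] at hij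
    have := hinj (i - 1) (by omega) (j - 1) (by omega) hij
    omega
  · intro i hi j hj hij
    cases i with
    | zero =>
      cases j with
      | zero => rfl
      | succ j => exact absurd (by simpa using hij) (hedge0 j (by omega))
    | succ i =>
      cases j with
      | zero => exact absurd (by simpa using hij.symm) (hedge0 i (by omega))
      | succ j =>
        simp only [Nat.add_eq_zero_iff, one_ne_zero, and_false, if_false, Nat.add_sub_cancel] at hij
        rcases lt_trichotomy i j with h3 | h3 | h3
        · exact absurd hij (hedge i (by omega) j (by omega) h3)
        · rw [h3]
        · exact absurd hij.symm (hedge j (by omega) i (by omega) h3)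
  · intro i hi
    cases i with
    | zero => simpa using hlab
    | succ i => simpa using (hstep i (by omega)).2
  · intro i hi hil
    simpa [hi.ne'] using (h1' (i - 1) (by omega)).2
  · simpa using hb0
  · simpa using h2

end Layout

/-! ### Existence of the new cycles. -/

namespace Net

/-- The tree path from `b` to `a` and the edge `e` form a cycle. -/
theorem isCycleSet_of_tree {N : Net} {X : Set ℕ} {par pe rank : ℕ → ℕ} {a b e : ℕ} {A : Set ℕ}
    (htree : ∀ v ∈ X, v ≠ a → par v ∈ X ∧ rank (par v) < rank v ∧
      N.graph.IsLink (pe v) v (par v) ∧ pe v ∈ A)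
    (heA : e ∉ A) (hb : b ∈ X) (he : N.graph.IsLink e a b) :
    ∃ r, par^[r] b = a ∧ (∀ i < r, par^[i] b ≠ a ∧ par^[i] b ∈ X) ∧
      (∀ i < r, ∀ j < r, pe (par^[i] b) = pe (par^[j] b) → i = j) ∧
      (∀ i < r, pe (par^[i] b) ∈ A) ∧
      (∀ i ≤ r, ∀ j ≤ r, par^[i] b = par^[j] b → i = j) ∧
      N.graph.IsCycleSet (insert e ((fun i => pe (par^[i] b)) '' Set.Iio r)) := by
  obtain ⟨r, h1, h2⟩ := exists_parent_path (X := X) (halt := fun v => v = a) (par := par)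
    (rank := rank) (fun v hv hva => Or.inr ⟨(htree v hv hva).1, (htree v hv hva).2.1⟩) b hb
  have hinj := iterate_inj_of_halt (halt := fun v => v = a) (fun i hi => (h1 i hi).2) h2
  have hc : N.graph.IsClosedPath r (fun i => par^[i] b) (fun i => pe (par^[i] b)) e := by
    refine ⟨?_, ?_, hinj, ?_⟩
    · intro i hi
      rw [Function.iterate_succ_apply']
      exact (htree _ (h1 i hi).1 (h1 i hi).2).2.2.1
    · simp only [h2, Function.iterate_zero, id]
      exact he
    · intro i hi h
      exact heA (h ▸ (htree _ (h1 i hi).1 (h1 i hi).2).2.2.2)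
  exact ⟨r, h2, fun i hi => ⟨(h1 i hi).2, (h1 i hi).1⟩, hc.edge_inj,
    fun i hi => (htree _ (h1 i hi).1 (h1 i hi).2).2.2.2, hinj, hc.isCycleSet⟩

theorem Cut3.mem_of_closed {N : Net} (h : N.Cut3) {X : Set ℕ} {a b p q : ℕ} (ha : a ∈ N.V)
    (hb : b ∈ N.V) (haX : a ∈ X)
    (hX : ∀ d ∈ N.E, d ≠ p → d ≠ q → ¬ N.Crosses X d) : b ∈ X := by
  by_contra hbX
  obtain ⟨d, hd, h1, h2, h3⟩ := h X ⟨a, ha, haX⟩ ⟨b, hb, hbX⟩ p q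
  exact hX d hd h1 h2 h3

theorem Cut3.mem_typeA {N : Net} (h : N.Cut3) {X : Set ℕ} {e a b : ℕ} (ha : a ∈ N.V)
    (hb : b ∈ N.V) (haX : a ∈ X)
    (hX : ∀ d ∈ (N.add e b a).E, d ≠ e → ¬ (N.add e b a).Crosses X d) : b ∈ X := by
  refine h.mem_of_closed (p := e) (q := e) ha hb haX fun d hd h1 _ => ?_
  simpa [Crosses, Net.add, h1] using hX d (by simp [Net.add, hd]) h1

/-- From `a` the half of `f` that is not forbidden leads to a vertex of `N`. From there all of `N`,
in particular `b`, is reached without `f`. -/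
theorem Cut3.mem_typeB {N : Net} (h : N.Cut3) (hN : N.Closed) {X : Set ℕ} {f f₂ F e a b : ℕ}
    (hf : f ∈ N.E) (hf₂ : f₂ ∉ N.E) (he : e ∉ N.E) (hef : e ≠ f₂) (hb : b ∈ N.V) (haX : a ∈ X)
    (hF : F = f ∨ F = f₂)
    (hX : ∀ d ∈ ((N.divide f f₂ a).add e b a).E, d ≠ e → d ≠ F →
      ¬ ((N.divide f f₂ a).add e b a).Crosses X d) : b ∈ X := by
  have hff : f₂ ≠ f := fun hff => hf₂ (hff ▸ hf)
  have hef' : e ≠ f := fun hff => he (hff ▸ hf)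
  have h1 : ∃ v ∈ N.V, v ∈ X := by
    rcases hF with rfl | rfl
    · have := hX f₂ (by simp [Net.add, Net.divide]) hef.symm hff
      simp only [Crosses, Net.add, Net.divide, Function.update_of_ne hef.symm, Function.update_self,
        Function.update_of_ne hff] at this
      exact ⟨_, (hN F hf).2, by tauto⟩
    · have := hX f (by simp [Net.add, Net.divide, hf]) hef'.symm hff.symm
      simp only [Crosses, Net.add, Net.divide, Function.update_of_ne hef'.symm, Function.update_self,
        Function.update_of_ne hff.symm] at this
      exact ⟨_, (hN f hf).1, by tauto⟩
  obtain ⟨v, hv, hvX⟩ := h1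
  refine h.mem_of_closed (p := f) (q := f) hv hb hvX fun d hd h1 _ => ?_
  have hde : d ≠ e := fun h => he (h ▸ hd)
  have hdf : d ≠ f₂ := fun h => hf₂ (h ▸ hd)
  have := hX d (by simp [Net.add, Net.divide, hd]) hde (by rcases hF with rfl | rfl <;> assumption)
  simpa [Crosses, Net.add, Net.divide, hde, hdf, h1] using this

/-- From `a` the remaining half of `f` leads into `N`, which is still connected without `f` and `g`,
and the remaining half of `g` leads to `b`. This is the place where cuts with two edges have to be
excluded. -/
theorem Cut3.mem_typeC {N : Net} (h : N.Cut3) (hN : N.Closed) {X : Set ℕ}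
    {f f₂ g g₂ F₁ F₂ e a b : ℕ} (hf : f ∈ N.E) (hf₂ : f₂ ∉ N.E) (hg : g ∈ N.E) (hg₂ : g₂ ∉ N.E)
    (hfg : f ≠ g) (hfg₂ : f₂ ≠ g₂) (he : e ∉ N.E) (hef : e ≠ f₂) (heg : e ≠ g₂) (haX : a ∈ X)
    (hF₁ : F₁ = f ∨ F₁ = f₂) (hF₂ : F₂ = g ∨ F₂ = g₂)
    (hX : ∀ d ∈ (((N.divide f f₂ a).divide g g₂ b).add e b a).E, d ≠ e → d ≠ F₁ → d ≠ F₂ →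
      ¬ (((N.divide f f₂ a).divide g g₂ b).add e b a).Crosses X d) : b ∈ X := by
  have hff : f₂ ≠ f := fun hff => hf₂ (hff ▸ hf)
  have hgg : g₂ ≠ g := fun hff => hg₂ (hff ▸ hg)
  have hfg' : f₂ ≠ g := fun hff => hf₂ (hff ▸ hg)
  have hgf' : g₂ ≠ f := fun hff => hg₂ (hff ▸ hf)
  have hef' : e ≠ f := fun hff => he (hff ▸ hf)
  have heg' : e ≠ g := fun hff => he (hff ▸ hg)
  have h1 : ∃ v ∈ N.V, v ∈ X := by
    rcases hF₁ with rfl | rfl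
    · have := hX f₂ (by simp [Net.add, Net.divide]) hef.symm hff (by rcases hF₂ with rfl | rfl <;> assumption)
      simp only [Crosses, Net.add, Net.divide, Function.update_of_ne hef.symm, Function.update_self,
        Function.update_of_ne hff, Function.update_of_ne hfg', Function.update_of_ne hfg₂] at this
      exact ⟨_, (hN F₁ hf).2, by tauto⟩
    · have := hX f (by simp [Net.add, Net.divide, hf]) hef'.symm hff.symm
        (by rcases hF₂ with rfl | rfl; exacts [hfg, hgf'.symm])
      simp only [Crosses, Net.add, Net.divide, Function.update_of_ne hef'.symm, Function.update_self,
        Function.update_of_ne hff.symm, Function.update_of_ne hgf'.symm,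
        Function.update_of_ne hfg] at this
      exact ⟨_, (hN f hf).1, by tauto⟩
  -- The old end of the remaining half of `g`.
  have h2 : ∃ v ∈ N.V, v ∈ X → b ∈ X := by
    rcases hF₂ with rfl | rfl
    · have := hX g₂ (by simp [Net.add, Net.divide]) heg.symm
        (by rcases hF₁ with rfl | rfl; exacts [hgf', hfg₂.symm]) hgg
      simp only [Crosses, Net.add, Net.divide, Function.update_of_ne heg.symm, Function.update_self,
        Function.update_of_ne hgg, Function.update_of_ne hfg.symm,
        Function.update_of_ne hfg'.symm] at this
      exact ⟨_, (hN F₂ hg).2, by tauto⟩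
    · have := hX g (by simp [Net.add, Net.divide, hg]) heg'.symm
        (by rcases hF₁ with rfl | rfl; exacts [hfg.symm, hfg'.symm]) hgg.symm
      simp only [Crosses, Net.add, Net.divide, Function.update_of_ne heg'.symm, Function.update_self,
        Function.update_of_ne hgg.symm, Function.update_of_ne hfg'.symm] at this
      exact ⟨_, (hN g hg).1, by tauto⟩
  obtain ⟨v, hv, hvX⟩ := h1
  obtain ⟨w, hw, hwX⟩ := h2
  refine hwX (h.mem_of_closed (p := f) (q := g) hv hw hvX fun d hd h1 h2 => ?_)
  have hde : d ≠ e := fun h => he (h ▸ hd)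
  have hdf : d ≠ f₂ := fun h => hf₂ (h ▸ hd)
  have hdg : d ≠ g₂ := fun h => hg₂ (h ▸ hd)
  have := hX d (by simp [Net.add, Net.divide, hd]) hde (by rcases hF₁ with rfl | rfl <;> assumption)
    (by rcases hF₂ with rfl | rfl <;> assumption)
  simpa [Crosses, Net.add, Net.divide, hde, hdf, hdg, h1, h2] using this

end Net

/-! ### The record of an extension sequence together with its bases. -/

open Graph in
/-- The operations `op i`, `i < k`, lead from a single vertex to `N`, and for each `i ≤ k` the sets
`U j`, `j < cnt i`, restricted to the edges of the `i`-th graph, form a lattice cycle basis. -/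
structure History (op : ℕ → ExtOp ℕ ℕ) (U : ℕ → Set ℕ) (cnt : ℕ → ℕ) (k : ℕ) (N : Net)
    (Γ : ℕ → Graph ℕ ℕ) : Prop where
  start_vertexSet : (Γ 0).vertexSet = {0}
  start_edgeSet : (Γ 0).edgeSet = ∅
  step : ∀ i < k, (op i).Applies (Γ i) (Γ (i + 1))
  last : Γ k = N.graph
  basis : N.Basis U (cnt k)
  stage : ∀ i ≤ k, (Γ i).IsLatticeCycleBasis ((fun j => U j ∩ (Γ i).edgeSet) '' Set.Iio (cnt i)) ∧
    Set.InjOn (fun j => U j ∩ (Γ i).edgeSet) (Set.Iio (cnt i))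
  nested : ∀ i < k, ∀ j < cnt i,
    (op i).embed (U j ∩ (Γ i).edgeSet) = U j ∩ (Γ (i + 1)).edgeSet
  lt : ∀ i < k, cnt i < cnt (i + 1)

namespace History

variable {op op' : ℕ → ExtOp ℕ ℕ} {U U' : ℕ → Set ℕ} {cnt cnt' : ℕ → ℕ} {k : ℕ} {N N' : Net}
  {Γ : ℕ → Graph ℕ ℕ}

theorem cnt_le (h : History op U cnt k N Γ) : ∀ i ≤ k, cnt i ≤ cnt k := by
  intro i hi
  obtain ⟨d, rfl⟩ := Nat.exists_eq_add_of_le hi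
  have : ∀ d', d' ≤ d → cnt i ≤ cnt (i + d') := by
    intro d' hd'
    induction d' with
    | zero => exact le_rfl
    | succ d' ih => exact (ih (by omega)).trans (h.lt (i + d') (by omega)).le
  exact this d le_rfl

/-- All stages use the same sets `U j`, restricted to their own edges. So the earlier stages carry
over when the data agree up to `k`. At the new stage the old cycles are images under the extension,
hence cycles by `Graph.IsCycleSet.of_applies`. -/
theorem extend (h : History op U cnt k N Γ) (hop : ∀ i < k, op' i = op i)
    (hU : ∀ j < cnt k, U' j = U j) (hcnt : ∀ i ≤ k, cnt' i = cnt i) (hN : N.Closed)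
    (hN' : N'.Closed) (happ : (op' k).Applies N.graph N'.graph) (hlt : cnt k < cnt' (k + 1))
    (hbasis : N'.Basis U' (cnt' (k + 1)))
    (hembed : ∀ j < cnt k, (op' k).embed (U' j ∩ N.E) = U' j ∩ N'.E)
    (hcyc : ∀ j, cnt k ≤ j → j < cnt' (k + 1) → N'.graph.IsCycleSet (U' j ∩ N'.E)) :
    ∃ Γ', History op' U' cnt' (k + 1) N' Γ' := by
  have hsame : ∀ i ≤ k, Function.update Γ (k + 1) N'.graph i = Γ i := fun i hi =>
    Function.update_of_ne (by omega) _ _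
  have hnew : Function.update Γ (k + 1) N'.graph (k + 1) = N'.graph := Function.update_self _ _ _
  have hle := h.cnt_le
  refine ⟨Function.update Γ (k + 1) N'.graph, ?_, ?_, ?_, hnew, hbasis, ?_, ?_, ?_⟩
  · rw [hsame 0 (by omega)]; exact h.start_vertexSet
  · rw [hsame 0 (by omega)]; exact h.start_edgeSet
  · intro i hi
    rcases Nat.lt_or_ge i k with h1 | h1
    · rw [hsame i h1.le, hsame (i + 1) h1, hop i h1]
      exact h.step i h1
    · obtain rfl : i = k := by omega
      rw [hsame i le_rfl, hnew, h.last]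
      exact happ
  · intro i hi
    rcases Nat.lt_or_ge k i with h1 | h1
    · obtain rfl : i = k + 1 := by omega
      rw [hnew]
      refine hbasis.isLatticeCycleBasis hN' fun j hj => ?_
      rw [Net.edgeSet_graph hN']
      rcases Nat.lt_or_ge j (cnt k) with h2 | h2
      · rw [← hembed j h2]
        refine Graph.IsCycleSet.of_applies happ ?_
        have := (h.stage k le_rfl).1.1 _ ⟨j, h2, rfl⟩
        simp only [h.last, Net.edgeSet_graph hN] at this
        rwa [← hU j h2] at this
      · exact hcyc j h2 hj
    · rw [hsame i h1, hcnt i h1]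
      have heq : Set.EqOn (fun j => U' j ∩ (Γ i).edgeSet) (fun j => U j ∩ (Γ i).edgeSet)
          (Set.Iio (cnt i)) := by
        intro j hj
        have : U' j = U j := hU j (lt_of_lt_of_le hj (hle i h1))
        simp only [this]
      rw [heq.image_eq, heq.injOn_iff]
      exact h.stage i h1
  · intro i hi j hj
    rcases Nat.lt_or_ge i k with h1 | h1
    · rw [hcnt i h1.le] at hj
      rw [hsame i h1.le, hsame (i + 1) h1, hop i h1, hU j (hj.trans_le (hle i h1.le))]
      exact h.nested i h1 j hj
    · obtain rfl : i = k := by omega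
      rw [hcnt i le_rfl] at hj
      rw [hsame i le_rfl, hnew, h.last, Net.edgeSet_graph hN, Net.edgeSet_graph hN']
      exact hembed j hj
  · intro i hi
    rcases Nat.lt_or_ge i k with h1 | h1
    · rw [hcnt i h1.le, hcnt (i + 1) h1]
      exact h.lt i h1
    · obtain rfl : i = k := by omega
      rw [hcnt i le_rfl]
      exact hlt

theorem conclude {s : RAM.State} {G : Graph ℕ ℕ}
    (h : History s.outOp s.outCycle s.outCount k N Γ) (hN : N.Closed) (hG : N.graph = G)
    (hU : ∀ j < s.outCount k, s.outCycle j ⊆ N.E) :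
    ∃ 𝒞 : ℕ → Set (Set ℕ), G.IsTopExtSeq 0 k s.outOp Γ ∧
      Graph.IsCompatibleChain k s.outOp Γ 𝒞 ∧ s.DescribesChain k Γ 𝒞 := by
  have hlast : Set.EqOn (fun j => s.outCycle j ∩ (Γ k).edgeSet) s.outCycle
      (Set.Iio (s.outCount k)) := by
    intro j hj
    simp only [h.last, Net.edgeSet_graph hN]
    exact Set.inter_eq_left.2 (hU j hj)
  refine ⟨fun i => (fun j => s.outCycle j ∩ (Γ i).edgeSet) '' Set.Iio (s.outCount i),
    ⟨h.start_vertexSet, h.start_edgeSet, h.step, h.last.trans hG⟩, ⟨fun i hi => (h.stage i hi).1, ?_⟩,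
    ⟨hlast.image_eq, ?_, fun i hi => (h.lt i hi).le, fun i hi => rfl⟩⟩
  · intro i hi
    have himg : (s.outOp i).embed '' ((fun j => s.outCycle j ∩ (Γ i).edgeSet) ''
        Set.Iio (s.outCount i)) =
        (fun j => s.outCycle j ∩ (Γ (i + 1)).edgeSet) '' Set.Iio (s.outCount i) := by
      rw [Set.image_image]
      exact Set.image_congr fun j hj => h.nested i hi j hj
    simp only [himg]
    have hlt := h.lt i hi
    have hinj := (h.stage (i + 1) hi).2
    -- The inclusion is proper: the first new cycle differs from all old ones, since the sets are
    -- distinct at the stage `i + 1`.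
    refine (Set.image_mono (Set.Iio_subset_Iio hlt.le)).ssubset_of_ne fun heq => ?_
    have hmem : s.outCycle (s.outCount i) ∩ (Γ (i + 1)).edgeSet ∈
        (fun j => s.outCycle j ∩ (Γ (i + 1)).edgeSet) '' Set.Iio (s.outCount i) := by
      rw [heq]
      exact ⟨_, hlt, rfl⟩
    obtain ⟨j, hj, hje⟩ := hmem
    have hj' : j < s.outCount i := hj
    have := hinj (show j < s.outCount (i + 1) by omega) (show s.outCount i < s.outCount (i + 1) from hlt)
      hje
    omega
  · exact hlast.injOn_iff.1 (h.stage k le_rfl).2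

end History

/-! ### Ears as topological extensions of the multigraph. -/

namespace Layout

/-- The set `W` of edges of the subgraph is a union of paths that represent edges. -/
def Respects (D : Layout) (W : Set ℕ) : Prop :=
  (∀ e f, D.lab e = f + 1 → (e ∈ W ↔ f ∈ W)) ∧ ∀ e, D.lab e = 0 → e ∉ W

/-- A layout of a subdivision of a 3-edge-connected multigraph. -/
structure Good (G : Graph ℕ ℕ) (n m : ℕ) (D : Layout) : Prop extends Embedded G n m D where
  closed : (D.net m).Closed
  cut3 : (D.net m).Cut3
  root : D.vst 0 = 1

variable {G : Graph ℕ ℕ} {n m : ℕ} {D D₁ D₂ D₃ : Layout} {l : ℕ} {x d : ℕ → ℕ}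

/-- The set `W` contains no edge outside the subgraph, so it avoids the ear altogether. -/
theorem Respects.ear {W : Set ℕ} (hW : D.Respects W) (he : D.Ear G l x d)
    (hr : D.Relabeled D₁ l x d) : D₁.Respects W := by
  constructor
  · intro e f hef
    rcases hr.lab_cases e with ⟨⟨i, hi, rfl⟩, h2⟩ | ⟨-, h2⟩
    · obtain rfl : f = d 0 := by omega
      have h3 := hW.2 _ (he.lab_zero i hi)
      have h4 := hW.2 _ (he.lab_zero 0 he.pos)
      tauto
    · exact hW.1 e f (h2 ▸ hef)
  · intro e h
    rcases hr.lab_cases e with ⟨-, h2⟩ | ⟨-, h2⟩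
    · omega
    · exact hW.2 e (h2 ▸ h)

/-- All edges of the divided path were in `W` or none was, and this passes to both parts. -/
theorem Respects.divide {W : Set ℕ} (hW : D.Respects W) {f j : ℕ} (hL : D.Link G f l x d)
    (hjl : j < l) (hdiv : D.Divided D₁ f l j x d) : D₁.Respects W := by
  constructor
  · intro e h heh
    rcases hdiv.lab_cases hL e with ⟨-, h1, h2⟩ | ⟨-, h2⟩
    · obtain rfl : h = d j := by omega
      have h3 := hW.1 e f h1
      have h4 := hW.1 (d j) f ((hL.lab_iff _).2 ⟨j, hjl, rfl⟩)
      tauto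
    · exact hW.1 e h (h2 ▸ heh)
  · intro e h
    rcases hdiv.lab_cases hL e with ⟨-, -, h2⟩ | ⟨-, h2⟩
    · omega
    · exact hW.2 e (h2 ▸ h)

/-- What the algorithm needs to know about a one-edge extension by the new edge `e` between `a` and
`b`: the new cycles are obtained from paths from `a` to `b` that avoid `e` and the two edges of a
pair in the list `Fs`. -/
structure Extension (G : Graph ℕ ℕ) (n m : ℕ) (D D' : Layout) (o : ExtOp ℕ ℕ) (e a b : ℕ)
    (Fs : List (ℕ × ℕ)) : Prop where
  good : D'.Good G n m
  length : 0 < Fs.length ∧ Fs.length ≤ 3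
  real : D'.vst a = 1
  mem : ∀ F ∈ Fs, F.1 ∈ (D'.net m).E ∧ F.2 ∈ (D'.net m).E
  link : (D'.net m).graph.IsLink e a b
  reach : ∀ F ∈ Fs, ∀ X : Set ℕ, a ∈ X → (∀ d ∈ (D'.net m).E, d ≠ e → d ≠ F.1 → d ≠ F.2 →
    ¬ (D'.net m).Crosses X d) → b ∈ X
  applies : o.Applies (D.net m).graph (D'.net m).graph
  embed : ∀ W, D.Respects W → o.embed (W ∩ (D.net m).E) = W ∩ (D'.net m).E
  respects : ∀ W, D.Respects W → D'.Respects W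
  basis : ∀ U K, (D.net m).Basis U K → (∀ j < K, D.Respects (U j)) →
    (∀ (i : ℕ) (hi : i < Fs.length), (D'.net m).graph.IsCycleSet (U (K + i) ∩ (D'.net m).E) ∧
      e ∈ U (K + i) ∧ (Fs[i].1 ≠ e → Fs[i].1 ∉ U (K + i)) ∧
      (Fs[i].2 ≠ e → Fs[i].2 ∉ U (K + i))) →
    (D'.net m).Basis U (K + Fs.length)

theorem even_of_isCycleSet {N : Net} (hN : N.Closed) {W : Set ℕ}
    (h : N.graph.IsCycleSet (W ∩ N.E)) : N.Even (Graph.indVect W) := by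
  classical
  refine (Net.even_indVect_of_isCycleSet hN h).congr fun d hd => ?_
  simp [Graph.indVect_apply, hd]

/-- With branch vertices at both ends the net only gains the edge `d 0`. The pair `(d 0, d 0)`
forbids nothing but the new edge itself, so that one cycle is requested. -/
theorem Extension.typeA (hD : D.Good G n m) (hE : G.edgeSet = Set.Iio m)
    (hV : G.vertexSet = Set.Iio n) (he : D.Ear G l x d) (hr : D.Relabeled D₁ l x d)
    (ha : D.vst (x l) = 1) (hb : D.vst (x 0) = 1) :
    Extension G n m D D₁ (.typeA (d 0) (x l) (x 0)) (d 0) (x l) (x 0) [(d 0, d 0)] := by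
  have hnet := he.net_eq hE hr
  have he0 : d 0 ∉ (D.net m).E := by
    rw [hD.mem_net, he.lab_zero 0 he.pos]; omega
  have hcl : (D₁.net m).Closed := by rw [hnet]; exact hD.closed.add hb ha
  have happ : (D.net m).graph.IsEdgeAddition (D₁.net m).graph (d 0) (x l) (x 0) := by
    rw [hnet]; exact hD.closed.isEdgeAddition he0 ha hb
  refine ⟨⟨hD.toEmbedded.ear hE hV he hr, hcl, ?_, ?_⟩, by simp, ?_, by rw [hnet]; simp [Net.add],
    happ.link_new, ?_, happ, ?_, fun W hW => hW.ear he hr, ?_⟩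
  · rw [hnet]; exact hD.cut3.add he0 _ _
  · rw [he.vst_other hr (by rw [hD.root]; omega), hD.root]
  · rw [he.vst_other hr (by omega), ha]
  · intro F hF X haX hX
    simp only [List.mem_singleton] at hF
    subst hF
    rw [hnet] at hX
    exact hD.cut3.mem_typeA ha hb haX fun d' hd' h1 => hX d' hd' h1 h1 h1
  · intro W hW
    have := hW.2 _ (he.lab_zero 0 he.pos)
    rw [hnet]
    ext d'
    simp only [ExtOp.embed, Net.add, Finset.coe_insert, Set.mem_inter_iff, Set.mem_insert_iff,
      Finset.mem_coe]
    constructor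
    · tauto
    · rintro ⟨h1, rfl | h2⟩
      · exact absurd h1 this
      · exact ⟨h1, h2⟩
  · intro U K hB hold hnew
    obtain ⟨h1, h2, -⟩ := hnew 0 (by simp)
    have h3 := even_of_isCycleSet hcl h1
    rw [hnet] at h3 ⊢
    exact hB.typeA he0 (fun j hj => (hold j hj).2 _ (he.lab_zero 0 he.pos)) h3 h2

/-- The new edge of a division is not an edge before the division. -/
theorem Link.label_new {f j : ℕ} (hL : D.Link G f l x d) (hj : 0 < j) (hjl : j < l) :
    D.lab (d j) = f + 1 ∧ d j ≠ f := by
  refine ⟨(hL.lab_iff _).2 ⟨j, hjl, rfl⟩, fun h => ?_⟩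
  have := hL.edge_inj j hjl 0 hL.pos (h.trans hL.first.symm)
  omega

theorem Ear.lab_of_ne (hr : D.Relabeled D₁ l x d) {e f : ℕ} (h : D₁.lab e = f + 1) (hf : f ≠ d 0) :
    D.lab e = f + 1 := by
  rcases hr.lab_cases e with ⟨-, h2⟩ | ⟨-, h2⟩ <;> omega

variable {f g l₁ j₁ l₂ j₂ : ℕ} {x₁ d₁ x₂ d₂ : ℕ → ℕ}

/-- The net of `D₂` arises by an addition followed by a division, and `Net.add_divide` brings it
into the order that the operation prescribes. The forbidden pairs `(f₂, f₂)` and `(f, f)` request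
one cycle for each half of `f`, as in `Net.Basis.typeB`. -/
theorem Extension.typeB (hD : D.Good G n m) (hE : G.edgeSet = Set.Iio m)
    (hV : G.vertexSet = Set.Iio n) (he : D.Ear G l x d) (hr : D.Relabeled D₁ l x d)
    (ha : D.vst (x l) = f + 2) (hb : D.vst (x 0) = 1) (hL : D₁.Link G f l₁ x₁ d₁) (hj : 0 < j₁)
    (hjl : j₁ < l₁) (hxa : x₁ j₁ = x l) (hdiv : D₁.Divided D₂ f l₁ j₁ x₁ d₁) :
    Extension G n m D D₂
      (.typeB (d 0) (x l) (x 0) f (d₁ j₁) (D₁.src f) (D₁.tgt f)) (d 0) (x l) (x 0)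
      [(d₁ j₁, d₁ j₁), (f, f)] := by
  have hD₁ := hD.toEmbedded.ear hE hV he hr
  have hlab0 := he.lab_zero 0 he.pos
  have hlabf := hD.vst_label _ f ha
  have hfE : f ∈ (D.net m).E := hD.mem_net.2 hlabf
  have hef : d 0 ≠ f := by rintro h; rw [h] at hlab0; omega
  obtain ⟨hf₂l, hff⟩ := hL.label_new hj hjl
  have hf₂l' := Ear.lab_of_ne hr hf₂l hef.symm
  have hf₂E : d₁ j₁ ∉ (D.net m).E := by rw [hD.mem_net]; omega
  have hef₂ : d 0 ≠ d₁ j₁ := by rintro h; rw [h] at hlab0; omega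
  have he0 : d 0 ∉ (D.net m).E := by rw [hD.mem_net]; omega
  have haV : x l ∉ (D.net m).V := by simp only [net, Set.mem_ofPred_eq]; omega
  have hnet : D₂.net m = ((D.net m).divide f (d₁ j₁) (x l)).add (d 0) (x 0) (x l) := by
    rw [hD₁.divide_net hL hj hjl hdiv, he.net_eq hE hr, hxa, Net.add_divide _ _ _ _ hef hef₂]
  have hsrc : D₁.src f = D.src f := by rw [hr.src_eq, Function.update_of_ne hef.symm]
  have htgt : D₁.tgt f = D.tgt f := by rw [hr.tgt_eq, Function.update_of_ne hef.symm]
  have hcl1 := hD.closed.divide hfE (d₁ j₁) (x l)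
  have hcl : (D₂.net m).Closed := by
    rw [hnet]; exact hcl1.add (Or.inr hb) (Or.inl rfl)
  have he0' : d 0 ∉ ((D.net m).divide f (d₁ j₁) (x l)).E := by
    simp [Net.divide, he0, hef₂]
  have happ : (ExtOp.typeB (d 0) (x l) (x 0) f (d₁ j₁) (D₁.src f) (D₁.tgt f)).Applies
      (D.net m).graph (D₂.net m).graph := by
    refine ⟨hb, ((D.net m).divide f (d₁ j₁) (x l)).graph, ?_, ?_⟩
    · rw [hsrc, htgt]
      exact hD.closed.isDivision hfE hf₂E haV
    · rw [hnet]
      exact hcl1.isEdgeAddition he0' (Or.inl rfl) (Or.inr hb)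
  have hresp : ∀ W, D.Respects W → d 0 ∉ W ∧ (f ∈ W ↔ d₁ j₁ ∈ W) := fun W hW =>
    ⟨hW.2 _ hlab0, (hW.1 _ _ hf₂l').symm⟩
  refine ⟨⟨hD₁.divide hL hj hjl hdiv, hcl, ?_, ?_⟩, by simp, ?_,
    by rw [hnet]; simp [Net.add, Net.divide, hfE], ?_, ?_, happ, ?_,
    fun W hW => (hW.ear he hr).divide hL hjl hdiv, ?_⟩
  · rw [hnet]; exact hD.cut3.typeB hD.closed hfE hf₂E he0 hef₂ hb
  · have h1 := he.vst_other hr (v := 0) (by rw [hD.root]; omega)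
    rcases hdiv.vst_cases hL hj hjl 0 with ⟨-, h2, -⟩ | ⟨-, h2, -⟩ | ⟨-, h2⟩
    · rw [h1, hD.root] at h2; omega
    · rw [h1, hD.root] at h2; omega
    · rw [h2, h1, hD.root]
  · have : x l ∈ (D₂.net m).V := by rw [hnet]; exact Or.inl rfl
    exact this
  · rw [Net.isLink_iff hcl, hnet]
    simp [Net.add]
  · intro F hF X haX hX
    simp only [List.mem_cons, List.not_mem_nil, or_false] at hF
    rw [hnet] at hX
    refine hD.cut3.mem_typeB (F := F.1) hD.closed hfE hf₂E he0 hef₂ hb haX ?_ ?_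
    · rcases hF with rfl | rfl <;> simp
    · intro d' hd' h1 h2
      exact hX d' hd' h1 h2 (by rcases hF with rfl | rfl <;> exact h2)
  · intro W hW
    have h1 := hresp W hW
    rw [hnet]
    ext d'
    simp only [ExtOp.embed, ExtOp.splitEdge, Net.add, Net.divide, Finset.coe_insert,
      Set.mem_inter_iff, Set.mem_insert_iff, Finset.mem_coe, Set.mem_ofPred_eq]
    constructor
    · rintro (⟨h2, h3⟩ | ⟨rfl, h2, h3⟩)
      · exact ⟨h2, Or.inr (Or.inr h3)⟩
      · exact ⟨h1.2.1 h2, Or.inr (Or.inl rfl)⟩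
    · rintro ⟨h2, rfl | rfl | h3⟩
      · exact absurd h2 h1.1
      · exact Or.inr ⟨rfl, h1.2.2 h2, hfE⟩
      · exact Or.inl ⟨h2, h3⟩
  · intro U K hB hold hnew
    obtain ⟨h1, h2, h3, -⟩ := hnew 0 (by simp)
    obtain ⟨h1', h2', h3', -⟩ := hnew 1 (by simp)
    have h4 := even_of_isCycleSet hcl h1
    have h4' := even_of_isCycleSet hcl h1'
    rw [hnet] at h4 h4' ⊢
    exact hB.typeB hD.closed hfE hf₂E he0 hef₂ haV hb (fun j hj => hresp _ (hold j hj)) h4 h2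
      (h3 hef₂.symm) h4' h2' (h3' hef.symm)

-- As the ends of the ear are interior to different paths, neither division affects the other path.
-- The forbidden pairs `(f₂, g₂)`, `(f₂, g)` and `(f, g₂)` leave the passages `f, g`, then `f, g₂`,
-- then `f₂, g`, in the order of `Net.Basis.typeC`.
set_option maxHeartbeats 1000000 in
theorem Extension.typeC (hD : D.Good G n m) (hE : G.edgeSet = Set.Iio m)
    (hV : G.vertexSet = Set.Iio n) (he : D.Ear G l x d) (hr : D.Relabeled D₁ l x d)
    (ha : D.vst (x l) = f + 2) (hb : D.vst (x 0) = g + 2) (hfg : f ≠ g)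
    (hL : D₁.Link G f l₁ x₁ d₁) (hj : 0 < j₁) (hjl : j₁ < l₁) (hxa : x₁ j₁ = x l)
    (hdiv : D₁.Divided D₂ f l₁ j₁ x₁ d₁)
    (hL₂ : D₂.Link G g l₂ x₂ d₂) (hj₂ : 0 < j₂) (hjl₂ : j₂ < l₂) (hxb : x₂ j₂ = x 0)
    (hdiv₂ : D₂.Divided D₃ g l₂ j₂ x₂ d₂) :
    Extension G n m D D₃
      (.typeC (d 0) (x l) (x 0) f (d₁ j₁) (D₁.src f) (D₁.tgt f) g (d₂ j₂) (D₂.src g) (D₂.tgt g))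
      (d 0) (x l) (x 0) [(d₁ j₁, d₂ j₂), (d₁ j₁, g), (f, d₂ j₂)] := by
  have hD₁ := hD.toEmbedded.ear hE hV he hr
  have hD₂ := hD₁.divide hL hj hjl hdiv
  have hlab0 := he.lab_zero 0 he.pos
  have hlabf := hD.vst_label _ f ha
  have hlabg := hD.vst_label _ g hb
  have hfE : f ∈ (D.net m).E := hD.mem_net.2 hlabf
  have hgE : g ∈ (D.net m).E := hD.mem_net.2 hlabg
  have hef : d 0 ≠ f := by rintro h; rw [h] at hlab0; omega
  have heg : d 0 ≠ g := by rintro h; rw [h] at hlab0; omega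
  obtain ⟨hf₂l, hff⟩ := hL.label_new hj hjl
  have hf₂l' := Ear.lab_of_ne hr hf₂l hef.symm
  have hf₂E : d₁ j₁ ∉ (D.net m).E := by rw [hD.mem_net]; omega
  have hef₂ : d 0 ≠ d₁ j₁ := by rintro h; rw [h] at hlab0; omega
  have he0 : d 0 ∉ (D.net m).E := by rw [hD.mem_net]; omega
  obtain ⟨hg₂l, hgg⟩ := hL₂.label_new hj₂ hjl₂
  have hf₂g : d₁ j₁ ≠ g := by rintro h; exact hf₂E (h ▸ hgE)
  have hg₂l₁ : D₁.lab (d₂ j₂) = g + 1 := by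
    rcases hdiv.lab_cases hL (d₂ j₂) with ⟨-, -, h2⟩ | ⟨-, h2⟩ <;> omega
  have hg₂l' := Ear.lab_of_ne hr hg₂l₁ heg.symm
  have hg₂E : d₂ j₂ ∉ (D.net m).E := by rw [hD.mem_net]; omega
  have heg₂ : d 0 ≠ d₂ j₂ := by rintro h; rw [h] at hlab0; omega
  have hfg₂ : d₁ j₁ ≠ d₂ j₂ := by rintro h; rw [h] at hf₂l'; omega
  have haV : x l ∉ (D.net m).V := by simp only [net, Set.mem_ofPred_eq]; omega
  have hbV : x 0 ∉ (D.net m).V := by simp only [net, Set.mem_ofPred_eq]; omega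
  have hba : x 0 ≠ x l := by rintro h; rw [h] at hb; omega
  have hnet : D₃.net m =
      (((D.net m).divide f (d₁ j₁) (x l)).divide g (d₂ j₂) (x 0)).add (d 0) (x 0) (x l) := by
    rw [hD₂.divide_net hL₂ hj₂ hjl₂ hdiv₂, hD₁.divide_net hL hj hjl hdiv, he.net_eq hE hr, hxa,
      hxb, Net.add_divide _ _ _ _ hef hef₂, Net.add_divide _ _ _ _ heg heg₂]
  have hsrc : D₁.src f = D.src f := by rw [hr.src_eq, Function.update_of_ne hef.symm]
  have htgt : D₁.tgt f = D.tgt f := by rw [hr.tgt_eq, Function.update_of_ne hef.symm]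
  have hcl1 := hD.closed.divide hfE (d₁ j₁) (x l)
  have hgE1 : g ∈ ((D.net m).divide f (d₁ j₁) (x l)).E := by simp [Net.divide, hgE]
  have hg₂E1 : d₂ j₂ ∉ ((D.net m).divide f (d₁ j₁) (x l)).E := by
    simp [Net.divide, hg₂E, hfg₂.symm]
  have hcl2 := hcl1.divide hgE1 (d₂ j₂) (x 0)
  have hcl : (D₃.net m).Closed := by
    rw [hnet]; exact hcl2.add (Or.inl rfl) (Or.inr (Or.inl rfl))
  have he0' : d 0 ∉ (((D.net m).divide f (d₁ j₁) (x l)).divide g (d₂ j₂) (x 0)).E := by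
    simp [Net.divide, he0, hef₂, heg₂]
  have hnet₂ : D₂.net m = ((D.net m).divide f (d₁ j₁) (x l)).add (d 0) (x 0) (x l) := by
    rw [hD₁.divide_net hL hj hjl hdiv, he.net_eq hE hr, hxa, Net.add_divide _ _ _ _ hef hef₂]
  have hsrc₂ : D₂.src g = ((D.net m).divide f (d₁ j₁) (x l)).src g :=
    (congrFun (congrArg Net.src hnet₂) g).trans (Function.update_of_ne heg.symm _ _)
  have htgt₂ : D₂.tgt g = ((D.net m).divide f (d₁ j₁) (x l)).tgt g :=
    (congrFun (congrArg Net.tgt hnet₂) g).trans (Function.update_of_ne heg.symm _ _)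
  have happ : (ExtOp.typeC (d 0) (x l) (x 0) f (d₁ j₁) (D₁.src f) (D₁.tgt f) g (d₂ j₂) (D₂.src g)
      (D₂.tgt g)).Applies (D.net m).graph (D₃.net m).graph := by
    have hed : (D.net m).graph.edgeSet = (D.net m).E := Net.edgeSet_graph hD.closed
    refine ⟨by rw [hed]; exact_mod_cast hfE, by rw [hed]; exact_mod_cast hgE, hfg,
      ((D.net m).divide f (d₁ j₁) (x l)).graph,
      (((D.net m).divide f (d₁ j₁) (x l)).divide g (d₂ j₂) (x 0)).graph, ?_, ?_, ?_⟩
    · rw [hsrc, htgt]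
      exact hD.closed.isDivision hfE hf₂E haV
    · rw [hsrc₂, htgt₂]
      exact hcl1.isDivision hgE1 hg₂E1 (by
        rintro (h | h)
        · exact hba h
        · exact hbV h)
    · rw [hnet]
      exact hcl2.isEdgeAddition he0' (Or.inr (Or.inl rfl)) (Or.inl rfl)
  have hresp : ∀ W, D.Respects W → d 0 ∉ W ∧ (f ∈ W ↔ d₁ j₁ ∈ W) ∧ (g ∈ W ↔ d₂ j₂ ∈ W) :=
    fun W hW => ⟨hW.2 _ hlab0, (hW.1 _ _ hf₂l').symm, (hW.1 _ _ hg₂l').symm⟩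
  refine ⟨⟨hD₂.divide hL₂ hj₂ hjl₂ hdiv₂, hcl, ?_, ?_⟩, by simp, ?_,
    by rw [hnet]; simp [Net.add, Net.divide, hfE, hgE], ?_, ?_, happ, ?_,
    fun W hW => ((hW.ear he hr).divide hL hjl hdiv).divide hL₂ hjl₂ hdiv₂, ?_⟩
  · rw [hnet]
    exact hD.cut3.typeC hD.closed hfE hf₂E hgE hg₂E hfg hfg₂ he0 hef₂ heg₂
  · have h1 := he.vst_other hr (v := 0) (by rw [hD.root]; omega)
    have h3 : D₂.vst 0 = 1 := by
      rcases hdiv.vst_cases hL hj hjl 0 with ⟨-, h2, -⟩ | ⟨-, h2, -⟩ | ⟨-, h2⟩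
      · rw [h1, hD.root] at h2; omega
      · rw [h1, hD.root] at h2; omega
      · rw [h2, h1, hD.root]
    rcases hdiv₂.vst_cases hL₂ hj₂ hjl₂ 0 with ⟨-, h2, -⟩ | ⟨-, h2, -⟩ | ⟨-, h2⟩ <;> omega
  · have : x l ∈ (D₃.net m).V := by rw [hnet]; exact Or.inr (Or.inl rfl)
    exact this
  · rw [Net.isLink_iff hcl, hnet]
    simp [Net.add]
  · intro F hF X haX hX
    simp only [List.mem_cons, List.not_mem_nil, or_false] at hF
    rw [hnet] at hX
    refine hD.cut3.mem_typeC (F₁ := F.1) (F₂ := F.2) hD.closed hfE hf₂E hgE hg₂E hfg hfg₂ he0 hef₂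
      heg₂ haX ?_ ?_ hX
    · rcases hF with rfl | rfl | rfl <;> simp
    · rcases hF with rfl | rfl | rfl <;> simp
  · intro W hW
    have h1 := hresp W hW
    rw [hnet]
    ext d'
    simp only [ExtOp.embed, ExtOp.splitEdge, Net.add, Net.divide, Finset.coe_insert,
      Set.mem_inter_iff, Set.mem_insert_iff, Finset.mem_coe, Set.mem_ofPred_eq]
    constructor
    · rintro ((⟨h2, h3⟩ | ⟨rfl, h2, h3⟩) | ⟨rfl, ⟨h2, h3⟩ | ⟨h4, h2, h3⟩⟩)
      · exact ⟨h2, Or.inr (Or.inr (Or.inr h3))⟩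
      · exact ⟨h1.2.1.1 h2, Or.inr (Or.inr (Or.inl rfl))⟩
      · exact ⟨h1.2.2.1 h2, Or.inr (Or.inl rfl)⟩
      · exact absurd h4.symm hf₂g
    · rintro ⟨h2, rfl | rfl | rfl | h3⟩
      · exact absurd h2 h1.1
      · exact Or.inr ⟨rfl, Or.inl ⟨h1.2.2.2 h2, hgE⟩⟩
      · exact Or.inl (Or.inr ⟨rfl, h1.2.1.2 h2, hfE⟩)
      · exact Or.inl (Or.inl ⟨h2, h3⟩)
  · intro U K hB hold hnew
    obtain ⟨h1, h2, h3, h4⟩ := hnew 0 (by simp)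
    obtain ⟨h1', h2', h3', h4'⟩ := hnew 1 (by simp)
    obtain ⟨h1'', h2'', h3'', h4''⟩ := hnew 2 (by simp)
    have h5 := even_of_isCycleSet hcl h1
    have h5' := even_of_isCycleSet hcl h1'
    have h5'' := even_of_isCycleSet hcl h1''
    rw [hnet] at h5 h5' h5'' ⊢
    exact hB.typeC hD.closed hfE hf₂E hgE hg₂E hfg hfg₂ he0 hef₂ heg₂ haV hbV hba
      (fun j hj => hresp _ (hold j hj)) h5 h2 (h3 hef₂.symm) (h4 heg₂.symm) h5' h2' (h3' hef₂.symm)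
      (h4' heg.symm) h5'' h2'' (h3'' hef.symm) (h4'' heg₂.symm)

/-! ### A measure of progress -/

/-- The weight of a vertex: branch vertices count twice. -/
def vertexWeight (c : ℕ) : ℕ := if c = 0 then 0 else if c = 1 then 2 else 1

/-- The weight of a layout. -/
def weight (n : ℕ) (D : Layout) : ℕ := ∑ v ∈ Finset.range n, vertexWeight (D.vst v)

theorem weight_le (n : ℕ) (D : Layout) : D.weight n ≤ 2 * n := by
  refine (Finset.sum_le_card_nsmul _ _ 2 fun v _ => ?_).trans (by simp [mul_comm])
  unfold vertexWeight
  split_ifs <;> omega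

theorem weight_ear_le (he : D.Ear G l x d) (hr : D.Relabeled D₁ l x d) :
    D.weight n ≤ D₁.weight n := by
  refine Finset.sum_le_sum fun v _ => ?_
  rcases hr.vst_cases v with ⟨⟨i, hi, hil, rfl⟩, -⟩ | ⟨-, h⟩
  · rw [he.vst_zero i hi hil]
    simp [vertexWeight]
  · rw [h]

/-- Such an ear has an interior vertex, whose weight rises from 0 to 1. This gives progress in
extensions of type A, which create no branch vertex. -/
theorem weight_ear_lt (hV : G.vertexSet = Set.Iio n) (he : D.Ear G l x d)
    (hr : D.Relabeled D₁ l x d) (hl : 1 < l) : D.weight n < D₁.weight n := by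
  refine Finset.sum_lt_sum (fun v _ => ?_) ⟨x 1, ?_, ?_⟩
  · rcases hr.vst_cases v with ⟨⟨i, hi, hil, rfl⟩, -⟩ | ⟨-, h⟩
    · rw [he.vst_zero i hi hil]
      simp [vertexWeight]
    · rw [h]
  · have := (he.link 0 he.pos).right_mem
    rw [hV] at this
    exact Finset.mem_range.2 this
  · rw [he.vst_zero 1 (by omega) hl, hr.vst_path 1 (by omega) hl]
    simp [vertexWeight]

/-- The weight of `x j` rises from 1 to 2, and the vertices that are only renamed keep their weight.
-/
theorem weight_divide_lt (hD : D.Embedded G n m) {j : ℕ} (hL : D.Link G f l x d) (hj : 0 < j)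
    (hjl : j < l) (hdiv : D.Divided D₁ f l j x d) : D.weight n < D₁.weight n := by
  refine Finset.sum_lt_sum (fun v _ => ?_) ⟨x j, ?_, ?_⟩
  · rcases hdiv.vst_cases hL hj hjl v with ⟨-, h1, h2⟩ | ⟨-, h1, h2⟩ | ⟨-, h2⟩
    · rw [h1, h2]; simp [vertexWeight]
    · rw [h1, h2]; simp [vertexWeight]
    · rw [h2]
  · have := (hL.vst_iff (x j)).2 ⟨j, hj, hjl, rfl⟩
    exact Finset.mem_range.2 (hD.vst_lt _ (by omega))
  · have h := (hL.vst_iff (x j)).2 ⟨j, hj, hjl, rfl⟩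
    rcases hdiv.vst_cases hL hj hjl (x j) with ⟨⟨i, h1, h2, h3⟩, -⟩ | ⟨-, h1, h2⟩ | ⟨h1, -⟩
    · have := hL.inj i j (by omega) h2 hj hjl h3
      omega
    · rw [h, h2]; simp [vertexWeight]
    · exact absurd rfl (h1 j le_rfl hjl)

end Layout

/-! ### A program logic for the random access machine. -/

namespace RAM

/-! ### Execution without a bound on the values -/

/-- Started in the state `s`, the program `p` halts after `t` time units in the state `s'`. -/
inductive Run : Prog → State → ℕ → State → Prop where
  | skip (s : State) : Run .skip s 1 s
  | assign (x : ℕ) (e : Expr) (s : State) :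
      Run (.assign x e) s (e.cost + 1) (s.setVar x (e.eval s))
  | store (A : ℕ) (i e : Expr) (s : State) :
      Run (.store A i e) s (i.cost + e.cost + 1) (s.setCell A (i.eval s) (e.eval s))
  | seq {p q : Prog} {s s₁ s₂ : State} {t₁ t₂ : ℕ} (hp : Run p s t₁ s₁)
      (hq : Run q s₁ t₂ s₂) : Run (.seq p q) s (t₁ + t₂) s₂
  | cond_true {e : Expr} {p q : Prog} {s s₁ : State} {t : ℕ}
      (hc : e.eval s ≠ 0) (hp : Run p s t s₁) : Run (.cond e p q) s (e.cost + 1 + t) s₁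
  | cond_false {e : Expr} {p q : Prog} {s s₁ : State} {t : ℕ}
      (hc : e.eval s = 0) (hq : Run q s t s₁) : Run (.cond e p q) s (e.cost + 1 + t) s₁
  | loop_done {e : Expr} {p : Prog} {s : State} (hc : e.eval s = 0) :
      Run (.loop e p) s (e.cost + 1) s
  | loop_step {e : Expr} {p : Prog} {s s₁ s₂ : State} {t₁ t₂ : ℕ}
      (hc : e.eval s ≠ 0) (hp : Run p s t₁ s₁) (hl : Run (.loop e p) s₁ t₂ s₂) :
      Run (.loop e p) s (e.cost + 1 + t₁ + t₂) s₂

/-! ### Programs whose values grow slowly -/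

/-- A bound for the constants and the number of sums in an expression. -/
def Expr.size : Expr → ℕ
  | .const c => c + 1
  | .var _ => 1
  | .cell _ i => i.size + 1
  | .plus a b => a.size + b.size + 1
  | .minus a b => a.size + b.size + 1

/-- The value of the expression exceeds the largest value in the memory at most by a constant. -/
def Expr.slow : Expr → Bool
  | .const _ => true
  | .var _ => true
  | .cell _ _ => true
  | .plus a (.const _) => a.slow
  | .plus _ _ => false
  | .minus a _ => a.slow

/-- A bound for the sizes of the expressions in a program. -/
def Prog.size : Prog → ℕ
  | .skip => 0
  | .assign _ e => e.size
  | .store _ i e => i.size + e.size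
  | .seq p q => p.size + q.size
  | .cond e p q => e.size + p.size + q.size
  | .loop e p => e.size + p.size

/-- Only slowly growing values are stored. -/
def Prog.slow : Prog → Bool
  | .skip => true
  | .assign _ e => e.slow
  | .store _ _ e => e.slow
  | .seq p q => p.slow && q.slow
  | .cond _ p q => p.slow && q.slow
  | .loop _ p => p.slow

/-- All values in the memory are at most `B`. -/
def State.Bounded (s : State) (B : ℕ) : Prop := (∀ x, s.var x ≤ B) ∧ ∀ A i, s.arr A i ≤ B

theorem State.Bounded.mono {s : State} {B B' : ℕ} (h : s.Bounded B) (hB : B ≤ B') : s.Bounded B' :=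
  ⟨fun x => (h.1 x).trans hB, fun A i => (h.2 A i).trans hB⟩

theorem State.Bounded.setVar {s : State} {B : ℕ} (h : s.Bounded B) (x : ℕ) {c : ℕ} (hc : c ≤ B) :
    (s.setVar x c).Bounded B := by
  refine ⟨fun y => ?_, h.2⟩
  simp only [State.setVar, Function.update_apply]
  split_ifs
  · exact hc
  · exact h.1 y

theorem State.Bounded.setCell {s : State} {B : ℕ} (h : s.Bounded B) (A i : ℕ) {c : ℕ}
    (hc : c ≤ B) : (s.setCell A i c).Bounded B := by
  refine ⟨h.1, fun A' i' => ?_⟩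
  by_cases hA : A' = A
  · subst hA
    simp only [State.setCell, Function.update_self, Function.update_apply]
    split_ifs
    · exact hc
    · exact h.2 A' i'
  · simp only [State.setCell, Function.update_of_ne hA]
    exact h.2 A' i'

theorem Expr.eval_le {s : State} {B : ℕ} (h : s.Bounded B) (hB : 1 ≤ B) (e : Expr) :
    e.eval s ≤ e.size * B := by
  induction e with
  | const c =>
    simp only [Expr.eval, Expr.size]
    nlinarith
  | var x =>
    simp only [Expr.eval, Expr.size, one_mul]
    exact h.1 x
  | cell A i ih =>
    simp only [Expr.eval, Expr.size]
    have := h.2 A (i.eval s)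
    nlinarith [Nat.zero_le (i.size * B)]
  | plus a b iha ihb => simp only [Expr.eval, Expr.size]; nlinarith
  | minus a b iha ihb =>
    simp only [Expr.eval, Expr.size]
    have : a.eval s - b.eval s ≤ a.eval s := Nat.sub_le _ _
    nlinarith [Nat.zero_le (b.size * B)]

theorem Expr.fits {s : State} {B W : ℕ} (h : s.Bounded B) (hB : 1 ≤ B) (e : Expr)
    (hW : e.size * B ≤ W) : e.Fits W s := by
  induction e with
  | const c => exact (Expr.eval_le h hB (.const c)).trans hW
  | var x => exact (Expr.eval_le h hB (.var x)).trans hW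
  | cell A i ih =>
    refine ⟨ih (le_trans ?_ hW), (Expr.eval_le h hB (.cell A i)).trans hW⟩
    exact Nat.mul_le_mul_right _ (Nat.le_succ _)
  | plus a b iha ihb =>
    refine ⟨iha (le_trans ?_ hW), ihb (le_trans ?_ hW), (Expr.eval_le h hB (.plus a b)).trans hW⟩ <;>
    · simp only [Expr.size]
      exact Nat.mul_le_mul_right _ (by omega)
  | minus a b iha ihb =>
    refine ⟨iha (le_trans ?_ hW), ihb (le_trans ?_ hW)⟩ <;>
    · simp only [Expr.size]
      exact Nat.mul_le_mul_right _ (by omega)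

theorem Expr.eval_le_of_slow {s : State} {B : ℕ} (h : s.Bounded B) (e : Expr)
    (hs : e.slow = true) : e.eval s ≤ B + e.size := by
  induction e with
  | const c => simp only [Expr.eval, Expr.size]; omega
  | var x => simp only [Expr.eval, Expr.size]; have := h.1 x; omega
  | cell A i ih => simp only [Expr.eval, Expr.size]; have := h.2 A (i.eval s); omega
  | plus a b iha ihb =>
    cases b with
    | const c =>
      have := iha hs
      simp only [Expr.eval, Expr.size]; omega
    | _ => simp [Expr.slow] at hs
  | minus a b iha ihb =>
    have := iha hs
    simp only [Expr.eval, Expr.size]; omega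

/-- A slow expression exceeds the largest stored value at most by its size, so the stored values
grow by at most `κ` per step and are at most `B + κ * t` after `t` steps. Evaluating an arbitrary
expression of the program multiplies this bound at most by `κ`. In particular, conditions and
addresses may contain sums of variables. -/
theorem Run.exec {p : Prog} {s s' : State} {t : ℕ} (h : Run p s t s') {κ B W : ℕ}
    (hslow : p.slow = true) (hκ : p.size ≤ κ) (hs : s.Bounded B) (hB : 1 ≤ B)
    (hW : κ * (B + κ * t) ≤ W) : Exec W p s t s' ∧ s'.Bounded (B + κ * t) := by
  have hmul : ∀ {a b c d : ℕ}, a ≤ c → b ≤ d → a * b ≤ c * d := fun h1 h2 => Nat.mul_le_mul h1 h2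
  induction h generalizing B with
  | skip s => exact ⟨.skip s, hs.mono (by omega)⟩
  | assign x e s =>
    simp only [Prog.size, Prog.slow] at hκ hslow
    have h1 := Expr.eval_le_of_slow hs e hslow
    have h2 : κ ≤ κ * (e.cost + 1) := Nat.le_mul_of_pos_right _ (by omega)
    refine ⟨.assign x e s (e.fits hs hB ((hmul hκ (by omega)).trans hW)), ?_⟩
    exact (hs.mono (by omega)).setVar x (by omega)
  | store A i e s =>
    simp only [Prog.size, Prog.slow] at hκ hslow
    have h1 := Expr.eval_le_of_slow hs e hslow
    have h2 : κ ≤ κ * (i.cost + e.cost + 1) := Nat.le_mul_of_pos_right _ (by omega)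
    refine ⟨.store A i e s (i.fits hs hB ((hmul (by omega) (by omega)).trans hW))
      (e.fits hs hB ((hmul (by omega) (by omega)).trans hW)), ?_⟩
    exact (hs.mono (by omega)).setCell A _ (by omega)
  | @seq p q s s₁ s₂ t₁ t₂ hp hq ihp ihq =>
    simp only [Prog.size, Prog.slow, Bool.and_eq_true] at hκ hslow
    rw [Nat.mul_add κ t₁] at hW ⊢
    obtain ⟨h1, h2⟩ := ihp hslow.1 (by omega) hs hB ((hmul le_rfl (by omega)).trans hW)
    obtain ⟨h3, h4⟩ := ihq hslow.2 (by omega) h2 (by omega) ((hmul le_rfl (by omega)).trans hW)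
    exact ⟨.seq h1 h3, h4.mono (by omega)⟩
  | @cond_true e p q s s₁ t hc hp ih =>
    simp only [Prog.size, Prog.slow, Bool.and_eq_true] at hκ hslow
    rw [Nat.mul_add κ _ t] at hW ⊢
    obtain ⟨h1, h2⟩ := ih hslow.1 (by omega) hs hB ((hmul le_rfl (by omega)).trans hW)
    exact ⟨.cond_true (e.fits hs hB ((hmul (by omega) (by omega)).trans hW)) hc h1,
      h2.mono (by omega)⟩
  | @cond_false e p q s s₁ t hc hp ih =>
    simp only [Prog.size, Prog.slow, Bool.and_eq_true] at hκ hslow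
    rw [Nat.mul_add κ _ t] at hW ⊢
    obtain ⟨h1, h2⟩ := ih hslow.2 (by omega) hs hB ((hmul le_rfl (by omega)).trans hW)
    exact ⟨.cond_false (e.fits hs hB ((hmul (by omega) (by omega)).trans hW)) hc h1,
      h2.mono (by omega)⟩
  | @loop_done e p s hc =>
    simp only [Prog.size] at hκ
    exact ⟨.loop_done (e.fits hs hB ((hmul (by omega) (by omega)).trans hW)) hc,
      hs.mono (by omega)⟩
  | @loop_step e p s s₁ s₂ t₁ t₂ hc hp hl ihp ihl =>
    have hslow' := hslow
    have hκ' := hκ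
    simp only [Prog.size, Prog.slow] at hκ hslow
    rw [Nat.mul_add κ _ t₂, Nat.mul_add κ _ t₁] at hW ⊢
    obtain ⟨h1, h2⟩ := ihp hslow (by omega) hs hB ((hmul le_rfl (by omega)).trans hW)
    obtain ⟨h3, h4⟩ := ihl hslow' hκ' h2 (by omega) ((hmul le_rfl (by omega)).trans hW)
    exact ⟨.loop_step (e.fits hs hB ((hmul (by omega) (by omega)).trans hW)) hc h1 h3,
      h4.mono (by omega)⟩

/-! ### Frames -/

/-- The variables written by a program. -/
def Prog.vars : Prog → List ℕ
  | .skip => []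
  | .assign x _ => [x]
  | .store _ _ _ => []
  | .seq p q => p.vars ++ q.vars
  | .cond _ p q => p.vars ++ q.vars
  | .loop _ p => p.vars

/-- The arrays written by a program. -/
def Prog.arrs : Prog → List ℕ
  | .skip => []
  | .assign _ _ => []
  | .store A _ _ => [A]
  | .seq p q => p.arrs ++ q.arrs
  | .cond _ p q => p.arrs ++ q.arrs
  | .loop _ p => p.arrs

/-- The states agree outside the variables `V` and the arrays `A`. -/
def Frame (V A : List ℕ) (s s' : State) : Prop :=
  (∀ x, x ∉ V → s'.var x = s.var x) ∧ ∀ X, X ∉ A → s'.arr X = s.arr X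

theorem Frame.refl (V A : List ℕ) (s : State) : Frame V A s s := ⟨fun _ _ => rfl, fun _ _ => rfl⟩

theorem Frame.trans {V A : List ℕ} {s s' s'' : State} (h : Frame V A s s') (h' : Frame V A s' s'') :
    Frame V A s s'' :=
  ⟨fun x hx => (h'.1 x hx).trans (h.1 x hx), fun X hX => (h'.2 X hX).trans (h.2 X hX)⟩

theorem Frame.mono {V V' A A' : List ℕ} {s s' : State} (h : Frame V A s s') (hV : V ⊆ V')
    (hA : A ⊆ A') : Frame V' A' s s' :=
  ⟨fun x hx => h.1 x fun h' => hx (hV h'), fun X hX => h.2 X fun h' => hX (hA h')⟩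

theorem Run.frame {p : Prog} {s s' : State} {t : ℕ} (h : Run p s t s') :
    Frame p.vars p.arrs s s' := by
  induction h with
  | skip s => exact Frame.refl _ _ _
  | assign x e s =>
    refine ⟨fun y hy => ?_, fun _ _ => rfl⟩
    simp only [Prog.vars, List.mem_singleton] at hy
    simp [State.setVar, hy]
  | store A i e s =>
    refine ⟨fun _ _ => rfl, fun X hX => ?_⟩
    simp only [Prog.arrs, List.mem_singleton] at hX
    simp [State.setCell, hX]
  | seq _ _ ih1 ih2 =>
    exact (ih1.mono (List.subset_append_left _ _) (List.subset_append_left _ _)).trans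
      (ih2.mono (List.subset_append_right _ _) (List.subset_append_right _ _))
  | cond_true _ _ ih => exact ih.mono (List.subset_append_left _ _) (List.subset_append_left _ _)
  | cond_false _ _ ih => exact ih.mono (List.subset_append_right _ _) (List.subset_append_right _ _)
  | loop_done _ => exact Frame.refl _ _ _
  | loop_step _ _ _ ih1 ih2 => exact ih1.trans ih2

/-! ### Total correctness with time bounds -/

/-- Started in `s`, the program `p` halts within time `T` in a state that satisfies `Q`. -/
def Ends (p : Prog) (s : State) (T : ℕ) (Q : State → Prop) : Prop :=
  ∃ t s', Run p s t s' ∧ t ≤ T ∧ Q s'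

theorem Ends.mono {p : Prog} {s : State} {T T' : ℕ} {Q Q' : State → Prop} (h : Ends p s T Q)
    (hT : T ≤ T') (hQ : ∀ s', Q s' → Q' s') : Ends p s T' Q' := by
  obtain ⟨t, s', h1, h2, h3⟩ := h
  exact ⟨t, s', h1, h2.trans hT, hQ _ h3⟩

theorem Ends.frame {p : Prog} {s : State} {T : ℕ} {Q : State → Prop} (h : Ends p s T Q) :
    Ends p s T fun s' => Q s' ∧ Frame p.vars p.arrs s s' := by
  obtain ⟨t, s', h1, h2, h3⟩ := h
  exact ⟨t, s', h1, h2, h3, h1.frame⟩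

theorem Ends.seq {p q : Prog} {s : State} {T₁ T₂ : ℕ} {Q : State → Prop}
    (h : Ends p s T₁ fun s' => Ends q s' T₂ Q) : Ends (.seq p q) s (T₁ + T₂) Q := by
  obtain ⟨t, s', h1, h2, t', s'', h3, h4, h5⟩ := h
  exact ⟨_, _, .seq h1 h3, by omega, h5⟩

theorem Ends.cond {e : Expr} {p q : Prog} {s : State} {T : ℕ} {Q : State → Prop}
    (h1 : e.eval s ≠ 0 → Ends p s T Q) (h2 : e.eval s = 0 → Ends q s T Q) :
    Ends (.cond e p q) s (e.cost + 1 + T) Q := by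
  by_cases h : e.eval s = 0
  · obtain ⟨t, s', h3, h4, h5⟩ := h2 h
    exact ⟨_, _, .cond_false h h3, by omega, h5⟩
  · obtain ⟨t, s', h3, h4, h5⟩ := h1 h
    exact ⟨_, _, .cond_true h h3, by omega, h5⟩

/-- A loop with an invariant and a potential that pays for the time. -/
theorem Ends.loop {e : Expr} {p : Prog} {s : State} (I : State → Prop) (Φ : State → ℕ) (h0 : I s)
    (hstep : ∀ s, I s → e.eval s ≠ 0 → ∃ T, Ends p s T fun s' => I s' ∧ Φ s' + T + e.cost + 1 ≤ Φ s) :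
    Ends (.loop e p) s (Φ s + e.cost + 1) fun s' => I s' ∧ e.eval s' = 0 := by
  induction hΦ : Φ s using Nat.strong_induction_on generalizing s with
  | _ k ih =>
    by_cases hc : e.eval s = 0
    · exact ⟨_, _, .loop_done hc, by omega, h0, hc⟩
    · obtain ⟨T, t, s₁, h1, h2, h3, h4⟩ := hstep s h0 hc
      obtain ⟨t', s₂, h5, h6, h7⟩ := ih (Φ s₁) (by omega) h3 rfl
      exact ⟨_, _, .loop_step hc h1 h5, by omega, h7⟩

/-- `for i from its present value while i < N do p`, with variables `i` and `N`. -/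
def Prog.upTo (i N : ℕ) (p : Prog) : Prog :=
  .loop (.minus (.var N) (.var i)) (.seq p (.assign i (.plus (.var i) (.const 1))))

/-- The potential is `(T + 8) * (hi - i)`: besides the body, a round pays 4 for the test and 4 for
the increment, and the last test accounts for the final 4. The body must not write the counter or
the limit. The invariant is requested after the increment, which explains the `setVar` in `hbody`.
-/
theorem Ends.upTo {i N : ℕ} {p : Prog} {s : State} {T lo hi : ℕ} (Inv : ℕ → State → Prop)
    (hi_notMem : i ∉ p.vars) (hN : N ∉ p.vars) (hiN : N ≠ i) (hlo : s.var i = lo)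
    (hhi : s.var N = hi) (hle : lo ≤ hi) (h0 : Inv lo s)
    (hbody : ∀ j s', lo ≤ j → j < hi → s'.var i = j → Frame (i :: p.vars) p.arrs s s' → Inv j s' →
      Ends p s' T fun s'' => Inv (j + 1) (s''.setVar i (j + 1))) :
    Ends (.upTo i N p) s ((T + 8) * (hi - lo) + 4) fun s' => Inv hi s' ∧ s'.var i = hi ∧
      Frame (i :: p.vars) p.arrs s s' := by
  have h := Ends.loop (e := .minus (.var N) (.var i))
    (p := .seq p (.assign i (.plus (.var i) (.const 1)))) (s := s)
    (fun s' => lo ≤ s'.var i ∧ s'.var i ≤ hi ∧ Frame (i :: p.vars) p.arrs s s' ∧ Inv (s'.var i) s')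
    (fun s' => (T + 8) * (hi - s'.var i)) ⟨hlo.ge, by omega, Frame.refl _ _ _, by rw [hlo]; exact h0⟩
    (by
      rintro s' ⟨h1, h2, h3, h4⟩ hc
      have hN' : s'.var N = hi := by
        rw [h3.1 N (by simp [hN, hiN]), hhi]
      simp only [Expr.eval, hN'] at hc
      have hlt : s'.var i < hi := by omega
      refine ⟨T + 4, ?_⟩
      apply Ends.seq
      refine (hbody (s'.var i) s' h1 hlt rfl h3 h4).frame.mono le_rfl fun s'' hs'' => ?_
      have hi'' : s''.var i = s'.var i := hs''.2.1 i hi_notMem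
      refine ⟨_, _, .assign _ _ _, le_rfl, ?_⟩
      simp only [Expr.eval, hi'']
      have hvar : (s''.setVar i (s'.var i + 1)).var i = s'.var i + 1 := by simp [State.setVar]
      rw [hvar]
      refine ⟨⟨by omega, by omega, ?_, hs''.1⟩, ?_⟩
      · refine h3.trans ⟨fun x hx => ?_, fun X hX => ?_⟩
        · simp only [List.mem_cons, not_or] at hx
          simp only [State.setVar, Function.update_of_ne hx.1]
          exact hs''.2.1 x hx.2
        · exact hs''.2.2 X hX
      · simp only [Expr.cost]
        have : hi - s'.var i = (hi - (s'.var i + 1)) + 1 := by omega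
        rw [this, Nat.mul_add]
        omega)
  refine h.mono ?_ fun s' hs' => ?_
  · simp only [Expr.cost, hlo]; omega
  · obtain ⟨⟨h1, h2, h3, h4⟩, h5⟩ := hs'
    have hN' : s'.var N = hi := by rw [h3.1 N (by simp [hN, hiN]), hhi]
    simp only [Expr.eval, hN'] at h5
    have : s'.var i = hi := by omega
    exact ⟨this ▸ h4, this, h3⟩

/-! ### Programs without loops -/

/-- The program has no loops. -/
def Prog.flat : Prog → Bool
  | .skip => true
  | .assign _ _ => true
  | .store _ _ _ => true
  | .seq p q => p.flat && q.flat
  | .cond _ p q => p.flat && q.flat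
  | .loop _ _ => false

/-- The effect of a program without loops. -/
def Prog.run : Prog → State → State
  | .skip, s => s
  | .assign x e, s => s.setVar x (e.eval s)
  | .store A i e, s => s.setCell A (i.eval s) (e.eval s)
  | .seq p q, s => q.run (p.run s)
  | .cond e p q, s => if e.eval s ≠ 0 then p.run s else q.run s
  | .loop _ _, s => s

/-- A time bound for a program without loops. -/
def Prog.cost : Prog → ℕ
  | .skip => 1
  | .assign _ e => e.cost + 1
  | .store _ i e => i.cost + e.cost + 1
  | .seq p q => p.cost + q.cost
  | .cond e p q => e.cost + 1 + (p.cost + q.cost)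
  | .loop _ _ => 0

theorem Prog.exists_run {p : Prog} (h : p.flat = true) (s : State) :
    ∃ t, Run p s t (p.run s) ∧ t ≤ p.cost := by
  induction p generalizing s with
  | skip => exact ⟨_, .skip s, le_rfl⟩
  | assign x e => exact ⟨_, .assign x e s, le_rfl⟩
  | store A i e => exact ⟨_, .store A i e s, le_rfl⟩
  | seq p q ihp ihq =>
    simp only [Prog.flat, Bool.and_eq_true] at h
    obtain ⟨t, h1, h2⟩ := ihp h.1 s
    obtain ⟨t', h3, h4⟩ := ihq h.2 (p.run s)
    exact ⟨_, .seq h1 h3, by simp only [Prog.cost]; omega⟩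
  | cond e p q ihp ihq =>
    simp only [Prog.flat, Bool.and_eq_true] at h
    by_cases hc : e.eval s = 0
    · obtain ⟨t, h1, h2⟩ := ihq h.2 s
      refine ⟨e.cost + 1 + t, ?_, ?_⟩
      · simp only [Prog.run, hc, ne_eq, not_true_eq_false, if_false]
        exact .cond_false hc h1
      · simp only [Prog.cost]; omega
    · obtain ⟨t, h1, h2⟩ := ihp h.1 s
      refine ⟨e.cost + 1 + t, ?_, ?_⟩
      · simp only [Prog.run, hc, ne_eq, not_false_eq_true, if_true]
        exact .cond_true hc h1
      · simp only [Prog.cost]; omega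
  | loop e p => simp [Prog.flat] at h

/-- Without loops the final state is a function of the initial one, so a specification is proved by
simplifying `Prog.run`, and the time bound is a closed inequality that can be decided. -/
theorem Ends.flat {p : Prog} {s : State} {T : ℕ} {Q : State → Prop} (h : p.flat = true)
    (hT : p.cost ≤ T) (hQ : Q (p.run s)) : Ends p s T Q := by
  obtain ⟨t, h1, h2⟩ := p.exists_run h s
  exact ⟨t, _, h1, h2.trans hT, hQ⟩

@[simp]
theorem State.setVar_var (s : State) (x c y : ℕ) :
    (s.setVar x c).var y = if y = x then c else s.var y := by
  simp [State.setVar, Function.update_apply]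

@[simp]
theorem State.setVar_arr (s : State) (x c : ℕ) : (s.setVar x c).arr = s.arr := rfl

@[simp]
theorem State.setCell_var (s : State) (A i c : ℕ) : (s.setCell A i c).var = s.var := rfl

@[simp]
theorem State.setCell_arr (s : State) (A i c X : ℕ) :
    (s.setCell A i c).arr X = if X = A then Function.update (s.arr A) i c else s.arr X := by
  simp [State.setCell, Function.update_apply]

end RAM

/-! ### The program -/

notation "vN" => (2 : ℕ)
notation "vM" => (3 : ℕ)
notation "vArcs" => (4 : ℕ)
notation "vLen" => (5 : ℕ)
notation "vCyc" => (6 : ℕ)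
notation "vOut" => (7 : ℕ)
notation "vGo" => (8 : ℕ)
notation "vZ" => (9 : ℕ)
notation "vKey" => (10 : ℕ)
notation "vE0" => (11 : ℕ)
notation "vA0" => (12 : ℕ)
notation "vB" => (13 : ℕ)
notation "vBv" => (14 : ℕ)
notation "vE" => (15 : ℕ)
notation "vA" => (16 : ℕ)
notation "vF1" => (17 : ℕ)
notation "vF2" => (18 : ℕ)
notation "vLim" => (19 : ℕ)
notation "vHead" => (20 : ℕ)
notation "vTail" => (21 : ℕ)
notation "vPos" => (22 : ℕ)
notation "vEnd" => (23 : ℕ)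
notation "vV" => (24 : ℕ)
notation "vW" => (25 : ℕ)
notation "vI" => (26 : ℕ)
notation "vY" => (27 : ℕ)
notation "vD" => (28 : ℕ)
notation "vK" => (29 : ℕ)
notation "vJ" => (30 : ℕ)
notation "vF" => (31 : ℕ)
notation "vFF" => (32 : ℕ)
notation "vFu" => (33 : ℕ)
notation "vFv" => (34 : ℕ)
notation "vCnt" => (35 : ℕ)
notation "vQ" => (36 : ℕ)
notation "vR" => (39 : ℕ)

notation "aOff" => (0 : ℕ)
notation "aNbr" => (1 : ℕ)
notation "aEdg" => (2 : ℕ)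
notation "aOwn" => (18 : ℕ)
notation "aLab" => (20 : ℕ)
notation "aVst" => (21 : ℕ)
notation "aNv" => (22 : ℕ)
notation "aNe" => (23 : ℕ)
notation "aSrc" => (24 : ℕ)
notation "aTgt" => (25 : ℕ)
notation "aArcE" => (26 : ℕ)
notation "aArcW" => (27 : ℕ)
notation "aVis" => (28 : ℕ)
notation "aQueue" => (29 : ℕ)
notation "aPar" => (30 : ℕ)
notation "aPe" => (31 : ℕ)
notation "aMark" => (32 : ℕ)
notation "aF1" => (33 : ℕ)
notation "aF2" => (34 : ℕ)
notation "aStart" => (16 : ℕ)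
notation "aList" => (17 : ℕ)

infixr:60 " ;; " => RAM.Prog.seq

namespace RAM

/-- An expression that is nonzero if and only if `a` and `b` have different values. -/
def Expr.ne (a b : Expr) : Expr := .plus (.minus a b) (.minus b a)

/-- An expression that is nonzero if and only if `a` is zero. -/
def Expr.isZero (a : Expr) : Expr := .minus (.const 1) a

/-- An expression that is nonzero if and only if `a` and `b` have the same value. -/
def Expr.eq (a b : Expr) : Expr := (Expr.ne a b).isZero

@[simp]
theorem Expr.eval_ne_eq_zero (a b : Expr) (s : State) :
    (Expr.ne a b).eval s = 0 ↔ a.eval s = b.eval s := by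
  simp only [Expr.ne, Expr.eval]; omega

@[simp]
theorem Expr.eval_isZero_eq_zero (a : Expr) (s : State) :
    a.isZero.eval s = 0 ↔ a.eval s ≠ 0 := by
  simp only [Expr.isZero, Expr.eval]; omega

@[simp]
theorem Expr.eval_eq_eq_zero (a b : Expr) (s : State) :
    (Expr.eq a b).eval s = 0 ↔ a.eval s ≠ b.eval s := by
  simp [Expr.eq]

/-- Execute `p` if the condition holds. -/
def Prog.when (e : Expr) (p : Prog) : Prog := .cond e p .skip

theorem Ends.when {e : Expr} {p : Prog} {s : State} {T : ℕ} {Q : State → Prop}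
    (h1 : e.eval s ≠ 0 → Ends p s T Q) (h2 : e.eval s = 0 → Q s) :
    Ends (.when e p) s (e.cost + 2 + T) Q :=
  (Ends.cond (T := T + 1) (fun h => (h1 h).mono (by omega) fun _ h => h)
    (fun h => ⟨1, s, .skip s, by omega, h2 h⟩)).mono (by omega) fun _ h => h

/-! ### Breadth-first search. -/

/-- Breadth-first search. The roots are the vertices marked in `aVis`, the arcs are the positions
with a nonzero entry in `aArcE`, and `aArcW` contains their heads. -/
def bfsScan : Prog :=
  .when (.cell aArcE (.var vPos)) <| .when (.isZero (.cell aVis (.cell aArcW (.var vPos)))) <|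
    .assign vW (.cell aArcW (.var vPos)) ;;
    .store aVis (.var vW) (.const 1) ;;
    .store aQueue (.var vTail) (.var vW) ;;
    .assign vTail (.plus (.var vTail) (.const 1)) ;;
    .store aPar (.var vW) (.var vV) ;;
    .store aPe (.var vW) (.minus (.cell aArcE (.var vPos)) (.const 1))

/-- Take the next vertex from the queue and follow its arcs. -/
def bfsStep : Prog :=
  (.assign vV (.cell aQueue (.var vHead)) ;;
    .assign vHead (.plus (.var vHead) (.const 1)) ;;
    .assign vPos (.cell aOff (.var vV)) ;;
    .assign vEnd (.cell aOff (.plus (.var vV) (.const 1)))) ;;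
  .upTo vPos vEnd bfsScan

/-- Put the roots into the queue. -/
def bfsInit : Prog :=
  (.assign vHead (.const 0) ;; .assign vTail (.const 0) ;; .assign vI (.const 0)) ;;
  .upTo vI vN (.when (.cell aVis (.var vI))
    (.store aQueue (.var vTail) (.var vI) ;; .assign vTail (.plus (.var vTail) (.const 1))))

/-- Breadth-first search. -/
def bfs : Prog := bfsInit ;; .loop (.minus (.var vTail) (.var vHead)) bfsStep

/-- The invariant of the search: the first `h` vertices of the queue have been treated, the arcs of
the last one of them up to the position `cur`. -/
structure BfsInv (n : ℕ) (s₀ s : State) (h cur : ℕ) : Prop where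
  var_n : s.var vN = n
  off : s.arr aOff = s₀.arr aOff
  arcE : s.arr aArcE = s₀.arr aArcE
  arcW : s.arr aArcW = s₀.arr aArcW
  head_le : h ≤ s.var vTail
  queue : ∀ i < s.var vTail, s.arr aQueue i < n ∧ s.arr aVis (s.arr aQueue i) ≠ 0
  inj : ∀ i < s.var vTail, ∀ j < s.var vTail, s.arr aQueue i = s.arr aQueue j → i = j
  mem : ∀ v < n, s.arr aVis v ≠ 0 → ∃ i < s.var vTail, s.arr aQueue i = v
  roots : ∀ v < n, s₀.arr aVis v ≠ 0 → s.arr aVis v ≠ 0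
  tree : ∀ j < s.var vTail, s₀.arr aVis (s.arr aQueue j) ≠ 0 ∨
    ∃ i < j, s.arr aPar (s.arr aQueue j) = s.arr aQueue i ∧
      ∃ p, s.arr aOff (s.arr aQueue i) ≤ p ∧ p < s.arr aOff (s.arr aQueue i + 1) ∧
        s.arr aArcE p ≠ 0 ∧ s.arr aArcW p = s.arr aQueue j ∧
        s.arr aPe (s.arr aQueue j) = s.arr aArcE p - 1
  done : ∀ i < h, ∀ p, s.arr aOff (s.arr aQueue i) ≤ p → p < s.arr aOff (s.arr aQueue i + 1) →
    (i + 1 = h → p < cur) → s.arr aArcE p ≠ 0 → s.arr aVis (s.arr aArcW p) ≠ 0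

/-- The result of the search. -/
structure SearchResult (n : ℕ) (s s' : State) : Prop where
  roots : ∀ v < n, s.arr aVis v ≠ 0 → s'.arr aVis v ≠ 0
  tree : ∃ rank : ℕ → ℕ, ∀ v < n, s'.arr aVis v ≠ 0 → s.arr aVis v ≠ 0 ∨
    s'.arr aPar v < n ∧ s'.arr aVis (s'.arr aPar v) ≠ 0 ∧ rank (s'.arr aPar v) < rank v ∧
      ∃ p, s.arr aOff (s'.arr aPar v) ≤ p ∧ p < s.arr aOff (s'.arr aPar v + 1) ∧
        s.arr aArcE p ≠ 0 ∧ s.arr aArcW p = v ∧ s'.arr aPe v = s.arr aArcE p - 1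
  closed : ∀ v < n, s'.arr aVis v ≠ 0 → ∀ p, s.arr aOff v ≤ p → p < s.arr aOff (v + 1) →
    s.arr aArcE p ≠ 0 → s'.arr aVis (s.arr aArcW p) ≠ 0

/-- Either the position holds no arc, or an arc to a vertex already reached, and then nothing
changes; or the head of the arc is appended to the queue. Its parent is the vertex at the queue
position `h - 1`, which precedes it. -/
theorem bfsScan_spec {n : ℕ} {s₀ s : State} {h j v : ℕ} (hinv : BfsInv n s₀ s h j)
    (hj : s.var vPos = j) (hv : s.var vV = v) (hh : 0 < h) (hvq : s.arr aQueue (h - 1) = v)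
    (hlo : s.arr aOff v ≤ j) (hhi : j < s.arr aOff (v + 1))
    (hW : s.arr aArcE j ≠ 0 → s.arr aArcW j < n) :
    Ends bfsScan s bfsScan.cost fun s' => BfsInv n s₀ (s'.setVar vPos (j + 1)) h (j + 1) ∧
      s'.arr aQueue (h - 1) = v ∧ (∀ i < h, s'.arr aQueue i = s.arr aQueue i) := by
  apply Ends.flat rfl le_rfl
  by_cases h1 : s.arr aArcE j = 0 ∨ s.arr aVis (s.arr aArcW j) ≠ 0
  · have hrun : bfsScan.run s = s := by
      rcases h1 with h1 | h1 <;>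
        simp [bfsScan, Prog.when, Prog.run, Expr.eval, hj, h1]
    rw [hrun]
    refine ⟨⟨hinv.var_n, hinv.off, hinv.arcE, hinv.arcW, hinv.head_le, hinv.queue, hinv.inj,
      hinv.mem, hinv.roots, hinv.tree, ?_⟩, hvq, fun _ _ => rfl⟩
    intro i hi p hp1 hp2 hp3 hp4
    by_cases hpj : i + 1 = h ∧ p = j
    · obtain ⟨-, rfl⟩ := hpj
      exact h1.resolve_left hp4
    · refine hinv.done i hi p hp1 hp2 (fun hih => ?_) hp4
      have := hp3 hih
      have : p ≠ j := fun h => hpj ⟨hih, h⟩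
      omega
  · push Not at h1
    obtain ⟨h1, h2⟩ := h1
    have hw := hW h1
    set w := s.arr aArcW j with hw'
    -- Every vertex in the queue has been marked, so the unmarked `w` is new, and the queue remains
    -- free of repetitions.
    have hwq : ∀ i < s.var vTail, s.arr aQueue i ≠ w := by
      intro i hi hiw
      exact (hinv.queue i hi).2 (hiw ▸ h2)
    have hrun : bfsScan.run s = ((((((s.setVar vW w).setCell aVis w 1).setCell aQueue (s.var vTail) w).setVar
        vTail (s.var vTail + 1)).setCell aPar w v).setCell aPe w (s.arr aArcE j - 1)) := by
      simp [bfsScan, Prog.when, Prog.run, Expr.eval, hj, h1, ← hw', h2, State.setVar, State.setCell, hv]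
    rw [hrun]
    have hT : ∀ i < h, i ≠ s.var vTail := fun i hi => by have := hinv.head_le; omega
    have hvlt : v < n := by
      rw [← hvq]
      exact (hinv.queue (h - 1) (by have := hinv.head_le; omega)).1
    refine ⟨⟨?_, ?_, ?_, ?_, ?_, ?_, ?_, ?_, ?_, ?_, ?_⟩, ?_, ?_⟩
    · simpa [State.setVar, State.setCell] using hinv.var_n
    · simpa [State.setVar, State.setCell] using hinv.off
    · simpa [State.setVar, State.setCell] using hinv.arcE
    · simpa [State.setVar, State.setCell] using hinv.arcW
    · have := hinv.head_le
      simp [State.setVar, State.setCell]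
      omega
    · intro i hi
      simp [State.setVar, State.setCell, Function.update_apply] at hi ⊢
      by_cases h3 : i = s.var vTail
      · simpa [h3] using hw
      · obtain ⟨h4, h5⟩ := hinv.queue i (by omega)
        simp only [h3, if_false, h4, true_and]
        split_ifs <;> simp [h5]
    · intro i hi i' hi' hii
      simp [State.setVar, State.setCell, Function.update_apply] at hi hi' hii ⊢
      split_ifs at hii with h3 h4 h4
      · omega
      · exact absurd hii.symm (hwq i' (by omega))
      · exact absurd hii (hwq i (by omega))
      · exact hinv.inj i (by omega) i' (by omega) hii
    · intro u hu hu1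
      simp [State.setVar, State.setCell, Function.update_apply] at hu1 ⊢
      by_cases huw : u = w
      · exact ⟨s.var vTail, by omega, by simp [huw]⟩
      · obtain ⟨i, hi, hiu⟩ := hinv.mem u hu (by simpa [huw] using hu1)
        exact ⟨i, by omega, by rw [if_neg (by omega)]; exact hiu⟩
    · intro u hu hu1
      have := hinv.roots u hu hu1
      simp [State.setVar, State.setCell, Function.update_apply]
      split_ifs <;> simp [this]
    · intro i hi
      simp [State.setVar, State.setCell, Function.update_apply] at hi ⊢
      by_cases h3 : i = s.var vTail
      · right
        refine ⟨h - 1, by have := hinv.head_le; omega, ?_, j, ?_⟩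
        · simp [h3, hT (h - 1) (by omega), hvq]
        · rw [if_neg (hT (h - 1) (by omega)), hvq]
          simp [h3, hlo, hhi, h1, ← hw']
      · have hi' : i < s.var vTail := by omega
        have hiw := hwq i hi'
        rcases hinv.tree i hi' with h4 | ⟨i', h4, h5, p, h6, h7, h8⟩
        · left; simpa [h3] using h4
        · right
          refine ⟨i', h4, ?_, p, ?_⟩
          · simp [h3, hiw, h5, show i' ≠ s.var vTail by omega]
          · simp [h3, hiw, show i' ≠ s.var vTail by omega]
            exact ⟨h6, h7, h8⟩
    · intro i hi p hp1 hp2 hp3 hp4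
      have hi' := hT i hi
      simp [State.setVar, State.setCell, Function.update_apply, hi'] at hp1 hp2 hp4 ⊢
      by_cases hpw : s.arr aArcW p = w
      · simp [hpw]
      · rw [if_neg hpw]
        refine hinv.done i hi p hp1 hp2 (fun hih => ?_) hp4
        have := hp3 hih
        have : p ≠ j := by rintro rfl; exact hpw rfl
        omega
    · simp [State.setVar, State.setCell, hT (h - 1) (by omega), hvq]
    · intro i hi
      simp [State.setVar, State.setCell, hT i hi]

end RAM

namespace RAM

/-- Between two steps the scan position of the invariant is `aOff n`. This lies beyond every arc, so
that `done` then speaks of complete adjacency lists. -/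
theorem bfsStep_spec {n : ℕ} {s₀ s : State} {h : ℕ} (hinv : BfsInv n s₀ s h (s₀.arr aOff n))
    (hmono : ∀ v < n, s₀.arr aOff v ≤ s₀.arr aOff (v + 1))
    (hW : ∀ v < n, ∀ p, s₀.arr aOff v ≤ p → p < s₀.arr aOff (v + 1) → s₀.arr aArcE p ≠ 0 →
      s₀.arr aArcW p < n)
    (hs : s.var vHead = h) (hT : h < s.var vTail) :
    Ends bfsStep s (30 + (bfsScan.cost + 8) * (s₀.arr aOff (s.arr aQueue h + 1) -
      s₀.arr aOff (s.arr aQueue h))) fun s' => BfsInv n s₀ s' (h + 1) (s₀.arr aOff n) ∧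
        s'.var vHead = h + 1 ∧ ∀ i < h + 1, s'.arr aQueue i = s.arr aQueue i := by
  have hmono' : ∀ v w, v ≤ w → w ≤ n → s₀.arr aOff v ≤ s₀.arr aOff w := by
    intro v w hvw
    induction w, hvw using Nat.le_induction with
    | base => exact fun _ => le_rfl
    | succ w _ ih => exact fun hw => (ih (by omega)).trans (hmono w (by omega))
  obtain ⟨hvn, hvv⟩ := hinv.queue h hT
  set v := s.arr aQueue h with hv
  refine Ends.mono (Ends.seq (Ends.flat (by rfl) (by decide) ?_)) (T := 16 + ((bfsScan.cost + 8) * (s₀.arr aOff (v + 1) -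
    s₀.arr aOff v) + 4)) ?_ fun _ h => h
  · set s₁ := Prog.run _ s with hs₁
    have hrun : s₁ = ((((s.setVar vV v).setVar vHead (h + 1)).setVar vPos (s₀.arr aOff v)).setVar vEnd
        (s₀.arr aOff (v + 1))) := by
      rw [hs₁]
      simp [Prog.run, Expr.eval, State.setVar, hs, hinv.off, ← hv]
    have hloop := Ends.upTo (i := vPos) (N := vEnd) (p := bfsScan) (s := s₁) (T := bfsScan.cost)
      (lo := s₀.arr aOff v) (hi := s₀.arr aOff (v + 1))
      (fun j s' => BfsInv n s₀ s' (h + 1) j ∧ ∀ i < h + 1, s'.arr aQueue i = s.arr aQueue i)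
      (by decide) (by decide) (by decide) (by rw [hrun]; simp [State.setVar])
      (by rw [hrun]; simp [State.setVar]) (hmono v hvn)
      (by
        rw [hrun]
        refine ⟨⟨?_, hinv.off, hinv.arcE, hinv.arcW, ?_, ?_, ?_, ?_, hinv.roots, ?_, ?_⟩, fun _ _ => rfl⟩
        · simpa [State.setVar] using hinv.var_n
        · simpa [State.setVar] using hT
        · simpa [State.setVar] using hinv.queue
        · simpa [State.setVar] using hinv.inj
        · simpa [State.setVar] using hinv.mem
        · simpa [State.setVar] using hinv.tree
        · intro i hi p hp1 hp2 hp3 hp4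
          simp only [State.setVar] at hp1 hp2 hp3 hp4 ⊢
          rw [hinv.off] at hp1 hp2
          rcases Nat.lt_or_ge i h with hih | hih
          · refine hinv.done i hih p (by rwa [hinv.off]) (by rwa [hinv.off]) (fun _ => ?_) hp4
            exact hp2.trans_le (hmono' _ _ (hinv.queue i (by omega)).1 le_rfl)
          · have : i = h := by omega
            subst this
            have := hp3 rfl
            rw [← hv] at hp1
            omega)
      (by
        rintro j s' h1 h2 h3 hfr ⟨h4, h5⟩
        have hv' : s'.var vV = v := by
          rw [hfr.1 vV (by decide), hrun]; simp [State.setVar]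
        refine (bfsScan_spec h4 h3 hv' (by omega) (by simpa using h5 h (by omega))
          (by rw [h4.off]; exact h1) (by rw [h4.off]; exact h2) ?_).mono le_rfl ?_
        · rw [h4.arcE, h4.arcW]
          exact hW v hvn j h1 h2
        · rintro s'' ⟨h6, h7, h8⟩
          exact ⟨h6, fun i hi => (h8 i hi).trans (h5 i hi)⟩)
    refine hloop.mono le_rfl ?_
    rintro s' ⟨⟨h1, h2⟩, h3, h4⟩
    refine ⟨⟨h1.var_n, h1.off, h1.arcE, h1.arcW, h1.head_le, h1.queue, h1.inj, h1.mem, h1.roots,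
      h1.tree, ?_⟩, ?_, h2⟩
    · intro i hi p hp1 hp2 hp3 hp4
      refine h1.done i hi p hp1 hp2 (fun hih => ?_) hp4
      have : i = h := by omega
      subst this
      rw [h1.off, h2 i hi] at hp2
      exact hp2
    · rw [h4.1 vHead (by decide), hrun]; simp [State.setVar]
  · omega

theorem bfsInit_spec {n : ℕ} {s : State} (hn : s.var vN = n) :
    Ends bfsInit s (40 * n + 10) fun s' => BfsInv n s s' 0 (s.arr aOff n) ∧ s'.var vHead = 0 := by
  refine Ends.mono (Ends.seq (Ends.flat (by rfl) (by decide) ?_)) (T := 6 + (20 * (n - 0) + 4)) ?_ fun _ h => h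
  · set s₁ := Prog.run _ s with hs₁
    have hrun : s₁ = (((s.setVar vHead 0).setVar vTail 0).setVar vI 0) := by
      rw [hs₁]
      simp [Prog.run, Expr.eval, State.setVar]
    refine (Ends.upTo (i := vI) (N := vN) (s := s₁) (T := 12) (lo := 0) (hi := n)
      (fun j s' =>
        (∀ i < s'.var vTail, s'.arr aQueue i < j ∧ s'.arr aVis (s'.arr aQueue i) ≠ 0) ∧
        (∀ i < s'.var vTail, ∀ j < s'.var vTail, s'.arr aQueue i = s'.arr aQueue j → i = j) ∧
        (∀ v < j, s'.arr aVis v ≠ 0 → ∃ i < s'.var vTail, s'.arr aQueue i = v))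
      (by decide) (by decide) (by decide) (by rw [hrun]; simp [State.setVar])
      (by rw [hrun]; simpa [State.setVar] using hn) (Nat.zero_le _) (by rw [hrun]; simp [State.setVar])
      ?_).mono le_rfl ?_
    · rintro j s' - hjn hj hfr ⟨h1, h2, h3⟩
      refine (Ends.when (T := 8) (fun hc => Ends.flat (by rfl) (by decide) ?_) (fun hc => ?_))
      · simp only [Expr.eval, hj] at hc
        simp only [Prog.run, Expr.eval, hj, State.setVar_var, State.setVar_arr, State.setCell_var,
          State.setCell_arr, Nat.reduceEqDiff, reduceIte]
        refine ⟨fun i hi => ?_, fun i hi i' hi' hii => ?_, fun v hv hv' => ?_⟩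
        · simp only [Function.update_apply]
          split_ifs with h4
          · exact ⟨by omega, hc⟩
          · have := h1 i (by omega)
            exact ⟨by omega, this.2⟩
        · simp only [Function.update_apply] at hii
          split_ifs at hii with h4 h5 h5
          · omega
          · have := h1 i' (by omega); omega
          · have := h1 i (by omega); omega
          · exact h2 i (by omega) i' (by omega) hii
        · by_cases hvj : v = j
          · exact ⟨s'.var vTail, by omega, by simp [hvj]⟩
          · obtain ⟨i, hi, hiv⟩ := h3 v (by omega) hv'
            exact ⟨i, by omega, by rw [Function.update_of_ne (by omega)]; exact hiv⟩
      · simp only [Expr.eval, hj] at hc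
        simp only [State.setVar_var, State.setVar_arr, Nat.reduceEqDiff, reduceIte]
        refine ⟨fun i hi => ?_, h2, fun v hv hv' => ?_⟩
        · have := h1 i hi
          exact ⟨by omega, this.2⟩
        · have : v ≠ j := by rintro rfl; exact hv' hc
          exact h3 v (by omega) hv'
    · rintro s' ⟨⟨h1, h2, h3⟩, h4, hfr⟩
      have harr : ∀ X, X ≠ aQueue → s'.arr X = s.arr X := by
        intro X hX
        rw [hfr.2 X (by simpa [Prog.when, Prog.arrs] using hX), hrun]
        rfl
      refine ⟨⟨?_, harr _ (by decide), harr _ (by decide), harr _ (by decide), Nat.zero_le _, h1, h2,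
        h3, ?_, ?_, ?_⟩, ?_⟩
      · rw [hfr.1 vN (by decide), hrun]; simpa [State.setVar] using hn
      · intro v _ hv; rwa [harr aVis (by decide)]
      · intro i hi
        left
        rw [← harr aVis (by decide)]
        exact (h1 i hi).2
      · intro i hi; omega
      · rw [hfr.1 vHead (by decide), hrun]; simp [State.setVar]
  · omega

/-- The rank of a vertex is its position in the queue, where parents precede their children. -/
theorem BfsInv.searchResult {n : ℕ} {s₀ s : State} {h : ℕ} (hinv : BfsInv n s₀ s h (s₀.arr aOff n))
    (hmono : ∀ v ≤ n, s₀.arr aOff v ≤ s₀.arr aOff n) (hh : s.var vTail ≤ h) :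
    SearchResult n s₀ s := by
  classical
  let rank : ℕ → ℕ := fun v => if h : ∃ i < s.var vTail, s.arr aQueue i = v then h.choose else 0
  have hrank : ∀ i < s.var vTail, rank (s.arr aQueue i) = i := by
    intro i hi
    have hex : ∃ i' < s.var vTail, s.arr aQueue i' = s.arr aQueue i := ⟨i, hi, rfl⟩
    simp only [rank, dif_pos hex]
    exact hinv.inj _ hex.choose_spec.1 _ hi hex.choose_spec.2
  refine ⟨hinv.roots, ⟨rank, fun v hv hv' => ?_⟩, fun v hv hv' p hp1 hp2 hp3 => ?_⟩
  · obtain ⟨j, hj, rfl⟩ := hinv.mem v hv hv'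
    refine (hinv.tree j hj).imp id ?_
    rintro ⟨i, hij, h1, p, h2, h3, h4, h5, h6⟩
    have hi : i < s.var vTail := hij.trans hj
    rw [h1, hrank i hi, hrank j hj, ← hinv.off, ← hinv.arcE, ← hinv.arcW]
    exact ⟨(hinv.queue i hi).1, (hinv.queue i hi).2, hij, p, h2, h3, h4, h5, h6⟩
  · obtain ⟨i, hi, rfl⟩ := hinv.mem v hv hv'
    rw [← hinv.off] at hp1 hp2
    rw [← hinv.arcE] at hp3
    rw [← hinv.arcW]
    refine hinv.done i (by omega) p hp1 hp2 (fun _ => ?_) hp3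
    rw [hinv.off] at hp2
    exact hp2.trans_le (hmono _ hv)

/-- Specification and running time of breadth-first search. -/
theorem bfs_spec : ∃ C : ℕ, ∀ (n : ℕ) (s : State), s.var vN = n →
    (∀ v < n, s.arr aOff v ≤ s.arr aOff (v + 1)) →
    (∀ v < n, ∀ p, s.arr aOff v ≤ p → p < s.arr aOff (v + 1) → s.arr aArcE p ≠ 0 →
      s.arr aArcW p < n) →
    Ends bfs s (C * (n + s.arr aOff n + 1)) (SearchResult n s) := by
  refine ⟨bfsScan.cost + 100, fun n s₀ hn hmono hW => ?_⟩
  set c := bfsScan.cost with hc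
  have hmono' : ∀ v ≤ n, s₀.arr aOff v ≤ s₀.arr aOff n := by
    intro v hv
    induction hv using Nat.decreasingInduction with
    | self => exact le_rfl
    | of_succ v hv ih => exact (hmono v hv).trans ih
  -- The potential is a sum over the set `A s` of the vertices that have not yet left the queue. A
  -- vertex `v` pays `g v`, one more than the number of its arcs.
  let A : State → Finset ℕ := fun s => Finset.range n \ (Finset.range (s.var vHead)).image (s.arr aQueue)
  let g : ℕ → ℕ := fun v => s₀.arr aOff (v + 1) - s₀.arr aOff v + 1
  -- The offsets telescope, so the initial potential is linear in the number of vertices and arcs.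
  have htotal : ∀ k ≤ n, ∑ v ∈ Finset.range k, g v + s₀.arr aOff 0 = s₀.arr aOff k + k := by
    intro k hk
    induction k with
    | zero => simp
    | succ k ih =>
      rw [Finset.sum_range_succ]
      have := hmono k (by omega)
      have := ih (by omega)
      simp only [g] at this ⊢
      omega
  refine Ends.mono (Ends.seq ((bfsInit_spec hn).mono le_rfl fun s₁ h₁ => ?_))
    (T := 40 * n + 10 + ((c + 60) * (n + s₀.arr aOff n) + 4)) ?_ fun _ h => h
  · obtain ⟨h₁, hh₁⟩ := h₁
    refine (Ends.loop (e := .minus (.var vTail) (.var vHead)) (p := bfsStep) (s := s₁)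
      (fun s => BfsInv n s₀ s (s.var vHead) (s₀.arr aOff n))
      (fun s => (c + 60) * ∑ v ∈ A s, g v) (by rwa [hh₁]) ?_).mono ?_ ?_
    · intro s hinv hcond
      simp only [Expr.eval] at hcond
      have hT : s.var vHead < s.var vTail := by omega
      obtain ⟨hvn, -⟩ := hinv.queue _ hT
      refine ⟨_, (bfsStep_spec hinv hmono hW rfl hT).mono le_rfl ?_⟩
      rintro s' ⟨h1, h2, h3⟩
      rw [h2]
      refine ⟨h1, ?_⟩
      set v := s.arr aQueue (s.var vHead) with hv
      have hA : A s = insert v (A s') := by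
        ext u
        simp only [A, h2, Finset.mem_insert, Finset.mem_sdiff, Finset.mem_range, Finset.mem_image,
          not_exists, not_and]
        constructor
        · rintro ⟨h4, h5⟩
          by_cases huv : u = v
          · exact .inl huv
          · refine .inr ⟨h4, fun i hi => ?_⟩
            rw [h3 i hi]
            rcases Nat.lt_or_ge i (s.var vHead) with h6 | h6
            · exact h5 i h6
            · have : i = s.var vHead := by omega
              rw [this]
              exact fun h => huv h.symm
        · rintro (rfl | ⟨h4, h5⟩)
          · refine ⟨hvn, fun i hi hiv => ?_⟩
            have := hinv.inj i (hi.trans hT) _ hT hiv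
            omega
          · exact ⟨h4, fun i hi => h3 i (by omega) ▸ h5 i (by omega)⟩
      have hvA : v ∉ A s' := by
        simp only [A, h2, Finset.mem_sdiff, Finset.mem_image, Finset.mem_range, not_and, not_not]
        exact fun _ => ⟨s.var vHead, by omega, h3 _ (by omega)⟩
      rw [hA, Finset.sum_insert hvA, Nat.mul_add]
      simp only [g, Expr.cost]
      nlinarith [Nat.zero_le (s₀.arr aOff (v + 1) - s₀.arr aOff v)]
    · simp only [Expr.cost]
      have h4 : A s₁ = Finset.range n := by simp [A, hh₁]
      have h5 := htotal n le_rfl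
      rw [h4]
      have : ∑ v ∈ Finset.range n, g v ≤ n + s₀.arr aOff n := by omega
      have := Nat.mul_le_mul_left (c + 60) this
      omega
    · rintro s' ⟨h4, h5⟩
      simp only [Expr.eval] at h5
      exact h4.searchResult hmono' (by omega)
  · nlinarith [Nat.zero_le (s₀.arr aOff n), Nat.zero_le n, Nat.zero_le c]

end RAM

/-! ### The adjacency lists in memory. -/

namespace RAM

/-- The memory holds the adjacency lists of `G`, and `aOwn` the vertex to which an arc belongs. -/
structure Static (G : Graph ℕ ℕ) (n m : ℕ) (s : State) : Prop where
  var_n : s.var vN = n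
  var_m : s.var vM = m
  var_arcs : s.var vArcs = s.arr aOff n
  off_mono : ∀ v < n, s.arr aOff v ≤ s.arr aOff (v + 1)
  own : ∀ v < n, ∀ p, s.arr aOff v ≤ p → p < s.arr aOff (v + 1) → s.arr aOwn p = v
  arc : ∀ p < s.arr aOff n, s.arr aOwn p < n ∧ s.arr aOff (s.arr aOwn p) ≤ p ∧
    p < s.arr aOff (s.arr aOwn p + 1) ∧ G.IsLink (s.arr aEdg p) (s.arr aOwn p) (s.arr aNbr p)
  exists_arc : ∀ e v w, G.IsLink e v w → ∃ p < s.arr aOff n, s.arr aOwn p = v ∧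
    s.arr aEdg p = e ∧ s.arr aNbr p = w
  arcs_le : s.arr aOff n ≤ 4 * m
  card_le : n ≤ 4 * m + 1

theorem Static.frame {G : Graph ℕ ℕ} {n m : ℕ} {s s' : State} {V A : List ℕ}
    (h : Static G n m s) (hf : Frame V A s s')
    (hV : vN ∉ V ∧ vM ∉ V ∧ vArcs ∉ V) (hA : aOff ∉ A ∧ aNbr ∉ A ∧ aEdg ∉ A ∧ aOwn ∉ A) :
    Static G n m s' := by
  obtain ⟨h1, h2, h3⟩ := hV
  obtain ⟨h4, h5, h6, h7⟩ := hA
  constructor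
  · rw [hf.1 _ h1]; exact h.var_n
  · rw [hf.1 _ h2]; exact h.var_m
  · rw [hf.1 _ h3, hf.2 _ h4]; exact h.var_arcs
  all_goals try simp only [hf.2 _ h4, hf.2 _ h5, hf.2 _ h6, hf.2 _ h7]
  · exact h.off_mono
  · exact h.own
  · exact h.arc
  · exact h.exists_arc
  · exact h.arcs_le
  · exact h.card_le

theorem Static.off_le {G : Graph ℕ ℕ} {n m : ℕ} {s : State} (h : Static G n m s) {v : ℕ}
    (hv : v ≤ n) : s.arr aOff v ≤ s.arr aOff n := by
  induction hv using Nat.decreasingInduction with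
  | self => exact le_rfl
  | of_succ v hv ih => exact (h.off_mono v hv).trans ih

section Input

open List

variable {G : Graph ℕ ℕ} {n m : ℕ} {adj : ℕ → List (ℕ × ℕ)}

theorem mem_adj (h : IsAdjacencyList G adj) (v w e : ℕ) : (w, e) ∈ adj v ↔ G.IsLink e v w := by
  rw [← List.count_pos_iff, h v w e]
  split_ifs <;> simp_all

theorem length_flatMap_succ (v : ℕ) : ((range (v + 1)).flatMap adj).length =
    ((range v).flatMap adj).length + (adj v).length := by
  simp [List.range_succ]

theorem length_flatMap_mono {v w : ℕ} (h : v ≤ w) : ((range v).flatMap adj).length ≤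
    ((range w).flatMap adj).length := by
  induction w, h using Nat.le_induction with
  | base => exact le_rfl
  | succ w _ ih => rw [length_flatMap_succ]; omega

theorem getD_flatMap {v i : ℕ} (hv : v < n) (hi : i < (adj v).length) :
    ((range n).flatMap adj).getD (((range v).flatMap adj).length + i) (0, 0) =
      (adj v)[i] := by
  induction n with
  | zero => omega
  | succ n ih =>
    rw [List.range_succ, List.flatMap_append]
    rcases Nat.lt_or_ge v n with h | h
    · rw [List.getD_append _ _ _ _, ih h]
      have := length_flatMap_mono (adj := adj) h
      rw [length_flatMap_succ] at this
      omega
    · obtain rfl : v = n := by omega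
      rw [List.getD_append_right _ _ _ _ (by omega)]
      simp [hi]

/-- Count the entries by their edges. An edge occurs only in the lists of its two ends, and at most
twice in each; the crude bound 4 per edge suffices. -/
theorem length_flatMap_le (hE : G.edgeSet = Set.Iio m)
    (hadj : IsAdjacencyList G adj) : ((range n).flatMap adj).length ≤ 4 * m := by
  classical
  set L := ((range n).flatMap adj).map Prod.snd with hL
  have hlen : ((range n).flatMap adj).length = (L : Multiset ℕ).card := by simp [hL]
  rw [hlen, ← Multiset.sum_count_eq_card (s := Finset.range m) (m := (L : Multiset ℕ))]
  · refine (Finset.sum_le_card_nsmul _ _ 4 fun e he => ?_).trans (by simp [mul_comm])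
    rw [Multiset.coe_count, hL]
    have hem : e ∈ G.edgeSet := by rw [hE]; exact Finset.mem_range.1 he
    obtain ⟨x, y, hxy⟩ := G.edge_mem_iff_exists_isLink e |>.1 hem
    have key : ∀ v, ((adj v).map Prod.snd).count e ≤ (if v = x then 2 else 0) + if v = y then 2 else 0 := by
      intro v
      by_cases hv : ∃ w, G.IsLink e v w
      · obtain ⟨w, hw⟩ := hv
        have h1 : ((adj v).map Prod.snd).count e = (adj v).count (w, e) := by
          rw [List.count, List.countP_map, List.count]
          refine List.countP_congr fun p hp => ?_
          obtain ⟨w', e'⟩ := p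
          rw [mem_adj hadj] at hp
          simp only [Function.comp, beq_iff_eq, Prod.mk.injEq]
          constructor
          · rintro rfl; exact ⟨hp.right_unique hw, rfl⟩
          · exact fun h => h.2
        have h2 := hadj v w e
        have h3 : v = x ∨ v = y := by
          rcases hw.eq_and_eq_or_eq_and_eq hxy with h | h
          · exact Or.inl h.1
          · exact Or.inr h.1
        have h4 : (adj v).count (w, e) ≤ 2 := by rw [h2]; split_ifs <;> omega
        rw [h1]
        rcases h3 with h3 | h3 <;> simp only [h3, if_true] at h4 ⊢ <;> omega
      · have : ((adj v).map Prod.snd).count e = 0 := by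
          rw [List.count_eq_zero]
          intro h
          simp only [List.mem_map, Prod.exists, exists_eq_right] at h
          obtain ⟨w, hw⟩ := h
          exact hv ⟨w, (mem_adj hadj v w e).1 hw⟩
        omega
    have hsum : ∀ k, (((range k).flatMap adj).map Prod.snd).count e ≤
        ∑ v ∈ Finset.range k, ((if v = x then 2 else 0) + if v = y then 2 else 0) := by
      intro k
      induction k with
      | zero => simp
      | succ k ih =>
        rw [List.range_succ, List.flatMap_append, List.map_append, List.count_append,
          Finset.sum_range_succ]
        have := key k
        simp only [List.flatMap_cons, List.flatMap_nil, List.append_nil] at this ⊢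
        omega
    refine (hsum n).trans ?_
    rw [Finset.sum_add_distrib, Finset.sum_ite_eq', Finset.sum_ite_eq']
    split_ifs <;> omega
  · intro e he
    rw [Multiset.mem_coe, hL] at he
    simp only [List.mem_map, List.mem_flatMap, Prod.exists, exists_eq_right] at he
    obtain ⟨w, v, -, hw⟩ := he
    have := ((mem_adj hadj v w e).1 hw).edge_mem
    rw [hE] at this
    exact Finset.mem_range.2 this

end Input

/-- Copy the parameters, and compute the owners of the arcs. -/
def setup : Prog :=
  (.assign vN (.var 0) ;; .assign vM (.var 1) ;; .assign vArcs (.cell aOff (.var vN)) ;;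
    .store aVst (.const 0) (.const 1) ;; .assign vV (.const 0)) ;;
  .upTo vV vN ((.assign vPos (.cell aOff (.var vV)) ;;
      .assign vEnd (.cell aOff (.plus (.var vV) (.const 1)))) ;;
    .upTo vPos vEnd (.store aOwn (.var vPos) (.var vV)))

theorem setup_spec {G : Graph ℕ ℕ} {n m : ℕ} {adj : ℕ → List (ℕ × ℕ)}
    (hV : G.vertexSet = Set.Iio n) (hE : G.edgeSet = Set.Iio m) (hG : G.IsEdgeConnected 3)
    (hadj : IsAdjacencyList G adj) :
    Ends setup (inputState n m adj) (100 * (n * m + n + 1)) fun s =>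
      Static G n m s ∧ (∀ x, 4 < x → x ≠ vV → x ≠ vPos → x ≠ vEnd → s.var x = 0) ∧
      (∀ A, 2 < A → A ≠ aOwn → A ≠ aVst → ∀ i, s.arr A i = 0) ∧
      (∀ i, s.arr aVst i = if i = 0 then 1 else 0) := by
  set s₀ := inputState n m adj with hs₀
  have hoff : ∀ v ≤ n, s₀.arr aOff v = ((List.range v).flatMap adj).length := by
    intro v hv; simp [hs₀, inputState, hv]
  have hoffn := hoff n le_rfl
  have hle : s₀.arr aOff n ≤ 4 * m := by rw [hoffn]; exact length_flatMap_le hE hadj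
  have hmono : ∀ v < n, s₀.arr aOff v ≤ s₀.arr aOff (v + 1) := by
    intro v hv
    rw [hoff v hv.le, hoff _ hv]
    exact length_flatMap_mono (Nat.le_succ _)
  have hmono' : ∀ v w, v ≤ w → w ≤ n → s₀.arr aOff v ≤ s₀.arr aOff w := by
    intro v w hvw hw
    rw [hoff v (by omega), hoff w hw]
    exact length_flatMap_mono hvw
  have hbody : Ends setup s₀ (26 + ((4 * m * 12 + 30) * (n - 0) + 4)) fun s =>
      (∀ v < n, ∀ p, s₀.arr aOff v ≤ p → p < s₀.arr aOff (v + 1) → s.arr aOwn p = v) ∧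
      Frame [vV, vPos, vEnd] [aOwn] ((((s₀.setVar vN n).setVar vM m).setVar vArcs
        (s₀.arr aOff n)).setCell aVst 0 1) s := by
    refine Ends.seq (Ends.flat (by rfl) (by decide) ?_)
    set s₁ := Prog.run _ s₀ with hs₁
    have hrun : s₁ = (((((s₀.setVar vN n).setVar vM m).setVar vArcs
        (s₀.arr aOff n)).setCell aVst 0 1).setVar vV 0) := by
      rw [hs₁]
      simp only [Prog.run, Expr.eval, State.setVar_var, State.setVar_arr, Nat.reduceEqDiff, reduceIte]
      simp [hs₀, inputState]
    refine (Ends.upTo (i := vV) (N := vN) (lo := 0) (hi := n) (T := 4 * m * 12 + 22)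
      (fun j s => ∀ v < j, ∀ p, s₀.arr aOff v ≤ p → p < s₀.arr aOff (v + 1) → s.arr aOwn p = v)
      (by decide) (by decide) (by decide) (by rw [hrun]; simp) (by rw [hrun]; simp) (Nat.zero_le _)
      (by intro v hv; omega) ?_).mono le_rfl ?_
    · intro j s _ hjn hj hfr hinv
      have hoff' : s.arr aOff = s₀.arr aOff := by
        rw [hfr.2 aOff (by decide), hrun]; simp
      refine Ends.mono (T := 10 + (12 * (s₀.arr aOff (j + 1) - s₀.arr aOff j) + 4))
        (Ends.seq (Ends.flat (by rfl) (by decide) ?_)) ?_ fun _ h => h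
      · simp only [Prog.run, Expr.eval, State.setVar_var, State.setVar_arr, Nat.reduceEqDiff,
          reduceIte, hj, hoff']
        refine (Ends.upTo (lo := s₀.arr aOff j) (hi := s₀.arr aOff (j + 1)) (T := 4)
          (fun q s' => ∀ v < j + 1, ∀ p, s₀.arr aOff v ≤ p → p < s₀.arr aOff (v + 1) →
            (v = j → p < q) → s'.arr aOwn p = v)
          (by decide) (by decide) (by decide) (by simp) (by simp) (hmono j hjn) ?_ ?_).mono le_rfl ?_
        · intro v hv p h1 h2 h3
          have : v ≠ j := by rintro rfl; have := h3 rfl; omega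
          exact hinv v (by omega) p h1 h2
        · intro q s' h1 h2 h3 hfr' hinv'
          have hj' : s'.var vV = j := by rw [hfr'.1 vV (by decide)]; simp [hj]
          apply Ends.flat (by rfl) (by decide)
          simp only [Prog.run, Expr.eval, State.setVar_arr, State.setCell_arr, h3, hj', reduceIte]
          intro v hv p h4 h5 h6
          simp only [Function.update_apply]
          -- The new entry cannot overwrite the owner of an arc of a vertex `v < j`, because the
          -- lists are stored one after the other.
          split_ifs with hpq
          · subst hpq
            by_contra hne
            have := hmono' (v + 1) j (by omega) (by omega)
            omega
          · exact hinv' v hv p h4 h5 fun h => by have := h6 h; omega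
        · rintro s' ⟨h1, -⟩ v hv p h2 h3
          exact h1 v hv p h2 h3 (by rintro rfl; exact h3)
      · have := hmono' (j + 1) n hjn le_rfl
        omega
    · rintro s ⟨h1, -, h3⟩
      refine ⟨h1, ?_⟩
      constructor
      · intro x hx
        simp only [List.mem_cons, List.not_mem_nil, or_false, not_or] at hx
        rw [h3.1 x (by simp [Prog.vars, Prog.upTo, hx]), hrun]
        simp [hx.1]
      · intro X hX
        rw [h3.2 X (by simpa [Prog.arrs, Prog.upTo] using hX), hrun]
        simp
  refine hbody.mono (by rw [Nat.sub_zero]; nlinarith [Nat.zero_le (n * m)]) ?_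
  rintro s ⟨h1, hfr⟩
  have harr : ∀ A, A ≠ aOwn → A ≠ aVst → s.arr A = s₀.arr A := by
    intro A h2 h3
    rw [hfr.2 A (by simpa using h2)]; simp [h3]
  have hpos : ∀ v < n, ∀ p, s₀.arr aOff v ≤ p → p < s₀.arr aOff (v + 1) →
      G.IsLink (s₀.arr aEdg p) v (s₀.arr aNbr p) := by
    intro v hv p h2 h3
    rw [hoff v hv.le] at h2
    rw [hoff (v + 1) hv, length_flatMap_succ] at h3
    obtain ⟨i, rfl⟩ := Nat.exists_eq_add_of_le h2
    have hi : i < (adj v).length := by omega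
    have := getD_flatMap (n := n) hv hi
    rw [← mem_adj hadj]
    have h4 : (s₀.arr aNbr (((List.range v).flatMap adj).length + i),
        s₀.arr aEdg (((List.range v).flatMap adj).length + i)) = (adj v)[i] := by
      rw [← this]; simp [hs₀, inputState]
    rw [h4]
    exact List.getElem_mem _
  have hexists : ∀ p < s₀.arr aOff n, ∃ v < n, s₀.arr aOff v ≤ p ∧ p < s₀.arr aOff (v + 1) := by
    intro p hp
    -- The owner of `p` precedes the first vertex whose list starts after `p`.
    have hex : ∃ v, p < s₀.arr aOff v := ⟨n, hp⟩
    have h0 : s₀.arr aOff 0 = 0 := by rw [hoff 0 (Nat.zero_le _)]; simp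
    have h2 := Nat.find_spec hex
    have h3 : Nat.find hex ≤ n := Nat.find_min' hex hp
    have h4 : Nat.find hex ≠ 0 := by intro h; rw [h] at h2; omega
    refine ⟨Nat.find hex - 1, by omega, ?_, ?_⟩
    · have := Nat.find_min hex (m := Nat.find hex - 1) (by omega)
      omega
    · rwa [Nat.sub_add_cancel (by omega)]
  have hex : ∀ e v w, G.IsLink e v w → ∃ p < s₀.arr aOff n, s.arr aOwn p = v ∧
      s₀.arr aEdg p = e ∧ s₀.arr aNbr p = w := by
    intro e v w hl
    have hv : v < n := by have := hl.left_mem; rw [hV] at this; exact this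
    obtain ⟨i, hi, hie⟩ := List.getElem_of_mem ((mem_adj hadj v w e).2 hl)
    have h2 := getD_flatMap (n := n) hv hi
    have h3 : s₀.arr aOff v = ((List.range v).flatMap adj).length := hoff v hv.le
    have h4 : s₀.arr aOff (v + 1) = ((List.range v).flatMap adj).length + (adj v).length := by
      rw [hoff (v + 1) hv, length_flatMap_succ]
    have h5 := hmono' (v + 1) n hv le_rfl
    refine ⟨s₀.arr aOff v + i, by omega, h1 v hv _ (by omega) (by omega), ?_⟩
    rw [h3]
    rw [hie] at h2
    constructor
    · exact congrArg Prod.snd h2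
    · exact congrArg Prod.fst h2
  have hvar : ∀ x, x ≠ vV → x ≠ vPos → x ≠ vEnd → s.var x = if x = vArcs then s₀.arr aOff n else
      if x = vM then m else if x = vN then n else s₀.var x := by
    intro x h2 h3 h4
    rw [hfr.1 x (by simp [h2, h3, h4])]; simp
  refine ⟨⟨?_, ?_, ?_, ?_, ?_, ?_, ?_, ?_, ?_⟩, ?_, ?_, ?_⟩
  · rw [hvar _ (by decide) (by decide) (by decide)]; simp
  · rw [hvar _ (by decide) (by decide) (by decide)]; simp
  · rw [hvar _ (by decide) (by decide) (by decide), harr aOff (by decide) (by decide)]; simp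
  · rw [harr aOff (by decide) (by decide)]; exact hmono
  · rw [harr aOff (by decide) (by decide)]; exact h1
  · rw [harr aOff (by decide) (by decide), harr aEdg (by decide) (by decide),
      harr aNbr (by decide) (by decide)]
    intro p hp
    obtain ⟨v, hv, h2, h3⟩ := hexists p hp
    rw [h1 v hv p h2 h3]
    exact ⟨hv, h2, h3, hpos v hv p h2 h3⟩
  · rw [harr aOff (by decide) (by decide), harr aEdg (by decide) (by decide),
      harr aNbr (by decide) (by decide)]
    exact hex
  · rw [harr aOff (by decide) (by decide)]; exact hle
  -- For `n ≥ 2` connectivity provides an arc at every vertex, so `n` is at most the number of arcs,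
  -- which is at most `4 * m`. The summand 1 covers the graph with a single vertex.
  · by_contra hcon
    have h2 : 2 ≤ n := by omega
    have h3 : ∀ v < n, ∃ p < s₀.arr aOff n, s.arr aOwn p = v := by
      intro v hv
      obtain ⟨e, x, y, -, -, hl, hx, -⟩ := hG.exists_crossing (X := {v}) ⟨v, by rw [hV]; exact hv, rfl⟩
        ⟨if v = 0 then 1 else 0, by rw [hV, Set.mem_Iio]; split_ifs <;> omega, by
          simp only [Set.mem_singleton_iff]; split_ifs <;> omega⟩ 0 0
      obtain rfl : x = v := hx
      obtain ⟨p, hp, h4, -⟩ := hex e x y hl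
      exact ⟨p, hp, h4⟩
    have h4 : Finset.range n ⊆ (Finset.range (s₀.arr aOff n)).image (s.arr aOwn) := by
      intro v hv
      obtain ⟨p, hp, h5⟩ := h3 v (Finset.mem_range.1 hv)
      exact Finset.mem_image.2 ⟨p, Finset.mem_range.2 hp, h5⟩
    have h5 := (Finset.card_le_card h4).trans Finset.card_image_le
    simp only [Finset.card_range] at h5
    omega
  · intro x hx h2 h3 h4
    rw [hvar x h2 h3 h4]
    simp [hs₀, inputState, show x ≠ 4 by omega, show x ≠ 3 by omega, show x ≠ 2 by omega,
      show x ≠ 0 by omega, show x ≠ 1 by omega]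
  · intro A h2 h3 h4 i
    rw [harr A h3 h4]
    simp [hs₀, inputState, show A ≠ 0 by omega, show A ≠ 1 by omega, show A ≠ 2 by omega]
  · intro i
    rw [hfr.2 aVst (by decide)]
    simp [Function.update_apply, hs₀, inputState]

end RAM

/-! ### The layout in memory. -/

namespace RAM

/-- A loop that is executed as long as a counter that is not stored is below `l`. -/
theorem Ends.count {e : Expr} {p : Prog} {s : State} {T l i : ℕ} (Inv : ℕ → State → Prop)
    (hi : i ≤ l) (h0 : Inv i s) (hc : ∀ j s, j < l → Inv j s → e.eval s ≠ 0)
    (hl : ∀ s, Inv l s → e.eval s = 0) (hb : ∀ j s, j < l → Inv j s → Ends p s T (Inv (j + 1))) :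
    Ends (.loop e p) s ((T + e.cost + 1) * (l - i) + (e.cost + 1)) (Inv l) := by
  induction hk : l - i generalizing i s with
  | zero =>
    obtain rfl : i = l := by omega
    exact ⟨_, _, .loop_done (hl s h0), by omega, h0⟩
  | succ k ih =>
    obtain ⟨t, s₁, h1, h2, h3⟩ := hb i s (by omega) h0
    obtain ⟨t', s₂, h4, h5, h6⟩ := ih (i := i + 1) (by omega) h3 (by omega)
    refine ⟨_, _, .loop_step (hc i s (by omega) h0) h1 h4, ?_, h6⟩
    rw [Nat.mul_add]
    omega

/-- The layout stored in the memory. -/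
def State.layout (s : State) : Layout :=
  ⟨s.arr aLab, s.arr aVst, s.arr aNv, s.arr aNe, s.arr aSrc, s.arr aTgt⟩

theorem Frame.layout {V A : List ℕ} {s s' : State} (h : Frame V A s s')
    (hA : aLab ∉ A ∧ aVst ∉ A ∧ aNv ∉ A ∧ aNe ∉ A ∧ aSrc ∉ A ∧ aTgt ∉ A) :
    s'.layout = s.layout := by
  obtain ⟨h1, h2, h3, h4, h5, h6⟩ := hA
  simp only [State.layout, h.2 _ h1, h.2 _ h2, h.2 _ h3, h.2 _ h4, h.2 _ h5, h.2 _ h6]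

/-! ### Trees in the multigraph of the layout -/

/-- Prepare the search in the multigraph of the layout: the arcs lead to the other ends of the
edges, and the edges `vE`, `vF1` and `vF2` are not used. -/
def netArcs : Prog :=
  .assign vI (.const 0) ;;
  .upTo vI vArcs (.store aArcE (.var vI) (.const 0) ;;
    .assign vK (.cell aLab (.cell aEdg (.var vI))) ;;
    .when (.var vK) (.when (.ne (.var vK) (.plus (.var vE) (.const 1)))
      (.when (.ne (.var vK) (.plus (.var vF1) (.const 1)))
        (.when (.ne (.var vK) (.plus (.var vF2) (.const 1)))
          (.store aArcE (.var vI) (.var vK) ;;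
            .cond (.eq (.cell aSrc (.minus (.var vK) (.const 1))) (.cell aOwn (.var vI)))
              (.store aArcW (.var vI) (.cell aTgt (.minus (.var vK) (.const 1))))
              (.store aArcW (.var vI) (.cell aSrc (.minus (.var vK) (.const 1)))))))))

/-- The search starts in the vertex `vA`. -/
def netRoots : Prog :=
  .assign vI (.const 0) ;;
  .upTo vI vN (.store aVis (.var vI) (.const 0) ;;
    .when (.eq (.var vI) (.var vA)) (.store aVis (.var vI) (.const 1)))

/-- Search a tree with root `vA` in the multigraph of the layout. -/
def netSearch : Prog := netArcs ;; netRoots ;; bfs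

/-- The edge in the multigraph that the arc `p` represents, plus one. -/
def State.netArc (s : State) (p : ℕ) : ℕ :=
  if s.arr aLab (s.arr aEdg p) ≠ s.var vE + 1 ∧ s.arr aLab (s.arr aEdg p) ≠ s.var vF1 + 1 ∧
    s.arr aLab (s.arr aEdg p) ≠ s.var vF2 + 1 then s.arr aLab (s.arr aEdg p) else 0

theorem netArcs_spec (s : State) :
    Ends netArcs s (110 * s.var vArcs + 6) fun s' => (∀ p < s.var vArcs,
      s'.arr aArcE p = s.netArc p ∧ (s.netArc p ≠ 0 → s'.arr aArcW p =
        if s.arr aSrc (s.netArc p - 1) = s.arr aOwn p then s.arr aTgt (s.netArc p - 1)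
        else s.arr aSrc (s.netArc p - 1))) ∧ Frame [vI, vK] [aArcE, aArcW] s s' := by
  refine Ends.mono (T := 2 + ((102 + 8) * (s.var vArcs - 0) + 4))
    (Ends.seq (Ends.flat (by rfl) (by decide) ?_)) (by omega) fun _ h => h
  simp only [Prog.run, Expr.eval]
  refine (Ends.upTo (lo := 0) (hi := s.var vArcs) (fun j s' => ∀ p < j, s'.arr aArcE p = s.netArc p ∧
    (s.netArc p ≠ 0 → s'.arr aArcW p =
        if s.arr aSrc (s.netArc p - 1) = s.arr aOwn p then s.arr aTgt (s.netArc p - 1)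
        else s.arr aSrc (s.netArc p - 1)))
    (by decide) (by decide) (by decide) (by simp) (by simp) (Nat.zero_le _)
    (by intro p hp; omega) ?_).mono le_rfl ?_
  · intro j s' _ hj hij hfr hinv
    have hX : ∀ X, X ≠ aArcE → X ≠ aArcW → s'.arr X = s.arr X := by
      intro X h1 h2
      rw [hfr.2 X (by simp [Prog.arrs, Prog.when, h1, h2])]; simp
    have hx : ∀ x, x ≠ vI → x ≠ vK → s'.var x = s.var x := by
      intro x h1 h2
      rw [hfr.1 x (by simp [Prog.vars, Prog.when, h1, h2])]; simp [h1]
    apply Ends.flat (by rfl) (by decide)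
    have key : ∀ s'' : State, s''.arr aArcE = Function.update (s'.arr aArcE) j (s.netArc j) →
        (∀ p, p ≠ j → s''.arr aArcW p = s'.arr aArcW p) → (s.netArc j ≠ 0 → s''.arr aArcW j =
        if s.arr aSrc (s.netArc j - 1) = s.arr aOwn j then s.arr aTgt (s.netArc j - 1)
        else s.arr aSrc (s.netArc j - 1)) → ∀ p < j + 1, (s''.setVar vI (j + 1)).arr aArcE p = s.netArc p ∧
        (s.netArc p ≠ 0 → (s''.setVar vI (j + 1)).arr aArcW p =
        if s.arr aSrc (s.netArc p - 1) = s.arr aOwn p then s.arr aTgt (s.netArc p - 1)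
        else s.arr aSrc (s.netArc p - 1)) := by
      intro s'' h1 h2 h3 p hp
      simp only [State.setVar_arr, h1, Function.update_apply]
      by_cases hpj : p = j
      · subst hpj
        exact ⟨if_pos rfl, h3⟩
      · rw [if_neg hpj, h2 p hpj]
        exact hinv p (by omega)
    have hl0 : s'.arr aLab = s.arr aLab := hX _ (by decide) (by decide)
    have hl1 : s'.arr aEdg = s.arr aEdg := hX _ (by decide) (by decide)
    have hl2 : s'.arr aSrc = s.arr aSrc := hX _ (by decide) (by decide)
    have hl3 : s'.arr aTgt = s.arr aTgt := hX _ (by decide) (by decide)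
    have hl4 : s'.arr aOwn = s.arr aOwn := hX _ (by decide) (by decide)
    have hl5 : s'.var vE = s.var vE := hx _ (by decide) (by decide)
    have hl6 : s'.var vF1 = s.var vF1 := hx _ (by decide) (by decide)
    have hl7 : s'.var vF2 = s.var vF2 := hx _ (by decide) (by decide)
    by_cases hcond : s.netArc j = 0
    · have h' := hcond
      unfold State.netArc at h'
      have h'' : s.arr aLab (s.arr aEdg j) = 0 ∨ s.arr aLab (s.arr aEdg j) = s.var vE + 1 ∨
          s.arr aLab (s.arr aEdg j) = s.var vF1 + 1 ∨ s.arr aLab (s.arr aEdg j) = s.var vF2 + 1 := by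
        split_ifs at h' <;> tauto
      apply key
      · simp only [Prog.run, Prog.when, ne_eq, Expr.eval_ne_eq_zero, Expr.eval, State.setVar_var,
          State.setVar_arr, State.setCell_var, State.setCell_arr, Nat.reduceEqDiff, reduceIte, hij, hl0,
          hl1, hl5, hl6, hl7]
        rcases h'' with h | h | h | h <;> simp [h, hcond]
      · intro p hp
        simp only [Prog.run, Prog.when, ne_eq, Expr.eval_ne_eq_zero, Expr.eval, State.setVar_var,
          State.setVar_arr, State.setCell_var, State.setCell_arr, Nat.reduceEqDiff, reduceIte, hij, hl0,
          hl1, hl5, hl6, hl7]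
        rcases h'' with h | h | h | h <;> simp [h]
      · intro h; exact absurd hcond h
    · have h' := hcond
      unfold State.netArc at h'
      rw [ite_eq_right_iff] at h'
      push Not at h'
      obtain ⟨⟨h1, h2, h3⟩, h4⟩ := h'
      have hval : s.netArc j = s.arr aLab (s.arr aEdg j) := by
        unfold State.netArc; rw [if_pos ⟨h1, h2, h3⟩]
      apply key
      · simp only [Prog.run, Prog.when, ne_eq, Expr.eval_ne_eq_zero, Expr.eval_eq_eq_zero, Expr.eval,
          State.setVar_var, State.setVar_arr, State.setCell_var, State.setCell_arr, Nat.reduceEqDiff,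
          reduceIte, hij, hl0, hl1, hl2, hl3, hl4, hl5, hl6, hl7, h1, h2, h3, h4, not_false_eq_true, hval]
        split_ifs <;> simp
      · intro p hp
        simp only [Prog.run, Prog.when, ne_eq, Expr.eval_ne_eq_zero, Expr.eval_eq_eq_zero, Expr.eval,
          State.setVar_var, State.setVar_arr, State.setCell_var, State.setCell_arr, Nat.reduceEqDiff,
          reduceIte, hij, hl0, hl1, hl2, hl3, hl4, hl5, hl6, hl7, h1, h2, h3, h4, not_false_eq_true]
        split_ifs <;> simp [hp]
      · intro _
        simp only [Prog.run, Prog.when, ne_eq, Expr.eval_ne_eq_zero, Expr.eval_eq_eq_zero, Expr.eval,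
          State.setVar_var, State.setVar_arr, State.setCell_var, State.setCell_arr, Nat.reduceEqDiff,
          reduceIte, hij, hl0, hl1, hl2, hl3, hl4, hl5, hl6, hl7, h1, h2, h3, h4, not_false_eq_true, hval,
          not_not]
        split_ifs <;> simp
  · rintro s' ⟨h1, -, h2⟩
    refine ⟨h1, fun x hx => ?_, fun X hX => ?_⟩
    · simp only [List.mem_cons, List.not_mem_nil, or_false, not_or] at hx
      rw [h2.1 x (by simp [Prog.vars, Prog.when, hx])]; simp [hx]
    · simp only [List.mem_cons, List.not_mem_nil, or_false, not_or] at hX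
      rw [h2.2 X (by simp [Prog.arrs, Prog.when, hX])]; simp

theorem netRoots_spec (s : State) :
    Ends netRoots s (30 * s.var vN + 6) fun s' => (∀ v < s.var vN,
      s'.arr aVis v = if v = s.var vA then 1 else 0) ∧ Frame [vI] [aVis] s s' := by
  refine Ends.mono (T := 2 + ((22 + 8) * (s.var vN - 0) + 4))
    (Ends.seq (Ends.flat (by rfl) (by decide) ?_)) (by omega) fun _ h => h
  simp only [Prog.run, Expr.eval]
  refine (Ends.upTo (lo := 0) (hi := s.var vN) (fun j s' => ∀ v < j,
      s'.arr aVis v = if v = s.var vA then 1 else 0)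
    (by decide) (by decide) (by decide) (by simp) (by simp) (Nat.zero_le _)
    (by intro p hp; omega) ?_).mono le_rfl ?_
  · intro j s' _ hj hij hfr hinv
    have hx : s'.var vA = s.var vA := by rw [hfr.1 vA (by decide)]; simp
    apply Ends.flat (by rfl) (by decide)
    intro v hv
    have := hinv v
    by_cases hja : j = s.var vA
    · by_cases hvj : v = j
      · simp [Prog.run, Prog.when, Expr.eval, hij, hx, hvj, hja]
      · have hva : v ≠ s.var vA := fun h => hvj (h.trans hja.symm)
        simp [Prog.run, Prog.when, Expr.eval, hij, hx, hja, hva, this (by omega)]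
    · by_cases hvj : v = j
      · simp [Prog.run, Prog.when, Expr.eval, hij, hx, hvj, hja]
      · simp [Prog.run, Prog.when, Expr.eval, hij, hx, hja, hvj, this (by omega)]
  · rintro s' ⟨h1, -, h2⟩
    refine ⟨h1, fun x hx => ?_, fun X hX => ?_⟩
    · simp only [List.mem_cons, List.not_mem_nil, or_false] at hx
      rw [h2.1 x (by simp [Prog.vars, Prog.when, hx])]; simp [hx]
    · simp only [List.mem_cons, List.not_mem_nil, or_false] at hX
      rw [h2.2 X (by simp [Prog.arrs, Prog.when, hX])]; simp

/-- The arrays `aPar` and `aPe` hold a tree with root `a` in the multigraph `N`, with edges from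
the set `A`. Its vertices are those marked in `aVis`. -/
structure TreeIn (N : Net) (n a : ℕ) (A : Set ℕ) (s : State) : Prop where
  root_lt : a < n
  root : s.arr aVis a ≠ 0
  parent : ∃ rank : ℕ → ℕ, ∀ v < n, s.arr aVis v ≠ 0 → v ≠ a → s.arr aPar v < n ∧
    s.arr aVis (s.arr aPar v) ≠ 0 ∧ rank (s.arr aPar v) < rank v ∧
    N.graph.IsLink (s.arr aPe v) v (s.arr aPar v) ∧ s.arr aPe v ∈ A

/-- No adjacency lists of the multigraph are stored. At a branch vertex, an arc of `G` whose edge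
has the label of `f` stands for `f`: the first edge of the path at the source, the last one at the
target. The other end of `f` is then read from `aSrc` and `aTgt`. So one search costs O(n + m),
however the multigraph changes. -/
theorem netSearch_spec : ∃ C : ℕ, ∀ (G : Graph ℕ ℕ) (n m : ℕ) (s : State), Static G n m s →
    s.layout.Embedded G n m → (s.layout.net m).Closed → s.arr aVst (s.var vA) = 1 →
    Ends netSearch s (C * (n + m + 1)) fun s' =>
      TreeIn (s.layout.net m) n (s.var vA) {d | d ∈ (s.layout.net m).E ∧ d ≠ s.var vE ∧
        d ≠ s.var vF1 ∧ d ≠ s.var vF2} s' ∧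
      ∀ d ∈ (s.layout.net m).E, d ≠ s.var vE → d ≠ s.var vF1 → d ≠ s.var vF2 →
        ¬ (s.layout.net m).Crosses {v | v < n ∧ s'.arr aVis v ≠ 0} d := by
  obtain ⟨C, hC⟩ := bfs_spec
  refine ⟨4 * C + 500, fun G n m s hs hD hcl ha => ?_⟩
  set D := s.layout with hDs
  have hlab : ∀ e, s.arr aLab e = D.lab e := fun _ => rfl
  have hsrc : ∀ e, s.arr aSrc e = D.src e := fun _ => rfl
  have htgt : ∀ e, s.arr aTgt e = D.tgt e := fun _ => rfl
  have hvst : ∀ e, s.arr aVst e = D.vst e := fun _ => rfl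
  have hreal : ∀ f, D.lab f = f + 1 → D.vst (D.src f) = 1 ∧ D.vst (D.tgt f) = 1 := fun f hf =>
    hcl f (hD.mem_net.2 hf)
  have harcnet : ∀ p, s.netArc p ≠ 0 → ∃ f, s.netArc p = f + 1 ∧ s.arr aLab (s.arr aEdg p) = f + 1 ∧
      D.lab f = f + 1 ∧ f ≠ s.var vE ∧ f ≠ s.var vF1 ∧ f ≠ s.var vF2 := by
    intro p hp
    unfold State.netArc at hp ⊢
    split_ifs at hp ⊢ with h1
    · obtain ⟨f, h2, h3⟩ := hD.lab_label _ hp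
      rw [hlab] at h1 ⊢
      exact ⟨f, h2, h2, h3, by omega, by omega, by omega⟩
    · exact absurd rfl hp
  refine Ends.mono (T := 110 * s.var vArcs + 6 + ((30 * n + 6) + C * (n + s.arr aOff n + 1)))
    (Ends.seq ((netArcs_spec s).mono le_rfl ?_)) ?_ fun _ h => h
  rotate_left
  · rw [hs.var_arcs]
    have := hs.arcs_le
    nlinarith [Nat.mul_le_mul_left C this, Nat.zero_le (C * n), Nat.zero_le (C * m)]
  rintro s₁ ⟨harc, hfr₁⟩
  have hn₁ : s₁.var vN = n := by rw [hfr₁.1 vN (by decide)]; exact hs.var_n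
  have h2 := netRoots_spec s₁
  rw [hn₁] at h2
  refine Ends.seq (h2.mono le_rfl ?_)
  rintro s₂ ⟨hvis, hfr₂⟩
  have hoff : s₂.arr aOff = s.arr aOff := by
    rw [hfr₂.2 aOff (by decide), hfr₁.2 aOff (by decide)]
  have hn₂ : s₂.var vN = n := by rw [hfr₂.1 vN (by decide), hn₁]
  have hA₁ : s₁.var vA = s.var vA := hfr₁.1 vA (by decide)
  rw [hA₁] at hvis
  have hE₂ : s₂.arr aArcE = s₁.arr aArcE := hfr₂.2 aArcE (by decide)
  have hW₂ : s₂.arr aArcW = s₁.arr aArcW := hfr₂.2 aArcW (by decide)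
  have hpM : ∀ v < n, ∀ p, p < s.arr aOff (v + 1) → p < s.var vArcs := by
    intro v hv p hp
    rw [hs.var_arcs]
    exact hp.trans_le (hs.off_le hv)
  have hhead : ∀ v < n, ∀ p, s.arr aOff v ≤ p → p < s.arr aOff (v + 1) → s₁.arr aArcE p ≠ 0 →
      ∃ f, s₁.arr aArcE p = f + 1 ∧ D.lab (s.arr aEdg p) = f + 1 ∧ D.lab f = f + 1 ∧ f ≠ s.var vE ∧
        f ≠ s.var vF1 ∧ f ≠ s.var vF2 ∧
        s₁.arr aArcW p = if D.src f = v then D.tgt f else D.src f := by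
    intro v hv p hp1 hp2 hp3
    obtain ⟨h3, h4⟩ := harc p (hpM v hv p hp2)
    rw [h3] at hp3
    obtain ⟨f, h5, h6, h7, h8⟩ := harcnet p hp3
    refine ⟨f, h3.trans h5, h6, h7, h8.1, h8.2.1, h8.2.2, ?_⟩
    rw [h4 hp3, h5, hs.own v hv p hp1 hp2]
    rfl
  have hheadreal : ∀ v < n, ∀ p, s.arr aOff v ≤ p → p < s.arr aOff (v + 1) → s₁.arr aArcE p ≠ 0 →
      D.vst (s₁.arr aArcW p) = 1 := by
    intro v hv p hp1 hp2 hp3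
    obtain ⟨f, -, -, h5, -, -, -, h6⟩ := hhead v hv p hp1 hp2 hp3
    rw [h6]
    have := hreal f h5
    split_ifs
    · exact this.2
    · exact this.1
  have hreal_lt : ∀ v, D.vst v = 1 → v < n := fun v hv => hD.vst_lt v (by omega)
  have han : s.var vA < n := hreal_lt _ ha
  have h3 := hC n s₂ hn₂ (by rw [hoff]; exact hs.off_mono) (by
    rw [hoff, hE₂, hW₂]
    exact fun v hv p hp1 hp2 hp3 => hreal_lt _ (hheadreal v hv p hp1 hp2 hp3))
  rw [hoff] at h3
  refine h3.mono le_rfl ?_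
  intro s₃ h
  have hvisa : ∀ v < n, s₂.arr aVis v ≠ 0 ↔ v = s.var vA := by
    intro v hv
    rw [hvis v hv]
    split_ifs with h4 <;> simp [h4]
  obtain ⟨rank, htree⟩ := h.tree
  rw [hoff, hE₂, hW₂] at htree
  have hclosed := h.closed
  rw [hoff, hE₂, hW₂] at hclosed
  have hrealv : ∀ v < n, s₃.arr aVis v ≠ 0 → D.vst v = 1 := by
    intro v hv hv3
    rcases htree v hv hv3 with h4 | ⟨h4, -, -, p, h5, h6, h7, h8, -⟩
    · rw [(hvisa v hv).1 h4]; exact ha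
    · rw [← h8]; exact hheadreal _ h4 p h5 h6 h7
  refine ⟨⟨han, h.roots _ han ((hvisa _ han).2 rfl), rank, fun v hv hv3 hva => ?_⟩, ?_⟩
  · rcases htree v hv hv3 with h4 | ⟨h4, h4', h4'', p, h5, h6, h7, h8, h9⟩
    · exact absurd ((hvisa v hv).1 h4) hva
    · obtain ⟨f, h10, h11, h12, h13, h14, h15, h16⟩ := hhead _ h4 p h5 h6 h7
      have hf : s₃.arr aPe v = f := by rw [h9, h10]; rfl
      have hfE : f ∈ (D.net m).E := hD.mem_net.2 h12
      rw [hf]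
      refine ⟨h4, h4', h4'', ?_, hfE, h13, h14, h15⟩
      rw [Net.isLink_iff hcl]
      refine ⟨hfE, ?_⟩
      have hown := hs.own _ h4 p h5 h6
      have hlink := (hs.arc p (by rw [← hs.var_arcs]; exact hpM _ h4 p h6)).2.2.2
      rw [hown] at hlink
      rw [h8] at h16
      show D.src f = v ∧ D.tgt f = _ ∨ D.src f = _ ∧ D.tgt f = v
      have hends := (hD.vst_of_isLink hcl h11 hlink).2
      have := hrealv _ h4 h4'
      split_ifs at h16 with h17
      · exact Or.inr ⟨h17, h16.symm⟩
      · left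
        rcases hends with h18 | ⟨-, h18 | h18⟩
        · omega
        · exact absurd h18.symm h17
        · exact ⟨h16.symm, h18.symm⟩
  · intro d hd h4 h5 h6
    have hd' := hD.mem_net.1 hd
    obtain ⟨l, x, dd, hL⟩ := hD.exists_link d hd'
    have hdr := hreal d hd'
    have hsn := hreal_lt _ hdr.1
    have htn := hreal_lt _ hdr.2
    have harcval : ∀ p, p < s.var vArcs → D.lab (s.arr aEdg p) = d + 1 → s₁.arr aArcE p = d + 1 := by
      intro p hp hpl
      rw [(harc p hp).1]
      unfold State.netArc
      rw [hlab, hpl, if_pos ⟨by omega, by omega, by omega⟩]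
    -- A reached end of the edge `d` has an arc on the path of `d`, and following this arc reaches
    -- the other end.
    have hstep : ∀ e u w, G.IsLink e u w → D.lab e = d + 1 → u < n → s₃.arr aVis u ≠ 0 →
        s₃.arr aVis (if D.src d = u then D.tgt d else D.src d) ≠ 0 := by
      intro e u w hl he hu hu3
      obtain ⟨p, hp, h7, h8, -⟩ := hs.exists_arc e u w hl
      obtain ⟨-, h9, h10, -⟩ := hs.arc p hp
      rw [h7] at h9 h10
      have h11 := harcval p (by rw [hs.var_arcs]; exact hp) (by rw [h8]; exact he)
      have h12 := hclosed u hu hu3 p h9 h10 (by omega)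
      obtain ⟨f, h13, -, -, -, -, -, h14⟩ := hhead u hu p h9 h10 (by omega)
      obtain rfl : f = d := by omega
      rwa [h14] at h12
    have hs1 : s₃.arr aVis (D.src d) ≠ 0 → s₃.arr aVis (D.tgt d) ≠ 0 := by
      intro h7
      have hl := hL.link 0 hL.pos
      rw [hL.src_eq, hL.first] at hl
      have := hstep d _ _ hl hd' hsn h7
      rwa [if_pos rfl] at this
    have hs2 : s₃.arr aVis (D.tgt d) ≠ 0 → s₃.arr aVis (D.src d) ≠ 0 := by
      intro h7
      have hpos := hL.pos
      have hl := hL.link (l - 1) (by omega)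
      rw [Nat.sub_add_cancel hL.pos, hL.tgt_eq] at hl
      have := hstep _ _ _ hl.symm ((hL.lab_iff _).2 ⟨l - 1, by omega, rfl⟩) htn h7
      split_ifs at this with h8
      · rw [h8]; exact this
      · exact this
    have hs3 : (D.net m).src d = D.src d := rfl
    have hs4 : (D.net m).tgt d = D.tgt d := rfl
    simp only [Net.Crosses, Set.mem_ofPred_eq, hs3, hs4]
    tauto

end RAM

/-! ### Listing a cycle of the multigraph as a set of edges of `G`. -/

theorem le_of_injective_below {r n : ℕ} {f : ℕ → ℕ} (h : ∀ i < r, f i < n)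
    (hinj : ∀ i < r, ∀ j < r, f i = f j → i = j) : r ≤ n := by
  have := Finset.card_le_card_of_injOn (s := Finset.range r) (t := Finset.range n) f
    (fun i hi => by simpa using h i (by simpa using hi))
    (fun i hi j hj hij => hinj i (by simpa using hi) j (by simpa using hj) hij)
  simpa using this

/-- The edges of the subgraph that belong to the edges `C` of the multigraph. -/
def Layout.spread (D : Layout) (C : Set ℕ) : Set ℕ := {d | ∃ c ∈ C, D.lab d = c + 1}

namespace Layout

variable {G : Graph ℕ ℕ} {n m : ℕ} {D : Layout} {C : Set ℕ}

theorem Embedded.respects_spread (hD : D.Embedded G n m) : D.Respects (D.spread C) := by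
  refine ⟨fun e f hef => ?_, fun e he => ?_⟩
  · obtain ⟨f', h1, h2⟩ := hD.lab_label e (by omega)
    obtain rfl : f' = f := by omega
    constructor
    · rintro ⟨c, hc, h3⟩
      obtain rfl : c = f' := by omega
      exact ⟨c, hc, h2⟩
    · rintro ⟨c, hc, h3⟩
      obtain rfl : c = f' := by omega
      exact ⟨c, hc, hef⟩
  · rintro ⟨c, -, h⟩
    omega

theorem Embedded.spread_inter (hD : D.Embedded G n m) (hC : C ⊆ (D.net m).E) :
    D.spread C ∩ (D.net m).E = C := by
  ext d
  constructor
  · rintro ⟨⟨c, hc, h1⟩, h2⟩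
    have := hD.mem_net.1 h2
    obtain rfl : c = d := by omega
    exact hc
  · intro hd
    exact ⟨⟨d, hd, hD.mem_net.1 (hC hd)⟩, hC hd⟩

end Layout

namespace RAM

/-- List the cycle that consists of the edge `vE` and the path in the tree from `vB` to `vA`, with
every edge of the multigraph replaced by its path. -/
def emit : Prog :=
  (.assign vW (.var vB) ;;
    .store aMark (.var vE) (.plus (.var vCyc) (.const 1)) ;;
    .store aList (.var vOut) (.var vE) ;;
    .assign vOut (.plus (.var vOut) (.const 1))) ;;
  .loop (.ne (.var vW) (.var vA))
    (.store aMark (.cell aPe (.var vW)) (.plus (.var vCyc) (.const 1)) ;;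
      .store aList (.var vOut) (.cell aPe (.var vW)) ;;
      .assign vOut (.plus (.var vOut) (.const 1)) ;;
      .assign vW (.cell aPar (.var vW))) ;;
  .assign vI (.const 0) ;;
  .upTo vI vLim
    (.when (.cell aLab (.var vI)) (.when (.ne (.cell aLab (.var vI)) (.plus (.var vI) (.const 1)))
      (.when (.eq (.cell aMark (.minus (.cell aLab (.var vI)) (.const 1)))
          (.plus (.var vCyc) (.const 1)))
        (.store aList (.var vOut) (.var vI) ;;
          .assign vOut (.plus (.var vOut) (.const 1)))))) ;;
  (.assign vCyc (.plus (.var vCyc) (.const 1)) ;; .store aStart (.var vCyc) (.var vOut))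

/-- The state `s'` arises from `s` by listing one more cycle `W`. -/
structure Listed (s s' : State) (W : Set ℕ) : Prop where
  cyc : s'.var vCyc = s.var vCyc + 1
  out_le : s.var vOut ≤ s'.var vOut
  start : s'.arr aStart = Function.update (s.arr aStart) (s.var vCyc + 1) (s'.var vOut)
  old : ∀ i < s.var vOut, s'.arr aList i = s.arr aList i
  mark : ∀ f, s'.arr aMark f ≤ s.var vCyc + 1
  new : s'.arr aList '' Set.Ico (s.var vOut) (s'.var vOut) = W

theorem image_update_Ico {f : ℕ → ℕ} {L L' v : ℕ} (h : L ≤ L') :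
    Function.update f L' v '' Set.Ico L (L' + 1) = insert v (f '' Set.Ico L L') := by
  have : Set.Ico L (L' + 1) = insert L' (Set.Ico L L') := by
    ext i; simp only [Set.mem_Ico, Set.mem_insert_iff]; omega
  rw [this, Set.image_insert_eq, Function.update_self]
  congr 1
  refine Set.image_congr fun i hi => Function.update_of_ne ?_ _ _
  have := hi.2
  omega

/-- There are two passes. The first follows the tree path, and lists and marks its edges; the second
runs through all edges below `vLim` and adds those whose path has a marked name, unless they are
this name themselves. The mark is the number of the cycle plus one, so old marks never have to be
erased. -/
theorem emit_run {s : State} {r : ℕ} {C : Set ℕ}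
    (hr : (s.arr aPar)^[r] (s.var vB) = s.var vA) (hra : ∀ i < r, (s.arr aPar)^[i] (s.var vB) ≠ s.var vA)
    (hmark : ∀ f, s.arr aMark f ≤ s.var vCyc)
    (hC : C = insert (s.var vE) ((fun i => s.arr aPe ((s.arr aPar)^[i] (s.var vB))) '' Set.Iio r))
    (hlabC : ∀ c ∈ C, s.arr aLab c = c + 1)
    (hk : ∀ d, s.arr aLab d ≠ 0 → s.arr aLab d ≠ d + 1 → d < s.var vLim) :
    Ends emit s (60 * (r + s.var vLim + 1)) fun s' => Listed s s' (s.layout.spread C) := by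
  classical
  let P : ℕ → Set ℕ := fun j => insert (s.var vE)
    ((fun i => s.arr aPe ((s.arr aPar)^[i] (s.var vB))) '' Set.Iio j)
  have hP : ∀ j, P (j + 1) = insert (s.arr aPe ((s.arr aPar)^[j] (s.var vB))) (P j) := by
    intro j
    have : Set.Iio (j + 1) = insert j (Set.Iio j) := by
      ext i; simp only [Set.mem_Iio, Set.mem_insert_iff]; omega
    simp only [P, this, Set.image_insert_eq]
    exact Set.insert_comm _ _ _
  -- The edges added by the second pass before it reaches `j`.
  let R : ℕ → Set ℕ := fun j => {d | d < j ∧ s.arr aLab d ≠ 0 ∧ s.arr aLab d ≠ d + 1 ∧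
    s.arr aLab d - 1 ∈ C}
  have hR : C ∪ R (s.var vLim) = s.layout.spread C := by
    ext d
    constructor
    · rintro (h | ⟨-, h1, -, h2⟩)
      · exact ⟨d, h, hlabC d h⟩
      · exact ⟨_, h2, show s.arr aLab d = _ by omega⟩
    · rintro ⟨c, hc, h⟩
      replace h : s.arr aLab d = c + 1 := h
      by_cases hd : s.arr aLab d = d + 1
      · left
        obtain rfl : c = d := by omega
        exact hc
      · right
        exact ⟨hk d (by omega) hd, by omega, hd, by rw [h]; exact hc⟩
  refine Ends.mono (T := 20 + ((30 * (r - 0) + 8) +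
    (2 + ((50 + 8) * (s.var vLim - 0) + 4 + 10)))) (Ends.seq (Ends.flat (by rfl) (by decide) ?_)) (by omega)
    fun _ h => h
  set s₁ := Prog.run _ s with hs₁
  have hrun : s₁ = ((((s.setVar vW (s.var vB)).setCell aMark (s.var vE) (s.var vCyc + 1)).setCell aList
      (s.var vOut) (s.var vE)).setVar vOut (s.var vOut + 1)) := by
    rw [hs₁]; simp [Prog.run, Expr.eval]
  clear_value s₁
  refine Ends.seq ((Ends.count (T := 22) (i := 0) (l := r) (fun j s' =>
    s'.var vW = (s.arr aPar)^[j] (s.var vB) ∧ s.var vOut ≤ s'.var vOut ∧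
    (∀ i < s.var vOut, s'.arr aList i = s.arr aList i) ∧
    s'.arr aList '' Set.Ico (s.var vOut) (s'.var vOut) = P j ∧
    (∀ f, s'.arr aMark f = s.var vCyc + 1 ∧ f ∈ P j ∨ s'.arr aMark f = s.arr aMark f ∧ f ∉ P j) ∧
    Frame [vW, vOut] [aMark, aList] s s')
    (Nat.zero_le _) ?_ ?_ ?_ ?_).mono (by simp [Expr.cost, Expr.ne]) ?_)
  · subst hrun
    have hP0 : P 0 = {s.var vE} := by simp [P]
    refine ⟨by simp, by simp, ?_, ?_, ?_, ⟨?_, ?_⟩⟩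
    · intro i hi
      simp [hi.ne]
    · simp only [State.setVar_var, State.setVar_arr, State.setCell_var, State.setCell_arr, Nat.reduceEqDiff,
        reduceIte]
      rw [image_update_Ico le_rfl, hP0]
      simp
    · intro f
      simp only [State.setVar_arr, State.setCell_arr, Nat.reduceEqDiff, reduceIte,
        Function.update_apply, hP0, Set.mem_singleton_iff]
      split_ifs with h <;> simp [h]
    · intro x hx
      simp only [List.mem_cons, List.not_mem_nil, or_false, not_or] at hx
      simp [hx]
    · intro X hX
      simp only [List.mem_cons, List.not_mem_nil, or_false, not_or] at hX
      simp [hX]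
  · rintro j s' hj ⟨h1, -, -, -, -, h6⟩
    rw [ne_eq, Expr.eval_ne_eq_zero]
    simp only [Expr.eval, h1, h6.1 vA (by decide)]
    exact hra j hj
  · rintro s' ⟨h1, -, -, -, -, h6⟩
    rw [Expr.eval_ne_eq_zero]
    simp only [Expr.eval, h1, h6.1 vA (by decide)]
    exact hr
  · rintro j s' hj ⟨h1, h2, h3, h4, h5, h6⟩
    have h7 : s'.arr aPe = s.arr aPe := h6.2 _ (by decide)
    have h8 : s'.arr aPar = s.arr aPar := h6.2 _ (by decide)
    have h9 : s'.var vCyc = s.var vCyc := h6.1 _ (by decide)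
    apply Ends.flat (by rfl) (by decide)
    simp only [Prog.run, Expr.eval, State.setVar_var, State.setVar_arr, State.setCell_var,
      State.setCell_arr, Nat.reduceEqDiff, reduceIte, h7, h8, h9, h1]
    refine ⟨by rw [Function.iterate_succ_apply'], by omega, ?_, ?_, ?_, ⟨?_, ?_⟩⟩
    · intro i hi
      rw [Function.update_of_ne (by omega)]
      exact h3 i hi
    · rw [image_update_Ico h2, h4, hP]
    · intro f
      rw [hP]
      simp only [Function.update_apply, Set.mem_insert_iff, not_or]
      split_ifs with h
      · simp [h]
      · simpa [h] using h5 f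
    · intro x hx
      have := h6.1 x hx
      simp only [List.mem_cons, List.not_mem_nil, or_false, not_or] at hx
      simp [hx, this]
    · intro X hX
      have := h6.2 X hX
      simp only [List.mem_cons, List.not_mem_nil, or_false, not_or] at hX
      simp [hX, this]
  · rintro s₂ ⟨-, h2, h3, h4, h5, h6⟩
    have hCP : P r = C := hC.symm
    rw [hCP] at h4 h5
    -- All older marks are at most `vCyc`, so the current mark identifies the edges of this cycle.
    have hmarkC : ∀ f, s₂.arr aMark f = s.var vCyc + 1 ↔ f ∈ C := by
      intro f
      have := hmark f
      rcases h5 f with ⟨h, h'⟩ | ⟨h, h'⟩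
      · simp [h, h']
      · simp only [h', iff_false]; omega
    refine Ends.seq (Ends.flat (by rfl) (by decide) ?_)
    refine Ends.seq ((Ends.upTo (T := 50) (lo := 0) (hi := s.var vLim) (fun j s' =>
      s.var vOut ≤ s'.var vOut ∧ (∀ i < s.var vOut, s'.arr aList i = s.arr aList i) ∧
      s'.arr aList '' Set.Ico (s.var vOut) (s'.var vOut) = C ∪ R j)
      (by decide) (by decide) (by decide) (by simp [Prog.run, Expr.eval])
      (by simp [Prog.run, Expr.eval]; exact h6.1 _ (by decide)) (Nat.zero_le _) ?_ ?_).mono le_rfl ?_)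
    · simp only [Prog.run, Expr.eval, State.setVar_var, State.setVar_arr, Nat.reduceEqDiff, reduceIte]
      refine ⟨h2, h3, ?_⟩
      have : R 0 = ∅ := by ext d; simp [R]
      rw [this, h4, Set.union_empty]
    · rintro j s' - hj hij hfr ⟨h7, h8, h9⟩
      have h10 : s'.arr aLab = s.arr aLab := by
        rw [hfr.2 _ (by decide)]; simp only [Prog.run, State.setVar_arr]; exact h6.2 _ (by decide)
      have h11 : s'.arr aMark = s₂.arr aMark := by
        rw [hfr.2 _ (by decide)]; simp [Prog.run]
      have h12 : s'.var vCyc = s.var vCyc := by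
        rw [hfr.1 _ (by decide)]; simp [Prog.run]; exact h6.1 _ (by decide)
      apply Ends.flat (by rfl) (by decide)
      have hRj : R (j + 1) = if s.arr aLab j ≠ 0 ∧ s.arr aLab j ≠ j + 1 ∧ s.arr aLab j - 1 ∈ C then
          insert j (R j) else R j := by
        split_ifs with h
        · ext d
          simp only [R, Set.mem_ofPred_eq, Set.mem_insert_iff]
          constructor
          · rintro ⟨h13, h14⟩
            by_cases hdj : d = j
            · exact Or.inl hdj
            · exact Or.inr ⟨by omega, h14⟩
          · rintro (rfl | ⟨h13, h14⟩)
            · exact ⟨by omega, h⟩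
            · exact ⟨by omega, h14⟩
        · ext d
          simp only [R, Set.mem_ofPred_eq]
          constructor
          · rintro ⟨h13, h14⟩
            refine ⟨?_, h14⟩
            have : d ≠ j := by rintro rfl; exact h h14
            omega
          · rintro ⟨h13, h14⟩
            exact ⟨by omega, h14⟩
      by_cases hcond : s.arr aLab j ≠ 0 ∧ s.arr aLab j ≠ j + 1 ∧ s.arr aLab j - 1 ∈ C
      · rw [hRj, if_pos hcond]
        obtain ⟨h13, h14, h15⟩ := hcond
        rw [← hmarkC] at h15
        simp only [Prog.run, Prog.when, ne_eq, Expr.eval_ne_eq_zero, Expr.eval_eq_eq_zero, Expr.eval,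
          State.setVar_var, State.setVar_arr, State.setCell_var, State.setCell_arr, Nat.reduceEqDiff,
          reduceIte, hij, h10, h11, h12, h13, h14, h15, not_false_eq_true, not_true_eq_false]
        refine ⟨by omega, fun i hi => ?_, ?_⟩
        · rw [Function.update_of_ne (by omega)]
          exact h8 i hi
        · rw [image_update_Ico h7, h9, Set.union_insert]
      · rw [hRj, if_neg hcond]
        have hsame : Prog.run (.when (.cell aLab (.var vI)) (.when (.ne (.cell aLab (.var vI))
          (.plus (.var vI) (.const 1))) (.when (.eq (.cell aMark (.minus (.cell aLab (.var vI)) (.const 1)))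
          (.plus (.var vCyc) (.const 1))) (.store aList (.var vOut) (.var vI) ;;
          .assign vOut (.plus (.var vOut) (.const 1)))))) s' = s' := by
          simp only [Prog.run, Prog.when, ne_eq, Expr.eval_ne_eq_zero, Expr.eval_eq_eq_zero, Expr.eval,
            hij, h10, h11, h12]
          rw [← hmarkC] at hcond
          split_ifs with h13 h14 h15 <;> first | rfl | exact absurd ⟨h13, h14, by tauto⟩ hcond
        rw [hsame]
        simp only [State.setVar_var, State.setVar_arr, Nat.reduceEqDiff, reduceIte]
        exact ⟨h7, h8, h9⟩
    · rintro s₃ ⟨⟨h7, h8, h9⟩, -, hfr⟩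
      have h11 : s₃.arr aMark = s₂.arr aMark := by
        rw [hfr.2 _ (by decide)]; simp [Prog.run]
      have h12 : s₃.var vCyc = s.var vCyc := by
        rw [hfr.1 _ (by decide)]; simp [Prog.run]; exact h6.1 _ (by decide)
      have h13 : s₃.arr aStart = s.arr aStart := by
        rw [hfr.2 _ (by decide)]; simp [Prog.run]; exact h6.2 _ (by decide)
      apply Ends.flat (by rfl) (by decide)
      rw [hR] at h9
      constructor
      all_goals simp only [Prog.run, Expr.eval, State.setVar_var, State.setVar_arr, State.setCell_var,
        State.setCell_arr, Nat.reduceEqDiff, reduceIte, h12, h13, h11]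
      · exact h7
      · exact h8
      · intro f
        have := hmark f
        rcases h5 f with ⟨h, -⟩ | ⟨h, -⟩ <;> omega
      · exact h9

/-- The tree uses only edges from `A`, and `e` is not among them, so the tree path from `b` to `a`
and `e` form a cycle that avoids every other edge outside `A`. If every path has length one, then
`vLim = 0` is admissible and the cycle is listed in time O(n). -/
theorem emit_spec {s : State} {G : Graph ℕ ℕ} {n m : ℕ} {A : Set ℕ}
    (hD : s.layout.Embedded G n m) (hcl : (s.layout.net m).Closed)
    (hT : TreeIn (s.layout.net m) n (s.var vA) A s) (hA : A ⊆ (s.layout.net m).E)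
    (heA : s.var vE ∉ A) (hb : s.var vB < n) (hbv : s.arr aVis (s.var vB) ≠ 0)
    (he : (s.layout.net m).graph.IsLink (s.var vE) (s.var vA) (s.var vB))
    (hmark : ∀ f, s.arr aMark f ≤ s.var vCyc)
    (hk : ∀ d, s.arr aLab d ≠ 0 → s.arr aLab d ≠ d + 1 → d < s.var vLim) :
    Ends emit s (60 * (n + s.var vLim + 1)) fun s' => ∃ W, Listed s s' W ∧ s.layout.Respects W ∧
      (s.layout.net m).graph.IsCycleSet (W ∩ (s.layout.net m).E) ∧ s.var vE ∈ W ∧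
      ∀ c ∈ (s.layout.net m).E, c ∉ A → c ≠ s.var vE → c ∉ W := by
  obtain ⟨rank, hrank⟩ := hT.parent
  obtain ⟨r, h1, h2, h3, h4, h5, h6⟩ := Net.isCycleSet_of_tree (N := s.layout.net m)
    (X := {v | v < n ∧ s.arr aVis v ≠ 0}) (rank := rank) (A := A)
    (fun v hv hva => by
      obtain ⟨h1, h2, h3, h4, h5⟩ := hrank v hv.1 hv.2 hva
      exact ⟨⟨h1, h2⟩, h3, h4, h5⟩) heA ⟨hb, hbv⟩ he
  -- The vertices of the tree path are distinct, so it has at most `n` edges.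
  have hrn : r ≤ n := le_of_injective_below (fun i hi => (h2 i hi).2.1)
    (fun i hi j hj hij => h5 i hi.le j hj.le hij)
  have heE : s.var vE ∈ (s.layout.net m).E := by
    have := he.edge_mem
    rw [Net.edgeSet_graph hcl] at this
    exact this
  set C : Set ℕ := insert (s.var vE) ((fun i => s.arr aPe ((s.arr aPar)^[i] (s.var vB))) '' Set.Iio r)
    with hC
  have hCE : C ⊆ (s.layout.net m).E := by
    rintro c (rfl | ⟨i, hi, rfl⟩)
    · exact heE
    · exact hA (h4 i hi)
  have hlabC : ∀ c ∈ C, s.arr aLab c = c + 1 := fun c hc => hD.mem_net.1 (hCE hc)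
  refine (emit_run h1 (fun i hi => (h2 i hi).1) hmark hC hlabC hk).mono (by omega) ?_
  intro s' hs'
  have hint := hD.spread_inter hCE
  refine ⟨_, hs', hD.respects_spread, by rw [hint]; exact h6, ⟨s.var vE, Or.inl rfl, hlabC _ (Or.inl rfl)⟩, ?_⟩
  intro c hc hcA hce hcW
  have : c ∈ C := by rw [← hint]; exact ⟨hcW, hc⟩
  rcases this with h | ⟨i, hi, rfl⟩
  · exact hce h
  · exact hcA (h4 i hi)

end RAM

/-! ### Relabelling a path and dividing an edge. -/

namespace RAM

/-- One step of the relabelling of a path. -/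
def relabelStep (X Y : ℕ) : Prog :=
  .store aVst (.var vW) (.plus (.var vD) (.const 2)) ;;
  .store aNv (.var vW) (.cell X (.var vW)) ;;
  .store aNe (.var vW) (.cell Y (.var vW)) ;;
  .store aLab (.cell Y (.var vW)) (.plus (.var vD) (.const 1)) ;;
  .assign vW (.cell X (.var vW))

/-- Declare a path to be the one that represents the edge `vD`. It starts with the vertex `vY` and
the edge `vD` to the vertex `vW`. The next vertices and edges are given by the arrays `X` and `Y`.
The path ends with the first vertex whose entry in `aVst` is not `vK`. -/
def relabel (X Y : ℕ) : Prog :=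
  (.store aSrc (.var vD) (.var vY) ;; .store aLab (.var vD) (.plus (.var vD) (.const 1))) ;;
  .loop (.eq (.cell aVst (.var vW)) (.var vK)) (relabelStep X Y) ;;
  .store aTgt (.var vD) (.var vW)

/-- The arrays `X`, `Y` are either the successor arrays themselves, when a part of an old path is
renamed, or the parent pointers of a search, when an ear is added. In the first case the successor
entries are overwritten by their own values, so the program need not distinguish the cases. -/
theorem relabelStep_run {X Y : ℕ} (hXY : X = aNv ∧ Y = aNe ∨ X = aPar ∧ Y = aPe) (s : State) :
    ((relabelStep X Y).run s).var = Function.update s.var vW (s.arr X (s.var vW)) ∧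
    ((relabelStep X Y).run s).arr aVst = Function.update (s.arr aVst) (s.var vW) (s.var vD + 2) ∧
    ((relabelStep X Y).run s).arr aNv = Function.update (s.arr aNv) (s.var vW) (s.arr X (s.var vW)) ∧
    ((relabelStep X Y).run s).arr aNe = Function.update (s.arr aNe) (s.var vW) (s.arr Y (s.var vW)) ∧
    ((relabelStep X Y).run s).arr aLab =
      Function.update (s.arr aLab) (s.arr Y (s.var vW)) (s.var vD + 1) ∧
    ((relabelStep X Y).run s).arr X = s.arr X ∧ ((relabelStep X Y).run s).arr Y = s.arr Y ∧
    ((relabelStep X Y).run s).arr aSrc = s.arr aSrc ∧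
    ((relabelStep X Y).run s).arr aTgt = s.arr aTgt := by
  refine ⟨?_, ?_⟩
  · rcases hXY with ⟨rfl, rfl⟩ | ⟨rfl, rfl⟩ <;> funext y <;>
      simp [relabelStep, Prog.run, Expr.eval, Function.update_apply]
  · rcases hXY with ⟨rfl, rfl⟩ | ⟨rfl, rfl⟩ <;> simp [relabelStep, Prog.run, Expr.eval]

/-- The walk recognizes the vertices still to be treated by their old state `vK`. The end `x l` has
a different state and is distinct from all relabelled vertices, so the walk stops exactly there. -/
theorem relabel_spec {X Y : ℕ} (hXY : X = aNv ∧ Y = aNe ∨ X = aPar ∧ Y = aPe) {s : State} {l : ℕ}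
    {x d : ℕ → ℕ} (hl : 0 < l) (hd : s.var vD = d 0) (hy : s.var vY = x 0) (hw : s.var vW = x 1)
    (hnext : ∀ i, 0 < i → i < l → s.arr X (x i) = x (i + 1) ∧ s.arr Y (x i) = d i)
    (hK : ∀ i, 0 < i → i < l → s.arr aVst (x i) = s.var vK) (hK' : s.arr aVst (x l) ≠ s.var vK)
    (hinj : ∀ i j, 0 < i → i < l → 0 < j → j < l → x i = x j → i = j) :
    Ends (relabel X Y) s (60 * (l + 1)) fun s' => s.layout.Relabeled s'.layout l x d ∧
      s'.var vW = x l ∧ ∀ y, y ≠ vW → s'.var y = s.var y := by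
  refine Ends.mono (T := 8 + ((30 + 15) * (l - 1) + 15 + 3)) (Ends.seq (Ends.flat (by rfl) (by decide) ?_))
    (by omega) fun _ h => h
  set s₁ := Prog.run _ s with hs₁
  have hrun : s₁ = (s.setCell aSrc (d 0) (x 0)).setCell aLab (d 0) (d 0 + 1) := by
    rw [hs₁]; simp [Prog.run, Expr.eval, hd, hy]
  clear_value s₁
  have hX₁ : s₁.arr X = s.arr X ∧ s₁.arr Y = s.arr Y := by
    rw [hrun]
    rcases hXY with ⟨rfl, rfl⟩ | ⟨rfl, rfl⟩ <;> simp
  -- The counter is the index of the current vertex. It starts with 1, since the first edge `d 0`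
  -- has been labelled before the loop.
  refine Ends.seq ((Ends.count (T := 30) (i := 1) (l := l) (fun j s' =>
    1 ≤ j ∧ s'.var = Function.update s.var vW (x j) ∧
    (∀ i, 0 < i → i < l → s'.arr X (x i) = x (i + 1) ∧ s'.arr Y (x i) = d i) ∧
    (∀ i < j, s'.arr aLab (d i) = d 0 + 1) ∧
    (∀ e, (∀ i < j, d i ≠ e) → s'.arr aLab e = s.arr aLab e) ∧
    (∀ i, 0 < i → i < j → s'.arr aVst (x i) = d 0 + 2) ∧
    (∀ v, (∀ i, 0 < i → i < j → x i ≠ v) → s'.arr aVst v = s.arr aVst v) ∧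
    (∀ i, 0 < i → i < j → s'.arr aNv (x i) = x (i + 1) ∧ s'.arr aNe (x i) = d i) ∧
    (∀ v, (∀ i, 0 < i → i < j → x i ≠ v) → s'.arr aNv v = s.arr aNv v ∧ s'.arr aNe v = s.arr aNe v) ∧
    s'.arr aSrc = Function.update (s.arr aSrc) (d 0) (x 0) ∧ s'.arr aTgt = s.arr aTgt)
    hl ?_ ?_ ?_ ?_).mono (by simp [Expr.cost, Expr.eq, Expr.ne, Expr.isZero]; omega) ?_)
  · refine ⟨le_rfl, ?_, ?_, ?_, ?_, ?_, ?_, ?_, ?_, ?_, ?_⟩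
    · rw [hrun]
      funext y
      simp only [State.setCell_var, Function.update_apply]
      split_ifs with h
      · rw [h, hw]
      · rfl
    · rw [hX₁.1, hX₁.2]; exact hnext
    · intro i hi
      obtain rfl : i = 0 := by omega
      rw [hrun]; simp
    · intro e he
      have := he 0 (by omega)
      rw [hrun]; simp [this.symm]
    · intro i h1 h2; omega
    · intro v _; rw [hrun]; simp
    · intro i h1 h2; omega
    · intro v _; rw [hrun]; simp
    · rw [hrun]; simp
    · rw [hrun]; simp
  · rintro j s' hj ⟨h1, h2, -, -, -, h3, h4, -⟩
    rw [ne_eq, Expr.eval_eq_eq_zero, not_not]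
    simp only [Expr.eval, h2, Function.update_self]
    -- The interior vertices are distinct, so the state of `x j` has not been changed yet.
    rw [h4 _ (fun i hi hij hx => by
      have := hinj i j hi (by omega) (by omega) hj hx; omega), hK j (by omega) hj]
    simp
  · rintro s' ⟨h1, h2, -, -, -, h3, h4, -⟩
    rw [Expr.eval_eq_eq_zero]
    simp only [Expr.eval, h2, Function.update_self]
    rw [h4 _ (fun i hi hij hx => hK' (by rw [← hx, hK i hi hij]))]
    simpa using hK'
  · rintro j s' hj ⟨h1, h2, h4, h5, h6, h7, h8, h9, h10, h11, h12⟩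
    apply Ends.flat (by rfl) (by simp [relabelStep, Prog.cost, Expr.cost])
    obtain ⟨r1, r2, r3, r4, r5, r6, r7, r8, r9⟩ := relabelStep_run hXY s'
    have hw' : s'.var vW = x j := by rw [h2]; simp
    have hd' : s'.var vD = d 0 := by rw [h2]; simp [hd]
    rw [hw', hd'] at r2
    rw [hw', (h4 j h1 hj).1] at r1 r3
    rw [hw', (h4 j h1 hj).2] at r4
    rw [hw', (h4 j h1 hj).2, hd'] at r5
    have hxj : ∀ i, 0 < i → i < j → x i ≠ x j := fun i hi hij hx => by
      have := hinj i j hi (by omega) (by omega) hj hx; omega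
    refine ⟨by omega, ?_, ?_, ?_, ?_, ?_, ?_, ?_, ?_, r8.trans h11, r9.trans h12⟩
    · rw [r1, h2]; simp
    · rw [r6, r7]; exact h4
    · intro i hi
      rw [r5, Function.update_apply]
      split_ifs with h
      · rfl
      · exact h5 i (by
          have : i ≠ j := by rintro rfl; exact h rfl
          omega)
    · intro e he
      rw [r5, Function.update_of_ne (he j (by omega)).symm]
      exact h6 e fun i hi => he i (by omega)
    · intro i hi hij
      rw [r2, Function.update_apply]
      split_ifs with h
      · rfl
      · exact h7 i hi (by
          have : i ≠ j := by rintro rfl; exact h rfl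
          omega)
    · intro v hv
      rw [r2, Function.update_of_ne (hv j (by omega) (by omega)).symm]
      exact h8 v fun i hi hij => hv i hi (by omega)
    · intro i hi hij
      rw [r3, r4]
      by_cases h : i = j
      · subst h; simp
      · rw [Function.update_of_ne (hxj i hi (by omega)), Function.update_of_ne (hxj i hi (by omega))]
        exact h9 i hi (by omega)
    · intro v hv
      rw [r3, r4, Function.update_of_ne (hv j (by omega) (by omega)).symm,
        Function.update_of_ne (hv j (by omega) (by omega)).symm]
      exact h10 v fun i hi hij => hv i hi (by omega)
  · rintro s' ⟨-, h2, -, h5, h6, h7, h8, h9, h10, h11, h12⟩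
    apply Ends.flat (by rfl) (by decide)
    have hw' : s'.var vW = x l := by rw [h2]; simp
    have hd' : s'.var vD = d 0 := by rw [h2]; simp [hd]
    simp only [Prog.run, Expr.eval, hw', hd']
    refine ⟨⟨?_, ?_, ?_, ?_, ?_, ?_, ?_, ?_⟩, ?_, ?_⟩
    · simpa [State.layout] using h5
    · simpa [State.layout] using h6
    · simpa [State.layout] using h7
    · simpa [State.layout] using h8
    · simpa [State.layout] using h9
    · simpa [State.layout] using h10
    · simpa [State.layout] using h11
    · simp [State.layout, h12]
    · simpa using hw'
    · intro y hy
      simp [h2, hy]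

/-- Divide an edge of the multigraph by the vertex `vQ` on its path. -/
def divide : Prog :=
  (.assign vF (.minus (.cell aVst (.var vQ)) (.const 2)) ;;
    .assign vFF (.cell aNe (.var vQ)) ;;
    .assign vFu (.cell aSrc (.var vF)) ;;
    .assign vFv (.cell aTgt (.var vF)) ;;
    .store aVst (.var vQ) (.const 1) ;;
    .assign vD (.var vFF) ;; .assign vY (.var vQ) ;; .assign vW (.cell aNv (.var vQ)) ;;
    .assign vK (.plus (.var vF) (.const 2))) ;;
  relabel aNv aNe ;;
  .store aTgt (.var vF) (.var vQ)

/-- The vertex `vQ` becomes a branch vertex first, then the rest of the path is renamed, and finally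
the first part receives its new target. The hypothesis `htgt` guarantees that the renaming stops at
the old target: `Embedded` alone does not exclude that the end of a path has the state of its
interior vertices. -/
theorem divide_spec {s : State} {G : Graph ℕ ℕ} {n m f : ℕ} (hD : s.layout.Embedded G n m)
    (ha : s.arr aVst (s.var vQ) = f + 2) (htgt : s.arr aVst (s.arr aTgt f) ≠ f + 2) :
    Ends divide s (100 * (n + 2)) fun s' => ∃ l j x d, s.layout.Link G f l x d ∧ 0 < j ∧ j < l ∧
      x j = s.var vQ ∧ s.layout.Divided s'.layout f l j x d ∧ s'.var vF = f ∧ s'.var vFF = d j ∧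
      s'.var vFu = s.arr aSrc f ∧ s'.var vFv = s.arr aTgt f := by
  obtain ⟨l, x, d, hL⟩ := hD.exists_link f (hD.vst_label _ f ha)
  obtain ⟨j, hj, hjl, hja⟩ := (hL.vst_iff _).1 ha
  have hvst : ∀ i, 0 < i → i < l → s.arr aVst (x i) = f + 2 := fun i hi hil =>
    (hL.vst_iff _).2 ⟨i, hi, hil, rfl⟩
  -- The `l - 1` interior vertices are distinct vertices of `G`, which bounds the time by O(n).
  have hln : l - 1 ≤ n := le_of_injective_below (f := fun i => x (i + 1))
    (fun i hi => hD.vst_lt _ (by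
      have h1 := hvst (i + 1) (by omega) (by omega)
      have h2 : s.layout.vst (x (i + 1)) = f + 2 := h1
      omega))
    (fun i hi i' hi' h => by
      have := hL.inj (i + 1) (i' + 1) (by omega) (by omega) (by omega) (by omega) h
      omega)
  have hnext : s.arr aNv (s.var vQ) = x (j + 1) ∧ s.arr aNe (s.var vQ) = d j := by
    rw [← hja]; exact hL.next j hj hjl
  refine Ends.mono (T := 36 + (60 * (l - j + 1) + 3)) (Ends.seq (Ends.flat (by rfl) (by decide) ?_))
    (by omega) fun _ h => h
  set s₁ := Prog.run _ s with hs₁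
  have hrun : s₁ = (((((((((s.setVar vF f).setVar vFF (d j)).setVar vFu (s.arr aSrc f)).setVar vFv
      (s.arr aTgt f)).setCell aVst (s.var vQ) 1).setVar vD (d j)).setVar vY (s.var vQ)).setVar vW
      (x (j + 1))).setVar vK (f + 2)) := by
    rw [hs₁]; simp [Prog.run, Expr.eval, ha, hnext]
  clear_value s₁
  have hlay : s₁.layout = { s.layout with vst := Function.update s.layout.vst (x j) 1 } := by
    rw [hrun, hja]; simp [State.layout]
  have hvst₁ : s₁.arr aVst = Function.update (s.arr aVst) (x j) 1 := by rw [hrun, hja]; simp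
  have hxl : s.arr aVst (x l) ≠ f + 2 := by rw [hL.tgt_eq]; exact htgt
  have hk : s₁.var vK = f + 2 := by rw [hrun]; simp
  refine Ends.seq ((relabel_spec (s := s₁) (l := l - j) (x := fun i => x (j + i))
    (d := fun i => d (j + i)) (Or.inl ⟨rfl, rfl⟩) (by omega) (by rw [hrun]; simp)
    (by rw [hrun]; simp [hja]) (by rw [hrun]; simp) ?_ ?_ ?_ ?_).mono le_rfl ?_)
  · intro i hi hil
    have := hL.next (j + i) (by omega) (by omega)
    rw [hrun]
    simpa [State.layout, Nat.add_assoc] using this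
  · intro i hi hil
    rw [hvst₁, hk, Function.update_of_ne, hvst _ (by omega) (by omega)]
    intro h
    have := hL.inj _ _ (by omega) (by omega) hj hjl h
    omega
  · rw [hvst₁, hk, Nat.add_sub_cancel' hjl.le, Function.update_of_ne]
    · exact hxl
    · intro h
      rw [h, hvst j hj hjl] at hxl
      exact hxl rfl
  · intro i i' h1 h2 h3 h4 h5
    have := hL.inj _ _ (by omega) (by omega) (by omega) (by omega) h5
    omega
  · rintro s₂ ⟨h1, h2, h3⟩
    rw [hlay] at h1
    apply Ends.flat (by rfl) (by decide)
    simp only [Prog.run, Expr.eval, h3 _ (show vF ≠ vW by decide), h3 _ (show vQ ≠ vW by decide),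
      h3 _ (show vFF ≠ vW by decide), h3 _ (show vFu ≠ vW by decide), h3 _ (show vFv ≠ vW by decide),
      State.setCell_var]
    refine ⟨l, j, x, d, hL, hj, hjl, hja, ⟨s₂.layout, h1, ?_⟩, ?_⟩
    · rw [hrun, hja]; simp [State.layout]
    · rw [hrun]; simp

/-! ### The search for an ear -/

/-- The arcs of the search lead to vertices outside the subgraph. -/
def earArcs : Prog :=
  .assign vI (.const 0) ;;
  .upTo vI vArcs (.store aArcE (.var vI) (.const 0) ;;
    .store aArcW (.var vI) (.cell aNbr (.var vI)) ;;
    .when (.isZero (.cell aLab (.cell aEdg (.var vI)))) (.when (.ne (.cell aEdg (.var vI)) (.var vE0))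
      (.when (.isZero (.cell aVst (.cell aNbr (.var vI))))
        (.store aArcE (.var vI) (.plus (.cell aEdg (.var vI)) (.const 1))))))

/-- The search starts with `vZ` and the interior vertices of a path. -/
def earRoots : Prog :=
  .assign vI (.const 0) ;;
  .upTo vI vN (.store aVis (.var vI) (.const 0) ;;
    .when (.eq (.var vI) (.var vZ)) (.store aVis (.var vI) (.const 1)) ;;
    .when (.eq (.cell aVst (.var vI)) (.var vKey)) (.store aVis (.var vI) (.const 1)))

/-- Find an edge `vE` from a reached vertex `vBv` to a vertex `vB` of the subgraph. -/
def earTarget : Prog :=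
  .assign vI (.const 0) ;;
  .upTo vI vArcs (.when (.cell aVis (.cell aOwn (.var vI)))
    (.when (.isZero (.cell aLab (.cell aEdg (.var vI)))) (.when (.ne (.cell aEdg (.var vI)) (.var vE0))
      (.when (.cell aVst (.cell aNbr (.var vI)))
        (.when (.ne (.cell aVst (.cell aNbr (.var vI))) (.var vKey))
          (.assign vB (.cell aNbr (.var vI)) ;; .assign vBv (.cell aOwn (.var vI)) ;;
            .assign vE (.cell aEdg (.var vI))))))))

/-- Search an ear. -/
def earSearch : Prog :=
  earArcs ;; earRoots ;; bfs ;;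
  (.store aPar (.var vZ) (.var vA0) ;; .store aPe (.var vZ) (.var vE0)) ;; earTarget

theorem earArcs_spec (s : State) :
    Ends earArcs s (80 * s.var vArcs + 6) fun s' => (∀ p < s.var vArcs,
      (s'.arr aArcE p ≠ 0 ↔ s.arr aLab (s.arr aEdg p) = 0 ∧ s.arr aEdg p ≠ s.var vE0 ∧
        s.arr aVst (s.arr aNbr p) = 0) ∧ (s'.arr aArcE p ≠ 0 → s'.arr aArcE p = s.arr aEdg p + 1) ∧
        s'.arr aArcW p = s.arr aNbr p) ∧ Frame [vI] [aArcE, aArcW] s s' := by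
  refine Ends.mono (T := 2 + ((72 + 8) * (s.var vArcs - 0) + 4))
    (Ends.seq (Ends.flat (by rfl) (by decide) ?_)) (by omega) fun _ h => h
  simp only [Prog.run, Expr.eval]
  refine (Ends.upTo (lo := 0) (hi := s.var vArcs) (fun j s' => ∀ p < j,
    (s'.arr aArcE p ≠ 0 ↔ s.arr aLab (s.arr aEdg p) = 0 ∧ s.arr aEdg p ≠ s.var vE0 ∧
        s.arr aVst (s.arr aNbr p) = 0) ∧ (s'.arr aArcE p ≠ 0 → s'.arr aArcE p = s.arr aEdg p + 1) ∧
        s'.arr aArcW p = s.arr aNbr p)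
    (by decide) (by decide) (by decide) (by simp) (by simp) (Nat.zero_le _)
    (by intro p hp; omega) ?_).mono le_rfl ?_
  · intro j s' _ hj hij hfr hinv
    have hX : ∀ X, X ≠ aArcE → X ≠ aArcW → s'.arr X = s.arr X := by
      intro X h1 h2
      rw [hfr.2 X (by simp [Prog.arrs, Prog.when, h1, h2])]; simp
    have hl0 : s'.arr aLab = s.arr aLab := hX _ (by decide) (by decide)
    have hl1 : s'.arr aEdg = s.arr aEdg := hX _ (by decide) (by decide)
    have hl2 : s'.arr aVst = s.arr aVst := hX _ (by decide) (by decide)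
    have hl3 : s'.arr aNbr = s.arr aNbr := hX _ (by decide) (by decide)
    have hl5 : s'.var vE0 = s.var vE0 := by rw [hfr.1 _ (by decide)]; simp
    apply Ends.flat (by rfl) (by decide)
    intro p hp
    simp only [Prog.run, Prog.when, ne_eq, Expr.eval_ne_eq_zero, Expr.eval_isZero_eq_zero, Expr.eval,
      State.setVar_arr, State.setCell_var, State.setCell_arr, Nat.reduceEqDiff, reduceIte, hij, hl0,
      hl1, hl2, hl3, hl5, not_not]
    by_cases hpj : p = j
    · subst hpj
      split_ifs with h1 h2 h3 <;> simp_all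
    · have := hinv p (by omega)
      split_ifs with h1 h2 h3 <;> simpa [hpj] using this
  · rintro s' ⟨h1, -, h2⟩
    refine ⟨h1, fun x hx => ?_, fun X hX => ?_⟩
    · simp only [List.mem_cons, List.not_mem_nil, or_false] at hx
      rw [h2.1 x (by simp [Prog.vars, Prog.when, hx])]; simp [hx]
    · simp only [List.mem_cons, List.not_mem_nil, or_false, not_or] at hX
      rw [h2.2 X (by simp [Prog.arrs, Prog.when, hX])]; simp

theorem earRoots_spec (s : State) :
    Ends earRoots s (60 * s.var vN + 6) fun s' => (∀ v < s.var vN,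
      (s'.arr aVis v ≠ 0 ↔ v = s.var vZ ∨ s.arr aVst v = s.var vKey)) ∧ Frame [vI] [aVis] s s' := by
  refine Ends.mono (T := 2 + ((52 + 8) * (s.var vN - 0) + 4))
    (Ends.seq (Ends.flat (by rfl) (by decide) ?_)) (by omega) fun _ h => h
  simp only [Prog.run, Expr.eval]
  refine (Ends.upTo (lo := 0) (hi := s.var vN) (fun j s' => ∀ v < j,
      (s'.arr aVis v ≠ 0 ↔ v = s.var vZ ∨ s.arr aVst v = s.var vKey))
    (by decide) (by decide) (by decide) (by simp) (by simp) (Nat.zero_le _)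
    (by intro p hp; omega) ?_).mono le_rfl ?_
  · intro j s' _ hj hij hfr hinv
    have hx : s'.var vZ = s.var vZ := by rw [hfr.1 vZ (by decide)]; simp
    have hx' : s'.var vKey = s.var vKey := by rw [hfr.1 vKey (by decide)]; simp
    have hX : s'.arr aVst = s.arr aVst := by rw [hfr.2 aVst (by decide)]; simp
    apply Ends.flat (by rfl) (by decide)
    intro v hv
    have hrun : ∀ s₁ : State, s₁ = Prog.run (.store aVis (.var vI) (.const 0) ;;
      .when (.eq (.var vI) (.var vZ)) (.store aVis (.var vI) (.const 1)) ;;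
      .when (.eq (.cell aVst (.var vI)) (.var vKey)) (.store aVis (.var vI) (.const 1))) s' →
      s₁.arr aVis = Function.update (s'.arr aVis) j
        (if j = s.var vZ ∨ s.arr aVst j = s.var vKey then 1 else 0) := by
      rintro s₁ rfl
      by_cases h1 : j = s.var vZ <;> by_cases h2 : s.arr aVst j = s.var vKey <;>
        simp [Prog.run, Prog.when, Expr.eval, hij, hx, hx', hX, h1, h2] <;> simp_all
    rw [State.setVar_arr, hrun _ rfl, Function.update_apply]
    by_cases hvj : v = j
    · subst hvj
      rw [if_pos rfl]
      split_ifs with h <;> simp [h]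
    · rw [if_neg hvj]
      exact hinv v (by omega)
  · rintro s' ⟨h1, -, h2⟩
    refine ⟨h1, fun x hx => ?_, fun X hX => ?_⟩
    · simp only [List.mem_cons, List.not_mem_nil, or_false] at hx
      rw [h2.1 x (by simp [Prog.vars, Prog.when, hx])]; simp [hx]
    · simp only [List.mem_cons, List.not_mem_nil, or_false] at hX
      rw [h2.2 X (by simp [Prog.arrs, Prog.when, hX])]; simp

/-- The arc `p` leads from a reached vertex to a vertex of the subgraph outside the path of roots. -/
def State.IsTarget (s : State) (p : ℕ) : Prop :=
  s.arr aVis (s.arr aOwn p) ≠ 0 ∧ s.arr aLab (s.arr aEdg p) = 0 ∧ s.arr aEdg p ≠ s.var vE0 ∧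
    s.arr aVst (s.arr aNbr p) ≠ 0 ∧ s.arr aVst (s.arr aNbr p) ≠ s.var vKey

theorem earTarget_spec {s : State} (h : ∃ p < s.var vArcs, s.IsTarget p) :
    Ends earTarget s (80 * s.var vArcs + 6) fun s' => (∃ p < s.var vArcs, s.IsTarget p ∧
      s'.var vB = s.arr aNbr p ∧ s'.var vBv = s.arr aOwn p ∧ s'.var vE = s.arr aEdg p) ∧
      Frame [vI, vB, vBv, vE] [] s s' := by
  refine Ends.mono (T := 2 + ((72 + 8) * (s.var vArcs - 0) + 4))
    (Ends.seq (Ends.flat (by rfl) (by decide) ?_)) (by omega) fun _ h => h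
  simp only [Prog.run, Expr.eval]
  -- The invariant claims something only after a target has been met. Later targets replace earlier
  -- ones.
  refine (Ends.upTo (lo := 0) (hi := s.var vArcs) (fun j s' => (∃ p < j, s.IsTarget p) →
      ∃ p < s.var vArcs, s.IsTarget p ∧
      s'.var vB = s.arr aNbr p ∧ s'.var vBv = s.arr aOwn p ∧ s'.var vE = s.arr aEdg p)
    (by decide) (by decide) (by decide) (by simp) (by simp) (Nat.zero_le _)
    (by rintro ⟨p, hp, -⟩; omega) ?_).mono le_rfl ?_
  · intro j s' _ hj hij hfr hinv
    have hX : s'.arr = s.arr := by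
      funext X
      rw [hfr.2 X (by simp [Prog.arrs, Prog.when])]; simp
    have hx : s'.var vE0 = s.var vE0 := by rw [hfr.1 _ (by decide)]; simp
    have hx' : s'.var vKey = s.var vKey := by rw [hfr.1 _ (by decide)]; simp
    apply Ends.flat (by rfl) (by decide)
    simp only [Prog.run, Prog.when, ne_eq, Expr.eval_ne_eq_zero, Expr.eval_isZero_eq_zero, Expr.eval,
      State.setVar_var, State.setVar_arr, Nat.reduceEqDiff, reduceIte, hij, hX, hx, hx', not_not]
    by_cases hj' : s.IsTarget j
    · obtain ⟨h1, h2, h3, h4, h5⟩ := hj'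
      intro _
      refine ⟨j, hj, ⟨h1, h2, h3, h4, h5⟩, ?_⟩
      simp [h1, h2, h3, h4, h5]
    · rintro ⟨p, hp, hp'⟩
      have hpj : p ≠ j := by rintro rfl; exact hj' hp'
      obtain ⟨q, hq, hq', h6⟩ := hinv ⟨p, by omega, hp'⟩
      refine ⟨q, hq, hq', ?_⟩
      split_ifs with h1 h2 h3 h4 h5 <;> first | exact h6 | exact absurd ⟨h1, h2, h3, h4, h5⟩ hj'
  · rintro s' ⟨h1, -, h2⟩
    refine ⟨h1 h, fun x hx => ?_, fun X hX => ?_⟩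
    · simp only [List.mem_cons, List.not_mem_nil, or_false, not_or] at hx
      rw [h2.1 x (by simp [Prog.vars, Prog.when, hx])]; simp [hx]
    · rw [h2.2 X (by simp [Prog.arrs, Prog.when])]; simp

end RAM

namespace Layout

variable {G : Graph ℕ ℕ} {n m : ℕ} {D D' : Layout} {f l j : ℕ} {x d : ℕ → ℕ}

theorem Divided.vst_of_ne (hdiv : D.Divided D' f l j x d) (hL : D.Link G f l x d) (hj : 0 < j)
    (hjl : j < l) {v : ℕ} (hv : D.vst v ≠ f + 2) : D'.vst v = D.vst v := by
  rcases hdiv.vst_cases hL hj hjl v with ⟨-, h, -⟩ | ⟨-, h, -⟩ | ⟨-, h⟩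
  · exact absurd h hv
  · exact absurd h hv
  · exact h

end Layout

namespace RAM

/-- The roots are `z` and all vertices with the state `key`, and the search proceeds through
vertices outside the subgraph, along edges other than `e₀`. The set of reached vertices is closed in
the sense of `Layout.Embedded.exists_target`, so an arc to a suitable vertex `b` exists, and
`Layout.exists_ear` turns it and the pointers into an ear. -/
theorem earSearch_spec : ∃ C : ℕ, ∀ (G : Graph ℕ ℕ) (n m : ℕ) (s : State), G.vertexSet = Set.Iio n →
    G.edgeSet = Set.Iio m → G.IsEdgeConnected 3 → Static G n m s → s.layout.Good G n m →
    s.layout.SearchStart G m (s.var vZ) (s.var vKey) (s.var vE0) (s.var vA0) → s.var vZ < n →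
    Ends earSearch s (C * (n + m + 1)) fun s' => ∃ r,
      s.layout.Ear G (r + 1)
        (fun i => if i = 0 then s'.var vB else (s'.arr aPar)^[i - 1] (s'.var vBv))
        (fun i => if i = 0 then s'.var vE else s'.arr aPe ((s'.arr aPar)^[i - 1] (s'.var vBv))) ∧
      (2 ≤ s.layout.vst (s.var vZ) ∧ s.layout.vst ((s'.arr aPar)^[r] (s'.var vBv)) = s.var vKey ∨
        s.layout.vst (s.var vZ) = 0 ∧ s.layout.vst ((s'.arr aPar)^[r] (s'.var vBv)) = 1 ∧ 0 < r) ∧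
      s.layout.vst (s'.var vB) ≠ s.var vKey := by
  obtain ⟨C, hC⟩ := bfs_spec
  refine ⟨4 * C + 1000, fun G n m s hV hE hG hs hD hstart hzn => ?_⟩
  have hkey0 : s.var vKey ≠ 0 := by rcases hstart with ⟨h1, h2, -⟩ | ⟨-, h2, -⟩ <;> omega
  refine Ends.mono (T := 80 * s.var vArcs + 6 + ((60 * n + 6) + (C * (n + s.arr aOff n + 1) + (6 +
    (80 * s.var vArcs + 6))))) (Ends.seq ((earArcs_spec s).mono le_rfl ?_)) ?_ fun _ h => h
  rotate_left
  · rw [hs.var_arcs]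
    have := hs.arcs_le
    nlinarith [Nat.mul_le_mul_left C this, Nat.zero_le (C * n), Nat.zero_le (C * m)]
  rintro s₁ ⟨harc, hfr₁⟩
  have hn₁ : s₁.var vN = n := by rw [hfr₁.1 vN (by decide)]; exact hs.var_n
  have h2 := earRoots_spec s₁
  rw [hn₁] at h2
  refine Ends.seq (h2.mono le_rfl ?_)
  rintro s₂ ⟨hvis, hfr₂⟩
  have hfr₁₂ : Frame [vI] [aArcE, aArcW, aVis] s s₂ :=
    (hfr₁.mono (by decide) (by decide)).trans (hfr₂.mono (by decide) (by decide))
  have hoff : s₂.arr aOff = s.arr aOff := hfr₁₂.2 _ (by decide)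
  have hn₂ : s₂.var vN = n := by rw [hfr₂.1 vN (by decide), hn₁]
  rw [show s₁.arr aVst = s.arr aVst from hfr₁.2 _ (by decide), show s₁.var vZ = s.var vZ from
    hfr₁.1 _ (by decide), show s₁.var vKey = s.var vKey from hfr₁.1 _ (by decide)] at hvis
  have hE₂ : s₂.arr aArcE = s₁.arr aArcE := hfr₂.2 aArcE (by decide)
  have hW₂ : s₂.arr aArcW = s₁.arr aArcW := hfr₂.2 aArcW (by decide)
  have hpM : ∀ v < n, ∀ p, p < s.arr aOff (v + 1) → p < s.var vArcs := by
    intro v hv p hp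
    rw [hs.var_arcs]
    exact hp.trans_le (hs.off_le hv)
  have hlink : ∀ v < n, ∀ p, s.arr aOff v ≤ p → p < s.arr aOff (v + 1) →
      G.IsLink (s.arr aEdg p) v (s.arr aNbr p) := by
    intro v hv p hp1 hp2
    have := (hs.arc p (by rw [← hs.var_arcs]; exact hpM v hv p hp2)).2.2.2
    rwa [hs.own v hv p hp1 hp2] at this
  have hlt : ∀ {e v w}, G.IsLink e v w → w < n := by
    intro e v w h
    have := h.right_mem
    rwa [hV] at this
  have h3 := hC n s₂ hn₂ (by rw [hoff]; exact hs.off_mono) (by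
    rw [hoff, hE₂, hW₂]
    intro v hv p hp1 hp2 hp3
    rw [(harc p (hpM v hv p hp2)).2.2]
    exact hlt (hlink v hv p hp1 hp2))
  rw [hoff] at h3
  refine Ends.seq (h3.frame.mono le_rfl ?_)
  rintro s₃ ⟨h, hfr₃⟩
  have hfr : ∀ x, x ∉ vI :: bfs.vars → s₃.var x = s.var x := fun x hx => by
    simp only [List.mem_cons, not_or] at hx
    rw [hfr₃.1 x hx.2, hfr₁₂.1 x (by simp [hx.1])]
  have hfrA : ∀ X, X ≠ aArcE → X ≠ aArcW → X ≠ aVis → X ∉ bfs.arrs → s₃.arr X = s.arr X :=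
    fun X h1 h2 h3 h4 => by rw [hfr₃.2 X h4, hfr₁₂.2 X (by simp [h1, h2, h3])]
  refine Ends.seq (Ends.flat (by rfl) (by decide) ?_)
  set s₄ := Prog.run _ s₃ with hs₄
  -- The root `z` receives the pointer along `e₀` to `a₀`. It is used only if `z` lies outside the
  -- subgraph; otherwise the path of pointers halts at `z`.
  have hrun : s₄ = (s₃.setCell aPar (s.var vZ) (s.var vA0)).setCell aPe (s.var vZ) (s.var vE0) := by
    rw [hs₄]
    simp only [Prog.run, Expr.eval, State.setCell_var, hfr vZ (by decide), hfr vA0 (by decide),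
      hfr vE0 (by decide)]
  clear_value s₄
  obtain ⟨rank, htree⟩ := h.tree
  have hclosed := h.closed
  rw [hoff, hE₂, hW₂] at htree hclosed
  let X : Set ℕ := {v | v < n ∧ s₃.arr aVis v ≠ 0}
  have hX : ∀ v ∈ X, s.layout.vst v = 0 ∨ s.layout.vst v = s.var vKey := by
    rintro v ⟨hv, hv3⟩
    rcases htree v hv hv3 with h4 | ⟨h4, -, -, p, h5, h6, h7, h8, -⟩
    · rcases (hvis v hv).1 h4 with rfl | h5
      · rcases hstart with ⟨-, h6, -⟩ | ⟨h6, -⟩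
        · exact Or.inr h6.symm
        · exact Or.inl h6
      · exact Or.inr h5
    · left
      have h9 := harc p (hpM _ h4 p h6)
      rw [← h8, h9.2.2]
      exact (h9.1.1 h7).2.2
  have hz : s.var vZ ∈ X := ⟨hzn, h.roots _ hzn ((hvis _ hzn).2 (Or.inl rfl))⟩
  have htarget := hD.toEmbedded.exists_target hD.closed hE hV hG ⟨0, hD.root⟩ hstart hz hzn
    (fun v hv => by
      have hvn : v < n := hD.vst_lt v (by omega)
      exact ⟨hvn, h.roots v hvn ((hvis v hvn).2 (Or.inr hv))⟩) hX
    (fun e v w hv hl hlab hee hw => by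
      obtain ⟨p, hp, h7, h8, h9⟩ := hs.exists_arc e v w hl
      obtain ⟨-, h10, h11, -⟩ := hs.arc p hp
      rw [h7] at h10 h11
      have h12 := harc p (by rwa [hs.var_arcs])
      have h13 : s₁.arr aArcE p ≠ 0 := h12.1.2 (by rw [h8, h9]; exact ⟨hlab, hee, hw⟩)
      have h14 := hclosed v hv.1 hv.2 p h10 h11 h13
      rw [h12.2.2, h9] at h14
      exact ⟨hlt hl, h14⟩)
  have hv4 : ∀ x, x ∉ vI :: bfs.vars → s₄.var x = s.var x := fun x hx => by
    rw [hrun]; simpa using hfr x hx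
  have ha4 : ∀ X, X ≠ aArcE → X ≠ aArcW → X ≠ aVis → X ∉ bfs.arrs → X ≠ aPar → X ≠ aPe →
      s₄.arr X = s.arr X := fun X h1 h2 h3 h4 h5 h6 => by
    rw [hrun]; simpa [h5, h6] using hfrA X h1 h2 h3 h4
  have hIs : ∀ p, s₄.IsTarget p ↔ s₃.arr aVis (s.arr aOwn p) ≠ 0 ∧ s.arr aLab (s.arr aEdg p) = 0 ∧
      s.arr aEdg p ≠ s.var vE0 ∧ s.arr aVst (s.arr aNbr p) ≠ 0 ∧
      s.arr aVst (s.arr aNbr p) ≠ s.var vKey := by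
    intro p
    have h1 : s₄.arr aVis = s₃.arr aVis := by rw [hrun]; simp
    simp only [State.IsTarget, h1, hv4 vE0 (by decide), hv4 vKey (by decide),
      ha4 aOwn (by decide) (by decide) (by decide) (by decide) (by decide) (by decide),
      ha4 aLab (by decide) (by decide) (by decide) (by decide) (by decide) (by decide),
      ha4 aVst (by decide) (by decide) (by decide) (by decide) (by decide) (by decide),
      ha4 aNbr (by decide) (by decide) (by decide) (by decide) (by decide) (by decide),
      ha4 aEdg (by decide) (by decide) (by decide) (by decide) (by decide) (by decide)]
  have hM4 : s₄.var vArcs = s.var vArcs := hv4 _ (by decide)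
  have h5 := earTarget_spec (s := s₄) (by
    obtain ⟨e, v, w, h6, h7, h8, h9, h10, h11⟩ := htarget
    obtain ⟨p, hp, h12, h13, h14⟩ := hs.exists_arc e v w h7
    refine ⟨p, by rw [hM4, hs.var_arcs]; exact hp, ?_⟩
    rw [hIs, h12, h13, h14]
    exact ⟨h6.2, h8, h9, h10, h11⟩)
  rw [hM4] at h5
  refine h5.mono le_rfl ?_
  rintro s₅ ⟨⟨p, hp, hpT, hB, hBv, hEe⟩, hfr₅⟩
  rw [hIs] at hpT
  rw [ha4 aNbr (by decide) (by decide) (by decide) (by decide) (by decide) (by decide)] at hB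
  rw [ha4 aOwn (by decide) (by decide) (by decide) (by decide) (by decide) (by decide)] at hBv
  rw [ha4 aEdg (by decide) (by decide) (by decide) (by decide) (by decide) (by decide)] at hEe
  obtain ⟨hpT1, hpT2, hpT3, hpT4, hpT5⟩ := hpT
  obtain ⟨ho1, ho2, ho3, ho4⟩ := hs.arc p (by rwa [← hs.var_arcs])
  have hPar : s₅.arr aPar = Function.update (s₃.arr aPar) (s.var vZ) (s.var vA0) := by
    rw [hfr₅.2 aPar (by simp), hrun]; simp
  have hPe : s₅.arr aPe = Function.update (s₃.arr aPe) (s.var vZ) (s.var vE0) := by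
    rw [hfr₅.2 aPe (by simp), hrun]; simp
  obtain ⟨r, h6, h7⟩ := Layout.exists_ear (G := G) (D := s.layout) (X := X) (par := s₅.arr aPar)
    (pe := s₅.arr aPe) (rank := rank) (v := s₅.var vBv) (e := s₅.var vE) (b := s₅.var vB) hstart
    hD.toEmbedded.key_ne hX
    (by
      rintro v ⟨hv, hv3⟩ hvz hv0
      rw [hPar, hPe, Function.update_of_ne hvz, Function.update_of_ne hvz]
      rcases htree v hv hv3 with h4 | ⟨h4, h4', h4'', q, h5, h6, h7, h8, h9⟩
      · rcases (hvis v hv).1 h4 with h5 | h5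
        · exact absurd h5 hvz
        · exact absurd (h5.symm.trans hv0) hkey0
      · have h10 := harc q (hpM _ h4 q h6)
        have h11 := h10.1.1 h7
        have h12 := hlink _ h4 q h5 h6
        rw [← h10.2.2, h8] at h12
        have h13 : s₃.arr aPe v = s.arr aEdg q := by rw [h9, h10.2.1 h7]; rfl
        rw [h13]
        exact ⟨⟨h4, h4'⟩, h4'', h12.symm, h11.1, h11.2.1⟩)
    (by rw [hPar, hPe]; simp) (by rw [hBv]; exact ⟨ho1, hpT1⟩)
    (by rw [hEe, hB, hBv]; exact ho4.symm) (by rw [hEe]; exact hpT2) (by rw [hEe]; exact hpT3)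
    (by rw [hB]; exact hpT4) (by rw [hB]; exact hpT5)
  refine ⟨r, h6, h7.imp id fun h => ⟨h.1, h.2.1, ?_⟩, by rw [hB]; exact hpT5⟩
  obtain ⟨i, hi, -⟩ := h.2.2
  omega

/-- Add the ear to the subgraph. -/
def makeEar : Prog :=
  (.assign vD (.var vE) ;; .assign vY (.var vB) ;; .assign vW (.var vBv) ;; .assign vK (.const 0)) ;;
  relabel aPar aPe ;; .assign vA (.var vW)

/-- The interior vertices of the ear have the state 0, so the relabelling follows the parent
pointers until it meets the subgraph; there it finds the end `a`. -/
theorem makeEar_spec {s : State} {G : Graph ℕ ℕ} {l : ℕ} {x d : ℕ → ℕ} (he : s.layout.Ear G l x d)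
    (hd : d 0 = s.var vE) (hx0 : x 0 = s.var vB) (hx1 : x 1 = s.var vBv)
    (hnext : ∀ i, 0 < i → i < l → s.arr aPar (x i) = x (i + 1) ∧ s.arr aPe (x i) = d i) :
    Ends makeEar s (60 * (l + 2)) fun s' => s.layout.Relabeled s'.layout l x d ∧ s'.var vA = x l := by
  refine Ends.mono (T := 8 + (60 * (l + 1) + 2)) (Ends.seq (Ends.flat (by rfl) (by decide) ?_))
    (by omega) fun _ h => h
  set s₁ := Prog.run _ s with hs₁
  have hrun : s₁ = ((((s.setVar vD (s.var vE)).setVar vY (s.var vB)).setVar vW (s.var vBv)).setVar vK 0) := by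
    rw [hs₁]; simp [Prog.run, Expr.eval]
  clear_value s₁
  have hlay : s₁.layout = s.layout := by rw [hrun]; rfl
  refine Ends.seq ((relabel_spec (s := s₁) (l := l) (x := x) (d := d) (Or.inr ⟨rfl, rfl⟩) he.pos
    (by rw [hrun]; simp [hd]) (by rw [hrun]; simp [hx0]) (by rw [hrun]; simp [hx1])
    (by rw [hrun]; simpa using hnext) ?_ ?_ he.inj).mono le_rfl ?_)
  · intro i hi hil
    rw [hrun]
    simpa [State.layout] using he.vst_zero i hi hil
  · rw [hrun]
    simpa [State.layout] using he.tgt_vst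
  · rintro s₂ ⟨h1, h2, h3⟩
    apply Ends.flat (by rfl) (by decide)
    rw [hlay] at h1
    simp only [Prog.run, Expr.eval, h2]
    exact ⟨h1, by simp⟩

end RAM

/-! ### One extension of the multigraph, executed and recorded. -/

namespace RAM

/-- Record an extension of type A. -/
def recordA : Prog :=
  .store 4 (.var vLen) (.var vE) ;; .store 5 (.var vLen) (.var vA) ;; .store 6 (.var vLen) (.var vB) ;;
  .store 3 (.var vLen) (.const 0) ;; .store aF1 (.const 0) (.var vE) ;; .store aF2 (.const 0) (.var vE) ;;
  .assign vCnt (.const 1)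

/-- Record an extension of type B. -/
def recordB : Prog :=
  .store 7 (.var vLen) (.var vF) ;; .store 8 (.var vLen) (.var vFF) ;;
  .store 9 (.var vLen) (.var vFu) ;; .store 10 (.var vLen) (.var vFv) ;;
  .store 3 (.var vLen) (.const 1) ;; .store aF1 (.const 0) (.var vFF) ;;
  .store aF2 (.const 0) (.var vFF) ;; .store aF1 (.const 1) (.var vF) ;;
  .store aF2 (.const 1) (.var vF) ;; .assign vCnt (.const 2)

/-- Record an extension of type C. -/
def recordC : Prog :=
  .store 11 (.var vLen) (.var vF) ;; .store 12 (.var vLen) (.var vFF) ;;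
  .store 13 (.var vLen) (.var vFu) ;; .store 14 (.var vLen) (.var vFv) ;;
  .store 3 (.var vLen) (.const 2) ;; .store aF1 (.const 0) (.cell 8 (.var vLen)) ;;
  .store aF2 (.const 0) (.var vFF) ;; .store aF1 (.const 1) (.cell 8 (.var vLen)) ;;
  .store aF2 (.const 1) (.var vF) ;; .store aF1 (.const 2) (.cell 7 (.var vLen)) ;;
  .store aF2 (.const 2) (.var vFF) ;; .assign vCnt (.const 3)

/-- Find an ear, add it to the subgraph, and record the extension of the multigraph. -/
def extend : Prog :=
  earSearch ;; makeEar ;; recordA ;;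
  .when (.minus (.cell aVst (.var vA)) (.const 1))
    ((.assign vQ (.var vA) ;; divide ;; recordB) ;;
    .when (.minus (.cell aVst (.var vB)) (.const 1)) (.assign vQ (.var vB) ;; divide ;; recordC))

/-- The state `s'` describes an extension `o` of the layout in `s`, with the new edge `e` between `a`
and `b` and the pairs `Fs` of edges that the new cycles avoid. -/
structure Extended (G : Graph ℕ ℕ) (n m : ℕ) (s s' : State) (o : ExtOp ℕ ℕ) (Fs : List (ℕ × ℕ)) :
    Prop where
  ext : Layout.Extension G n m s.layout s'.layout o (s'.var vE) (s'.var vA) (s'.var vB) Fs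
  op : s'.outOp (s.var vLen) = o
  op_old : ∀ i, i ≠ s.var vLen → s'.outOp i = s.outOp i
  cnt : s'.var vCnt = Fs.length
  pairs : ∀ (i : ℕ) (hi : i < Fs.length), s'.arr aF1 i = Fs[i].1 ∧ s'.arr aF2 i = Fs[i].2

theorem outOp_congr {s s' : State} {i : ℕ} (h : ∀ A, 3 ≤ A → A ≤ 14 → s'.arr A i = s.arr A i) :
    s'.outOp i = s.outOp i := by
  simp only [State.outOp, h 3 (by decide) (by decide), h 4 (by decide) (by decide),
    h 5 (by decide) (by decide), h 6 (by decide) (by decide), h 7 (by decide) (by decide),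
    h 8 (by decide) (by decide), h 9 (by decide) (by decide), h 10 (by decide) (by decide),
    h 11 (by decide) (by decide), h 12 (by decide) (by decide), h 13 (by decide) (by decide),
    h 14 (by decide) (by decide)]

theorem recordA_run (s : State) :
    (recordA.run s).layout = s.layout ∧ (recordA.run s).outOp (s.var vLen) =
      .typeA (s.var vE) (s.var vA) (s.var vB) ∧
    (∀ A, 3 ≤ A → A ≤ 14 → ∀ i ≠ s.var vLen, (recordA.run s).arr A i = s.arr A i) ∧
    (recordA.run s).arr 4 (s.var vLen) = s.var vE ∧ (recordA.run s).arr 5 (s.var vLen) = s.var vA ∧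
    (recordA.run s).arr 6 (s.var vLen) = s.var vB ∧ (recordA.run s).arr aF1 0 = s.var vE ∧
    (recordA.run s).arr aF2 0 = s.var vE ∧ (recordA.run s).var vCnt = 1 ∧
    ∀ x, x ≠ vCnt → (recordA.run s).var x = s.var x := by
  refine ⟨?_, ?_, ?_, ?_⟩
  · simp [recordA, Prog.run, State.layout]
  · simp [recordA, Prog.run, State.outOp, Expr.eval]
  · intro A h1 h2 i hi
    interval_cases A <;> simp [recordA, Prog.run, Expr.eval, hi]
  · simp [recordA, Prog.run, Expr.eval]
    tauto

/-- The records are cumulative: the entries `e`, `a`, `b` of type A stay in place, type B adds the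
first division, and type C adds the second one to both. -/
theorem recordB_run (s : State) :
    (recordB.run s).layout = s.layout ∧ (recordB.run s).outOp (s.var vLen) =
      .typeB (s.arr 4 (s.var vLen)) (s.arr 5 (s.var vLen)) (s.arr 6 (s.var vLen)) (s.var vF)
        (s.var vFF) (s.var vFu) (s.var vFv) ∧
    (∀ A, 3 ≤ A → A ≤ 14 → ∀ i ≠ s.var vLen, (recordB.run s).arr A i = s.arr A i) ∧
    (∀ A, 3 < A → A < 7 → (recordB.run s).arr A = s.arr A) ∧
    (recordB.run s).arr 7 (s.var vLen) = s.var vF ∧ (recordB.run s).arr 8 (s.var vLen) = s.var vFF ∧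
    (recordB.run s).arr 9 (s.var vLen) = s.var vFu ∧ (recordB.run s).arr 10 (s.var vLen) = s.var vFv ∧
    (recordB.run s).arr aF1 0 = s.var vFF ∧ (recordB.run s).arr aF2 0 = s.var vFF ∧
    (recordB.run s).arr aF1 1 = s.var vF ∧ (recordB.run s).arr aF2 1 = s.var vF ∧
    (recordB.run s).var vCnt = 2 ∧ ∀ x, x ≠ vCnt → (recordB.run s).var x = s.var x := by
  refine ⟨?_, ?_, ?_, ?_, ?_⟩
  · simp [recordB, Prog.run, State.layout]
  · simp [recordB, Prog.run, State.outOp, Expr.eval]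
  · intro A h1 h2 i hi
    interval_cases A <;> simp [recordB, Prog.run, Expr.eval, hi]
  · intro A h1 h2
    interval_cases A <;> simp [recordB, Prog.run, Expr.eval]
  · simp [recordB, Prog.run, Expr.eval]
    tauto

theorem recordC_run (s : State) :
    (recordC.run s).layout = s.layout ∧ (recordC.run s).outOp (s.var vLen) =
      .typeC (s.arr 4 (s.var vLen)) (s.arr 5 (s.var vLen)) (s.arr 6 (s.var vLen)) (s.arr 7 (s.var vLen))
        (s.arr 8 (s.var vLen)) (s.arr 9 (s.var vLen)) (s.arr 10 (s.var vLen)) (s.var vF)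
        (s.var vFF) (s.var vFu) (s.var vFv) ∧
    (∀ A, 3 ≤ A → A ≤ 14 → ∀ i ≠ s.var vLen, (recordC.run s).arr A i = s.arr A i) ∧
    (recordC.run s).arr aF1 0 = s.arr 8 (s.var vLen) ∧ (recordC.run s).arr aF2 0 = s.var vFF ∧
    (recordC.run s).arr aF1 1 = s.arr 8 (s.var vLen) ∧ (recordC.run s).arr aF2 1 = s.var vF ∧
    (recordC.run s).arr aF1 2 = s.arr 7 (s.var vLen) ∧ (recordC.run s).arr aF2 2 = s.var vFF ∧
    (recordC.run s).var vCnt = 3 ∧ ∀ x, x ≠ vCnt → (recordC.run s).var x = s.var x := by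
  refine ⟨?_, ?_, ?_, ?_⟩
  · simp [recordC, Prog.run, State.layout]
  · simp [recordC, Prog.run, State.outOp, Expr.eval]
  · intro A h1 h2 i hi
    interval_cases A <;> simp [recordC, Prog.run, Expr.eval, hi]
  · simp [recordC, Prog.run, Expr.eval]
    tauto

/-- If the search starts inside a path, the end `a` of the ear is interior to this path and `b` is
not, so the type is B or C with `f ≠ g`. If it starts outside, all vertices of the subgraph are
branch vertices, and the ear passes through `z`; so the type is A and the ear has an interior
vertex. The weight grows in each case. -/
theorem extend_spec : ∃ C : ℕ, ∀ (G : Graph ℕ ℕ) (n m : ℕ) (s : State), G.vertexSet = Set.Iio n →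
    G.edgeSet = Set.Iio m → G.IsEdgeConnected 3 → Static G n m s → s.layout.Good G n m →
    s.layout.SearchStart G m (s.var vZ) (s.var vKey) (s.var vE0) (s.var vA0) → s.var vZ < n →
    Ends extend s (C * (n + m + 1)) fun s' => ∃ o Fs, Extended G n m s s' o Fs ∧
      s.layout.weight n < s'.layout.weight n := by
  obtain ⟨C, hC⟩ := earSearch_spec
  refine ⟨C + 1000, fun G n m s hV hE hG hs hD hstart hzn => ?_⟩
  refine Ends.mono (T := C * (n + m + 1) + (60 * (n + 4) + (recordA.cost + (6 +
    ((2 + (100 * (n + 2) + 40)) + (6 + (2 + (100 * (n + 2) + 50)))))))) (Ends.seq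
    ((hC G n m s hV hE hG hs hD hstart hzn).frame.mono le_rfl ?_)) ?_ fun _ h => h
  rotate_left
  · have : recordA.cost ≤ 40 := by decide
    nlinarith [Nat.zero_le n, Nat.zero_le m]
  rintro s₁ ⟨⟨r, he, hends, hbk⟩, hfr₁⟩
  have hlay₁ : s₁.layout = s.layout := hfr₁.layout (by decide)
  set x : ℕ → ℕ := fun i => if i = 0 then s₁.var vB else (s₁.arr aPar)^[i - 1] (s₁.var vBv) with hx
  set d : ℕ → ℕ := fun i => if i = 0 then s₁.var vE else
    s₁.arr aPe ((s₁.arr aPar)^[i - 1] (s₁.var vBv)) with hd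
  have hd0 : d 0 = s₁.var vE := rfl
  have hx0 : x 0 = s₁.var vB := rfl
  have hx1 : x 1 = s₁.var vBv := rfl
  have hxr : x (r + 1) = (s₁.arr aPar)^[r] (s₁.var vBv) := rfl
  have hnext : ∀ i, 0 < i → i < r + 1 → s₁.arr aPar (x i) = x (i + 1) ∧ s₁.arr aPe (x i) = d i := by
    intro i hi _
    simp only [hx, hd, show i ≠ 0 by omega, if_false, show i + 1 ≠ 0 by omega, and_true]
    obtain ⟨i, rfl⟩ : ∃ k, i = k + 1 := ⟨i - 1, by omega⟩
    simp only [Nat.add_sub_cancel, Function.iterate_succ_apply']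
  rw [← hxr] at hends
  rw [← hx0] at hbk
  clear_value x d
  -- The ear has `r` interior vertices, which are distinct; so it is processed in time O(n).
  have hrn : r ≤ n := le_of_injective_below (f := fun i => x (i + 1))
    (fun i hi => by
      have := (he.link i (by omega)).right_mem
      rwa [hV] at this)
    (fun i hi i' hi' h => by
      have := he.inj (i + 1) (i' + 1) (by omega) (by omega) (by omega) (by omega) h
      omega)
  refine Ends.seq ((makeEar_spec (by rw [hlay₁]; exact he) hd0 hx0 hx1 hnext).frame.mono (by omega) ?_)
  rintro s₂ ⟨⟨hr, hA₂⟩, hfr₂⟩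
  rw [hlay₁] at hr
  have hE₂ : s₂.var vE = d 0 := by rw [hfr₂.1 _ (by decide), hd0]
  have hB₂ : s₂.var vB = x 0 := by rw [hfr₂.1 _ (by decide), hx0]
  have hk₂ : s₂.var vLen = s.var vLen := by rw [hfr₂.1 _ (by decide), hfr₁.1 _ (by decide)]
  have hop₂ : ∀ A, 3 ≤ A → A ≤ 14 → s₂.arr A = s.arr A := by
    intro A h1 h2
    rw [hfr₂.2 A (by interval_cases A <;> decide), hfr₁.2 A (by interval_cases A <;> decide)]
  refine Ends.seq (Ends.flat (by rfl) le_rfl ?_)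
  obtain ⟨ra1, ra2, ra3, ra4, ra5, ra6, ra7, ra8, ra9, ra10⟩ := recordA_run s₂
  rw [hE₂, hA₂, hB₂, hk₂] at ra2
  rw [hk₂] at ra3 ra4 ra5 ra6
  rw [hE₂] at ra4 ra7 ra8
  rw [hA₂] at ra5
  rw [hB₂] at ra6
  set s₃ := recordA.run s₂
  have hE₃ := ra10 vE (by decide)
  have hA₃ := ra10 vA (by decide)
  have hB₃ := ra10 vB (by decide)
  have hk₃ := ra10 vLen (by decide)
  rw [hE₂] at hE₃
  rw [hA₂] at hA₃
  rw [hB₂] at hB₃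
  rw [hk₂] at hk₃
  clear_value s₃
  rw [← ra1] at hr
  have hD₁ := hD.toEmbedded.ear hE hV he hr
  have hva₃ : s₃.arr aVst (x (r + 1)) = s.layout.vst (x (r + 1)) := he.vst_other hr he.tgt_vst
  have hop₃ : ∀ A, 3 ≤ A → A ≤ 14 → ∀ i ≠ s.var vLen, s₃.arr A i = s.arr A i := by
    intro A h1 h2 i hi
    rw [ra3 A h1 h2 i hi, hop₂ A h1 h2]
  refine Ends.when (fun hc => ?_) (fun hc => ?_)
  · simp only [Expr.eval, hA₃, hva₃] at hc
    obtain ⟨f, hf⟩ : ∃ f, s.layout.vst (x (r + 1)) = f + 2 := ⟨s.layout.vst (x (r + 1)) - 2, by omega⟩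
    have hlabf : s.layout.lab f = f + 1 := hD.vst_label _ f hf
    have hfd : f ≠ d 0 := by
      rintro rfl
      have := he.lab_zero 0 he.pos
      omega
    have htgtf := (hD.closed f (hD.mem_net.2 hlabf)).2
    have htgtf' : s.layout.vst (s.layout.tgt f) = 1 := htgtf
    have htgt₃ : s₃.layout.tgt f = s.layout.tgt f := by rw [hr.tgt_eq, Function.update_of_ne hfd]
    refine Ends.seq (Ends.seq (Ends.flat (by rfl) (by decide) ?_))
    have hQ : Prog.run (.assign vQ (.var vA)) s₃ = s₃.setVar vQ (x (r + 1)) := by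
      simp [Prog.run, Expr.eval, hA₃]
    rw [hQ]
    refine Ends.seq ((divide_spec (s := s₃.setVar vQ (x (r + 1))) (f := f) (m := m) hD₁ (by
      simpa [hva₃] using hf) ?_).frame.mono le_rfl ?_)
    · have h1 := he.vst_other hr (v := s.layout.tgt f) (by omega)
      show s₃.layout.vst (s₃.layout.tgt f) ≠ f + 2
      rw [htgt₃, h1]
      omega
    · rintro s₄ ⟨⟨l₁, j₁, x₁, d₁, hL, hj, hjl, hxa, hdiv, q1, q2, q3, q4⟩, hfr₄⟩
      have hlay : (s₃.setVar vQ (x (r + 1))).layout = s₃.layout := rfl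
      rw [hlay] at hL hdiv
      replace hxa : x₁ j₁ = x (r + 1) := by simpa using hxa
      replace q3 : s₄.var vFu = s₃.layout.src f := q3
      replace q4 : s₄.var vFv = s₃.layout.tgt f := q4
      have hv₄ : ∀ y, y ∉ vQ :: divide.vars → s₄.var y = s₃.var y := by
        intro y hy
        simp only [List.mem_cons, not_or] at hy
        rw [hfr₄.1 y hy.2]; simp [hy.1]
      have ha₄ : ∀ A, A ∉ divide.arrs → s₄.arr A = s₃.arr A := by
        intro A hA
        rw [hfr₄.2 A hA]; simp
      apply Ends.flat (by rfl) (by decide)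
      obtain ⟨rb1, rb2, rb3, rb4, rb5, rb6, rb7, rb8, rb9, rb10, rb11, rb12, rb13, rb14⟩ := recordB_run s₄
      set s₅ := recordB.run s₄
      have hv₅ : ∀ y, y ∉ vQ :: vCnt :: divide.vars → s₅.var y = s₃.var y := by
        intro y hy
        simp only [List.mem_cons, not_or] at hy
        rw [rb14 y hy.2.1, hv₄ y (by simp [hy])]
      have hk₄ : s₄.var vLen = s.var vLen := by rw [hv₄ _ (by decide), hk₃]
      rw [hk₄] at rb2 rb3 rb5 rb6 rb7 rb8
      rw [ha₄ 4 (by decide), ha₄ 5 (by decide), ha₄ 6 (by decide), ra4, ra5, ra6, q1, q2, q3, q4] at rb2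
      rw [q1] at rb5 rb11 rb12
      rw [q2] at rb6 rb9 rb10
      rw [q3] at rb7
      rw [q4] at rb8
      have ha5 : s₅.arr 4 (s.var vLen) = d 0 ∧ s₅.arr 5 (s.var vLen) = x (r + 1) ∧
          s₅.arr 6 (s.var vLen) = x 0 := by
        rw [rb4 4 (by decide) (by decide), rb4 5 (by decide) (by decide), rb4 6 (by decide) (by decide),
          ha₄ 4 (by decide), ha₄ 5 (by decide), ha₄ 6 (by decide)]
        exact ⟨ra4, ra5, ra6⟩
      have hk₅ : s₅.var vLen = s.var vLen := by rw [hv₅ _ (by decide), hk₃]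
      have hE₅ : s₅.var vE = d 0 := by rw [hv₅ _ (by decide), hE₃]
      have hA₅ : s₅.var vA = x (r + 1) := by rw [hv₅ _ (by decide), hA₃]
      have hB₅ : s₅.var vB = x 0 := by rw [hv₅ _ (by decide), hB₃]
      clear_value s₅
      rw [← rb1] at hdiv
      have hop₅ : ∀ A, 3 ≤ A → A ≤ 14 → ∀ i ≠ s.var vLen, s₅.arr A i = s.arr A i := by
        intro A h1 h2 i hi
        rw [rb3 A h1 h2 i hi, ha₄ A (by interval_cases A <;> decide), hop₃ A h1 h2 i hi]
      have hw₅ : s.layout.weight n < s₅.layout.weight n :=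
        (Layout.weight_ear_le he hr).trans_lt (Layout.weight_divide_lt hD₁ hL hj hjl hdiv)
      -- The key is the state of `a`. Hence the state of `b`, which differs from the key, cannot
      -- belong to the path of `f`.
      have hkeyf : s.var vKey = f + 2 := by
        rcases hends with ⟨-, h⟩ | ⟨-, h, -⟩
        · rw [← h, hf]
        · omega
      have hb₃ : s₃.layout.vst (x 0) = s.layout.vst (x 0) := he.vst_other hr he.src_vst
      have hb₅ : s₅.arr aVst (x 0) = s.layout.vst (x 0) := by
        refine Eq.trans ?_ hb₃
        exact hdiv.vst_of_ne hL hj hjl (by rw [hb₃]; omega)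
      refine Ends.when (fun hc' => ?_) (fun hc' => ?_)
      · simp only [Expr.eval, hB₅, hb₅] at hc'
        obtain ⟨g, hg⟩ : ∃ g, s.layout.vst (x 0) = g + 2 := ⟨s.layout.vst (x 0) - 2, by omega⟩
        have hfg : f ≠ g := by rintro rfl; omega
        have hlabg : s.layout.lab g = g + 1 := hD.vst_label _ g hg
        have hgd : g ≠ d 0 := by
          rintro rfl
          have := he.lab_zero 0 he.pos
          omega
        have htgtg : s.layout.vst (s.layout.tgt g) = 1 := (hD.closed g (hD.mem_net.2 hlabg)).2
        -- The new name `d₁ j₁` carried the label of `f`, whereas `g` carried its own.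
        have hgf₂ : g ≠ d₁ j₁ := by
          intro h
          have h1 := (hL.label_new hj hjl).1
          rw [← h] at h1
          have h2 := Layout.Ear.lab_of_ne hr h1 hfd
          omega
        have htgt₅ : s₅.layout.tgt g = s.layout.tgt g := by
          rw [hdiv.tgt_eq hjl, Function.update_of_ne hfg.symm, Function.update_of_ne hgf₂, hr.tgt_eq,
            Function.update_of_ne hgd]
        have hD₂ := hD₁.divide hL hj hjl hdiv
        refine Ends.seq (Ends.flat (by rfl) (by decide) ?_)
        have hQ : Prog.run (.assign vQ (.var vB)) s₅ = s₅.setVar vQ (x 0) := by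
          simp [Prog.run, Expr.eval, hB₅]
        rw [hQ]
        refine Ends.seq ((divide_spec (s := s₅.setVar vQ (x 0)) (f := g) (m := m) hD₂ (by
          simpa [hb₅] using hg) ?_).frame.mono le_rfl ?_)
        · have h1 := he.vst_other hr (v := s.layout.tgt g) (by omega)
          have h2 := hdiv.vst_of_ne hL hj hjl (v := s.layout.tgt g) (by omega)
          show s₅.layout.vst (s₅.layout.tgt g) ≠ g + 2
          rw [htgt₅, h2, h1]
          omega
        · rintro s₆ ⟨⟨l₂, j₂, x₂, d₂, hL₂, hj₂, hjl₂, hxb, hdiv₂, q5, q6, q7, q8⟩, hfr₆⟩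
          have hlay : (s₅.setVar vQ (x 0)).layout = s₅.layout := rfl
          rw [hlay] at hL₂ hdiv₂
          replace hxb : x₂ j₂ = x 0 := by simpa using hxb
          replace q7 : s₆.var vFu = s₅.layout.src g := q7
          replace q8 : s₆.var vFv = s₅.layout.tgt g := q8
          have hv₆ : ∀ y, y ∉ vQ :: divide.vars → s₆.var y = s₅.var y := by
            intro y hy
            simp only [List.mem_cons, not_or] at hy
            rw [hfr₆.1 y hy.2]; simp [hy.1]
          have ha₆ : ∀ A, A ∉ divide.arrs → s₆.arr A = s₅.arr A := by
            intro A hA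
            rw [hfr₆.2 A hA]; simp
          apply Ends.flat (by rfl) (by decide)
          obtain ⟨rc1, rc2, rc3, rc4, rc5, rc6, rc7, rc8, rc9, rc10, rc11⟩ := recordC_run s₆
          set s₇ := recordC.run s₆
          have hv₇ : ∀ y, y ∉ vQ :: vCnt :: divide.vars → s₇.var y = s₅.var y := by
            intro y hy
            simp only [List.mem_cons, not_or] at hy
            rw [rc11 y hy.2.1, hv₆ y (by simp [hy])]
          have hk₆ : s₆.var vLen = s.var vLen := by rw [hv₆ _ (by decide), hk₅]
          rw [hk₆] at rc2 rc3 rc4 rc6 rc8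
          rw [ha₆ 4 (by decide), ha₆ 5 (by decide), ha₆ 6 (by decide), ha₆ 7 (by decide),
            ha₆ 8 (by decide), ha₆ 9 (by decide), ha₆ 10 (by decide), ha5.1, ha5.2.1, ha5.2.2, rb5, rb6,
            rb7, rb8, q5, q6, q7, q8] at rc2
          rw [ha₆ 8 (by decide), rb6] at rc4 rc6
          rw [ha₆ 7 (by decide), rb5] at rc8
          rw [q5] at rc7
          rw [q6] at rc5 rc9
          have hE₇ : s₇.var vE = d 0 := by rw [hv₇ _ (by decide), hE₅]
          have hA₇ : s₇.var vA = x (r + 1) := by rw [hv₇ _ (by decide), hA₅]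
          have hB₇ : s₇.var vB = x 0 := by rw [hv₇ _ (by decide), hB₅]
          clear_value s₇
          rw [← rc1] at hdiv₂
          refine ⟨_, [(d₁ j₁, d₂ j₂), (d₁ j₁, g), (f, d₂ j₂)], ⟨?_, rc2, ?_, rc10, ?_⟩,
            hw₅.trans (Layout.weight_divide_lt hD₂ hL₂ hj₂ hjl₂ hdiv₂)⟩
          · rw [hE₇, hA₇, hB₇]
            exact Layout.Extension.typeC hD hE hV he hr hf hg hfg hL hj hjl hxa hdiv hL₂ hj₂ hjl₂ hxb hdiv₂
          · intro i hi
            refine outOp_congr fun A h1 h2 => ?_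
            rw [rc3 A h1 h2 i hi, ha₆ A (by interval_cases A <;> decide), hop₅ A h1 h2 i hi]
          · intro i hi
            simp only [List.length_cons, List.length_nil, Nat.zero_add, Nat.reduceAdd] at hi
            interval_cases i
            · exact ⟨rc4, rc5⟩
            · exact ⟨rc6, rc7⟩
            · exact ⟨rc8, rc9⟩
      · simp only [Expr.eval, hB₅, hb₅] at hc'
        have hb1 : s.layout.vst (x 0) = 1 := by have := he.src_vst; omega
        refine ⟨_, [(d₁ j₁, d₁ j₁), (f, f)], ⟨?_, rb2, ?_, rb13, ?_⟩, hw₅⟩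
        · rw [hE₅, hA₅, hB₅]
          exact Layout.Extension.typeB hD hE hV he hr hf hb1 hL hj hjl hxa hdiv
        · intro i hi
          exact outOp_congr fun A h1 h2 => hop₅ A h1 h2 i hi
        · intro i hi
          simp only [List.length_cons, List.length_nil, Nat.zero_add, Nat.reduceAdd] at hi
          interval_cases i
          · exact ⟨rb9, rb10⟩
          · exact ⟨rb11, rb12⟩
  · simp only [Expr.eval, hA₃, hva₃] at hc
    have ha1 : s.layout.vst (x (r + 1)) = 1 := by have := he.tgt_vst; omega
    -- A search from inside a path ends inside this path, so a branch vertex `a` indicates a search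
    -- from outside.
    have hz0 : s.layout.vst (s.var vZ) = 0 ∧ 0 < r := by
      rcases hends with ⟨h1, h2⟩ | ⟨h1, -, h2⟩
      · rcases hstart with ⟨h3, h4, -⟩ | ⟨h3, -⟩ <;> omega
      · exact ⟨h1, h2⟩
    have hb1 : s.layout.vst (x 0) = 1 := by
      rcases hstart with ⟨h3, -⟩ | ⟨-, -, -, -, -, h3⟩
      · omega
      · have h1 := h3 (x 0)
        have h2 := he.src_vst
        omega
    refine ⟨_, [(d 0, d 0)], ⟨?_, ra2, ?_, ra9, ?_⟩, Layout.weight_ear_lt hV he hr (by omega)⟩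
    · rw [hE₃, hA₃, hB₃]
      exact Layout.Extension.typeA hD hE hV he hr ha1 hb1
    · intro i hi
      exact outOp_congr fun A h1 h2 => hop₃ A h1 h2 i hi
    · intro i hi
      simp only [List.length_cons, List.length_nil, Nat.zero_add, Nat.lt_one_iff] at hi
      subst hi
      exact ⟨ra7, ra8⟩

end RAM

/-! ### The invariant of the algorithm, and one full step. -/

/-- The history is continued by an extension of the layout. -/
theorem Layout.Extension.history {G : Graph ℕ ℕ} {n m : ℕ} {D D' : Layout} {o : ExtOp ℕ ℕ}
    {e a b k : ℕ} {Fs : List (ℕ × ℕ)} {op op' : ℕ → ExtOp ℕ ℕ} {U U' : ℕ → Set ℕ} {cnt cnt' : ℕ → ℕ}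
    {Γ : ℕ → Graph ℕ ℕ} (hext : Extension G n m D D' o e a b Fs)
    (h : History op U cnt k (D.net m) Γ) (hcl : (D.net m).Closed)
    (hresp : ∀ j < cnt k, D.Respects (U j)) (hop : ∀ i < k, op' i = op i) (hopk : op' k = o)
    (hU : ∀ j < cnt k, U' j = U j) (hcnt : ∀ i ≤ k, cnt' i = cnt i)
    (hcntk : cnt' (k + 1) = cnt k + Fs.length)
    (hnew : ∀ (i : ℕ) (hi : i < Fs.length), (D'.net m).graph.IsCycleSet (U' (cnt k + i) ∩ (D'.net m).E) ∧
      e ∈ U' (cnt k + i) ∧ (Fs[i].1 ≠ e → Fs[i].1 ∉ U' (cnt k + i)) ∧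
      (Fs[i].2 ≠ e → Fs[i].2 ∉ U' (cnt k + i))) :
    ∃ Γ', History op' U' cnt' (k + 1) (D'.net m) Γ' := by
  have hresp' : ∀ j < cnt k, D.Respects (U' j) := fun j hj => by rw [hU j hj]; exact hresp j hj
  have hpos := hext.length.1
  refine h.extend hop hU hcnt hcl hext.good.closed (by rw [hopk]; exact hext.applies) (by omega) ?_ ?_ ?_
  · rw [hcntk]
    exact hext.basis U' (cnt k) (h.basis.congr fun j hj => (hU j hj).symm) hresp' hnew
  · intro j hj
    rw [hopk]
    exact hext.embed _ (hresp' j hj)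
  · intro j hj hj'
    obtain ⟨i, rfl⟩ := Nat.exists_eq_add_of_le hj
    exact (hnew i (by omega)).1

namespace RAM

/-- The output arrays are ready for the next cycle. -/
structure OutOK (s : State) : Prop where
  last : s.arr aStart (s.var vCyc) = s.var vOut
  start_le : ∀ j ≤ s.var vCyc, s.arr aStart j ≤ s.var vOut
  mark_le : ∀ f, s.arr aMark f ≤ s.var vCyc

theorem OutOK.frame {s s' : State} {V A : List ℕ} (h : OutOK s) (hf : Frame V A s s')
    (hV : vCyc ∉ V ∧ vOut ∉ V) (hA : aStart ∉ A ∧ aMark ∉ A) : OutOK s' := by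
  constructor
  · rw [hf.1 _ hV.1, hf.1 _ hV.2, hf.2 _ hA.1]; exact h.last
  · rw [hf.1 _ hV.1, hf.1 _ hV.2, hf.2 _ hA.1]; exact h.start_le
  · rw [hf.1 _ hV.1, hf.2 _ hA.2]; exact h.mark_le

theorem outCycle_congr {s s' : State} (h : s'.arr aStart = s.arr aStart)
    (h' : s'.arr aList = s.arr aList) : s'.outCycle = s.outCycle := by
  funext j
  simp only [State.outCycle, h, h']

theorem Listed.outOK {s s' : State} {W : Set ℕ} (h : Listed s s' W) (hs : OutOK s) : OutOK s' := by
  constructor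
  · rw [h.cyc, h.start, Function.update_self]
  · intro j hj
    rw [h.cyc] at hj
    rw [h.start, Function.update_apply]
    split_ifs with h1
    · exact le_rfl
    · exact (hs.start_le j (by omega)).trans h.out_le
  · rw [h.cyc]; exact h.mark

theorem Listed.outCycle_old {s s' : State} {W : Set ℕ} (h : Listed s s' W) (hs : OutOK s) {j : ℕ}
    (hj : j < s.var vCyc) : s'.outCycle j = s.outCycle j := by
  simp only [State.outCycle]
  rw [h.start, Function.update_of_ne (by omega), Function.update_of_ne (by omega)]
  refine Set.image_congr fun i hi => h.old i (hi.2.trans_le (hs.start_le _ (by omega)))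

theorem Listed.outCycle_new {s s' : State} {W : Set ℕ} (h : Listed s s' W) (hs : OutOK s) :
    s'.outCycle (s.var vCyc) = W := by
  simp only [State.outCycle]
  rw [h.start, Function.update_of_ne (by omega), Function.update_self, hs.last]
  exact h.new

/-- The invariant of the algorithm. -/
structure Main (G : Graph ℕ ℕ) (n m : ℕ) (s : State) : Prop where
  static : Static G n m s
  good : s.layout.Good G n m
  out : OutOK s
  resp : ∀ j < s.var vCyc, s.layout.Respects (s.outCycle j)
  cnt : s.outCount (s.var vLen) = s.var vCyc
  hist : ∃ Γ, History s.outOp s.outCycle s.outCount (s.var vLen) (s.layout.net m) Γ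

/-- The variables below 8, the arrays below 26 and the marks hold everything on which the invariant
depends. The rest is working memory, which every search may overwrite. -/
theorem Main.frame {G : Graph ℕ ℕ} {n m : ℕ} {s s' : State} {V A : List ℕ} (h : Main G n m s)
    (hf : Frame V A s s') (hV : ∀ x ∈ V, 8 ≤ x)
    (hA : ∀ X ∈ A, 26 ≤ X ∧ X ≠ aMark) : Main G n m s' := by
  have hv : ∀ x < 8, s'.var x = s.var x := fun x hx => hf.1 x fun h => by have := hV x h; omega
  have ha : ∀ X, X < 26 ∨ X = aMark → s'.arr X = s.arr X := fun X hX => hf.2 X fun h => by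
    have := hA X h; omega
  have hV' : ∀ x < 8, x ∉ V := fun x hx h => by have := hV x h; omega
  have hA' : ∀ X, X < 26 ∨ X = aMark → X ∉ A := fun X hX h => by have := hA X h; omega
  have hlay : s'.layout = s.layout := hf.layout ⟨hA' _ (by decide), hA' _ (by decide),
    hA' _ (by decide), hA' _ (by decide), hA' _ (by decide), hA' _ (by decide)⟩
  have hcyc : s'.outCycle = s.outCycle := outCycle_congr (ha _ (by decide)) (ha _ (by decide))
  have hop : s'.outOp = s.outOp := funext fun i => outOp_congr fun A _ h2 => by
    rw [ha A (by omega)]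
  have hcnt : s'.outCount = s.outCount := by
    funext i
    simp only [State.outCount, ha 15 (by decide)]
  refine ⟨h.static.frame hf ⟨hV' _ (by decide), hV' _ (by decide), hV' _ (by decide)⟩
    ⟨hA' _ (by decide), hA' _ (by decide), hA' _ (by decide), hA' _ (by decide)⟩, by rw [hlay]; exact h.good,
    h.out.frame hf ⟨hV' _ (by decide), hV' _ (by decide)⟩ ⟨hA' _ (by decide), hA' _ (by decide)⟩, ?_, ?_, ?_⟩
  · rw [hlay, hcyc, hv _ (by decide)]; exact h.resp
  · rw [hcnt, hv _ (by decide), hv _ (by decide)]; exact h.cnt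
  · rw [hop, hcyc, hcnt, hlay, hv _ (by decide)]; exact h.hist

/-- The invariant is preserved by an extension of the layout and the listing of the new cycles. -/
theorem Main.advance {G : Graph ℕ ℕ} {n m : ℕ} {s s' : State} {o : ExtOp ℕ ℕ} {e a b : ℕ}
    {Fs : List (ℕ × ℕ)} (h : Main G n m s)
    (hext : Layout.Extension G n m s.layout s'.layout o e a b Fs) (hs : Static G n m s') (hout : OutOK s')
    (hlen : s'.var vLen = s.var vLen + 1) (hcyc : s'.var vCyc = s.var vCyc + Fs.length)
    (hop : s'.outOp (s.var vLen) = o) (hop' : ∀ i < s.var vLen, s'.outOp i = s.outOp i)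
    (hcnt : ∀ i ≤ s.var vLen, s'.outCount i = s.outCount i)
    (hcnt' : s'.outCount (s.var vLen + 1) = s'.var vCyc)
    (hold : ∀ j < s.var vCyc, s'.outCycle j = s.outCycle j)
    (hnew : ∀ (i : ℕ) (hi : i < Fs.length), s'.layout.Respects (s'.outCycle (s.var vCyc + i)) ∧
      (s'.layout.net m).graph.IsCycleSet (s'.outCycle (s.var vCyc + i) ∩ (s'.layout.net m).E) ∧
      e ∈ s'.outCycle (s.var vCyc + i) ∧ (Fs[i].1 ≠ e → Fs[i].1 ∉ s'.outCycle (s.var vCyc + i)) ∧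
      (Fs[i].2 ≠ e → Fs[i].2 ∉ s'.outCycle (s.var vCyc + i))) : Main G n m s' := by
  obtain ⟨Γ, hΓ⟩ := h.hist
  refine ⟨hs, hext.good, hout, ?_, by rw [hlen, hcnt'], ?_⟩
  · intro j hj
    rcases Nat.lt_or_ge j (s.var vCyc) with h1 | h1
    · rw [hold j h1]
      exact hext.respects _ (h.resp j h1)
    · obtain ⟨i, rfl⟩ := Nat.exists_eq_add_of_le h1
      exact (hnew i (by omega)).1
  · rw [hlen]
    refine hext.history hΓ h.good.closed (by rw [h.cnt]; exact h.resp) hop' hop (by rw [h.cnt]; exact hold)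
      hcnt (by rw [hcnt', hcyc, h.cnt]) fun i hi => ?_
    rw [h.cnt]
    exact (hnew i hi).2

/-- List the cycles for the pairs of edges that are given in `aF1` and `aF2`. -/
def cycles : Prog :=
  (.assign vJ (.const 0) ;; .assign vLim (.var vM)) ;;
  .upTo vJ vCnt ((.assign vF1 (.cell aF1 (.var vJ)) ;; .assign vF2 (.cell aF2 (.var vJ))) ;;
    netSearch ;; emit)

/-- Conclude the treatment of an extension. -/
def finish : Prog :=
  .assign vLen (.plus (.var vLen) (.const 1)) ;; .store 15 (.var vLen) (.var vCyc)

/-- Treat one extension. -/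
def step : Prog := extend ;; cycles ;; finish

/-- For each pair a tree with root `a` is searched in the multigraph without `e` and the edges of
the pair. It contains `b` by `Extension.reach`, so the cycle can be listed. Since `Fs` has at most
three entries, the whole is linear in `n + m`. -/
theorem cycles_spec : ∃ C : ℕ, ∀ (G : Graph ℕ ℕ) (n m : ℕ) (D : Layout) (o : ExtOp ℕ ℕ) (s : State)
    (Fs : List (ℕ × ℕ)), Static G n m s → OutOK s →
    Layout.Extension G n m D s.layout o (s.var vE) (s.var vA) (s.var vB) Fs →
    s.var vCnt = Fs.length →
    (∀ (i : ℕ) (hi : i < Fs.length), s.arr aF1 i = Fs[i].1 ∧ s.arr aF2 i = Fs[i].2) →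
    Ends cycles s (C * (n + m + 1) * Fs.length + 10) fun s' => OutOK s' ∧
      s'.var vCyc = s.var vCyc + Fs.length ∧
      (∀ j < s.var vCyc, s'.outCycle j = s.outCycle j) ∧
      ∀ (i : ℕ) (hi : i < Fs.length), s.layout.Respects (s'.outCycle (s.var vCyc + i)) ∧
        (s.layout.net m).graph.IsCycleSet (s'.outCycle (s.var vCyc + i) ∩ (s.layout.net m).E) ∧
        s.var vE ∈ s'.outCycle (s.var vCyc + i) ∧
        (Fs[i].1 ≠ s.var vE → Fs[i].1 ∉ s'.outCycle (s.var vCyc + i)) ∧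
        (Fs[i].2 ≠ s.var vE → Fs[i].2 ∉ s'.outCycle (s.var vCyc + i)) := by
  obtain ⟨C, hC⟩ := netSearch_spec
  refine ⟨C + 100, fun G n m D o s Fs hs hout hext hcnt hpairs => ?_⟩
  have hD := hext.good.toEmbedded
  have hcl := hext.good.closed
  refine Ends.mono (T := 4 + ((10 + (C * (n + m + 1) + 60 * (n + m + 1)) + 8) * (Fs.length - 0) + 4))
    (Ends.seq (Ends.flat (by rfl) (by decide) ?_)) ?_ fun _ h => h
  rotate_left
  · have h1 : Fs.length ≤ (n + m + 1) * Fs.length := Nat.le_mul_of_pos_left _ (by omega)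
    rw [Nat.sub_zero]
    linarith [Nat.zero_le ((n + m + 1) * Fs.length)]
  set s₀ := Prog.run _ s with hs₀
  have hf₀ : Frame [vJ, vLim] [] s s₀ := by
    refine ⟨fun x hx => ?_, fun X _ => ?_⟩
    · simp only [List.mem_cons, List.not_mem_nil, or_false, not_or] at hx
      simp [hs₀, Prog.run, hx]
    · simp [hs₀, Prog.run]
  have hlim₀ : s₀.var vLim = m := by simp [hs₀, Prog.run, Expr.eval, hs.var_m]
  have hJ₀ : s₀.var vJ = 0 := by simp [hs₀, Prog.run, Expr.eval]
  clear_value s₀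
  refine (Ends.upTo (lo := 0) (hi := Fs.length) (T := 10 + (C * (n + m + 1) + 60 * (n + m + 1)))
    (fun j s' => OutOK s' ∧ s'.var vCyc = s.var vCyc + j ∧
      (∀ j < s.var vCyc, s'.outCycle j = s.outCycle j) ∧
      ∀ (i : ℕ) (hi : i < Fs.length), i < j → s.layout.Respects (s'.outCycle (s.var vCyc + i)) ∧
        (s.layout.net m).graph.IsCycleSet (s'.outCycle (s.var vCyc + i) ∩ (s.layout.net m).E) ∧
        s.var vE ∈ s'.outCycle (s.var vCyc + i) ∧
        (Fs[i].1 ≠ s.var vE → Fs[i].1 ∉ s'.outCycle (s.var vCyc + i)) ∧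
        (Fs[i].2 ≠ s.var vE → Fs[i].2 ∉ s'.outCycle (s.var vCyc + i))) (by decide)
    (by decide) (by decide) hJ₀ (by rw [hf₀.1 _ (by decide), hcnt]) (Nat.zero_le _) ?_ ?_).mono le_rfl ?_
  · exact ⟨hout.frame hf₀ (by decide) (by decide), hf₀.1 _ (by decide), fun j _ => by
      rw [outCycle_congr (hf₀.2 _ (by decide)) (hf₀.2 _ (by decide))], fun i hi h => by omega⟩
  · rintro j s₁ - hj hJ₁ hf₁ ⟨ho₁, hc₁, hold₁, hnew₁⟩
    have hf := (hf₀.mono (List.subset_append_left _ _) (List.subset_append_left _ _)).trans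
      (hf₁.mono (List.subset_append_right [vJ, vLim] _) (List.subset_append_right [] _))
    have hlim₁ : s₁.var vLim = m := by rw [hf₁.1 _ (by decide), hlim₀]
    refine Ends.mono (T := 10 + (C * (n + m + 1) + 60 * (n + m + 1))) ?_ le_rfl fun _ h => h
    refine Ends.seq (Ends.flat (by rfl) (by decide) ?_)
    set s₂ := Prog.run _ s₁ with hs₂
    have hf₂ : Frame [vF1, vF2] [] s₁ s₂ := by
      refine ⟨fun x hx => ?_, fun X _ => ?_⟩
      · simp only [List.mem_cons, List.not_mem_nil, or_false, not_or] at hx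
        simp [hs₂, Prog.run, hx]
      · simp [hs₂, Prog.run]
    have hF : s₂.var vF1 = Fs[j].1 ∧ s₂.var vF2 = Fs[j].2 := by
      obtain ⟨h1, h2⟩ := hpairs j hj
      rw [← h1, ← h2, ← hf.2 aF1 (by decide), ← hf.2 aF2 (by decide)]
      simp [hs₂, Prog.run, Expr.eval, hJ₁]
    clear_value s₂
    have hg := (hf.mono (List.subset_append_left _ _) (List.subset_append_left _ _)).trans
      (hf₂.mono (List.subset_append_right _ _) (List.subset_append_right _ _))
    have hlay : s₂.layout = s.layout := hg.layout (by decide)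
    have hst : Static G n m s₂ := hs.frame hg (by decide) (by decide)
    have hvE : s₂.var vE = s.var vE := hg.1 _ (by decide)
    have hvA : s₂.var vA = s.var vA := hg.1 _ (by decide)
    have hvB : s₂.var vB = s.var vB := hg.1 _ (by decide)
    have hc₂ : s₂.var vCyc = s.var vCyc + j := by rw [hf₂.1 _ (by decide), hc₁]
    have ho₂ : OutOK s₂ := ho₁.frame hf₂ (by decide) (by decide)
    have hcy₂ : s₂.outCycle = s₁.outCycle := outCycle_congr (hf₂.2 _ (by decide)) (hf₂.2 _ (by decide))
    refine Ends.seq ((hC G n m s₂ hst (by rw [hlay]; exact hD) (by rw [hlay]; exact hcl) (by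
      rw [hvA, show s₂.arr aVst = s.arr aVst from congrArg Layout.vst hlay]
      exact hext.real)).frame.mono le_rfl ?_)
    rintro s₃ ⟨⟨hT, hX⟩, hf₃⟩
    rw [hlay, hvE, hF.1, hF.2] at hT hX
    rw [hvA] at hT
    have hlay₃ : s₃.layout = s.layout := by rw [hf₃.layout (by decide), hlay]
    have hc₃ : s₃.var vCyc = s.var vCyc + j := by rw [hf₃.1 _ (by decide), hc₂]
    have ho₃ : OutOK s₃ := ho₂.frame hf₃ (by decide) (by decide)
    have hcy₃ : s₃.outCycle = s₁.outCycle := by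
      rw [outCycle_congr (hf₃.2 _ (by decide)) (hf₃.2 _ (by decide)), hcy₂]
    have hE₃ : s₃.var vE = s.var vE := by rw [hf₃.1 _ (by decide), hvE]
    have hA₃ : s₃.var vA = s.var vA := by rw [hf₃.1 _ (by decide), hvA]
    have hB₃ : s₃.var vB = s.var vB := by rw [hf₃.1 _ (by decide), hvB]
    have hlim₃ : s₃.var vLim = m := by
      rw [hf₃.1 _ (by decide), hf₂.1 _ (by decide), hlim₁]
    -- The set of reached vertices is closed under all permitted edges, hence contains `b`.
    have hb := hext.reach Fs[j] (List.getElem_mem hj) {v | v < n ∧ s₃.arr aVis v ≠ 0}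
      ⟨hT.root_lt, hT.root⟩ hX
    have hemit := emit_spec (s := s₃) (G := G) (n := n) (m := m)
      (A := {d | d ∈ (s.layout.net m).E ∧ d ≠ s.var vE ∧ d ≠ Fs[j].1 ∧ d ≠ Fs[j].2})
      (by rw [hlay₃]; exact hD) (by rw [hlay₃]; exact hcl) (by rw [hlay₃, hA₃]; exact hT)
      (by rw [hlay₃]; exact fun d hd => hd.1) (by rw [hE₃]; exact fun h => h.2.1 rfl)
      (by rw [hB₃]; exact hb.1) (by rw [hB₃]; exact hb.2)
      (by rw [hlay₃, hE₃, hA₃, hB₃]; exact hext.link) ho₃.mark_le (fun d h _ => by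
        rw [hlim₃]
        refine hD.lab_lt d ?_
        rw [← hlay₃]
        exact h)
    rw [hlim₃] at hemit
    refine hemit.mono le_rfl ?_
    rintro s₄ ⟨W, hL, hW1, hW2, hW3, hW4⟩
    rw [hlay₃] at hW1 hW2 hW4
    rw [hE₃] at hW3 hW4
    have hlast : s₄.outCycle (s.var vCyc + j) = W := by rw [← hc₃]; exact hL.outCycle_new ho₃
    have hprev : ∀ i < s.var vCyc + j, s₄.outCycle i = s₁.outCycle i := fun i hi => by
      rw [hL.outCycle_old ho₃ (by omega), hcy₃]
    have hcy : (s₄.setVar vJ (j + 1)).outCycle = s₄.outCycle := rfl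
    refine ⟨(hL.outOK ho₃).frame (V := [vJ]) (A := []) ⟨fun x hx => ?_, fun _ _ => rfl⟩ (by decide)
      (by decide), ?_, ?_, ?_⟩
    · simp only [List.mem_cons, List.not_mem_nil, or_false] at hx
      simp [hx]
    · have := hL.cyc
      simp only [State.setVar_var, Nat.reduceEqDiff, if_false]
      omega
    · intro i hi
      rw [hcy, hprev i (by omega), hold₁ i hi]
    · intro i hi hij
      rw [hcy]
      rcases Nat.lt_or_ge i j with h1 | h1
      · rw [hprev _ (by omega)]
        exact hnew₁ i hi h1
      · obtain rfl : i = j := by omega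
        rw [hlast]
        obtain ⟨hm1, hm2⟩ := hext.mem _ (List.getElem_mem hj)
        exact ⟨hW1, hW2, hW3, fun h => hW4 _ hm1 (fun h' => h'.2.2.1 rfl) h,
          fun h => hW4 _ hm2 (fun h' => h'.2.2.2 rfl) h⟩
  · rintro s' ⟨⟨h1, h2, h3, h4⟩, -, -⟩
    exact ⟨h1, h2, h3, fun i hi => h4 i hi hi⟩

theorem step_spec : ∃ C : ℕ, ∀ (G : Graph ℕ ℕ) (n m : ℕ) (s : State), G.vertexSet = Set.Iio n →
    G.edgeSet = Set.Iio m → G.IsEdgeConnected 3 → Main G n m s →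
    s.layout.SearchStart G m (s.var vZ) (s.var vKey) (s.var vE0) (s.var vA0) → s.var vZ < n →
    Ends step s (C * (n + m + 1)) fun s' => Main G n m s' ∧ s.layout.weight n < s'.layout.weight n := by
  obtain ⟨C₁, hC₁⟩ := extend_spec
  obtain ⟨C₂, hC₂⟩ := cycles_spec
  refine ⟨C₁ + 3 * C₂ + 20, fun G n m s hV hE hG hs hstart hzn => ?_⟩
  refine Ends.mono (T := C₁ * (n + m + 1) + ((C₂ * (n + m + 1) * 3 + 10) + 8)) (Ends.seq
    ((hC₁ G n m s hV hE hG hs.static hs.good hstart hzn).frame.mono le_rfl ?_)) ?_ fun _ h => h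
  rotate_left
  · linarith [Nat.zero_le n, Nat.zero_le m]
  rintro s₁ ⟨⟨o, Fs, hx, hw⟩, hf₁⟩
  have hst₁ : Static G n m s₁ := hs.static.frame hf₁ (by decide) (by decide)
  have hout₁ : OutOK s₁ := hs.out.frame hf₁ (by decide) (by decide)
  refine Ends.seq ((hC₂ G n m s.layout o s₁ Fs hst₁ hout₁ hx.ext hx.cnt hx.pairs).frame.mono
    (Nat.add_le_add_right (Nat.mul_le_mul_left _ hx.ext.length.2) _) ?_)
  rintro s₂ ⟨⟨hout₂, hc₂, hold₂, hnew₂⟩, hf₂⟩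
  apply Ends.flat (by rfl) (by decide)
  set s₃ := Prog.run finish s₂ with hs₃
  have hf₃ : Frame [vLen] [15] s₂ s₃ := by
    refine ⟨fun x hx => ?_, fun X hX => ?_⟩
    · simp only [List.mem_cons, List.not_mem_nil, or_false] at hx
      simp [hs₃, finish, Prog.run, hx]
    · simp only [List.mem_cons, List.not_mem_nil, or_false] at hX
      simp [hs₃, finish, Prog.run, hX]
  have hlen₂ : s₂.var vLen = s.var vLen := by rw [hf₂.1 _ (by decide), hf₁.1 _ (by decide)]
  have hlen₃ : s₃.var vLen = s.var vLen + 1 := by simp [hs₃, finish, Prog.run, Expr.eval, hlen₂]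
  have hcnt₃ : s₃.arr 15 = Function.update (s.arr 15) (s.var vLen + 1) (s₂.var vCyc) := by
    have : s₂.arr 15 = s.arr 15 := by rw [hf₂.2 _ (by decide), hf₁.2 _ (by decide)]
    simp [hs₃, finish, Prog.run, Expr.eval, hlen₂, this]
  clear_value s₃
  have hlay : s₃.layout = s₁.layout := by rw [hf₃.layout (by decide), hf₂.layout (by decide)]
  have hc₁ : s₁.var vCyc = s.var vCyc := hf₁.1 _ (by decide)
  have hc₃ : s₃.var vCyc = s₂.var vCyc := hf₃.1 _ (by decide)
  have hcy₃ : s₃.outCycle = s₂.outCycle := outCycle_congr (hf₃.2 _ (by decide)) (hf₃.2 _ (by decide))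
  have hcy₁ : s₁.outCycle = s.outCycle := outCycle_congr (hf₁.2 _ (by decide)) (hf₁.2 _ (by decide))
  have hop : ∀ i, s₃.outOp i = s₁.outOp i := fun i => outOp_congr fun A h1 h2 => by
    rw [hf₃.2 A (by interval_cases A <;> decide), hf₂.2 A (by interval_cases A <;> decide)]
  have hx' := hx.ext
  rw [← hlay] at hx' hw
  refine ⟨hs.advance hx' ((hst₁.frame hf₂ (by decide) (by decide)).frame hf₃ (by decide) (by decide))
    (hout₂.frame hf₃ (by decide) (by decide)) hlen₃ (by rw [hc₃, hc₂, hc₁]) (by rw [hop, hx.op])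
    (fun i hi => by rw [hop, hx.op_old i hi.ne]) ?_ ?_ ?_ ?_, hw⟩
  · intro i hi
    simp only [State.outCount, hcnt₃]
    rw [Function.update_of_ne (by omega)]
  · simp only [State.outCount, hcnt₃, Function.update_self, hc₃]
  · intro j hj
    rw [hcy₃, hold₂ j (by omega), hcy₁]
  · rw [hlay, hcy₃, ← hc₁]
    exact hnew₂

end RAM

/-! ### The first phase: all vertices become branch vertices. -/

namespace RAM

/-- Find the start of the next ear: the interior of a path, or else an edge that leaves the
subgraph. -/
def select : Prog :=
  (.assign vZ (.var vN) ;; .assign vV (.const 0)) ;;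
  .upTo vV vN (.when (.minus (.cell aVst (.var vV)) (.const 1))
    (.assign vZ (.var vV) ;; .assign vKey (.cell aVst (.var vV)) ;; .assign vE0 (.var vM))) ;;
  .when (.eq (.var vZ) (.var vN)) (.assign vPos (.const 0) ;;
    .upTo vPos vArcs (.when (.cell aVst (.cell aOwn (.var vPos)))
      (.when (.isZero (.cell aVst (.cell aNbr (.var vPos))))
        (.assign vZ (.cell aNbr (.var vPos)) ;; .assign vA0 (.cell aOwn (.var vPos)) ;;
          .assign vE0 (.cell aEdg (.var vPos)) ;; .assign vKey (.plus (.var vM) (.const 2)))))) ;;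
  .assign vGo (.minus (.var vN) (.var vZ))

/-- The result of the selection of a start. -/
def Selected (G : Graph ℕ ℕ) (n m : ℕ) (s : State) : Prop :=
  (s.var vGo ≠ 0 → s.var vZ < n ∧
    s.layout.SearchStart G m (s.var vZ) (s.var vKey) (s.var vE0) (s.var vA0)) ∧
  (s.var vGo = 0 → ∀ v < n, s.layout.vst v = 1)

/-- The value `vZ = n` means that no start has been found. Interior vertices have priority: the arcs
are inspected only if there are none, so that `SearchStart` holds with all states at most 1. If
neither pass finds anything, the subgraph contains all vertices by `Layout.vst_eq_one`. -/
theorem select_spec {G : Graph ℕ ℕ} {n m : ℕ} {s : State} (hV : G.vertexSet = Set.Iio n)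
    (hG : G.IsEdgeConnected 3) (hs : Static G n m s) (hD : s.layout.Good G n m) :
    Ends select s (500 * (n + m + 1)) (Selected G n m) := by
  have hvst : ∀ v, s.arr aVst v = s.layout.vst v := fun _ => rfl
  have hlt := hD.vst_lt
  set D := s.layout with hDs
  have h0n : 0 < n := hlt 0 (by rw [hD.root]; omega)
  refine Ends.mono (T := 4 + (((40 + 8) * (n - 0) + 4) + ((12 + (2 + ((80 + 8) * (4 * m) + 4))) + 10)))
    (Ends.seq (Ends.flat (by rfl) (by decide) ?_)) (by omega) fun _ h => h
  set s₀ := Prog.run _ s with hs₀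
  have hf₀ : Frame [vZ, vV] [] s s₀ := by
    refine ⟨fun x hx => ?_, fun X _ => ?_⟩
    · simp only [List.mem_cons, List.not_mem_nil, or_false, not_or] at hx
      simp [hs₀, Prog.run, hx]
    · simp [hs₀, Prog.run]
  have hZ₀ : s₀.var vZ = n := by simp [hs₀, Prog.run, Expr.eval, hs.var_n]
  have hV₀ : s₀.var vV = 0 := by simp [hs₀, Prog.run, Expr.eval]
  clear_value s₀
  refine Ends.seq ((Ends.upTo (lo := 0) (hi := n) (T := 40)
    (fun j s' => (s'.var vZ = n ∧ ∀ v < j, D.vst v ≤ 1) ∨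
      (s'.var vZ < n ∧ 2 ≤ D.vst (s'.var vZ) ∧ s'.var vKey = D.vst (s'.var vZ) ∧ s'.var vE0 = m))
    (by decide) (by decide) (by decide) hV₀ (by rw [hf₀.1 _ (by decide), hs.var_n]) (Nat.zero_le _)
    (Or.inl ⟨hZ₀, fun v hv => by omega⟩) ?_).mono le_rfl ?_)
  · rintro j s₁ - hj hj₁ hf₁ hI
    have ha : s₁.arr aVst = D.vst := by rw [hf₁.2 _ (by decide), hf₀.2 _ (by decide)]; rfl
    have hm : s₁.var vM = m := by rw [hf₁.1 _ (by decide), hf₀.1 _ (by decide), hs.var_m]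
    apply Ends.flat (by rfl) (by decide)
    by_cases hc : 2 ≤ D.vst j
    · right
      have hc' : D.vst j - 1 ≠ 0 := by omega
      simp only [Prog.run, Prog.when, Expr.eval, ha, hj₁, hc', hm, State.setVar_var, State.setVar_arr,
        Nat.reduceEqDiff, reduceIte, ne_eq, not_false_eq_true]
      exact ⟨hj, hc, trivial, trivial⟩
    · have hc' : D.vst j - 1 = 0 := by omega
      simp only [Prog.run, Prog.when, Expr.eval, ha, hj₁, hc', State.setVar_var,
        Nat.reduceEqDiff, reduceIte, ne_eq, not_true_eq_false]
      rcases hI with ⟨h1, h2⟩ | hI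
      · refine Or.inl ⟨h1, fun v hv => ?_⟩
        by_cases hvj : v = j
        · subst hvj; omega
        · exact h2 v (by omega)
      · exact Or.inr hI
  rintro s₁ ⟨hI, -, hf₁⟩
  have hf := (hf₀.mono (List.subset_append_left _ _) (List.subset_append_left _ _)).trans
    (hf₁.mono (List.subset_append_right [vZ, vV] _) (List.subset_append_right [] _))
  have hs₁ : Static G n m s₁ := hs.frame hf (by decide) (by decide)
  have hlay₁ : s₁.layout = D := hf.layout (by decide)
  clear hf hf₁ hf₀ hs₀ hZ₀ hV₀
  clear_value D
  have hfinal : ∀ s₂ : State, s₂.layout = D → s₂.var vN = n →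
      ((s₂.var vZ = n ∧ ∀ v < n, D.vst v = 1) ∨ (s₂.var vZ < n ∧
        D.SearchStart G m (s₂.var vZ) (s₂.var vKey) (s₂.var vE0) (s₂.var vA0))) →
      Ends (.assign vGo (.minus (.var vN) (.var vZ))) s₂ 10 (Selected G n m) := by
    intro s₂ hl hn h
    apply Ends.flat (by rfl) (by decide)
    have hl' : (s₂.setVar vGo (n - s₂.var vZ)).layout = D := hl
    simp only [Prog.run, Expr.eval, hn, Selected, hl', State.setVar_var, Nat.reduceEqDiff, reduceIte]
    rcases h with ⟨h1, h2⟩ | ⟨h1, h2⟩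
    · exact ⟨fun h => by omega, fun _ => h2⟩
    · exact ⟨fun _ => ⟨h1, h2⟩, fun h => by omega⟩
  refine Ends.seq ?_
  refine Ends.mono (T := Expr.cost (.eq (.var vZ) (.var vN)) + 2 + (2 + ((80 + 8) * (4 * m) + 4)))
    (Ends.when (fun hc => ?_) (fun hc => ?_)) (by simp [Expr.cost, Expr.eq, Expr.ne, Expr.isZero])
    fun _ h => h
  · rw [ne_eq, Expr.eval_eq_eq_zero, not_not] at hc
    simp only [Expr.eval, hs₁.var_n] at hc
    have hle : ∀ v, D.vst v ≤ 1 := by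
      intro v
      rcases Nat.lt_or_ge v n with h1 | h1
      · rcases hI with ⟨-, h2⟩ | ⟨h2, -⟩
        · exact h2 v h1
        · omega
      · by_contra h2
        have := hlt v (by omega)
        omega
    refine Ends.seq (Ends.flat (by rfl) (by decide) ?_)
    set s₂ := Prog.run _ s₁ with hs₂
    have hf₂ : Frame [vPos] [] s₁ s₂ := by
      refine ⟨fun x hx => ?_, fun X _ => ?_⟩
      · simp only [List.mem_cons, List.not_mem_nil, or_false] at hx
        simp [hs₂, Prog.run, hx]
      · simp [hs₂, Prog.run]
    have hp₂ : s₂.var vPos = 0 := by simp [hs₂, Prog.run, Expr.eval]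
    clear_value s₂
    have harc := hs₁.arcs_le
    refine (Ends.upTo (lo := 0) (hi := s₁.arr aOff n) (T := 80)
      (fun j s' => (s'.var vZ = n ∧ ∀ p < j, D.vst (s₁.arr aOwn p) ≠ 0 → D.vst (s₁.arr aNbr p) ≠ 0) ∨
        (s'.var vZ < n ∧ D.SearchStart G m (s'.var vZ) (s'.var vKey) (s'.var vE0) (s'.var vA0)))
      (by decide) (by decide) (by decide) hp₂ (by rw [hf₂.1 _ (by decide), hs₁.var_arcs]) (Nat.zero_le _)
      (Or.inl ⟨by rw [hf₂.1 _ (by decide), hc], fun v hv => by omega⟩) ?_).mono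
      (by rw [Nat.sub_zero]; omega) ?_
    · rintro j s₃ - hj hj₃ hf₃ hI
      have ha : s₃.arr aVst = D.vst := by
        rw [hf₃.2 _ (by decide), hf₂.2 _ (by decide)]
        exact congrArg Layout.vst hlay₁
      have ho : s₃.arr aOwn = s₁.arr aOwn := by rw [hf₃.2 _ (by decide), hf₂.2 _ (by decide)]
      have hn : s₃.arr aNbr = s₁.arr aNbr := by rw [hf₃.2 _ (by decide), hf₂.2 _ (by decide)]
      have he : s₃.arr aEdg = s₁.arr aEdg := by rw [hf₃.2 _ (by decide), hf₂.2 _ (by decide)]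
      have hm : s₃.var vM = m := by rw [hf₃.1 _ (by decide), hf₂.1 _ (by decide), hs₁.var_m]
      apply Ends.flat (by rfl) (by decide)
      obtain ⟨h1, -, -, h2⟩ := hs₁.arc j hj
      by_cases hca : D.vst (s₁.arr aOwn j) = 0
      · simp only [Prog.run, Prog.when, Expr.eval, ha, hj₃, ho, hca, State.setVar_var,
          Nat.reduceEqDiff, reduceIte, ne_eq, not_true_eq_false]
        refine hI.imp_left fun h => ⟨h.1, fun p hp hp' => ?_⟩
        by_cases hpj : p = j
        · subst hpj; exact absurd hca hp'
        · exact h.2 p (by omega) hp'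
      by_cases hcb : D.vst (s₁.arr aNbr j) = 0
      · right
        simp only [Prog.run, Prog.when, Expr.eval, Expr.eval_isZero_eq_zero, ha, hj₃, ho, hn, he, hm, hca, hcb,
          State.setVar_var, State.setVar_arr, Nat.reduceEqDiff, reduceIte, ne_eq, not_false_eq_true,
          not_true_eq_false]
        have hz := h2.right_mem
        rw [hV] at hz
        refine ⟨hz, Or.inr ⟨hcb, rfl, ?_, h2.symm, ?_, hle⟩⟩
        · have := hle (s₁.arr aOwn j)
          omega
        -- An edge of the subgraph has both ends in it, so the edge to the missing vertex is
        -- unlabelled.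
        · by_contra hl
          obtain ⟨f, hf, -⟩ := hD.lab_label _ hl
          obtain ⟨-, h3⟩ := hD.vst_of_isLink hD.closed hf h2.symm
          omega
      · simp only [Prog.run, Prog.when, Expr.eval, Expr.eval_isZero_eq_zero, ha, hj₃, ho, hn, hca, hcb,
          State.setVar_var, Nat.reduceEqDiff, reduceIte, ne_eq, not_false_eq_true, not_true_eq_false]
        refine hI.imp_left fun h => ⟨h.1, fun p hp hp' => ?_⟩
        by_cases hpj : p = j
        · subst hpj; exact hcb
        · exact h.2 p (by omega) hp'
    · rintro s₃ ⟨hI, -, hf₃⟩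
      refine hfinal s₃ (by rw [hf₃.layout (by decide), hf₂.layout (by decide), hlay₁])
        (by rw [hf₃.1 _ (by decide), hf₂.1 _ (by decide), hs₁.var_n]) (hI.imp_left fun h => ⟨h.1, ?_⟩)
      refine Layout.vst_eq_one hV hG ⟨0, h0n, hD.root⟩ (fun v _ => hle v) fun e u v hl hu => ?_
      obtain ⟨p, hp, rfl, rfl, rfl⟩ := hs₁.exists_arc e u v hl
      exact h.2 p hp (by omega)
  · rw [Expr.eval_eq_eq_zero] at hc
    simp only [Expr.eval, hs₁.var_n] at hc
    refine hfinal s₁ hlay₁ hs₁.var_n (Or.inr ?_)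
    rcases hI with ⟨h1, -⟩ | ⟨h1, h2, h3, h4⟩
    · exact absurd h1 hc
    · exact ⟨h1, Or.inl ⟨h2, h3, h4⟩⟩

/-- Extend the subgraph until all vertices are branch vertices. -/
def span : Prog := select ;; .loop (.var vGo) (step ;; select)

/-- Every round raises the weight, which is at most `2 * n`. So the potential is proportional to `2
* n - weight`, with the factor O(n + m) for a round. -/
theorem span_spec : ∃ C : ℕ, ∀ (G : Graph ℕ ℕ) (n m : ℕ) (s : State), G.vertexSet = Set.Iio n →
    G.edgeSet = Set.Iio m → G.IsEdgeConnected 3 → Main G n m s →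
    Ends span s (C * ((n + m + 1) * (2 * n + 2))) fun s' => Main G n m s' ∧ ∀ v < n, s'.layout.vst v = 1 := by
  obtain ⟨C, hC⟩ := step_spec
  refine ⟨C + 600, fun G n m s hV hE hG hs => ?_⟩
  have hsel : ∀ s, Main G n m s → Ends select s (500 * (n + m + 1)) fun s' => Main G n m s' ∧
      s'.layout = s.layout ∧ Selected G n m s' := fun s hs =>
    (select_spec hV hG hs.static hs.good).frame.mono le_rfl fun s' h =>
      ⟨hs.frame h.2 (by decide) (by decide), h.2.layout (by decide), h.1⟩
  refine Ends.mono (T := 500 * (n + m + 1) + ((C + 600) * (n + m + 1) * (2 * n) + 2)) (Ends.seq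
    ((hsel s hs).mono le_rfl ?_)) ?_ fun _ h => h
  rotate_left
  · have : (C + 600) * ((n + m + 1) * (2 * n + 2)) =
        (C + 600) * (n + m + 1) * (2 * n) + 2 * (C * (n + m + 1)) + 1200 * (n + m + 1) := by ring
    omega
  rintro s₁ ⟨hs₁, -, hsel₁⟩
  refine (Ends.loop (fun s' => Main G n m s' ∧ Selected G n m s')
    (fun s' => (C + 600) * (n + m + 1) * (2 * n - s'.layout.weight n)) ⟨hs₁, hsel₁⟩ ?_).mono ?_ ?_
  · rintro s₂ ⟨hs₂, hsel₂⟩ hc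
    obtain ⟨hz, hstart⟩ := hsel₂.1 hc
    refine ⟨C * (n + m + 1) + 500 * (n + m + 1), Ends.seq ((hC G n m s₂ hV hE hG hs₂ hstart hz).mono le_rfl ?_)⟩
    rintro s₃ ⟨hs₃, hw⟩
    refine (hsel s₃ hs₃).mono le_rfl ?_
    rintro s₄ ⟨hs₄, hlay, hsel₄⟩
    refine ⟨⟨hs₄, hsel₄⟩, ?_⟩
    have h1 := Layout.weight_le n s₃.layout
    obtain ⟨d, hd⟩ : ∃ d, 2 * n - s₂.layout.weight n = (2 * n - s₄.layout.weight n) + 1 + d :=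
      ⟨2 * n - s₂.layout.weight n - (2 * n - s₄.layout.weight n) - 1, by rw [hlay]; omega⟩
    rw [hd]
    simp only [Expr.cost]
    have : (C + 600) * (n + m + 1) * ((2 * n - s₄.layout.weight n) + 1 + d) =
        (C + 600) * (n + m + 1) * (2 * n - s₄.layout.weight n) + C * (n + m + 1) + 600 * (n + m + 1) +
          (C + 600) * (n + m + 1) * d := by ring
    omega
  · have := Nat.mul_le_mul_left ((C + 600) * (n + m + 1)) (Nat.sub_le (2 * n) (s₁.layout.weight n))
    simp only [Expr.cost]
    omega
  · rintro s₂ ⟨⟨hs₂, hsel₂⟩, hc⟩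
    exact ⟨hs₂, hsel₂.2 hc⟩

end RAM

-- The second phase: the remaining edges are added.

notation "vFrom" => (37 : ℕ)
notation "vTo" => (38 : ℕ)

namespace Layout

variable {G : Graph ℕ ℕ} {n m : ℕ} {D : Layout}

/-- If all vertices are branch vertices, then every path that represents an edge has length one. -/
theorem Embedded.isLink_of_spanning (hD : D.Embedded G n m) (hall : ∀ v < n, D.vst v = 1) {e : ℕ}
    (he : D.lab e ≠ 0) : D.lab e = e + 1 ∧ G.IsLink e (D.src e) (D.tgt e) := by
  obtain ⟨f, h1, h2⟩ := hD.lab_label e he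
  obtain ⟨l, x, d, hL⟩ := hD.exists_link f h2
  have hpos := hL.pos
  have hl : l = 1 := by
    by_contra hl
    have h3 := (hL.vst_iff (x 1)).2 ⟨1, by omega, by omega, rfl⟩
    have h4 := hall _ (hD.vst_lt (x 1) (by omega))
    omega
  subst hl
  obtain ⟨i, hi, rfl⟩ := (hL.lab_iff e).1 h1
  obtain rfl : i = 0 := by omega
  have hfirst := hL.first
  have h3 := hL.link 0 hi
  rw [hL.src_eq, hL.tgt_eq, hfirst] at h3
  rw [hfirst]
  exact ⟨h2, h3⟩

theorem Embedded.graph_eq (hD : D.Embedded G n m) (hcl : (D.net m).Closed) (hV : G.vertexSet = Set.Iio n)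
    (hE : G.edgeSet = Set.Iio m) (hall : ∀ v < n, D.vst v = 1) (hlab : ∀ e < m, D.lab e ≠ 0) :
    (D.net m).graph = G := by
  refine Graph.ext ?_ fun e x y => ?_
  · rw [hV]
    ext v
    refine ⟨fun hv => hD.vst_lt v ?_, fun hv => hall v hv⟩
    have : D.vst v = 1 := hv
    omega
  · rw [Net.isLink_iff hcl]
    constructor
    · rintro ⟨he, h⟩
      have h1 := (hD.isLink_of_spanning hall (e := e) (by rw [hD.mem_net.1 he]; omega)).2
      rcases h with ⟨rfl, rfl⟩ | ⟨rfl, rfl⟩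
      · exact h1
      · exact h1.symm
    · intro h
      have he := h.edge_mem
      rw [hE] at he
      obtain ⟨h1, h2⟩ := hD.isLink_of_spanning hall (hlab e he)
      refine ⟨hD.mem_net.2 h1, ?_⟩
      rcases h2.eq_and_eq_or_eq_and_eq h with h3 | h3
      · exact Or.inl h3
      · exact Or.inr h3

end Layout

namespace RAM

/-- If the edge at the position `vFrom` does not belong to the subgraph, then add it and list the
cycle that it forms with the tree. -/
def addEdge : Prog :=
  .when (.isZero (.cell aLab (.cell aEdg (.var vFrom))))
    ((.assign vE (.cell aEdg (.var vFrom)) ;; .assign vB (.cell aNbr (.var vFrom)) ;;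
        .store aLab (.var vE) (.plus (.var vE) (.const 1)) ;; .store aSrc (.var vE) (.var vB) ;;
        .store aTgt (.var vE) (.var vA)) ;;
      recordA ;; emit ;; finish)

/-- Add the remaining edges at the vertex `vR`. -/
def addEdges : Prog :=
  (.assign vE (.var vM) ;; .assign vF1 (.var vM) ;; .assign vF2 (.var vM) ;; .assign vA (.var vR) ;;
    .assign vLim (.const 0)) ;;
  netSearch ;;
  (.assign vFrom (.cell aOff (.var vR)) ;; .assign vTo (.cell aOff (.plus (.var vR) (.const 1)))) ;;
  .upTo vFrom vTo addEdge ;;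
  .assign vR (.plus (.var vR) (.const 1))

/-- Add the remaining edges. -/
def complete : Prog := .assign vR (.const 0) ;; .loop (.minus (.var vN) (.var vR)) addEdges

theorem TreeIn.mono {N N' : Net} {n a : ℕ} {A A' : Set ℕ} {s s' : State} (h : TreeIn N n a A s)
    (hN : ∀ e u v, N.graph.IsLink e u v → N'.graph.IsLink e u v) (hA : A ⊆ A')
    (hvis : s'.arr aVis = s.arr aVis) (hpar : s'.arr aPar = s.arr aPar) (hpe : s'.arr aPe = s.arr aPe) :
    TreeIn N' n a A' s' := by
  obtain ⟨rank, hr⟩ := h.parent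
  refine ⟨h.root_lt, by rw [hvis]; exact h.root, rank, fun v hv hv' hva => ?_⟩
  rw [hvis] at hv'
  rw [hvis, hpar, hpe]
  obtain ⟨h1, h2, h3, h4, h5⟩ := hr v hv hv' hva
  exact ⟨h1, h2, h3, hN _ _ _ h4, hA h5⟩

/-- The invariant while the remaining edges are added. -/
structure Spanning (G : Graph ℕ ℕ) (n m a : ℕ) (s : State) : Prop extends Main G n m s where
  all : ∀ v < n, s.layout.vst v = 1
  var_a : s.var vA = a
  lim : s.var vLim = 0
  tree : TreeIn (s.layout.net m) n a (s.layout.net m).E s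
  vis : ∀ v < n, s.arr aVis v ≠ 0

/-- All vertices are branch vertices, so the missing edge from `b` to `a` is an ear of length one.
The tree with root `a` is not searched again: it remains a tree in the enlarged multigraph and does
not contain the new edge. As all paths have length one, the cycle is listed with `vLim = 0`, which
reduces the cost of an edge to O(n). -/
theorem addEdge_spec {G : Graph ℕ ℕ} {n m a p : ℕ} {s : State} (hV : G.vertexSet = Set.Iio n)
    (hE : G.edgeSet = Set.Iio m) (hs : Spanning G n m a s) (hp : s.var vFrom = p) (hpn : p < s.arr aOff n)
    (hown : s.arr aOwn p = a) :
    Ends addEdge s (60 * (n + 1) + 100) fun s' => Spanning G n m a s' ∧ s'.arr aLab (s.arr aEdg p) ≠ 0 ∧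
      ∀ e, s.arr aLab e ≠ 0 → s'.arr aLab e ≠ 0 := by
  have hD := hs.good
  refine Ends.mono (T := Expr.cost (.isZero (.cell aLab (.cell aEdg (.var vFrom)))) + 2 +
    (20 + (40 + (60 * (n + 0 + 1) + 8)))) (Ends.when (fun hc => ?_) (fun hc => ?_))
    (by simp [Expr.cost, Expr.isZero]; omega) fun _ h => h
  · rw [ne_eq, Expr.eval_isZero_eq_zero, not_not] at hc
    simp only [Expr.eval, hp] at hc
    obtain ⟨-, -, -, hlink⟩ := hs.static.arc p hpn
    rw [hown] at hlink
    set e := s.arr aEdg p with he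
    set b := s.arr aNbr p with hb
    have ha1 := hlink.left_mem
    have hb1 := hlink.right_mem
    rw [hV] at ha1 hb1
    refine Ends.seq (Ends.flat (by rfl) (by decide) ?_)
    set s₁ := Prog.run _ s with hs₁
    have hf₁ : Frame [vE, vB] [aLab, aSrc, aTgt] s s₁ := by
      refine ⟨fun x hx => ?_, fun X hX => ?_⟩
      · simp only [List.mem_cons, List.not_mem_nil, or_false, not_or] at hx
        simp [hs₁, Prog.run, hx]
      · simp only [List.mem_cons, List.not_mem_nil, or_false, not_or] at hX
        simp [hs₁, Prog.run, hX]
    have hE₁ : s₁.var vE = e := by simp [hs₁, Prog.run, Expr.eval, hp, he]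
    have hB₁ : s₁.var vB = b := by simp [hs₁, Prog.run, Expr.eval, hp, hb]
    have hlab₁ : s₁.layout.lab = Function.update s.layout.lab e (e + 1) := by
      simp [State.layout, hs₁, Prog.run, Expr.eval, hp, he]
    have hsrc₁ : s₁.layout.src = Function.update s.layout.src e b := by
      simp [State.layout, hs₁, Prog.run, Expr.eval, hp, he, hb]
    have htgt₁ : s₁.layout.tgt = Function.update s.layout.tgt e a := by
      simp [State.layout, hs₁, Prog.run, Expr.eval, hp, he, hs.var_a]
    clear_value s₁
    have hvst₁ : s₁.layout.vst = s.layout.vst := hf₁.2 aVst (by decide)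
    have hA₁ : s₁.var vA = a := by rw [hf₁.1 _ (by decide), hs.var_a]
    set x : ℕ → ℕ := fun i => if i = 0 then b else a with hx
    have hear : s.layout.Ear G 1 x (fun _ => e) := by
      refine ⟨one_pos, ?_, by omega, by omega, fun _ _ => hc, by omega, ?_, ?_⟩
      · intro i hi
        obtain rfl : i = 0 := by omega
        simpa [hx] using hlink.symm
      · rw [hs.all _ (by simpa [hx] using hb1)]; omega
      · rw [hs.all _ (by simpa [hx] using ha1)]; omega
    -- An ear of length one has no interior vertices, so only the label and the ends of `e` are
    -- written.
    have hrel : s.layout.Relabeled s₁.layout 1 x (fun _ => e) := by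
      refine ⟨fun i _ => by simp [hlab₁], fun d hd => ?_, by omega, fun v _ => by rw [hvst₁], by omega,
        fun v _ => ⟨?_, ?_⟩, by simpa [hx] using hsrc₁, by simpa [hx] using htgt₁⟩
      · rw [hlab₁, Function.update_of_ne (fun h => hd 0 one_pos h.symm)]
      · exact congrFun (hf₁.2 aNv (by decide)) v
      · exact congrFun (hf₁.2 aNe (by decide)) v
    have hext : Layout.Extension G n m s.layout s₁.layout (.typeA e a b) e a b [(e, e)] := by
      simpa [hx] using Layout.Extension.typeA hD hE hV hear hrel (hs.all _ (by simpa [hx] using ha1))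
        (hs.all _ (by simpa [hx] using hb1))
    have hnet := hear.net_eq hE hrel
    have heE : e ∉ (s.layout.net m).E := by
      rw [hD.mem_net, show s.layout.lab e = 0 from hc]; omega
    have hmono : ∀ d u v, (s.layout.net m).graph.IsLink d u v → (s₁.layout.net m).graph.IsLink d u v := by
      intro d u v h
      rw [Net.isLink_iff hD.closed] at h
      rw [Net.isLink_iff hext.good.closed, hnet]
      have hde : d ≠ e := fun hde => heE (hde ▸ h.1)
      simpa [Net.add, hde] using h
    have hsub : ((s.layout.net m).E : Set ℕ) ⊆ (s₁.layout.net m).E := by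
      intro d hd
      rw [hnet]
      exact Finset.mem_coe.2 (Finset.mem_insert_of_mem hd)
    refine Ends.seq (Ends.flat (p := recordA) (s := s₁) (by rfl) (by decide) ?_)
    obtain ⟨ra1, ra2, ra3, -, -, -, -, -, -, ra10⟩ := recordA_run s₁
    have hf₂ : Frame recordA.vars recordA.arrs s₁ (recordA.run s₁) := by
      obtain ⟨t, h1, -⟩ := Prog.exists_run (p := recordA) (by rfl) s₁
      exact h1.frame
    set s₂ := recordA.run s₁
    clear_value s₂
    have hf₁₂ := (hf₁.mono (List.subset_append_left _ recordA.vars)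
      (List.subset_append_left _ recordA.arrs)).trans
      (hf₂.mono (List.subset_append_right _ _) (List.subset_append_right _ _))
    have hE₂ : s₂.var vE = e := by rw [ra10 _ (by decide), hE₁]
    have hA₂ : s₂.var vA = a := by rw [ra10 _ (by decide), hA₁]
    have hB₂ : s₂.var vB = b := by rw [ra10 _ (by decide), hB₁]
    have hlim₂ : s₂.var vLim = 0 := by rw [hf₁₂.1 _ (by decide), hs.lim]
    have hout₂ : OutOK s₂ := hs.out.frame hf₁₂ (by decide) (by decide)
    have hT₂ : TreeIn (s₂.layout.net m) n (s₂.var vA) (s.layout.net m).E s₂ := by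
      rw [ra1, hA₂]
      exact hs.tree.mono hmono subset_rfl (hf₁₂.2 _ (by decide)) (hf₁₂.2 _ (by decide))
        (hf₁₂.2 _ (by decide))
    have hall₂ : ∀ v < n, s₂.layout.vst v = 1 := by
      rw [ra1, hvst₁]; exact hs.all
    have hext₂ := hext
    rw [← ra1] at hext₂ hsub
    -- No edge carries the label of another edge, so the condition on `vLim` is vacuous.
    have hemit := emit_spec hext₂.good.toEmbedded hext₂.good.closed hT₂ hsub (by rw [hE₂]; exact heE)
      (by rw [hB₂]; exact hb1)
      (by rw [hB₂, hf₁₂.2 aVis (by decide)]; exact hs.vis _ hb1) (by rw [hE₂, hA₂, hB₂]; exact hext₂.link)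
      hout₂.mark_le (fun d h1 h2 =>
        absurd (hext₂.good.toEmbedded.isLink_of_spanning hall₂ (e := d) h1).1 h2)
    rw [hlim₂] at hemit
    refine Ends.seq (hemit.frame.mono le_rfl ?_)
    rintro s₃ ⟨⟨W, hL, hW1, hW2, hW3, hW4⟩, hf₃⟩
    rw [hE₂] at hW3
    have hout₃ := hL.outOK hout₂
    apply Ends.flat (by rfl) (by decide)
    set s₄ := Prog.run finish s₃ with hs₄
    have hf₄ : Frame [vLen] [15] s₃ s₄ := by
      refine ⟨fun x hx => ?_, fun X hX => ?_⟩
      · simp only [List.mem_cons, List.not_mem_nil, or_false] at hx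
        simp [hs₄, finish, Prog.run, hx]
      · simp only [List.mem_cons, List.not_mem_nil, or_false] at hX
        simp [hs₄, finish, Prog.run, hX]
    have hlen₂ : s₂.var vLen = s.var vLen := hf₁₂.1 _ (by decide)
    have hlen₃ : s₃.var vLen = s.var vLen := by rw [hf₃.1 _ (by decide), hlen₂]
    have hlen₄ : s₄.var vLen = s.var vLen + 1 := by simp [hs₄, finish, Prog.run, Expr.eval, hlen₃]
    have hcnt₄ : s₄.arr 15 = Function.update (s.arr 15) (s.var vLen + 1) (s₃.var vCyc) := by
      have : s₃.arr 15 = s.arr 15 := by rw [hf₃.2 _ (by decide), hf₁₂.2 _ (by decide)]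
      simp [hs₄, finish, Prog.run, Expr.eval, hlen₃, this]
    clear_value s₄
    have hlay₄ : s₄.layout = s₂.layout := by rw [hf₄.layout (by decide), hf₃.layout (by decide)]
    have hc₂ : s₂.var vCyc = s.var vCyc := hf₁₂.1 _ (by decide)
    have hc₃ := hL.cyc
    have hc₄ : s₄.var vCyc = s₃.var vCyc := hf₄.1 _ (by decide)
    have hcy₄ : s₄.outCycle = s₃.outCycle := outCycle_congr (hf₄.2 _ (by decide)) (hf₄.2 _ (by decide))
    have hcy₂ : s₂.outCycle = s.outCycle :=
      outCycle_congr (hf₁₂.2 _ (by decide)) (hf₁₂.2 _ (by decide))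
    have hop₄ : ∀ i, s₄.outOp i = s₂.outOp i := fun i => outOp_congr fun A h1 h2 => by
      rw [hf₄.2 A (by interval_cases A <;> decide), hf₃.2 A (by interval_cases A <;> decide)]
    have hlen₁ : s₁.var vLen = s.var vLen := hf₁.1 _ (by decide)
    have hext₄ := hext₂
    rw [← hlay₄] at hext₄
    have hlab₄ : s₄.arr aLab = Function.update (s.arr aLab) e (e + 1) := by
      have : s₄.layout.lab = Function.update s.layout.lab e (e + 1) := by rw [hlay₄, ra1, hlab₁]
      exact this
    have hmain : Main G n m s₄ := by
      refine hs.advance hext₄ (((hs.static.frame hf₁₂ (by decide) (by decide)).frame hf₃ (by decide)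
        (by decide)).frame hf₄ (by decide) (by decide)) (hout₃.frame hf₄ (by decide) (by decide)) hlen₄
        (by rw [hc₄, hc₃, hc₂]; rfl) ?_ ?_ ?_ ?_ ?_ ?_
      · rw [hop₄, ← hlen₁, ra2, hE₁, hA₁, hB₁]
      · intro i hi
        rw [hop₄]
        refine outOp_congr fun A h1 h2 => ?_
        rw [ra3 A h1 h2 i (by omega), hf₁.2 A (by interval_cases A <;> decide)]
      · intro i hi
        simp only [State.outCount, hcnt₄]
        rw [Function.update_of_ne (by omega)]
      · simp only [State.outCount, hcnt₄, Function.update_self, hc₄]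
      · intro j hj
        rw [hcy₄, hL.outCycle_old hout₂ (by omega), hcy₂]
      · intro i hi
        simp only [List.length_cons, List.length_nil, Nat.zero_add, Nat.lt_one_iff] at hi
        subst hi
        rw [Nat.add_zero, hlay₄, hcy₄, ← hc₂, hL.outCycle_new hout₂]
        exact ⟨hW1, hW2, hW3, fun h => absurd rfl h, fun h => absurd rfl h⟩
    refine ⟨{ hmain with
      all := by rw [hlay₄]; exact hall₂
      var_a := by rw [hf₄.1 _ (by decide), hf₃.1 _ (by decide), hA₂]
      lim := by rw [hf₄.1 _ (by decide), hf₃.1 _ (by decide), hlim₂]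
      tree := ?_
      vis := ?_ }, ?_, ?_⟩
    · rw [hlay₄]
      rw [hA₂] at hT₂
      exact hT₂.mono (fun _ _ _ h => h) hsub (by rw [hf₄.2 _ (by decide), hf₃.2 _ (by decide)])
        (by rw [hf₄.2 _ (by decide), hf₃.2 _ (by decide)]) (by rw [hf₄.2 _ (by decide), hf₃.2 _ (by decide)])
    · rw [hf₄.2 aVis (by decide), hf₃.2 aVis (by decide), hf₁₂.2 aVis (by decide)]
      exact hs.vis
    · rw [hlab₄, Function.update_self]; omega
    · intro d hd
      rw [hlab₄, Function.update_of_ne]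
      · exact hd
      · rintro rfl; exact hd hc
  · rw [Expr.eval_isZero_eq_zero] at hc
    simp only [Expr.eval, hp] at hc
    exact ⟨hs, hc, fun _ h => h⟩

/-- Every vertex is once the root of a search, which costs O(n + m), and every arc at the root costs
O(n). The potential accordingly pays `K` for each remaining root and `60 * (n + 1) + 108` for each
arc at these roots. Every edge is an arc at one of its ends, so in the end none is missing. -/
theorem complete_spec : ∃ C : ℕ, ∀ (G : Graph ℕ ℕ) (n m : ℕ) (s : State), G.vertexSet = Set.Iio n →
    G.edgeSet = Set.Iio m → Main G n m s → (∀ v < n, s.layout.vst v = 1) →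
    Ends complete s (C * ((n + m + 1) * (n + 1))) fun s' => Main G n m s' ∧
      (s'.layout.net m).graph = G := by
  obtain ⟨C, hC⟩ := netSearch_spec
  refine ⟨C + 1000, fun G n m s hV hE hs hall => ?_⟩
  set K := C * (n + m + 1) + 100 with hK
  refine Ends.mono (T := 2 + (K * n + (60 * (n + 1) + 108) * s.arr aOff n + 4))
    (Ends.seq (Ends.flat (by rfl) (by decide) ?_)) ?_ fun _ h => h
  rotate_left
  · have h1 := Nat.mul_le_mul_left (60 * (n + 1) + 108) hs.static.arcs_le
    nlinarith [Nat.zero_le (n * m), Nat.zero_le (C * (n + m + 1)), Nat.zero_le (n * n)]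
  set s₀ := Prog.run _ s with hs₀
  have hf₀ : Frame [vR] [] s s₀ := by
    refine ⟨fun x hx => ?_, fun X _ => ?_⟩
    · simp only [List.mem_cons, List.not_mem_nil, or_false] at hx
      simp [hs₀, Prog.run, hx]
    · simp [hs₀, Prog.run]
  have hR₀ : s₀.var vR = 0 := by simp [hs₀, Prog.run, Expr.eval]
  clear_value s₀
  have hs₀' : Main G n m s₀ := hs.frame hf₀ (by decide) (by decide)
  have hoff₀ : s₀.arr aOff = s.arr aOff := hf₀.2 _ (by decide)
  refine (Ends.loop (fun s' => Main G n m s' ∧ (∀ v < n, s'.layout.vst v = 1) ∧ s'.var vR ≤ n ∧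
      (∀ p < s₀.arr aOff (s'.var vR), s'.arr aLab (s₀.arr aEdg p) ≠ 0) ∧
      Frame addEdges.vars addEdges.arrs s₀ s')
    (fun s' => K * (n - s'.var vR) + (60 * (n + 1) + 108) * (s₀.arr aOff n - s₀.arr aOff (s'.var vR)))
    ⟨hs₀', by rw [hf₀.layout (by decide)]; exact hall, by omega, ?_, Frame.refl _ _ _⟩ ?_).mono ?_ ?_
  · intro p hp
    exfalso
    obtain ⟨h1, h2, -⟩ := hs₀'.static.arc p (hp.trans_le (hs₀'.static.off_le (by omega)))
    rw [hR₀] at hp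
    have : s₀.arr aOff 0 ≤ s₀.arr aOff (s₀.arr aOwn p) := by
      have hmono := hs₀'.static.off_mono
      have : ∀ w ≤ n, s₀.arr aOff 0 ≤ s₀.arr aOff w := by
        intro w hw
        induction w with
        | zero => exact le_rfl
        | succ w ih => exact (ih (by omega)).trans (hmono w (by omega))
      exact this _ h1.le
    omega
  · rintro s₁ ⟨hs₁, hall₁, -, hlab₁, hfr₁⟩ hc
    have hst := hs₁.static
    simp only [Expr.eval, hst.var_n] at hc
    set r := s₁.var vR with hr
    have hrn : r < n := by omega
    have hmono := hs₀'.static.off_mono r hrn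
    have hle := hs₀'.static.off_le (v := r + 1) hrn
    refine ⟨12 + (C * (n + m + 1) + (10 + (((60 * (n + 1) + 100 + 8) *
      (s₀.arr aOff (r + 1) - s₀.arr aOff r) + 4) + 4))), ?_⟩
    have hoff₁ : s₁.arr aOff = s₀.arr aOff := hfr₁.2 _ (by decide)
    have hedg₁ : s₁.arr aEdg = s₀.arr aEdg := hfr₁.2 _ (by decide)
    have hown₁ : s₁.arr aOwn = s₀.arr aOwn := hfr₁.2 _ (by decide)
    suffices h : Ends addEdges s₁ (12 + (C * (n + m + 1) + (10 + (((60 * (n + 1) + 100 + 8) *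
      (s₀.arr aOff (r + 1) - s₀.arr aOff r) + 4) + 4)))) fun s' => Main G n m s' ∧
        (∀ v < n, s'.layout.vst v = 1) ∧ s'.var vR = r + 1 ∧
        ∀ p < s₀.arr aOff (r + 1), s'.arr aLab (s₀.arr aEdg p) ≠ 0 by
      refine h.frame.mono le_rfl ?_
      rintro s' ⟨⟨h1, h2, h3, h4⟩, h5⟩
      rw [h3]
      refine ⟨⟨h1, h2, hrn, h4, hfr₁.trans h5⟩, ?_⟩
      have hu : n - r = (n - (r + 1)) + 1 := by omega
      obtain ⟨w, hw⟩ : ∃ w, s₀.arr aOff n - s₀.arr aOff (r + 1) = w := ⟨_, rfl⟩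
      obtain ⟨y, hy⟩ : ∃ y, s₀.arr aOff (r + 1) - s₀.arr aOff r = y := ⟨_, rfl⟩
      have hwy : s₀.arr aOff n - s₀.arr aOff r = w + y := by omega
      rw [hw, hy, hwy, hu, Nat.mul_add K, Nat.mul_add (60 * (n + 1) + 108)]
      rw [show 60 * (n + 1) + 100 + 8 = 60 * (n + 1) + 108 from rfl]
      simp only [Expr.cost, hK]
      omega
    refine Ends.seq (Ends.flat (by rfl) (by decide) ?_)
    set s₂ := Prog.run _ s₁ with hs₂
    have hf₂ : Frame [vE, vF1, vF2, vA, vLim] [] s₁ s₂ := by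
      refine ⟨fun x hx => ?_, fun X _ => ?_⟩
      · simp only [List.mem_cons, List.not_mem_nil, or_false, not_or] at hx
        simp [hs₂, Prog.run, hx]
      · simp [hs₂, Prog.run]
    have hA₂ : s₂.var vA = r := by simp [hs₂, Prog.run, Expr.eval, ← hr]
    have hm₂ : s₂.var vE = m ∧ s₂.var vF1 = m ∧ s₂.var vF2 = m := by
      simp [hs₂, Prog.run, Expr.eval, hst.var_m]
    have hL₂ : s₂.var vLim = 0 := by simp [hs₂, Prog.run, Expr.eval]
    clear_value s₂
    have hs₂' : Main G n m s₂ := hs₁.frame hf₂ (by decide) (by decide)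
    have hlay₂ : s₂.layout = s₁.layout := hf₂.layout (by decide)
    refine Ends.seq ((hC G n m s₂ hs₂'.static hs₂'.good.toEmbedded hs₂'.good.closed (by
      rw [hA₂, show s₂.arr aVst = s₁.arr aVst from congrArg Layout.vst hlay₂]
      exact hall₁ r hrn)).frame.mono le_rfl ?_)
    rintro s₃ ⟨⟨hT, hX⟩, hf₃⟩
    have hs₃ : Main G n m s₃ := hs₂'.frame hf₃ (by decide) (by decide)
    have hlay₃ : s₃.layout = s₁.layout := by rw [hf₃.layout (by decide), hlay₂]
    rw [hlay₂] at hT hX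
    rw [hA₂] at hT
    have hvis₃ : ∀ v < n, s₃.arr aVis v ≠ 0 := fun v hv =>
      (hs₁.good.cut3.mem_of_closed (X := {v | v < n ∧ s₃.arr aVis v ≠ 0}) (a := r) (b := v) (p := m) (q := m)
        (hall₁ r hrn) (hall₁ v hv) ⟨hrn, hT.root⟩ fun d hd _ _ => ?_).2
    rotate_left
    -- The three forbidden edges are set to `m`, which is not an edge, so the tree spans all
    -- vertices.
    · have hdm : d ≠ m := by
        have := hs₁.good.lab_lt d (by rw [hs₁.good.mem_net.1 hd]; omega)
        omega
      exact hX d hd (by rwa [hm₂.1]) (by rwa [hm₂.2.1]) (by rwa [hm₂.2.2])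
    refine Ends.seq (Ends.flat (by rfl) (by decide) ?_)
    set s₄ := Prog.run _ s₃ with hs₄
    have hf₄ : Frame [vFrom, vTo] [] s₃ s₄ := by
      refine ⟨fun x hx => ?_, fun X _ => ?_⟩
      · simp only [List.mem_cons, List.not_mem_nil, or_false, not_or] at hx
        simp [hs₄, Prog.run, hx]
      · simp [hs₄, Prog.run]
    have hR₃ : s₃.var vR = r := by rw [hf₃.1 _ (by decide), hf₂.1 _ (by decide)]
    have hoff₃ : s₃.arr aOff = s₀.arr aOff := by
      rw [hf₃.2 _ (by decide), hf₂.2 _ (by decide), hoff₁]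
    have hF₄ : s₄.var vFrom = s₀.arr aOff r := by simp [hs₄, Prog.run, Expr.eval, hR₃, hoff₃]
    have hT₄ : s₄.var vTo = s₀.arr aOff (r + 1) := by simp [hs₄, Prog.run, Expr.eval, hR₃, hoff₃]
    clear_value s₄
    have hlay₄ : s₄.layout = s₁.layout := by rw [hf₄.layout (by decide), hlay₃]
    have hmain₄ : Main G n m s₄ := hs₃.frame hf₄ (by decide) (by decide)
    have hsp₄ : Spanning G n m r s₄ := { hmain₄ with
      all := by rw [hlay₄]; exact hall₁
      var_a := by rw [hf₄.1 _ (by decide), hf₃.1 _ (by decide), hA₂]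
      lim := by rw [hf₄.1 _ (by decide), hf₃.1 _ (by decide), hL₂]
      tree := by
        rw [hlay₄]
        exact hT.mono (fun _ _ _ h => h) (fun d hd => hd.1) (hf₄.2 _ (by decide)) (hf₄.2 _ (by decide))
          (hf₄.2 _ (by decide))
      vis := by rw [hf₄.2 aVis (by decide)]; exact hvis₃ }
    have hoff₄ : s₄.arr aOff = s₀.arr aOff := by rw [hf₄.2 _ (by decide), hoff₃]
    have hedg₄ : s₄.arr aEdg = s₀.arr aEdg := by
      rw [hf₄.2 _ (by decide), hf₃.2 _ (by decide), hf₂.2 _ (by decide), hedg₁]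
    have hown₄ : s₄.arr aOwn = s₀.arr aOwn := by
      rw [hf₄.2 _ (by decide), hf₃.2 _ (by decide), hf₂.2 _ (by decide), hown₁]
    refine Ends.seq ((Ends.upTo (lo := s₀.arr aOff r) (hi := s₀.arr aOff (r + 1)) (T := 60 * (n + 1) + 100)
      (fun j s' => Spanning G n m r s' ∧ ∀ p < j, s'.arr aLab (s₀.arr aEdg p) ≠ 0) (by decide) (by decide)
      (by decide) hF₄ hT₄ hmono ?_ ?_).mono le_rfl ?_)
    · refine ⟨hsp₄, fun p hp => ?_⟩
      rw [show s₄.arr aLab = s₁.arr aLab from congrArg Layout.lab hlay₄]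
      exact hlab₁ p hp
    · rintro j s₅ hj1 hj2 hj hf₅ ⟨hs₅, hlab₅⟩
      have hoff₅ : s₅.arr aOff = s₀.arr aOff := by rw [hf₅.2 _ (by decide), hoff₄]
      have hown₅ : s₅.arr aOwn = s₀.arr aOwn := by rw [hf₅.2 _ (by decide), hown₄]
      have hedg₅ : s₅.arr aEdg = s₀.arr aEdg := by rw [hf₅.2 _ (by decide), hedg₄]
      refine (addEdge_spec hV hE hs₅ hj (by rw [hoff₅]; omega) (by
        rw [hown₅]; exact hs₀'.static.own r hrn j hj1 hj2)).mono le_rfl ?_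
      rintro s₆ ⟨hs₆, h1, h2⟩
      rw [hedg₅] at h1
      have hmain₆ : Main G n m (s₆.setVar vFrom (j + 1)) := hs₆.toMain.frame (V := [vFrom]) (A := [])
        ⟨fun x hx => by
          simp only [List.mem_cons, List.not_mem_nil, or_false] at hx
          simp [hx], fun _ _ => rfl⟩ (by decide) (by decide)
      refine ⟨{ hmain₆ with
        all := hs₆.all
        var_a := by simpa using hs₆.var_a
        lim := by simpa using hs₆.lim
        tree := hs₆.tree.mono (fun _ _ _ h => h) subset_rfl rfl rfl rfl
        vis := hs₆.vis }, fun p hp => ?_⟩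
      by_cases hpj : p = j
      · subst hpj; exact h1
      · exact h2 _ (hlab₅ p (by omega))
    · rintro s₅ ⟨⟨hs₅, hlab₅⟩, -, hf₅⟩
      have hR₅ : s₅.var vR = r := by rw [hf₅.1 _ (by decide), hf₄.1 _ (by decide), hR₃]
      apply Ends.flat (by rfl) (by decide)
      have hrun : Prog.run (.assign vR (.plus (.var vR) (.const 1))) s₅ = s₅.setVar vR (r + 1) := by
        simp [Prog.run, Expr.eval, hR₅]
      rw [hrun]
      refine ⟨hs₅.toMain.frame (V := [vR]) (A := []) ⟨fun x hx => by
        simp only [List.mem_cons, List.not_mem_nil, or_false] at hx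
        simp [hx], fun _ _ => rfl⟩ (by decide) (by decide), hs₅.all, by simp, hlab₅⟩
  · simp only [Expr.cost, hoff₀]
    have h1 : n - s₀.var vR = n := by omega
    rw [h1]
    have := Nat.mul_le_mul_left (60 * (n + 1) + 108)
      (Nat.sub_le (s.arr aOff n) (s.arr aOff (s₀.var vR)))
    omega
  · rintro s₁ ⟨⟨hs₁, hall₁, hRn, hlab₁, hfr₁⟩, hc⟩
    simp only [Expr.eval, hs₁.static.var_n] at hc
    have hRn' : s₁.var vR = n := by omega
    rw [hRn'] at hlab₁
    refine ⟨hs₁, hs₁.good.toEmbedded.graph_eq hs₁.good.closed hV hE hall₁ fun e he => ?_⟩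
    have : e ∈ G.edgeSet := by rw [hE]; exact he
    obtain ⟨u, v, huv⟩ := Graph.exists_isLink_of_mem_edgeSet this
    obtain ⟨p, hp, -, rfl, -⟩ := hs₀'.static.exists_arc e u v huv
    exact hlab₁ p hp

end RAM

/-! ### The complete algorithm and its bounds. -/

namespace RAM

theorem inputState_bounded {G : Graph ℕ ℕ} {n m : ℕ} {adj : ℕ → List (ℕ × ℕ)}
    (hV : G.vertexSet = Set.Iio n) (hE : G.edgeSet = Set.Iio m) (hadj : IsAdjacencyList G adj) :
    (inputState n m adj).Bounded (4 * m + n + 1) := by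
  have hentry : ∀ i, (((List.range n).flatMap adj).getD i (0, 0)).1 ≤ n ∧
      (((List.range n).flatMap adj).getD i (0, 0)).2 ≤ m := by
    intro i
    rcases Nat.lt_or_ge i ((List.range n).flatMap adj).length with h | h
    · rw [List.getD_eq_getElem _ _ h]
      obtain ⟨v, -, hv⟩ := List.mem_flatMap.1 (List.getElem_mem h)
      have hl := (mem_adj hadj v _ _).1 hv
      have h1 := hl.right_mem
      have h2 := hl.edge_mem
      rw [hV] at h1
      rw [hE] at h2
      exact ⟨h1.le, h2.le⟩
    · rw [List.getD_eq_default _ _ h]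
      exact ⟨Nat.zero_le _, Nat.zero_le _⟩
  constructor
  · intro x
    simp only [inputState]
    split_ifs <;> omega
  · intro A i
    have h1 := hentry i
    simp only [inputState]
    split_ifs with hA hi
    · have h2 := length_flatMap_mono (adj := adj) hi
      have h3 := length_flatMap_le (n := n) hE hadj
      omega
    all_goals omega

/-- The memory after the setup is a layout of the single vertex 0. The lattice of even vectors on
the empty edge set is trivial, with the empty basis. -/
theorem main_initial {G : Graph ℕ ℕ} {n m : ℕ} {s : State} (hn : 0 < n) (hs : Static G n m s)
    (hvar : ∀ x, 4 < x → x ≠ vV → x ≠ vPos → x ≠ vEnd → s.var x = 0)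
    (harr : ∀ A, 2 < A → A ≠ aOwn → A ≠ aVst → ∀ i, s.arr A i = 0)
    (hvst : ∀ i, s.arr aVst i = if i = 0 then 1 else 0) : Main G n m s := by
  have hvst' : ∀ v, s.layout.vst v = if v = 0 then 1 else 0 := hvst
  have hlab : ∀ e, s.layout.lab e = 0 := harr aLab (by decide) (by decide) (by decide)
  have hV : (s.layout.net m).V = {0} := by
    ext v
    simp [Layout.net, hvst']
  have hE : (s.layout.net m).E = ∅ := by
    ext e
    simp [Layout.net, hlab]
  have hcl : (s.layout.net m).Closed := by
    intro e he
    simp [hE] at he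
  have hcyc : s.var vCyc = 0 := hvar _ (by decide) (by decide) (by decide) (by decide)
  have hlen : s.var vLen = 0 := hvar _ (by decide) (by decide) (by decide) (by decide)
  have hout : s.var vOut = 0 := hvar _ (by decide) (by decide) (by decide) (by decide)
  have hcnt : ∀ i, s.outCount i = 0 := harr 15 (by decide) (by decide) (by decide)
  have hbasis : (s.layout.net m).Basis s.outCycle 0 :=
    ⟨fun _ _ j hj => by omega, fun _ _ => ⟨0, fun d hd => by simp [hE] at hd⟩⟩
  refine ⟨hs, ⟨⟨fun e h => absurd (hlab e) h, fun v h => ?_, fun e h => absurd (hlab e) h, fun v f h => ?_,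
    fun f h => ?_⟩, hcl, ?_, by rw [hvst']; rfl⟩, ⟨?_, ?_, ?_⟩, by omega, by rw [hcnt, hcyc],
    fun _ => (s.layout.net m).graph, hV, ?_, by omega, rfl, by rw [hcnt]; exact hbasis, ?_, by omega, by omega⟩
  · rw [hvst'] at h
    split_ifs at h with h0
    · omega
    · exact absurd rfl h
  · rw [hvst'] at h
    split_ifs at h; omega
  · rw [hlab] at h; omega
  · rintro X ⟨x, hx, hxX⟩ ⟨y, hy, hyX⟩
    rw [hV, Set.mem_singleton_iff] at hx hy
    rw [hx] at hxX
    rw [hy] at hyX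
    exact absurd hxX hyX
  · rw [harr aStart (by decide) (by decide) (by decide), hout]
  · intro j _
    rw [harr aStart (by decide) (by decide) (by decide)]
    exact Nat.zero_le _
  · intro f
    rw [harr aMark (by decide) (by decide) (by decide)]
    exact Nat.zero_le _
  · rw [Net.edgeSet_graph hcl, hE, Finset.coe_empty]
  · intro i _
    rw [hcnt]
    exact hbasis.isLatticeCycleBasis hcl fun j hj => by omega

/-- The algorithm. -/
def algorithm : Prog :=
  setup ;; span ;; complete ;; .assign 0 (.const 0) ;; .assign 1 (.var vLen)

/-- The phases cost O(mn + n), O((n + m)n) and O((n + m)n), up to lower terms. The inequality `n ≤ 4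
* m + 1` reduces all of this to `m * n + 1`; the summand 1 is needed for `m = 0`. -/
theorem algorithm_spec : ∃ C : ℕ, ∀ (n m : ℕ) (G : Graph ℕ ℕ) (adj : ℕ → List (ℕ × ℕ)),
    G.vertexSet = Set.Iio n → G.edgeSet = Set.Iio m → G.IsEdgeConnected 3 → IsAdjacencyList G adj →
    Ends algorithm (inputState n m adj) (C * (m * n + 1)) fun s =>
      ∃ (Γ : ℕ → Graph ℕ ℕ) (𝒞 : ℕ → Set (Set ℕ)), G.IsTopExtSeq s.outStart s.outLength s.outOp Γ ∧
        Graph.IsCompatibleChain s.outLength s.outOp Γ 𝒞 ∧ s.DescribesChain s.outLength Γ 𝒞 := by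
  obtain ⟨C₁, hC₁⟩ := span_spec
  obtain ⟨C₂, hC₂⟩ := complete_spec
  refine ⟨18 * C₁ + 9 * C₂ + 1000, fun n m G adj hV hE hG hadj => ?_⟩
  have hn : 0 < n := by
    obtain ⟨v, hv⟩ := (hG ∅ (by simp) (by simp)).1
    have hv' : v ∈ G.vertexSet := by simpa using hv
    rw [hV] at hv'
    exact lt_of_le_of_lt (Nat.zero_le v) hv'
  have hsetup := setup_spec hV hE hG hadj
  -- The bound does not mention the state, so it can be extracted from any final state of the setup.
  have hcard : n ≤ 4 * m + 1 := by
    obtain ⟨_, _, -, -, hst, -⟩ := hsetup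
    exact hst.card_le
  have hnm : n ≤ m * n + 1 := by
    rcases Nat.eq_zero_or_pos m with rfl | hm
    · omega
    · exact (Nat.le_mul_of_pos_left n hm).trans (Nat.le_succ _)
  have hmn : m ≤ m * n := Nat.le_mul_of_pos_right m hn
  have hnn : n * n ≤ 4 * (m * n) + n := by nlinarith
  have hq : (n + m + 1) * (n + 1) ≤ 9 * (m * n + 1) := by nlinarith
  refine Ends.mono (T := 100 * (n * m + n + 1) + (C₁ * ((n + m + 1) * (2 * n + 2)) +
    (C₂ * ((n + m + 1) * (n + 1)) + 10))) (Ends.seq (hsetup.mono le_rfl ?_)) ?_ fun _ h => h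
  rotate_left
  · have h1 := Nat.mul_le_mul_left C₁ hq
    have h2 := Nat.mul_le_mul_left C₂ hq
    have h3 : (n + m + 1) * (2 * n + 2) = 2 * ((n + m + 1) * (n + 1)) := by ring
    rw [h3]
    nlinarith
  rintro s₁ ⟨hst, hvar, harr, hvst⟩
  refine Ends.seq ((hC₁ G n m s₁ hV hE hG (main_initial hn hst hvar harr hvst)).mono le_rfl ?_)
  rintro s₂ ⟨hs₂, hall⟩
  refine Ends.seq ((hC₂ G n m s₂ hV hE hs₂ hall).mono le_rfl ?_)
  rintro s₃ ⟨hs₃, hgraph⟩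
  apply Ends.flat (by rfl) (by decide)
  set s₄ := Prog.run _ s₃ with hs₄
  have harr₄ : s₄.arr = s₃.arr := by simp [hs₄, Prog.run]
  have hstart : s₄.outStart = 0 := by simp [hs₄, State.outStart, Prog.run, Expr.eval]
  have hlength : s₄.outLength = s₃.var vLen := by simp [hs₄, State.outLength, Prog.run, Expr.eval]
  clear_value s₄
  have hop : s₄.outOp = s₃.outOp := funext fun i => outOp_congr fun A _ _ => by rw [harr₄]
  have hcyc : s₄.outCycle = s₃.outCycle := outCycle_congr (by rw [harr₄]) (by rw [harr₄])
  have hcnt : s₄.outCount = s₃.outCount := by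
    funext i
    simp only [State.outCount, harr₄]
  obtain ⟨Γ, hΓ⟩ := hs₃.hist
  refine ⟨Γ, ?_⟩
  rw [hstart, hlength]
  rw [← hop, ← hcyc, ← hcnt] at hΓ
  refine hΓ.conclude hs₃.good.closed hgraph fun j hj e he => ?_
  rw [hcnt, hs₃.cnt] at hj
  rw [hcyc] at he
  rw [← Net.edgeSet_graph hs₃.good.closed, hgraph, hE]
  refine hs₃.good.lab_lt e fun h0 => (hs₃.resp j hj).2 e h0 he

end RAM

/-- There are a program `P` and a constant `c` such that, for every 3-edge-connected graph `G` with
vertices `0, …, n - 1` and edges `0, …, m - 1`, given by adjacency lists, `P` halts after at most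
`c * (m * n + 1)` steps and outputs a topological extension sequence of `G` and a compatible chain
of lattice cycle bases. -/
theorem mainTheorem5 :
    ∃ (P : RAM.Prog) (c : ℕ), ∀ (n m : ℕ) (G : Graph ℕ ℕ) (adj : ℕ → List (ℕ × ℕ)),
      G.vertexSet = Set.Iio n → G.edgeSet = Set.Iio m → G.IsEdgeConnected 3 →
      RAM.IsAdjacencyList G adj →
      ∃ (t : ℕ) (s : RAM.State),
        RAM.Exec ((n + m + 2) ^ c) P (RAM.inputState n m adj) t s ∧
        t ≤ c * (m * n + 1) ∧
        ∃ (Γ : ℕ → Graph ℕ ℕ) (𝒞 : ℕ → Set (Set ℕ)),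
          G.IsTopExtSeq s.outStart s.outLength s.outOp Γ ∧
          Graph.IsCompatibleChain s.outLength s.outOp Γ 𝒞 ∧
          s.DescribesChain s.outLength Γ 𝒞 := by
  obtain ⟨C, hC⟩ := RAM.algorithm_spec
  obtain ⟨κ, hκ⟩ : ∃ κ, RAM.algorithm.size = κ := ⟨_, rfl⟩
  refine ⟨RAM.algorithm, κ * (4 + κ * C) + 2 + C, fun n m G adj hV hE hG hadj => ?_⟩
  obtain ⟨t, s, hrun, ht, hres⟩ := hC n m G adj hV hE hG hadj
  refine ⟨t, s, ?_, ht.trans (Nat.mul_le_mul_right _ (by omega)), hres⟩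
  refine (hrun.exec (κ := κ) (by rfl) hκ.le (RAM.inputState_bounded hV hE hadj) (by omega) ?_).1
  set X := n + m + 2 with hX
  have h1 : m * n + 1 ≤ X ^ 2 := by rw [hX]; nlinarith
  have h2 : 4 * m + n + 1 ≤ 4 * X ^ 2 := by
    have : X ≤ X ^ 2 := Nat.le_self_pow (by decide) X
    omega
  have h3 : κ * t ≤ κ * C * X ^ 2 := by
    rw [Nat.mul_assoc]
    exact Nat.mul_le_mul_left κ (ht.trans (Nat.mul_le_mul_left C h1))
  -- A constant is absorbed by the exponent: `a ≤ 2 ^ a ≤ X ^ a`, because `X ≥ 2`.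
  have h4 : κ * (4 + κ * C) ≤ X ^ (κ * (4 + κ * C)) :=
    Nat.lt_two_pow_self.le.trans (Nat.pow_le_pow_left (by omega) _)
  calc κ * (4 * m + n + 1 + κ * t) ≤ κ * (4 * X ^ 2 + κ * C * X ^ 2) :=
        Nat.mul_le_mul_left κ (Nat.add_le_add h2 h3)
    _ = κ * (4 + κ * C) * X ^ 2 := by ring
    _ ≤ X ^ (κ * (4 + κ * C)) * X ^ 2 := Nat.mul_le_mul_right _ h4
    _ = X ^ (κ * (4 + κ * C) + 2) := (pow_add _ _ _).symm
    _ ≤ X ^ (κ * (4 + κ * C) + 2 + C) := Nat.pow_le_pow_right (by omega) (by omega)
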